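/- **Setting.** Let $M$ be a compact, connected, smooth, orientable manifold with (possibly empty) boundary, of dimension $d\ge 1$. Let $\partial_1M,\dots,\partial_sM$ be the path components of $\partial M$. Assume that $M$ and every $\partial_iM$ are aspherical (path connected with $\pi_n=0$ for all $n\ge 2$) and that $\pi_1(\partial_iM,p)\to\pi_1(M,p)$ is injective for all $i$ and all $p\in\partial_iM$. Fix $x\in M$, points $x_i\in\partial_iM$ and paths $e_i$ in $M$ from $x_i$ to $x$. Let $\Gamma_i\subset\pi_1(M,x)$ be the image of $\pi_1(\partial_iM,x_i)$ under the conjugation $[\gamma]\mapsto[\overline{e_i}*\gamma*e_i]$, and assume $\Gamma_i\cap\Gamma_j=1$ for $i\ne j$. **Complexes.** Let $D=\mathrm{Dcone}(\bigcup_i\partial_iM\to M)$ be the space obtained from $M$ by coning each $\partial_iM$ to a point $c_i$. Let $R$ be a commutative ring; all chain complexes have coefficients in $R$, and $C_*$ denotes singular chains. * $\mathrm{Dcone}(\bigoplus_iC_*(\partial_iM)\to C_*(M))$ is the chain complex freely generated in degree $n$ by the singular $n$-simplices of $M$ and, for each $i$, by the cones $\mathrm{Cone}_i(\tau)$ over the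 singular $(n-1)$-simplices $\tau$ of $\partial_iM$ (for $n=0$: by the cone point $c_i$). Its boundary operator is the singular one on $C_*(M)$, and $\partial\,\mathrm{Cone}_i(\tau)=\mathrm{Cone}_i(\partial\tau)+(-1)^{\dim\tau+1}\tau$, where for $\dim\tau=0$ the term $\mathrm{Cone}_i(\partial\tau)$ means $c_i$. Let $j_2$ be its inclusion into $C_*(D)$, which realizes $\mathrm{Cone}_i(\tau)$ as the topological cone over $\tau$ with last vertex $c_i$. * $\widehat C_*^{x_i}(\partial_iM)\subset C_*(D)$ is generated by the simplices of $\partial_iM$ and the cones $\mathrm{Cone}_i(\tau)$ (including $c_i$) that have all vertices in $x_i$, or all but the last vertex in $x_i$ and the last vertex in $c_i$. * $\widehat C_*^x(M)\subset C_*(D)$ is the subcomplex freely generated by the singular simplices $\sigma$ of $D$ such that either all vertices of $\sigma$ are in $x$, or for some $i$ there is a simplex $\sigma'$ of the same dimension in $\widehat C_*^{x_i}(\partial_iM)$ such that conjugation with $e_i$ maps the $1$-skeleton of $\sigma'$ to that of $\sigma$ up to homotopy in $D$ fixing the $0$-skeleton. Here vertices $x_i$ and $c_i$ of $\sigma'$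 correspond to vertices $x$ and $c_i$ of $\sigma$, an edge $\varepsilon$ of $\sigma'$ from $x_i$ to $x_i$ is sent to $\overline{e_i}*\varepsilon*e_i$, and an edge $\varepsilon$ from $x_i$ to $c_i$ is sent to $\overline{e_i}*\varepsilon$. Let $j_1:\widehat C_*^x(M)\to C_*(D)$ be the inclusion. **Claim.** For every commutative ring $R$ there is a chain map $$F:\mathrm{Dcone}\Bigl(\bigoplus_iC_*(\partial_iM)\to C_*(M)\Bigr)\to\widehat C_*^x(M)$$ such that $j_1\circ F$ is chain homotopic to $j_2$, and every such chain map $F$ induces isomorphisms of homology groups in all degrees. Consequently, with coefficients $R=\mathbb R$, $$H_d(\widehat C_*^x(M);\mathbb R)\cong\mathbb R\qquad\text{if } d\ge 2.$$ -/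

import Mathlib

open CategoryTheory
open scoped Manifold ContDiff Topology

noncomputable section

namespace HatComplex

universe u v

/-! ### Quasisimplicial sets and their chain complexes -/

/-- A quasisimplicial set: sets of `n`-simplices with face maps (no degeneracies)
satisfying the usual identity `∂ᵢ ∂ⱼ₊₁ = ∂ⱼ ∂ᵢ` for `i ≤ j`. -/
structure QSet where
  obj : ℕ → Type u
  face : ∀ {n : ℕ}, Fin (n + 2) → obj (n + 1) → obj n
  face_face : ∀ {n : ℕ} (i j : Fin (n + 2)), i ≤ j → ∀ s : obj (n + 2),
    face i (face j.succ s) = face j (face i.castSucc s)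

namespace QSet

/-- Morphisms of quasisimplicial sets. -/
structure Hom (S T : QSet.{u}) where
  app : ∀ {n : ℕ}, S.obj n → T.obj n
  app_face : ∀ {n : ℕ} (j : Fin (n + 2)) (s : S.obj (n + 1)),
    app (S.face j s) = T.face j (app s)

/-- The quasisimplicial subset of simplices satisfying a predicate closed under faces. -/
def sub (S : QSet.{u}) (P : ∀ {n : ℕ}, S.obj n → Prop)
    (hP : ∀ {n : ℕ} (j : Fin (n + 2)) (s : S.obj (n + 1)), P s → P (S.face j s)) : QSet.{u} where
  obj n := {s : S.obj n // P s}
  face j s := ⟨S.face j s.1, hP j s.1 s.2⟩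
  face_face i j h s := Subtype.ext (S.face_face i j h s.1)

/-- The inclusion of a quasisimplicial subset. -/
def subι (S : QSet.{u}) (P : ∀ {n : ℕ}, S.obj n → Prop)
    (hP : ∀ {n : ℕ} (j : Fin (n + 2)) (s : S.obj (n + 1)), P s → P (S.face j s)) :
    Hom (S.sub P hP) S where
  app s := s.1
  app_face _ _ := rfl

/-- The boundary operator `∂ = ∑ⱼ (-1)ʲ ∂ⱼ` on the free `R`-modules on the simplices. -/
def boundary (R : Type v) [CommRing R] (S : QSet.{u}) (n : ℕ) :
    (S.obj (n + 1) →₀ R) →ₗ[R] (S.obj n →₀ R) :=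
  ∑ j : Fin (n + 2), ((-1 : ℤ) ^ (j : ℕ)) • Finsupp.lmapDomain R R (S.face j)

theorem boundary_single (R : Type v) [CommRing R] (S : QSet.{u}) (n : ℕ) (s : S.obj (n + 1))
    (r : R) : boundary R S n (Finsupp.single s r) =
      ∑ j : Fin (n + 2), ((-1 : ℤ) ^ (j : ℕ)) • Finsupp.single (S.face j s) r := by
  simp [boundary, LinearMap.sum_apply, Finsupp.mapDomain_single]

theorem boundary_comp_boundary (R : Type v) [CommRing R] (S : QSet.{u}) (n : ℕ) :
    boundary R S n ∘ₗ boundary R S (n + 1) = 0 := by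
  refine Finsupp.lhom_ext fun s r => ?_
  rw [LinearMap.comp_apply, boundary_single, map_sum]
  simp only [map_zsmul, boundary_single, Finset.smul_sum, smul_smul, LinearMap.zero_apply]
  rw [← Finset.sum_product', Finset.univ_product_univ]
  let P := Fin (n + 3) × Fin (n + 2)
  let A : Finset P := {ij : P | (ij.1 : ℕ) ≤ (ij.2 : ℕ)}
  rw [← Finset.sum_add_sum_compl A, ← eq_neg_iff_add_eq_zero, ← Finset.sum_neg_distrib]
  let φ : ∀ ij : P, ij ∈ A → P := fun ij hij =>
    (ij.2.succ, Fin.castLT ij.1 (lt_of_le_of_lt (Finset.mem_filter.mp hij).right (Fin.is_lt ij.2)))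
  apply Finset.sum_bij φ
  · intro ij hij
    simp_rw [A, φ, Finset.compl_filter, Finset.mem_filter_univ, Fin.val_succ,
      Fin.val_castLT] at hij ⊢
    omega
  · rintro ⟨i, j⟩ hij ⟨i', j'⟩ hij' h
    have h1 := congr_arg (fun q : P => (q.1 : ℕ)) h
    have h2 := congr_arg (fun q : P => (q.2 : ℕ)) h
    simp only [φ, Fin.val_succ, Fin.val_castLT] at h1 h2
    exact Prod.ext (Fin.ext h2) (Fin.ext (by simpa using h1))
  · rintro ⟨i', j'⟩ hij'
    simp_rw [A, Finset.compl_filter, Finset.mem_filter_univ, not_le] at hij'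
    refine ⟨(j'.castSucc, i'.pred ?_), ?_, ?_⟩
    · rintro rfl
      simp at hij'
    · simp only [A, Finset.mem_filter_univ, Fin.val_castSucc, Fin.val_pred]
      omega
    · simp [φ]
  · rintro ⟨i, j⟩ hij
    simp only [A, Finset.mem_filter_univ] at hij
    have hi : (i : ℕ) < n + 2 := lt_of_le_of_lt hij j.2
    obtain ⟨i, rfl⟩ : ∃ k : Fin (n + 2), i = k.castSucc := ⟨i.castLT hi, by simp⟩
    simp only [φ, Fin.val_succ, Fin.val_castSucc, Fin.castLT_castSucc, ← neg_smul]
    rw [S.face_face i j hij s]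
    congr 1
    ring

/-- The simplicial chain complex of a quasisimplicial set with coefficients in `R`. -/
def chains (R : Type v) [CommRing R] (S : QSet.{u}) :
    ChainComplex (ModuleCat.{max u v} R) ℕ :=
  ChainComplex.of (fun n => ModuleCat.of R (S.obj n →₀ R))
    (fun n => ModuleCat.ofHom (boundary R S n))
    (fun n => by
      rw [← ModuleCat.ofHom_comp, boundary_comp_boundary]
      rfl)

/-- The chain map induced by a morphism of quasisimplicial sets. -/
def chainsMap (R : Type v) [CommRing R] {S T : QSet.{u}} (f : Hom S T) :
    chains R S ⟶ chains R T :=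
  ChainComplex.ofHom
    (fun n => ModuleCat.ofHom (Finsupp.lmapDomain R R (f.app (n := n))))
    (fun n => by
      simp only [chains, ChainComplex.of_d, ← ModuleCat.ofHom_comp]
      congr 1
      refine Finsupp.lhom_ext fun s r => ?_
      simp only [LinearMap.comp_apply, Finsupp.lmapDomain_apply, Finsupp.mapDomain_single,
        boundary_single, ← f.app_face]
      rw [← Finsupp.lmapDomain_apply R R, map_sum]
      simp only [map_zsmul, Finsupp.lmapDomain_apply, Finsupp.mapDomain_single])

/-! ### Disjoint cones of quasisimplicial sets -/

/-- The simplices of dimension `n - 1`, with one empty simplex of dimension `-1`: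
these are the bases of the cone simplices of dimension `n`. -/
def aug (S : QSet.{u}) : ℕ → Type u
  | 0 => PUnit
  | n + 1 => S.obj n

/-- The faces of an `n`-simplex, including the empty face of a `0`-simplex. -/
def augFace (S : QSet.{u}) : ∀ {n : ℕ}, Fin (n + 1) → S.aug (n + 1) → S.aug n
  | 0, _, _ => PUnit.unit
  | _ + 1, j, s => S.face j s

theorem augFace_augFace (S : QSet.{u}) : ∀ {n : ℕ} (i j : Fin (n + 1)), i ≤ j →
    ∀ s : S.aug (n + 2),
      S.augFace i (S.augFace (n := n + 1) j.succ s) =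
        S.augFace j (S.augFace (n := n + 1) i.castSucc s)
  | 0, _, _, _, _ => rfl
  | _ + 1, i, j, h, s => S.face_face i j h s

/-- Faces in the disjoint cone: simplices of `S` keep their faces; a cone simplex `Cone(t)`
of dimension `n + 1` (cone point last) has the faces `∂ⱼ Cone(t) = Cone(∂ⱼ t)` for `j ≤ n`
and `∂ₙ₊₁ Cone(t) = t`. -/
def dconeFace {ι : Type} (S : QSet.{u}) (T : ι → QSet.{u}) (f : ∀ i, Hom (T i) S) {n : ℕ}
    (j : Fin (n + 2)) :
    S.obj (n + 1) ⊕ (Σ i, (T i).aug (n + 1)) → S.obj n ⊕ (Σ i, (T i).aug n)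
  | .inl s => .inl (S.face j s)
  | .inr ⟨i, t⟩ => Fin.lastCases (motive := fun _ => S.obj n ⊕ (Σ i, (T i).aug n))
      (.inl ((f i).app t)) (fun k => .inr ⟨i, (T i).augFace k t⟩) j

@[simp] theorem dconeFace_inl {ι : Type} (S : QSet.{u}) (T : ι → QSet.{u})
    (f : ∀ i, Hom (T i) S) {n : ℕ} (j : Fin (n + 2)) (s : S.obj (n + 1)) :
    dconeFace S T f j (.inl s) = .inl (S.face j s) := rfl

@[simp] theorem dconeFace_last {ι : Type} (S : QSet.{u}) (T : ι → QSet.{u})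
    (f : ∀ i, Hom (T i) S) {n : ℕ} (i : ι) (t : (T i).aug (n + 1)) :
    dconeFace S T f (Fin.last (n + 1)) (.inr ⟨i, t⟩) = .inl ((f i).app t) := by
  simp [dconeFace]

@[simp] theorem dconeFace_castSucc {ι : Type} (S : QSet.{u}) (T : ι → QSet.{u})
    (f : ∀ i, Hom (T i) S) {n : ℕ} (k : Fin (n + 1)) (i : ι) (t : (T i).aug (n + 1)) :
    dconeFace S T f k.castSucc (.inr ⟨i, t⟩) = .inr ⟨i, (T i).augFace k t⟩ := by
  simp [dconeFace]

/-- The disjoint cone `Dcone(⋃ᵢ Tᵢ → S)`: the pushout of `⋃ᵢ Tᵢ → S` along the inclusions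
`Tᵢ → Cone(Tᵢ)`. Its `n`-simplices are the `n`-simplices of `S` and, for each `i`, the cones over
the `(n-1)`-simplices of `Tᵢ` (for `n = 0`: the cone point `cᵢ`). -/
def dcone {ι : Type} (S : QSet.{u}) (T : ι → QSet.{u}) (f : ∀ i, Hom (T i) S) : QSet.{u} where
  obj n := S.obj n ⊕ (Σ i, (T i).aug n)
  face j := dconeFace S T f j
  face_face := by
    rintro n i j h (s | ⟨a, t⟩)
    · simp [S.face_face i j h]
    · induction j using Fin.lastCases with
      | last =>
        rw [Fin.succ_last, dconeFace_last, dconeFace_castSucc, dconeFace_last, dconeFace_inl]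
        congr 1
        exact ((f a).app_face i t).symm
      | cast j =>
        induction i using Fin.lastCases with
        | last => exact absurd h (not_le.mpr (Fin.castSucc_lt_last j))
        | cast i =>
          rw [← Fin.castSucc_succ, dconeFace_castSucc, dconeFace_castSucc, dconeFace_castSucc,
            dconeFace_castSucc, augFace_augFace _ i j (by simpa using h)]

end QSet

/-! ### Singular simplices -/

/-- The standard `n`-simplex. -/
abbrev Simp (n : ℕ) : Type := stdSimplex ℝ (Fin (n + 1))

/-- The `k`-th vertex of the standard `n`-simplex. -/
abbrev vert {n : ℕ} (k : Fin (n + 1)) : Simp n := stdSimplex.vertex k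

/-- The affine inclusion of the face opposite to the `j`-th vertex. -/
def coface {n : ℕ} (j : Fin (n + 2)) : C(Simp n, Simp (n + 1)) :=
  ⟨stdSimplex.map j.succAbove, stdSimplex.continuous_map _⟩

theorem coface_vert {n : ℕ} (j : Fin (n + 2)) (k : Fin (n + 1)) :
    coface j (vert k) = vert (j.succAbove k) :=
  stdSimplex.map_vertex _ _

/-- The singular simplices of a topological space with their faces. -/
def sing (X : Type u) [TopologicalSpace X] : QSet.{u} where
  obj n := C(Simp n, X)
  face j s := s.comp (coface j)
  face_face i j h s := by
    ext p
    simp only [ContinuousMap.comp_apply, coface, ContinuousMap.coe_mk, stdSimplex.map_comp_apply]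
    congr 2
    funext k
    simp only [Function.comp_apply, Fin.succAbove, Fin.lt_def, Fin.le_def] at h ⊢
    ext
    split_ifs <;> simp_all <;> omega

/-- Postcomposition of singular simplices with a continuous map. -/
def singMap {X Y : Type u} [TopologicalSpace X] [TopologicalSpace Y] (f : C(X, Y)) :
    QSet.Hom (sing X) (sing Y) where
  app s := f.comp s
  app_face _ _ := rfl

/-- The straight segment between two points of a simplex. -/
def segment {n : ℕ} (p q : Simp n) : Path p q where
  toFun t := ⟨fun k => (1 - (t : ℝ)) * p k + (t : ℝ) * q k, by
    have h := (convex_stdSimplex ℝ (Fin (n + 1))) p.2 q.2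
      (sub_nonneg.mpr t.2.2) t.2.1 (sub_add_cancel 1 (t : ℝ))
    exact h⟩
  continuous_toFun := by
    refine Continuous.subtype_mk (continuous_pi fun k => ?_) _
    fun_prop
  source' := by ext k; change (1 - (0 : ℝ)) * p k + 0 * q k = p k; ring
  target' := by ext k; change (1 - (1 : ℝ)) * p k + 1 * q k = q k; ring

theorem coface_succAbove {n : ℕ} (j : Fin (n + 2)) (p : Simp n) (k : Fin (n + 1)) :
    coface j p (j.succAbove k) = p k := by
  simp [coface, FunOnFinite.linearMap_apply_apply, Finset.sum_filter]

theorem coface_self {n : ℕ} (j : Fin (n + 2)) (p : Simp n) : coface j p j = 0 := by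
  simp [coface, FunOnFinite.linearMap_apply_apply]

theorem segment_coface {n : ℕ} (j : Fin (n + 2)) (p q : Simp n) :
    (segment p q).map (coface j).continuous = segment (coface j p) (coface j q) := by
  ext t k
  induction k using Fin.succAboveCases j with
  | x =>
    change coface j (segment p q t) j = (1 - (t : ℝ)) * coface j p j + (t : ℝ) * coface j q j
    simp [coface_self]
  | p k =>
    change coface j (segment p q t) (j.succAbove k) =
      (1 - (t : ℝ)) * coface j p (j.succAbove k) + (t : ℝ) * coface j q (j.succAbove k)
    simp only [coface_succAbove]
    rfl

/-- The parametrisation `(v, t) ↦ ((1 - t) v, t)` of `Δⁿ⁺¹` as the cone over `Δⁿ`, whose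
cone point is the last vertex. -/
def joinPt {n : ℕ} : C(Simp n × unitInterval, Simp (n + 1)) where
  toFun z := ⟨Fin.snoc (α := fun _ => ℝ) (fun k => (1 - (z.2 : ℝ)) * z.1 k) (z.2 : ℝ), by
    constructor
    · intro k
      induction k using Fin.lastCases with
      | last => simpa using z.2.2.1
      | cast k =>
        rw [Fin.snoc_castSucc]
        exact mul_nonneg (sub_nonneg.mpr z.2.2.2) (z.1.2.1 k)
    · rw [Fin.sum_univ_castSucc]
      simp [← Finset.mul_sum]⟩
  continuous_toFun := by
    refine Continuous.subtype_mk (continuous_pi fun k => ?_) _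
    induction k using Fin.lastCases with
    | last => simpa using (by fun_prop : Continuous fun z : Simp n × unitInterval => (z.2 : ℝ))
    | cast k =>
      have h : Continuous fun z : Simp n × unitInterval => (z.1 k : ℝ) :=
        (continuous_apply k).comp (continuous_subtype_val.comp continuous_fst)
      simpa using (by fun_prop : Continuous fun z : Simp n × unitInterval => (1 - (z.2 : ℝ)) * z.1 k)

@[simp] theorem joinPt_last {n : ℕ} (z : Simp n × unitInterval) :
    joinPt z (Fin.last (n + 1)) = (z.2 : ℝ) := by
  exact Fin.snoc_last (α := fun _ => ℝ) (z.2 : ℝ) (fun k => (1 - (z.2 : ℝ)) * z.1 k)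

@[simp] theorem joinPt_castSucc {n : ℕ} (z : Simp n × unitInterval) (k : Fin (n + 1)) :
    joinPt z k.castSucc = (1 - (z.2 : ℝ)) * z.1 k := by
  exact Fin.snoc_castSucc (α := fun _ => ℝ) (z.2 : ℝ) (fun k => (1 - (z.2 : ℝ)) * z.1 k) k

theorem joinPt_surjective {n : ℕ} : Function.Surjective (joinPt (n := n)) := by
  intro p
  have hsum : ∑ k : Fin (n + 1), p k.castSucc = 1 - p (Fin.last (n + 1)) := by
    have h := stdSimplex.sum_eq_one p
    rw [Fin.sum_univ_castSucc] at h
    linarith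
  have h0 : 0 ≤ p (Fin.last (n + 1)) := p.2.1 _
  have h1 : p (Fin.last (n + 1)) ≤ 1 := stdSimplex.le_one p _
  by_cases h : p (Fin.last (n + 1)) = 1
  · refine ⟨(vert 0, ⟨p (Fin.last (n + 1)), h0, h1⟩), ?_⟩
    ext k
    induction k using Fin.lastCases with
    | last => simp
    | cast k =>
      have h2 : p k.castSucc = 0 := by
        rw [h, sub_self] at hsum
        exact (Finset.sum_eq_zero_iff_of_nonneg (fun k _ => p.2.1 _)).1 hsum k (Finset.mem_univ _)
      rw [joinPt_castSucc, h2]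
      simp [h]
  · have hpos : 0 < 1 - p (Fin.last (n + 1)) := sub_pos.mpr (lt_of_le_of_ne h1 h)
    refine ⟨(⟨fun k => (1 - p (Fin.last (n + 1)))⁻¹ * p k.castSucc, fun k => ?_, ?_⟩,
      ⟨p (Fin.last (n + 1)), h0, h1⟩), ?_⟩
    · exact mul_nonneg (inv_nonneg.mpr hpos.le) (p.2.1 _)
    · rw [← Finset.mul_sum, hsum, inv_mul_cancel₀ hpos.ne']
    · ext k
      induction k using Fin.lastCases with
      | last => simp
      | cast k =>
        rw [joinPt_castSucc]
        exact mul_inv_cancel_left₀ hpos.ne' _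

theorem joinPt_isQuotientMap {n : ℕ} : Topology.IsQuotientMap (joinPt (n := n)) :=
  joinPt.continuous.isClosedMap.isQuotientMap joinPt.continuous joinPt_surjective

theorem coface_last_eq {n : ℕ} (v : Simp n) : coface (Fin.last (n + 1)) v = joinPt (v, 0) := by
  ext k
  induction k using Fin.lastCases with
  | last => rw [coface_self]; simp
  | cast k =>
    have h := coface_succAbove (Fin.last (n + 1)) v k
    rw [Fin.succAbove_last] at h
    rw [h]
    simp

theorem coface_castSucc_joinPt {n : ℕ} (j : Fin (n + 2)) (v : Simp n) (t : unitInterval) :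
    coface j.castSucc (joinPt (v, t)) = joinPt (coface j v, t) := by
  ext k
  induction k using Fin.lastCases with
  | last =>
    have h := coface_succAbove j.castSucc (joinPt (v, t)) (Fin.last (n + 1))
    have h' : j.castSucc.succAbove (Fin.last (n + 1)) = Fin.last (n + 2) := by
      simp [Fin.succAbove, Fin.lt_def, Fin.ext_iff]
      omega
    rw [h', joinPt_last] at h
    rw [h, joinPt_last]
  | cast k =>
    rw [joinPt_castSucc]
    induction k using Fin.succAboveCases j with
    | x => simp [coface_self]
    | p k =>
      rw [coface_succAbove, ← Fin.castSucc_succAbove_castSucc, coface_succAbove, joinPt_castSucc]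

theorem coface_zero_eq (v w : Simp 0) : coface (0 : Fin 2) v = joinPt (w, 1) := by
  ext k
  fin_cases k
  · have h := coface_self (0 : Fin 2) v
    have h' := joinPt_castSucc (w, (1 : unitInterval)) 0
    simp at h h' ⊢
    rw [h, h']
  · have h := coface_succAbove (0 : Fin 2) v 0
    have h' := joinPt_last (w, (1 : unitInterval))
    simp at h h' ⊢
    rw [h, ← h']

/-! ### Disjoint cones of topological spaces -/

section TopologicalCone

variable {Y : Type u} [TopologicalSpace Y] {s : ℕ} (A : Fin s → Set Y)

/-- The disjoint union of `Y`, the cylinders `Aᵢ × [0,1]` and one point for each `i`. -/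
abbrev DConePre : Type u := Y ⊕ (Σ i, (A i × unitInterval) ⊕ PUnit.{u + 1})

/-- The gluing relation of the disjoint cone: `a ∈ Y` is glued to `(a, 0) ∈ Aᵢ × [0,1]`, and all
points `(a, 1) ∈ Aᵢ × [0,1]` are glued to the `i`-th cone point. -/
inductive DConeRel : DConePre A → DConePre A → Prop
  | base (i : Fin s) (a : A i) : DConeRel (.inl (a : Y)) (.inr ⟨i, .inl (a, 0)⟩)
  | apex (i : Fin s) (a : A i) : DConeRel (.inr ⟨i, .inl (a, 1)⟩) (.inr ⟨i, .inr PUnit.unit⟩)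

/-- The disjoint cone `Dcone(⋃ᵢ Aᵢ → Y)`: the space obtained from `Y` by coning each `Aᵢ` to a
point `cᵢ`, with the quotient topology. -/
def DCone : Type u := Quot (DConeRel A)

instance : TopologicalSpace (DCone A) := inferInstanceAs (TopologicalSpace (Quot (DConeRel A)))

namespace DCone

/-- The map `Y → Dcone(⋃ᵢ Aᵢ → Y)`. -/
def of : C(Y, DCone A) where
  toFun a := Quot.mk _ (.inl a)
  continuous_toFun := continuous_quot_mk.comp continuous_inl

/-- The map `Aᵢ × [0,1] → Cone(Aᵢ) ⊆ Dcone(⋃ᵢ Aᵢ → Y)`. -/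
def cyl (i : Fin s) : C(A i × unitInterval, DCone A) where
  toFun z := Quot.mk _ (.inr ⟨i, .inl z⟩)
  continuous_toFun := continuous_quot_mk.comp
    (continuous_inr.comp (continuous_sigmaMk.comp continuous_inl))

/-- The cone point `cᵢ`. -/
def apex (i : Fin s) : DCone A := Quot.mk _ (.inr ⟨i, .inr PUnit.unit⟩)

theorem cyl_zero (i : Fin s) (a : A i) : cyl A i (a, 0) = of A (a : Y) :=
  (Quot.sound (DConeRel.base i a)).symm

theorem cyl_one (i : Fin s) (a : A i) : cyl A i (a, 1) = apex A i :=
  Quot.sound (DConeRel.apex i a)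

end DCone

/-- The inclusion `Aᵢ ⊆ Y`. -/
def incl (i : Fin s) : C(A i, Y) := ⟨Subtype.val, continuous_subtype_val⟩

variable {A}

theorem cyl_factors {i : Fin s} {n : ℕ} (τ : C(Simp n, A i)) :
    Function.FactorsThrough
      ((DCone.cyl A i).comp (τ.prodMap (ContinuousMap.id unitInterval))) (joinPt (n := n)) := by
  rintro ⟨v, t⟩ ⟨w, t'⟩ h
  have ht : t = t' := by
    have := congr_arg (fun p => p (Fin.last (n + 1))) h
    simpa [Subtype.ext_iff] using this
  subst ht
  by_cases h1 : t = 1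
  · subst h1
    exact (DCone.cyl_one A i _).trans (DCone.cyl_one A i _).symm
  · have hv : v = w := by
      ext k
      have := congr_arg (fun p => p k.castSucc) h
      simp only [joinPt_castSucc] at this
      exact mul_left_cancel₀ (sub_ne_zero.mpr fun h => h1 (Subtype.ext h.symm)) this
    rw [hv]

/-- The cone, with cone point `cᵢ` as last vertex, over a singular `(n-1)`-simplex `τ` of `Aᵢ`: the
singular `n`-simplex `((1 - t) v, t) ↦ (τ v, t)` of `Cone(Aᵢ)`. The cone over the empty simplex is
the `0`-simplex `cᵢ`. -/
def coneSimplex (i : Fin s) : ∀ {n : ℕ}, (sing (A i)).aug n → C(Simp n, DCone A)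
  | 0, _ => ContinuousMap.const _ (DCone.apex A i)
  | _ + 1, τ => joinPt_isQuotientMap.lift
      ((DCone.cyl A i).comp (ContinuousMap.prodMap τ (ContinuousMap.id unitInterval))) (cyl_factors τ)

theorem coneSimplex_joinPt (i : Fin s) {n : ℕ} (τ : C(Simp n, A i)) (v : Simp n) (t : unitInterval) :
    coneSimplex (A := A) (n := n + 1) i τ (joinPt (v, t)) = DCone.cyl A i (τ v, t) :=
  DFunLike.congr_fun (joinPt_isQuotientMap.lift_comp _ (cyl_factors τ)) (v, t)

theorem coneSimplex_face_last (i : Fin s) {n : ℕ} (τ : C(Simp n, A i)) :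
    (coneSimplex (A := A) (n := n + 1) i τ).comp (coface (Fin.last (n + 1))) =
      (DCone.of A).comp ((incl A i).comp τ) := by
  ext v
  rw [ContinuousMap.comp_apply, coface_last_eq, coneSimplex_joinPt, DCone.cyl_zero]
  rfl

theorem coneSimplex_face_castSucc (i : Fin s) : ∀ {n : ℕ} (j : Fin (n + 1)) (τ : C(Simp n, A i)),
    (coneSimplex (A := A) (n := n + 1) i τ).comp (coface j.castSucc) =
      coneSimplex (A := A) i ((sing (A i)).augFace j τ)
  | 0, j, τ => by
    ext v
    obtain rfl : j = 0 := Fin.fin_one_eq_zero j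
    rw [ContinuousMap.comp_apply, Fin.castSucc_zero, coface_zero_eq v v, coneSimplex_joinPt,
      DCone.cyl_one]
    rfl
  | n + 1, j, τ => by
    ext p
    obtain ⟨⟨v, t⟩, rfl⟩ := joinPt_surjective p
    rw [ContinuousMap.comp_apply, coface_castSucc_joinPt, coneSimplex_joinPt]
    exact (coneSimplex_joinPt i (τ.comp (coface j)) v t).symm

variable (A)

/-- The quasisimplicial set `Dcone(⋃ᵢ C_*(Aᵢ) → C_*(Y))`. -/
def dconeSing : QSet.{u} :=
  QSet.dcone (sing Y) (fun i : Fin s => sing (A i)) (fun i => singMap (incl A i))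

/-- The singular simplex of `Dcone(⋃ᵢ Aᵢ → Y)` given by a simplex of `Dcone(⋃ᵢ C_*(Aᵢ) → C_*(Y))`:
simplices of `Y` are included, cones are realised by topological cones. -/
def dconeSimplex {n : ℕ} : (dconeSing A).obj n → C(Simp n, DCone A)
  | .inl σ => (DCone.of A).comp σ
  | .inr ⟨i, τ⟩ => coneSimplex i τ

/-- The inclusion of `Dcone(⋃ᵢ C_*(Aᵢ) → C_*(Y))` into the singular simplices of
`Dcone(⋃ᵢ Aᵢ → Y)`. -/
def dconeSingIncl : QSet.Hom (dconeSing A) (sing (DCone A)) where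
  app := dconeSimplex A
  app_face := by
    rintro n j (σ | ⟨i, τ⟩)
    · rfl
    · induction j using Fin.lastCases with
      | last =>
        refine Eq.trans ?_ (coneSimplex_face_last i τ).symm
        exact congr_arg (dconeSimplex A) (QSet.dconeFace_last (sing Y)
          (fun i : Fin s => sing (A i)) (fun i => singMap (incl A i)) i τ)
      | cast j =>
        refine Eq.trans ?_ (coneSimplex_face_castSucc i j τ).symm
        exact congr_arg (dconeSimplex A) (QSet.dconeFace_castSucc (sing Y)
          (fun i : Fin s => sing (A i)) (fun i => singMap (incl A i)) j i τ)

/-! ### The complex of simplices with vertices in `x` or in the cone points -/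

variable {A}

/-- A singular simplex of `Dcone(⋃ᵢ Aᵢ → Y)` belongs to `Cone(C_*(Aᵢ))`: it is a simplex of `Aᵢ`
or the cone over one. -/
def InCone (i : Fin s) {n : ℕ} (σ : C(Simp n, DCone A)) : Prop :=
  (∃ τ : C(Simp n, A i), σ = (DCone.of A).comp ((incl A i).comp τ)) ∨
    ∃ τ : (sing (A i)).aug n, σ = coneSimplex i τ

/-- The simplices generating `Ĉ_*^{xᵢ}(Aᵢ)`: those in `Cone(C_*(Aᵢ))` with all vertices in `xᵢ`, or
with all but the last vertex in `xᵢ` and the last vertex in `cᵢ`. -/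
def InHatPart (i : Fin s) (xi : A i) {n : ℕ} (σ : C(Simp n, DCone A)) : Prop :=
  InCone i σ ∧
    ((∀ k, σ (vert k) = DCone.of A (xi : Y)) ∨
      ((∀ k, k ≠ Fin.last n → σ (vert k) = DCone.of A (xi : Y)) ∧
        σ (vert (Fin.last n)) = DCone.apex A i))

/-- The restriction of a singular simplex to the segment between two points. -/
def edge {X : Type u} [TopologicalSpace X] {n : ℕ} (σ : C(Simp n, X)) (p q : Simp n) :
    Path (σ p) (σ q) :=
  (segment p q).map σ.continuous

/-- Conjugation with the path `e` from `xᵢ` to `x` maps the 1-skeleton of `σ'` to the 1-skeleton of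
`σ`, up to homotopy fixing the 0-skeleton. Here `g k` is the path from the `k`-th vertex of `σ` to
that of `σ'`: the reverse of `e` at vertices `xᵢ` of `σ'`, constant at vertices `cᵢ`; conjugation
maps an edge `ε` of `σ'` from the `k`-th to the `l`-th vertex to `g k * ε * (g l)⁻¹`. -/
def ConjSkeleton (i : Fin s) {x : Y} {xi : A i} (e : Path (xi : Y) x) {n : ℕ}
    (σ' σ : C(Simp n, DCone A)) : Prop :=
  ∃ g : ∀ k : Fin (n + 1), Path (σ (vert k)) (σ' (vert k)),
    (∀ k, (∀ t, g k t = DCone.of A (e.symm t)) ∨ (∀ t, g k t = DCone.apex A i)) ∧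
    ∀ k l, k < l → (edge σ (vert k) (vert l)).Homotopic
      (((g k).trans (edge σ' (vert k) (vert l))).trans (g l).symm)

/-- The simplices generating `Ĉ_*^x(Y)`: those with all vertices in `x`, and those whose 1-skeleton
is, up to homotopy fixing the 0-skeleton, obtained by conjugation with `eᵢ` from the 1-skeleton of
a simplex of `Ĉ_*^{xᵢ}(Aᵢ)`, for some `i`. -/
def IsHat (x : Y) (y : ∀ i, A i) (e : ∀ i, Path (y i : Y) x) {n : ℕ}
    (σ : C(Simp n, DCone A)) : Prop :=
  (∀ k, σ (vert k) = DCone.of A x) ∨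
    ∃ i, ∃ σ' : C(Simp n, DCone A), InHatPart i (y i) σ' ∧ ConjSkeleton i (e i) σ' σ

theorem InHatPart.face {i : Fin s} {xi : A i} {n : ℕ} {σ : C(Simp (n + 1), DCone A)}
    (h : InHatPart i xi σ) (j : Fin (n + 2)) : InHatPart i xi (σ.comp (coface j)) := by
  obtain ⟨hc, hv⟩ := h
  constructor
  · rcases hc with ⟨τ, rfl⟩ | ⟨τ, rfl⟩
    · exact Or.inl ⟨τ.comp (coface j), rfl⟩
    · induction j using Fin.lastCases with
      | last => exact Or.inl ⟨τ, coneSimplex_face_last i τ⟩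
      | cast j => exact Or.inr ⟨(sing (A i)).augFace j τ, coneSimplex_face_castSucc i j τ⟩
  · simp only [ContinuousMap.comp_apply, coface_vert]
    rcases hv with hv | ⟨hv, hl⟩
    · exact Or.inl fun k => hv _
    · induction j using Fin.lastCases with
      | last =>
        refine Or.inl fun k => hv _ ?_
        rw [Fin.succAbove_last]
        exact (Fin.castSucc_lt_last k).ne
      | cast j =>
        have h' : j.castSucc.succAbove (Fin.last n) = Fin.last (n + 1) := by
          simp [Fin.succAbove, Fin.lt_def, Fin.ext_iff]
          omega
        refine Or.inr ⟨fun k hk => hv _ fun h => hk ?_, by rw [h', hl]⟩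
        exact Fin.succAbove_right_injective (h.trans h'.symm)

theorem edge_coface {X : Type u} [TopologicalSpace X] {n : ℕ} (σ : C(Simp (n + 1), X))
    (j : Fin (n + 2)) (p q : Simp n) :
    edge (σ.comp (coface j)) p q = edge σ (coface j p) (coface j q) := by
  unfold edge
  rw [← segment_coface]
  rfl

theorem ConjSkeleton.face {i : Fin s} {x : Y} {xi : A i} {e : Path (xi : Y) x} {n : ℕ}
    {σ' σ : C(Simp (n + 1), DCone A)} (h : ConjSkeleton i e σ' σ) (j : Fin (n + 2)) :
    ConjSkeleton i e (σ'.comp (coface j)) (σ.comp (coface j)) := by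
  obtain ⟨g, hg, hh⟩ := h
  have hj := coface_vert j
  refine ⟨fun k => (g (j.succAbove k)).cast (congr_arg σ (hj k)) (congr_arg σ' (hj k)),
    fun k => hg _, fun k l hkl => ?_⟩
  have key : ∀ (a b : Fin (n + 2)) (p q : Simp (n + 1)) (hp : p = vert a) (hq : q = vert b),
      a < b → (edge σ p q).Homotopic
        ((((g a).cast (congr_arg σ hp) (congr_arg σ' hp)).trans (edge σ' p q)).trans
          ((g b).cast (congr_arg σ hq) (congr_arg σ' hq)).symm) := by
    rintro a b p q rfl rfl hab
    exact hh a b hab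
  have := key _ _ _ _ (hj k) (hj l) (Fin.succAbove_lt_succAbove_iff.mpr hkl)
  rw [edge_coface, edge_coface]
  exact this

theorem IsHat.face {x : Y} {y : ∀ i, A i} {e : ∀ i, Path (y i : Y) x} {n : ℕ}
    (j : Fin (n + 2)) (σ : C(Simp (n + 1), DCone A)) (h : IsHat x y e σ) :
    IsHat x y e (σ.comp (coface j)) := by
  rcases h with h | ⟨i, σ', h1, h2⟩
  · refine Or.inl fun k => ?_
    rw [ContinuousMap.comp_apply, coface_vert, h]
  · exact Or.inr ⟨i, σ'.comp (coface j), h1.face j, h2.face j⟩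

/-- The quasisimplicial set of the simplices generating `Ĉ_*^x(Y)`. -/
def hatSimplices (x : Y) (y : ∀ i, A i) (e : ∀ i, Path (y i : Y) x) : QSet.{u} :=
  (sing (DCone A)).sub (fun {_} σ => IsHat x y e σ) (fun {_} j σ h => IsHat.face j σ h)

/-- The chain complex `Ĉ_*^x(Y)` with coefficients in `R`. -/
def hatChains (R : Type v) [CommRing R] (x : Y) (y : ∀ i, A i) (e : ∀ i, Path (y i : Y) x) :
    ChainComplex (ModuleCat.{max u v} R) ℕ :=
  (hatSimplices x y e).chains R

variable (A) in
/-- The chain complex `Dcone(⊕ᵢ C_*(Aᵢ) → C_*(Y))` with coefficients in `R`. -/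
def dconeChains (R : Type v) [CommRing R] : ChainComplex (ModuleCat.{max u v} R) ℕ :=
  (dconeSing A).chains R

/-- The inclusion `j₁` of `Ĉ_*^x(Y)` into the singular chain complex of `Dcone(⋃ᵢ Aᵢ → Y)`. -/
def j₁ (R : Type v) [CommRing R] (x : Y) (y : ∀ i, A i) (e : ∀ i, Path (y i : Y) x) :
    hatChains R x y e ⟶ (sing (DCone A)).chains R :=
  QSet.chainsMap R (QSet.subι _ _ _)

variable (A) in
/-- The inclusion `j₂` of `Dcone(⊕ᵢ C_*(Aᵢ) → C_*(Y))` into the singular chain complex of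
`Dcone(⋃ᵢ Aᵢ → Y)`. -/
def j₂ (R : Type v) [CommRing R] : dconeChains A R ⟶ (sing (DCone A)).chains R :=
  QSet.chainsMap R (dconeSingIncl A)

/-- The subgroup `Γᵢ` of `π₁(Y, x)`: the image of `π₁(Aᵢ, xᵢ) → π₁(Y, xᵢ)`, transported to the base
point `x` by conjugation with the path `e` from `xᵢ` to `x`. -/
def peripheralSubgroup (i : Fin s) {x : Y} {xi : A i} (e : Path (xi : Y) x) :
    Subgroup (FundamentalGroup Y x) :=
  (FundamentalGroup.map (incl A i) xi).range.map
    (FundamentalGroup.fundamentalGroupMulEquivOfPath e).toMonoidHom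

end TopologicalCone

/-! ### Hypotheses on manifolds -/

/-- A space is aspherical if it is path connected and all its homotopy groups in degrees `≥ 2`
vanish. -/
def IsAspherical (X : Type u) [TopologicalSpace X] : Prop :=
  PathConnectedSpace X ∧ ∀ n : ℕ, 2 ≤ n → ∀ p : X, Subsingleton (HomotopyGroup.Pi n X p)

/-- The sets `B 1, …, B s` are the path components of `S`, each listed once. -/
def IsPathComponents {X : Type u} [TopologicalSpace X] (S : Set X) {s : ℕ}
    (B : Fin s → Set X) : Prop :=
  Function.Injective B ∧ Set.range B = {C | ∃ p ∈ S, C = pathComponentIn S p}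

/-- A smooth `d`-manifold with boundary is orientable: the tangent spaces can be oriented in a
locally constant way. The sign `ε p` records whether the orientation at `p` agrees with the
standard orientation of `ℝᵈ` in the preferred chart at `p`. -/
def IsOrientable (d : ℕ) [NeZero d] (M : Type u) [TopologicalSpace M]
    [ChartedSpace (EuclideanHalfSpace d) M] [IsManifold (𝓡∂ d) ∞ M] : Prop :=
  haveI : IsManifold (𝓡∂ d) 1 M := IsManifold.of_le (n := ∞) (by simp)
  ∃ ε : M → ℤˣ, ∀ p : M, ∀ᶠ q in 𝓝 p,
    0 < ((ε p * ε q : ℤˣ) : ℝ) * (tangentCoordChange (𝓡∂ d) q p q).det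

end HatComplex

end

/-!
Write `Y` for the manifold, `A i` for the components of its boundary and `D = DCone A` for the
disjoint cone. Everything is done with chains rather than homology classes, in augmented
quasisimplicial sets (`ASet`) whose level `n` consists of the simplices with `n` vertices. In this
way a cycle in degree `0` is automatically a reduced one, and a cone over the empty simplex is the
cone point.

*The chain map.* The inclusion `j₂` is a quasi-isomorphism by an excision argument. After subdivision
a chain of `D` is a sum of a chain near the base `Y` and of chains in the disjoint open cones
(`exists_dcone_small`). The homotopy `DCone.deform` pushes the first summand into `Y`, and the
difference between the remaining summands and algebraic cones bounds because the closed cones are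
contractible (`exists_dcone_cycle`, `exists_dcone_bd`). The inclusion `j₁` is a quasi-isomorphism
since both complexes have the homology of the complex of simplices with all vertices in `x`. For
singular chains of `D` this is seen by attaching to every vertex `p` a path from `p` to `x`
(`whisker`). For the hat complex it is seen by prepending the path from `x` to `cᵢ` to every simplex
with last vertex `cᵢ` (`hatPrepend_homotopy`), which stays in the hat complex by the description
`IsConeHat` of these simplices: all edges to the last vertex are homotopic to one fixed path.
Attaching paths to the vertices also produces a chain map `F` (`exists_hatMap`). If `F` is any chain
map with `j₁ ∘ F` homotopic to `j₂`, then `F` is a quasi-isomorphism by two-out-of-three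
(`isIso_homologyMap_of_homotopy`).

*The top homology.* It remains to compute `H_d(D)`. The complement of `Y` in `D` is the disjoint union
of open cones, which are contractible, so for `2 ≤ d` the group `H_d(D)` agrees with the
homology of `D` relative to this complement (`exists_absolute_class`). The cones serve as a collar: every chart of `Y`, including those
at boundary points, extends to an open embedding into `D` of an open subset of `ℝᵈ` (`collarChart`).
So `D` is an oriented topological manifold near the compact subset `Y`, and the classical
construction of the fundamental class applies. The homology of `ℝᵈ` relative to the complement of a
box is computed by Mayer–Vietoris, bounding one coordinate after the other (`exists_generator_pbox`).
Classes relative to the complement of a compact set vanish above degree `d` and are detected by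
points in degree `d` (`detected_of_isCompact`, `detected_of_charts`). Linear maps act on the local
homology through the sign of the determinant (`exists_sign_character`), hence so do changes of charts
(`IsLocalClass.transition`). Consequently the orientation of `Y` gives coherent local classes, which
glue to a global one (`exists_orientation_class`), and this class is a basis because `Y` is connected
(`exists_fundamental_class`).
-/

open CategoryTheory
open scoped Manifold ContDiff Topology

noncomputable section

namespace HatComplex

universe u v w

/-! ### Augmented quasisimplicial sets -/

/-- An augmented quasisimplicial set, indexed by the number of vertices of a simplex: `obj n`
consists of the simplices with `n` vertices, so that `obj 0` contains the empty simplices. -/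
structure ASet where
  obj : ℕ → Type u
  face : ∀ {n : ℕ}, Fin (n + 1) → obj (n + 1) → obj n
  face_face : ∀ {n : ℕ} (i j : Fin (n + 1)), i ≤ j → ∀ s : obj (n + 2),
    face i (face j.succ s) = face j (face i.castSucc s)

namespace ASet

/-- Morphisms of augmented quasisimplicial sets. -/
structure Hom (S : ASet.{u}) (T : ASet.{v}) where
  app : ∀ {n : ℕ}, S.obj n → T.obj n
  app_face : ∀ {n : ℕ} (j : Fin (n + 1)) (s : S.obj (n + 1)), app (S.face j s) = T.face j (app s)

/-- Composition of morphisms. -/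
def Hom.comp {S : ASet.{u}} {T : ASet.{v}} {W : ASet.{w}} (g : Hom T W) (f : Hom S T) :
    Hom S W where
  app s := g.app (f.app s)
  app_face j s := by rw [f.app_face, g.app_face]

variable (R : Type*) [CommRing R]

/-- The boundary operator of the augmented chain complex. -/
def bd (S : ASet.{u}) (n : ℕ) : (S.obj (n + 1) →₀ R) →ₗ[R] (S.obj n →₀ R) :=
  ∑ j : Fin (n + 1), ((-1 : ℤ) ^ (j : ℕ)) • Finsupp.lmapDomain R R (S.face j)

theorem bd_single (S : ASet.{u}) (n : ℕ) (s : S.obj (n + 1)) (r : R) :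
    bd R S n (Finsupp.single s r) =
      ∑ j : Fin (n + 1), ((-1 : ℤ) ^ (j : ℕ)) • Finsupp.single (S.face j s) r := by
  simp [bd, LinearMap.sum_apply, Finsupp.mapDomain_single]

theorem bd_comp_bd (S : ASet.{u}) (n : ℕ) : bd R S n ∘ₗ bd R S (n + 1) = 0 := by
  refine Finsupp.lhom_ext fun s r => ?_
  rw [LinearMap.comp_apply, bd_single, map_sum]
  simp only [map_zsmul, bd_single, Finset.smul_sum, smul_smul, LinearMap.zero_apply]
  rw [← Finset.sum_product', Finset.univ_product_univ]
  let P := Fin (n + 2) × Fin (n + 1)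
  let A : Finset P := {ij : P | (ij.1 : ℕ) ≤ (ij.2 : ℕ)}
  rw [← Finset.sum_add_sum_compl A, ← eq_neg_iff_add_eq_zero, ← Finset.sum_neg_distrib]
  let φ : ∀ ij : P, ij ∈ A → P := fun ij hij =>
    (ij.2.succ, Fin.castLT ij.1 (lt_of_le_of_lt (Finset.mem_filter.mp hij).right (Fin.is_lt ij.2)))
  apply Finset.sum_bij φ
  · intro ij hij
    simp_rw [A, φ, Finset.compl_filter, Finset.mem_filter_univ, Fin.val_succ,
      Fin.val_castLT] at hij ⊢
    omega
  · rintro ⟨i, j⟩ hij ⟨i', j'⟩ hij' h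
    have h1 := congr_arg (fun q : P => (q.1 : ℕ)) h
    have h2 := congr_arg (fun q : P => (q.2 : ℕ)) h
    simp only [φ, Fin.val_succ, Fin.val_castLT] at h1 h2
    exact Prod.ext (Fin.ext h2) (Fin.ext (by simpa using h1))
  · rintro ⟨i', j'⟩ hij'
    simp_rw [A, Finset.compl_filter, Finset.mem_filter_univ, not_le] at hij'
    refine ⟨(j'.castSucc, i'.pred ?_), ?_, ?_⟩
    · rintro rfl
      simp at hij'
    · simp only [A, Finset.mem_filter_univ, Fin.val_castSucc, Fin.val_pred]
      omega
    · simp [φ]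
  · rintro ⟨i, j⟩ hij
    simp only [A, Finset.mem_filter_univ] at hij
    have hi : (i : ℕ) < n + 1 := lt_of_le_of_lt hij j.2
    obtain ⟨i, rfl⟩ : ∃ k : Fin (n + 1), i = k.castSucc := ⟨i.castLT hi, by simp⟩
    simp only [φ, Fin.val_succ, Fin.val_castSucc, Fin.castLT_castSucc, ← neg_smul]
    rw [S.face_face i j hij s]
    congr 1
    ring

theorem bd_bd (S : ASet.{u}) (n : ℕ) (c : S.obj (n + 2) →₀ R) :
    bd R S n (bd R S (n + 1) c) = 0 :=
  LinearMap.congr_fun (bd_comp_bd R S n) c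

/-- The chain map induced by a morphism. -/
def push {S : ASet.{u}} {T : ASet.{v}} (f : Hom S T) (n : ℕ) :
    (S.obj n →₀ R) →ₗ[R] (T.obj n →₀ R) :=
  Finsupp.lmapDomain R R (f.app (n := n))

@[simp] theorem push_single {S : ASet.{u}} {T : ASet.{v}} (f : Hom S T) (n : ℕ) (s : S.obj n)
    (r : R) : push R f n (Finsupp.single s r) = Finsupp.single (f.app s) r := by
  simp [push, Finsupp.mapDomain_single]

theorem bd_push {S : ASet.{u}} {T : ASet.{v}} (f : Hom S T) (n : ℕ) (c : S.obj (n + 1) →₀ R) :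
    bd R T n (push R f (n + 1) c) = push R f n (bd R S n c) := by
  induction c using Finsupp.induction_linear with
  | zero => simp
  | add a b ha hb => simp only [map_add, ha, hb]
  | single s r => simp only [push_single, bd_single, map_sum, map_zsmul, f.app_face]

theorem push_comp {S : ASet.{u}} {T : ASet.{v}} {W : ASet.{w}} (g : Hom T W) (f : Hom S T) (n : ℕ)
    (c : S.obj n →₀ R) : push R (g.comp f) n c = push R g n (push R f n c) := by
  induction c using Finsupp.induction_linear with
  | zero => simp
  | add a b ha hb => simp only [map_add, ha, hb]
  | single s r => simp only [push_single]; rfl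

end ASet

/-- A linear map sends chains supported in `A` to `N` if it does so on the simplices in `A`. -/
theorem map_mem_of_supported {R : Type*} [CommRing R] {α : Type*} {M : Type*} [AddCommGroup M]
    [Module R M] (L : (α →₀ R) →ₗ[R] M) {A : Set α} {N : Submodule R M}
    (h : ∀ a ∈ A, L (Finsupp.single a 1) ∈ N) {c : α →₀ R} (hc : c ∈ Finsupp.supported R R A) :
    L c ∈ N := by
  rw [Finsupp.supported_eq_span_single] at hc
  induction hc using Submodule.span_induction with
  | mem x hx => obtain ⟨a, ha, rfl⟩ := hx; exact h a ha
  | zero => simp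
  | add x y _ _ hx hy => rw [map_add]; exact N.add_mem hx hy
  | smul r x _ hx => rw [map_smul]; exact N.smul_mem r hx

open ASet

/-! ### Chains of ordered tuples -/

section Tuples

/-- The ordered tuples of elements of `E`. -/
abbrev tup (E : Type u) : ASet.{u} where
  obj n := Fin n → E
  face j s := s ∘ j.succAbove
  face_face i j h s := by
    funext k
    simp only [Function.comp_apply]
    congr 1
    simp only [Fin.succAbove, Fin.lt_def, Fin.le_def] at h ⊢
    ext
    split_ifs <;> simp_all <;> omega

/-- The map of tuples induced by a map of sets. -/
abbrev tupMap {E : Type u} {F : Type v} (g : E → F) : Hom (tup E) (tup F) where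
  app s := g ∘ s
  app_face _ _ := rfl

variable (R : Type*) [CommRing R] {E : Type u} {F : Type v}

/-- Prepending the vertex `b` to the tuples of a chain. -/
def cone (b : E) (n : ℕ) : ((tup E).obj n →₀ R) →ₗ[R] ((tup E).obj (n + 1) →₀ R) :=
  Finsupp.lmapDomain R R (fun v : Fin n → E => (Fin.cons b v : Fin (n + 1) → E))

@[simp] theorem cone_single (b : E) (n : ℕ) (v : (tup E).obj n) (r : R) :
    cone R b n (Finsupp.single v r) = Finsupp.single (Fin.cons b v : Fin (n + 1) → E) r := by
  simp [cone, Finsupp.mapDomain_single]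

/-- The cone over a chain `c` bounds `c` up to the cone over its boundary. -/
theorem bd_cone (b : E) (n : ℕ) (c : (tup E).obj (n + 1) →₀ R) :
    bd R (tup E) (n + 1) (cone R b (n + 1) c) = c - cone R b n (bd R (tup E) n c) := by
  induction c using Finsupp.induction_linear with
  | zero => simp
  | add x y hx hy => simp only [map_add, hx, hy]; abel
  | single v r =>
    rw [cone_single, bd_single, Fin.sum_univ_succ, bd_single, map_sum, sub_eq_add_neg,
      ← Finset.sum_neg_distrib]
    congr 1
    · simp only [Fin.val_zero, pow_zero, one_smul]
      congr 1
    · refine Finset.sum_congr rfl fun j _ => ?_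
      rw [map_zsmul, cone_single, Fin.val_succ, pow_succ, mul_neg_one, neg_smul]
      congr 3
      funext k
      refine Fin.cases ?_ (fun k => ?_) k <;> simp

theorem push_cone (g : E → F) (b : E) (n : ℕ) (c : (tup E).obj n →₀ R) :
    push R (tupMap g) (n + 1) (cone R b n c) = cone R (g b) n (push R (tupMap g) n c) := by
  induction c using Finsupp.induction_linear with
  | zero => simp
  | add x y hx hy => simp only [map_add, hx, hy]
  | single v r =>
    rw [cone_single]
    erw [push_single, push_single, cone_single]
    congr 1
    funext k
    refine Fin.cases ?_ (fun k => ?_) k <;> simp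

/-- The subdivision homotopy on chains of tuples: `T v = b(v) · (v - T ∂v)`, where `b(v)` is a point
attached to the tuple `v` (its barycenter in the applications). -/
def subdivT (b : ∀ {n : ℕ}, (Fin (n + 1) → E) → E) :
    ∀ n : ℕ, ((tup E).obj n →₀ R) →ₗ[R] ((tup E).obj (n + 1) →₀ R)
  | 0 => 0
  | n + 1 => Finsupp.linearCombination R fun v : Fin (n + 1) → E =>
      cone R (b v) (n + 1) (Finsupp.single v 1 -
        subdivT b n (bd R (tup E) n (Finsupp.single v 1)))

/-- The subdivision operator, defined from the homotopy `T` by `Sd = id - ∂T - T∂`. -/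
def subdiv (b : ∀ {n : ℕ}, (Fin (n + 1) → E) → E) :
    ∀ n : ℕ, ((tup E).obj n →₀ R) →ₗ[R] ((tup E).obj n →₀ R)
  | 0 => LinearMap.id
  | n + 1 => LinearMap.id - bd R (tup E) (n + 1) ∘ₗ subdivT R b (n + 1) -
      subdivT R b n ∘ₗ bd R (tup E) n

variable (b : ∀ {n : ℕ}, (Fin (n + 1) → E) → E)

theorem subdivT_single (n : ℕ) (v : (tup E).obj (n + 1)) :
    subdivT R b (n + 1) (Finsupp.single v 1) = cone R (b v) (n + 1) (Finsupp.single v 1 -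
      subdivT R b n (bd R (tup E) n (Finsupp.single v 1))) := by
  simp only [subdivT]
  rw [Finsupp.linearCombination_single, one_smul]

theorem subdiv_succ (n : ℕ) (c : (tup E).obj (n + 1) →₀ R) :
    subdiv R b (n + 1) c = c - bd R (tup E) (n + 1) (subdivT R b (n + 1) c) -
      subdivT R b n (bd R (tup E) n c) := rfl

/-- The subdivision of a tuple is the cone with vertex `b(v)` over the subdivision of its
boundary. -/
theorem subdiv_single (n : ℕ) (v : (tup E).obj (n + 1)) :
    subdiv R b (n + 1) (Finsupp.single v 1) =
      cone R (b v) n (subdiv R b n (bd R (tup E) n (Finsupp.single v 1))) := by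
  rw [subdiv_succ, subdivT_single, bd_cone, map_sub]
  cases n with
  | zero => simp [subdivT, subdiv]
  | succ n =>
    rw [subdiv_succ, bd_bd, map_zero, sub_zero]
    abel

/-- Naturality of the subdivision homotopy under maps preserving the chosen points `b`. -/
theorem push_subdivT {b' : ∀ {n : ℕ}, (Fin (n + 1) → F) → F} (g : E → F)
    (hg : ∀ (n : ℕ) (v : Fin (n + 1) → E), g (b v) = b' (g ∘ v)) (n : ℕ)
    (c : (tup E).obj n →₀ R) :
    push R (tupMap g) (n + 1) (subdivT R b n c) = subdivT R b' n (push R (tupMap g) n c) := by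
  induction n with
  | zero => simp [subdivT]
  | succ n ih =>
    induction c using Finsupp.induction_linear with
    | zero => simp
    | add x y hx hy => simp only [map_add, hx, hy]
    | single v r =>
      rw [← mul_one r, ← smul_eq_mul, ← Finsupp.smul_single, map_smul, map_smul, map_smul, map_smul,
        subdivT_single, push_cone, map_sub, ih, push_single, subdivT_single, ← bd_push, push_single,
        hg]

/-- The prism operator on chains of tuples, from `E` to `E × F`, between the maps `v ↦ (v, s)` and
`v ↦ (v, t)`. -/
def prism (s t : F) : ∀ n : ℕ, ((tup E).obj n →₀ R) →ₗ[R] ((tup (E × F)).obj (n + 1) →₀ R)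
  | 0 => 0
  | n + 1 => Finsupp.linearCombination R fun v : (tup E).obj (n + 1) =>
      cone R (v 0, s) (n + 1) (push R (tupMap fun x => (x, t)) (n + 1) (Finsupp.single v 1) -
        push R (tupMap fun x => (x, s)) (n + 1) (Finsupp.single v 1) -
        prism s t n (bd R (tup E) n (Finsupp.single v 1)))

theorem prism_single (s t : F) (n : ℕ) (v : (tup E).obj (n + 1)) :
    prism R s t (n + 1) (Finsupp.single v 1) =
      cone R (v 0, s) (n + 1) (push R (tupMap fun x => (x, t)) (n + 1) (Finsupp.single v 1) -
        push R (tupMap fun x => (x, s)) (n + 1) (Finsupp.single v 1) -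
        prism R s t n (bd R (tup E) n (Finsupp.single v 1))) := by
  simp only [prism]
  rw [Finsupp.linearCombination_single, one_smul]

theorem push_tupMap_zero (g : E → F) (h : E → F) (c : (tup E).obj 0 →₀ R) :
    push R (tupMap g) 0 c = push R (tupMap h) 0 c := by
  unfold push
  congr 2
  funext v k
  exact k.elim0

/-- The prism operator is a chain homotopy between the top and the bottom of the prism. -/
theorem bd_prism (s t : F) (n : ℕ) (c : (tup E).obj (n + 1) →₀ R) :
    bd R (tup (E × F)) (n + 1) (prism R s t (n + 1) c) =
      push R (tupMap fun x => (x, t)) (n + 1) c - push R (tupMap fun x => (x, s)) (n + 1) c -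
        prism R s t n (bd R (tup E) n c) := by
  induction c using Finsupp.induction_linear with
  | zero => simp
  | add x y hx hy => simp only [map_add, hx, hy]; abel
  | single v r =>
    rw [← mul_one r, ← smul_eq_mul, ← Finsupp.smul_single]
    simp only [map_smul, ← smul_sub]
    congr 1
    rw [prism_single, bd_cone, sub_eq_self]
    refine (congrArg _ ?_).trans (map_zero (cone R _ _))
    rw [map_sub, map_sub, bd_push, bd_push]
    generalize Finsupp.single v (1 : R) = c
    induction n with
    | zero =>
      rw [push_tupMap_zero R (fun x => (x, t)) (fun x => (x, s)), sub_self, zero_sub]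
      simp only [prism]
      rw [LinearMap.zero_apply, map_zero, neg_zero]
    | succ n ih =>
      have h : bd R (tup (E × F)) (n + 1) (prism R s t (n + 1) (bd R (tup E) (n + 1) c)) =
          push R (tupMap fun x => (x, t)) (n + 1) (bd R (tup E) (n + 1) c) -
          push R (tupMap fun x => (x, s)) (n + 1) (bd R (tup E) (n + 1) c) -
          prism R s t n (bd R (tup E) n (bd R (tup E) (n + 1) c)) := by
        generalize bd R (tup E) (n + 1) c = e
        induction e using Finsupp.induction_linear with
        | zero => simp
        | add x y hx hy => simp only [map_add, hx, hy]; abel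
        | single v r =>
          rw [← mul_one r, ← smul_eq_mul, ← Finsupp.smul_single]
          simp only [map_smul, ← smul_sub]
          congr 1
          rw [prism_single, bd_cone, sub_eq_self]
          refine (congrArg _ ?_).trans (map_zero (cone R _ _))
          rw [map_sub, map_sub, bd_push, bd_push]
          exact ih v (Finsupp.single v 1)
      rw [h, bd_bd, map_zero, sub_zero, sub_self]

theorem push_prism {E' : Type*} (s t : F) (g : E → E') (n : ℕ) (c : (tup E).obj n →₀ R) :
    push R (tupMap (Prod.map g id)) (n + 1) (prism R s t n c) =
      prism R s t n (push R (tupMap g) n c) := by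
  induction n with
  | zero => simp [prism]
  | succ n ih =>
    induction c using Finsupp.induction_linear with
    | zero => simp
    | add x y hx hy => simp only [map_add, hx, hy]
    | single v r =>
      have hp : ∀ q : F, push R (tupMap (Prod.map g id)) (n + 1)
          (push R (tupMap fun x => (x, q)) (n + 1) (Finsupp.single v 1)) =
          push R (tupMap fun x => (x, q)) (n + 1)
            (push R (tupMap g) (n + 1) (Finsupp.single v 1)) := fun q => by
        rw [← push_comp, ← push_comp]
        rfl
      rw [← mul_one r, ← smul_eq_mul, ← Finsupp.smul_single, map_smul, map_smul, map_smul, map_smul,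
        prism_single, push_cone, map_sub (push R _ _), map_sub (push R _ _), hp, hp, ih, ← bd_push, push_single, prism_single]
      rfl

/-- The vertices of the tuples of the prism over `v` lie over the vertices of `v`. -/
theorem prism_mem_supported (s t : F) (n : ℕ) {Q : E → Prop} {c : (tup E).obj n →₀ R}
    (hc : c ∈ Finsupp.supported R R {v : Fin n → E | ∀ k, Q (v k)}) :
    prism R s t n c ∈ Finsupp.supported R R
      {w : Fin (n + 1) → E × F | ∀ k, Q (w k).1 ∧ ((w k).2 = s ∨ (w k).2 = t)} := by
  induction n with
  | zero => simp [prism]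
  | succ n ih =>
    refine map_mem_of_supported _ (fun v hv => ?_) hc
    rw [prism_single]
    refine map_mem_of_supported (A := {w : Fin (n + 1) → E × F |
      ∀ k, Q (w k).1 ∧ ((w k).2 = s ∨ (w k).2 = t)}) _ (fun w hw => ?_) ?_
    · rw [cone_single]
      refine Finsupp.single_mem_supported _ _ fun k => ?_
      refine Fin.cases ?_ (fun k => ?_) k
      · exact ⟨hv 0, Or.inl rfl⟩
      · exact hw k
    · refine Submodule.sub_mem _ (Submodule.sub_mem _ ?_ ?_) (ih ?_)
      · rw [push_single]
        exact Finsupp.single_mem_supported _ _ fun k => ⟨hv k, Or.inr rfl⟩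
      · rw [push_single]
        exact Finsupp.single_mem_supported _ _ fun k => ⟨hv k, Or.inl rfl⟩
      · rw [bd_single]
        refine Submodule.sum_mem _ fun j _ => ?_
        rw [← Int.cast_smul_eq_zsmul R]
        exact Submodule.smul_mem _ _ (Finsupp.single_mem_supported _ _ fun k => hv _)

end Tuples

/-! ### The augmented singular complex -/

/-- The augmented quasisimplicial set of a quasisimplicial set: one empty simplex is added. -/
def QSet.toA (S : QSet.{u}) : ASet.{u} where
  obj := S.aug
  face := S.augFace
  face_face := S.augFace_augFace

/-- The morphism of augmented quasisimplicial sets induced by a morphism. -/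
def QSet.homA {S T : QSet.{u}} (f : QSet.Hom S T) : ASet.Hom S.toA T.toA where
  app {n} := match n with
    | 0 => fun s => s
    | _ + 1 => fun s => f.app s
  app_face {n} j s := match n, j, s with
    | 0, _, _ => rfl
    | _ + 1, j, s => f.app_face j s

/-- The augmented quasisimplicial set of singular simplices of `X`. -/
def sg (X : Type u) [TopologicalSpace X] : ASet.{u} := (sing X).toA

section Singular

variable {X : Type u} {Y : Type v} {Z : Type w} [TopologicalSpace X] [TopologicalSpace Y]
  [TopologicalSpace Z]

/-- A singular simplex with `n + 1` vertices as a continuous map. -/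
def toMap {n : ℕ} (σ : (sg X).obj (n + 1)) : C(Simp n, X) := σ

/-- A continuous map as a singular simplex. -/
def ofMap {n : ℕ} (σ : C(Simp n, X)) : (sg X).obj (n + 1) := σ

@[simp] theorem toMap_ofMap {n : ℕ} (σ : C(Simp n, X)) : toMap (ofMap σ) = σ := rfl

@[simp] theorem ofMap_toMap {n : ℕ} (σ : (sg X).obj (n + 1)) : ofMap (toMap σ) = σ := rfl

instance : Unique ((sg X).obj 0) := inferInstanceAs (Unique PUnit)

theorem toMap_face {n : ℕ} (j : Fin (n + 2)) (σ : (sg X).obj (n + 2)) :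
    toMap ((sg X).face j σ) = (toMap σ).comp (coface j) := rfl

theorem face_ofMap {n : ℕ} (j : Fin (n + 2)) (σ : C(Simp (n + 1), X)) :
    (sg X).face j (ofMap σ) = ofMap (σ.comp (coface j)) := rfl

/-- A morphism into the singular simplices, given in all dimensions `≥ 0`. -/
def sgHom {S : ASet.{w}} (f : ∀ n, S.obj (n + 1) → C(Simp n, X))
    (hf : ∀ (n : ℕ) (j : Fin (n + 2)) (s : S.obj (n + 2)),
      f n (S.face j s) = (f (n + 1) s).comp (coface j)) : Hom S (sg X) where
  app {n} := match n with
    | 0 => fun _ => default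
    | n + 1 => fun s => ofMap (f n s)
  app_face {n} j s := match n, j, s with
    | 0, _, _ => rfl
    | n + 1, j, s => hf n j s

theorem hom_sg_ext {S : ASet.{w}} {f g : Hom S (sg X)}
    (h : ∀ (n : ℕ) (s : S.obj (n + 1)), f.app s = g.app s) : f = g := by
  obtain ⟨f, hf⟩ := f
  obtain ⟨g, hg⟩ := g
  congr 1
  funext n s
  match n, s with
  | 0, s => exact Subsingleton.elim _ _
  | n + 1, s => exact h n s

/-- The morphism of singular simplices induced by a continuous map. -/
def sgMap (f : C(X, Y)) : Hom (sg X) (sg Y) :=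
  sgHom (fun _ σ => f.comp (toMap σ)) fun _ _ _ => rfl

theorem sgMap_app (f : C(X, Y)) {n : ℕ} (σ : (sg X).obj (n + 1)) :
    (sgMap f).app σ = ofMap (f.comp (toMap σ)) := rfl

theorem sgMap_comp (g : C(Y, Z)) (f : C(X, Y)) : sgMap (g.comp f) = (sgMap g).comp (sgMap f) :=
  hom_sg_ext fun _ _ => rfl

theorem sgMap_id : (sgMap (ContinuousMap.id X)) = ⟨fun s => s, fun _ _ => rfl⟩ :=
  hom_sg_ext fun _ _ => rfl

/-- The simplices contained in the subset `U`; the empty simplex is contained in every subset. -/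
def inSet (U : Set X) : ∀ n : ℕ, Set ((sg X).obj n)
  | 0 => Set.univ
  | _ + 1 => {σ | ∀ p, toMap σ p ∈ U}

variable (R : Type*) [CommRing R]

theorem push_sgMap_comp (g : C(Y, Z)) (f : C(X, Y)) (n : ℕ) (c : (sg X).obj n →₀ R) :
    push R (sgMap (g.comp f)) n c = push R (sgMap g) n (push R (sgMap f) n c) := by
  rw [sgMap_comp, push_comp]

theorem push_sgMap_id (n : ℕ) (c : (sg X).obj n →₀ R) :
    push R (sgMap (ContinuousMap.id X)) n c = c := by
  rw [sgMap_id]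
  exact Finsupp.mapDomain_id

/-- The singular chains supported in the subset `U`. -/
def supp (U : Set X) (n : ℕ) : Submodule R ((sg X).obj n →₀ R) :=
  Finsupp.supported R R (inSet U n)

variable {R}

theorem supp_mono {U V : Set X} (h : U ⊆ V) (n : ℕ) : supp R U n ≤ supp R V n := by
  refine Finsupp.supported_mono ?_
  match n with
  | 0 => exact fun _ _ => trivial
  | n + 1 => exact fun σ hσ p => h (hσ p)

theorem mem_supp_zero (U : Set X) (c : (sg X).obj 0 →₀ R) : c ∈ supp R U 0 :=
  fun _ _ => trivial

theorem mem_supp_univ (n : ℕ) (c : (sg X).obj n →₀ R) : c ∈ supp R Set.univ n := by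
  match n with
  | 0 => exact fun _ _ => trivial
  | n + 1 => exact fun _ _ _ => trivial

theorem single_mem_supp {U : Set X} {n : ℕ} {σ : (sg X).obj (n + 1)} (h : ∀ p, toMap σ p ∈ U)
    (r : R) : Finsupp.single σ r ∈ supp R U (n + 1) :=
  Finsupp.single_mem_supported _ _ h

theorem supp_inter (U V : Set X) (n : ℕ) : supp R (U ∩ V) n = supp R U n ⊓ supp R V n := by
  rw [supp, supp, supp, ← Finsupp.supported_inter]
  congr 1
  match n with
  | 0 => exact (Set.inter_univ _).symm
  | n + 1 => ext σ; exact forall_and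

theorem bd_mem_supp {U : Set X} {n : ℕ} {c : (sg X).obj (n + 1) →₀ R}
    (hc : c ∈ supp R U (n + 1)) : bd R (sg X) n c ∈ supp R U n := by
  match n with
  | 0 => exact mem_supp_zero _ _
  | n + 1 =>
    refine map_mem_of_supported _ (fun σ hσ => ?_) hc
    rw [bd_single]
    refine Submodule.sum_mem _ fun j _ => ?_
    rw [← Int.cast_smul_eq_zsmul R]
    exact Submodule.smul_mem _ _ (single_mem_supp (fun p => hσ (coface j p)) _)

theorem push_mem_supp {U : Set X} {V : Set Y} (f : C(X, Y)) (hf : Set.MapsTo f U V) {n : ℕ}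
    {c : (sg X).obj n →₀ R} (hc : c ∈ supp R U n) : push R (sgMap f) n c ∈ supp R V n := by
  match n with
  | 0 => exact mem_supp_zero _ _
  | n + 1 =>
    refine map_mem_of_supported _ (fun σ hσ => ?_) hc
    rw [push_single]
    exact single_mem_supp (fun p => hf (hσ p)) _

/-! ### Affine simplices -/

/-- The affine simplex in a standard simplex with the given vertices. -/
def aff {k m : ℕ} (v : Fin (k + 1) → Simp m) : C(Simp k, Simp m) where
  toFun w := ⟨∑ i, w i • (v i).1, (convex_stdSimplex ℝ _).sum_mem (fun i _ => w.2.1 i)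
    (stdSimplex.sum_eq_one w) fun i _ => (v i).2⟩
  continuous_toFun := by
    refine Continuous.subtype_mk ?_ _
    refine continuous_finsetSum _ fun i _ => ?_
    exact ((continuous_apply i).comp continuous_subtype_val).smul continuous_const

theorem aff_val {k m : ℕ} (v : Fin (k + 1) → Simp m) (w : Simp k) :
    (aff v w).1 = ∑ i, w i • (v i).1 := rfl

theorem aff_coe {k m : ℕ} (v : Fin (k + 1) → Simp m) (w : Simp k) (l : Fin (m + 1)) :
    aff v w l = ∑ i, w i * v i l := by
  change (aff v w).1 l = _
  rw [aff_val, Finset.sum_apply]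
  rfl

theorem vert_apply {n : ℕ} (k l : Fin (n + 1)) : (vert k : Simp n) l = if l = k then 1 else 0 := by
  change (stdSimplex.vertex k : Simp n).1 l = _
  have h := stdSimplex.vertex_coe (S := ℝ) k
  rw [show (stdSimplex.vertex k : Simp n).1 = Pi.single k 1 from h, Pi.single_apply]

theorem aff_vert {k m : ℕ} (v : Fin (k + 1) → Simp m) (l : Fin (k + 1)) :
    aff v (vert l) = v l := by
  ext i
  rw [aff_coe]
  simp [vert_apply]

theorem aff_verts (m : ℕ) : aff (fun k => (vert k : Simp m)) = ContinuousMap.id _ := by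
  ext w i
  rw [aff_coe]
  simp [vert_apply]

theorem aff_comp_coface {k m : ℕ} (v : Fin (k + 2) → Simp m) (j : Fin (k + 2)) :
    (aff v).comp (coface j) = aff (v ∘ j.succAbove) := by
  ext w i
  rw [ContinuousMap.comp_apply, aff_coe, aff_coe, Fin.sum_univ_succAbove _ j, coface_self, zero_mul,
    zero_add]
  simp only [coface_succAbove, Function.comp_apply]

theorem coface_eq_aff {n : ℕ} (j : Fin (n + 2)) :
    coface j = aff (fun k => (vert (j.succAbove k) : Simp (n + 1))) := by
  rw [← ContinuousMap.id_comp (coface j), ← aff_verts, aff_comp_coface]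
  rfl

theorem aff_aff {k l m : ℕ} (u : Fin (l + 1) → Simp m) (v : Fin (k + 1) → Simp l) (w : Simp k) :
    aff u (aff v w) = aff (aff u ∘ v) w := by
  ext i
  rw [aff_coe, aff_coe]
  simp only [Function.comp_apply, aff_coe, Finset.sum_mul, Finset.mul_sum]
  rw [Finset.sum_comm]
  exact Finset.sum_congr rfl fun _ _ => Finset.sum_congr rfl fun _ _ => by ring

/-- The affine simplex in a prism with the given vertices. -/
def affP {k m : ℕ} (v : Fin (k + 1) → Simp m × unitInterval) :
    C(Simp k, Simp m × unitInterval) where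
  toFun w := (aff (fun i => (v i).1) w, ⟨∑ i, w i • ((v i).2 : ℝ),
    (convex_Icc (0 : ℝ) 1).sum_mem (fun i _ => w.2.1 i) (stdSimplex.sum_eq_one w)
      fun i _ => (v i).2.2⟩)
  continuous_toFun := by
    refine (ContinuousMap.continuous _).prodMk (Continuous.subtype_mk ?_ _)
    refine continuous_finsetSum _ fun i _ => ?_
    exact ((continuous_apply i).comp continuous_subtype_val).smul continuous_const

theorem affP_snd {k m : ℕ} (v : Fin (k + 1) → Simp m × unitInterval) (w : Simp k) :
    ((affP v w).2 : ℝ) = ∑ i, w i • ((v i).2 : ℝ) := rfl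

theorem affP_vert {k m : ℕ} (v : Fin (k + 1) → Simp m × unitInterval) (l : Fin (k + 1)) :
    affP v (vert l) = v l := by
  refine Prod.ext (aff_vert _ l) (Subtype.ext ?_)
  rw [affP_snd]
  simp [vert_apply]

theorem affP_comp_coface {k m : ℕ} (v : Fin (k + 2) → Simp m × unitInterval) (j : Fin (k + 2)) :
    (affP v).comp (coface j) = affP (v ∘ j.succAbove) := by
  ext1 w
  refine Prod.ext (DFunLike.congr_fun (aff_comp_coface (fun i => (v i).1) j) w) (Subtype.ext ?_)
  rw [ContinuousMap.comp_apply, affP_snd, affP_snd, Fin.sum_univ_succAbove _ j, coface_self,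
    zero_smul, zero_add]
  simp only [coface_succAbove, Function.comp_apply]

theorem affP_const {k m : ℕ} (v : Fin (k + 1) → Simp m) (t : unitInterval) (w : Simp k) :
    affP (fun i => (v i, t)) w = (aff v w, t) := by
  refine Prod.ext rfl (Subtype.ext ?_)
  rw [affP_snd]
  change ∑ i, w i • (t : ℝ) = t
  rw [← Finset.sum_smul, stdSimplex.sum_eq_one w, one_smul]

theorem affP_map {k l m : ℕ} (u : Fin (l + 1) → Simp m) (v : Fin (k + 1) → Simp l × unitInterval)
    (w : Simp k) : Prod.map (aff u) id (affP v w) = affP (Prod.map (aff u) id ∘ v) w :=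
  Prod.ext (aff_aff _ _ _) rfl

/-- The realization of tuples of points of a simplex as affine singular simplices. -/
def affHom (m : ℕ) : Hom (tup (Simp m)) (sg (Simp m)) :=
  sgHom (fun _ v => aff v) fun _ j v => (aff_comp_coface v j).symm

/-- The realization of tuples of points of a prism as affine singular simplices. -/
def affPHom (m : ℕ) : Hom (tup (Simp m × unitInterval)) (sg (Simp m × unitInterval)) :=
  sgHom (fun _ v => affP v) fun _ j v => (affP_comp_coface v j).symm

variable (R)

/-- The tuple of the vertices of the standard simplex, as a chain. -/
def vertChain (n : ℕ) : (tup (Simp n)).obj (n + 1) →₀ R := Finsupp.single vert 1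

variable {R}

theorem push_aff {k m : ℕ} (u : Fin (k + 1) → Simp m) (n : ℕ) (c : (tup (Simp k)).obj n →₀ R) :
    push R (sgMap (aff u)) n (push R (affHom k) n c) =
      push R (affHom m) n (push R (tupMap (aff u)) n c) := by
  rw [← push_comp, ← push_comp]
  congr 2
  refine hom_sg_ext fun n v => ?_
  exact ContinuousMap.ext fun w => aff_aff u v w

theorem push_affP {k m : ℕ} (u : Fin (k + 1) → Simp m) (n : ℕ)
    (c : (tup (Simp k × unitInterval)).obj n →₀ R) :
    push R (sgMap ((aff u).prodMap (ContinuousMap.id unitInterval))) n (push R (affPHom k) n c) =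
      push R (affPHom m) n (push R (tupMap (Prod.map (aff u) id)) n c) := by
  rw [← push_comp, ← push_comp]
  congr 2
  refine hom_sg_ext fun n v => ?_
  exact ContinuousMap.ext fun w => affP_map u v w

theorem push_vertChain {n : ℕ} (σ : (sg X).obj (n + 1)) :
    push R (sgMap (toMap σ)) (n + 1) (push R (affHom n) (n + 1) (vertChain R n)) =
      Finsupp.single σ 1 := by
  rw [vertChain, push_single, push_single]
  congr 1
  change ofMap ((toMap σ).comp (aff vert)) = σ
  rw [show aff (vert : Fin (n + 1) → Simp n) = ContinuousMap.id _ from aff_verts n]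
  rfl

theorem push_tupMap_vertChain {n m : ℕ} (v : Fin (n + 1) → Simp m) :
    push R (tupMap (aff v)) (n + 1) (vertChain R n) = Finsupp.single v 1 := by
  rw [vertChain, push_single]
  congr 1
  funext k
  exact aff_vert v k

theorem push_affHom_single {k m : ℕ} (v : (tup (Simp m)).obj (k + 1)) :
    push R (affHom m) (k + 1) (Finsupp.single v 1) = Finsupp.single (ofMap (aff v)) 1 := by
  rw [push_single]
  rfl

/-! ### Subdivision of singular chains -/

/-- The barycenter of an affine simplex. -/
def bary {m n : ℕ} (v : Fin (n + 1) → Simp m) : Simp m := aff v stdSimplex.barycenter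

variable (R X) in
/-- The subdivision homotopy on singular chains. -/
def singT : ∀ n : ℕ, ((sg X).obj n →₀ R) →ₗ[R] ((sg X).obj (n + 1) →₀ R)
  | 0 => 0
  | n + 1 => Finsupp.linearCombination R fun σ : (sg X).obj (n + 1) =>
      push R (sgMap (toMap σ)) (n + 2) (push R (affHom n) (n + 2)
        (subdivT R bary (n + 1) (vertChain R n)))

variable (R X) in
/-- The subdivision operator on singular chains. -/
def singSd : ∀ n : ℕ, ((sg X).obj n →₀ R) →ₗ[R] ((sg X).obj n →₀ R)
  | 0 => LinearMap.id
  | n + 1 => LinearMap.id - bd R (sg X) (n + 1) ∘ₗ singT X R (n + 1) -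
      singT X R n ∘ₗ bd R (sg X) n

theorem singT_single {n : ℕ} (σ : (sg X).obj (n + 1)) :
    singT X R (n + 1) (Finsupp.single σ 1) = push R (sgMap (toMap σ)) (n + 2)
      (push R (affHom n) (n + 2) (subdivT R bary (n + 1) (vertChain R n))) := by
  simp only [singT]
  rw [Finsupp.linearCombination_single, one_smul]

theorem singT_affine {m : ℕ} (σ : C(Simp m, X)) (n : ℕ) (c : (tup (Simp m)).obj n →₀ R) :
    singT X R n (push R (sgMap σ) n (push R (affHom m) n c)) =
      push R (sgMap σ) (n + 1) (push R (affHom m) (n + 1) (subdivT R bary n c)) := by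
  match n with
  | 0 => simp [singT, subdivT]
  | n + 1 =>
    induction c using Finsupp.induction_linear with
    | zero => simp
    | add x y hx hy => simp only [map_add, hx, hy]
    | single v r =>
      rw [← mul_one r, ← smul_eq_mul, ← Finsupp.smul_single]
      simp only [map_smul]
      congr 1
      rw [push_affHom_single, push_single, sgMap_app, toMap_ofMap, singT_single, toMap_ofMap,
        push_sgMap_comp, push_aff, push_subdivT R (b := bary) (b' := bary) _ (fun n w => aff_aff _ _ _),
        push_tupMap_vertChain]

theorem singSd_affine {m : ℕ} (σ : C(Simp m, X)) (n : ℕ) (c : (tup (Simp m)).obj n →₀ R) :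
    singSd X R n (push R (sgMap σ) n (push R (affHom m) n c)) =
      push R (sgMap σ) n (push R (affHom m) n (subdiv R bary n c)) := by
  match n with
  | 0 => rfl
  | n + 1 =>
    simp only [singSd, LinearMap.sub_apply, LinearMap.comp_apply, LinearMap.id_apply, subdiv]
    simp only [map_sub]
    rw [singT_affine, bd_push, bd_push, bd_push, bd_push, singT_affine]

theorem singT_mem_supp {U : Set X} {n : ℕ} {c : (sg X).obj n →₀ R} (hc : c ∈ supp R U n) :
    singT X R n c ∈ supp R U (n + 1) := by
  match n with
  | 0 => simp [singT]
  | n + 1 =>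
    refine map_mem_of_supported _ (fun σ hσ => ?_) hc
    rw [singT_single]
    exact push_mem_supp _ (fun p _ => hσ p) (mem_supp_univ _ _)

theorem singSd_succ (n : ℕ) (c : (sg X).obj (n + 1) →₀ R) :
    singSd X R (n + 1) c = c - bd R (sg X) (n + 1) (singT X R (n + 1) c) -
      singT X R n (bd R (sg X) n c) := rfl

theorem singSd_mem_supp {U : Set X} {n : ℕ} {c : (sg X).obj n →₀ R} (hc : c ∈ supp R U n) :
    singSd X R n c ∈ supp R U n := by
  match n with
  | 0 => exact hc
  | n + 1 =>
    rw [singSd_succ]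
    exact Submodule.sub_mem _ (Submodule.sub_mem _ hc (bd_mem_supp (singT_mem_supp hc)))
      (singT_mem_supp (bd_mem_supp hc))

theorem bd_singSd (n : ℕ) (c : (sg X).obj (n + 1) →₀ R) :
    bd R (sg X) n (singSd X R (n + 1) c) = singSd X R n (bd R (sg X) n c) := by
  rw [singSd_succ, map_sub, map_sub, bd_bd, sub_zero]
  match n with
  | 0 => simp [singT, singSd]
  | n + 1 => rw [singSd_succ, bd_bd, map_zero, sub_zero]

/-! ### Small simplices -/

/-- The affine simplices with vertices in the convex set `C` and edges of length at most `δ`. -/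
def smallTup (m : ℕ) (C : Set (Fin (m + 1) → ℝ)) (δ : ℝ) (n : ℕ) : Set ((tup (Simp m)).obj n) :=
  {v : Fin n → Simp m | (∀ i j, dist (v i) (v j) ≤ δ) ∧ ∀ i, (v i).1 ∈ C}

/-- The mesh estimate behind the convergence of barycentric subdivision. -/
theorem dist_bary_le {m n : ℕ} {v : Fin (n + 1) → Simp m} {δ : ℝ}
    (hv : ∀ i j, dist (v i) (v j) ≤ δ) (j : Fin (n + 1)) :
    dist (bary v) (v j) ≤ (n : ℝ) / (n + 1) * δ := by
  have hn : (0 : ℝ) < (n : ℝ) + 1 := by positivity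
  rw [Subtype.dist_eq, dist_eq_norm]
  have h1 : (bary v).1 - (v j).1 = ∑ i, (1 / ((n : ℝ) + 1)) • ((v i).1 - (v j).1) := by
    simp only [smul_sub, Finset.sum_sub_distrib]
    rw [bary, aff_val]
    congr 1
    · refine Finset.sum_congr rfl fun i _ => ?_
      congr 1
      change (Fintype.card (Fin (n + 1)) : ℝ)⁻¹ = _
      simp
    · rw [Finset.sum_const, Finset.card_univ, Fintype.card_fin, ← Nat.cast_smul_eq_nsmul ℝ,
        smul_smul]
      push_cast
      rw [mul_one_div_cancel hn.ne', one_smul]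
  rw [h1, Fin.sum_univ_succAbove _ j, sub_self, smul_zero, zero_add]
  refine (norm_sum_le _ _).trans ?_
  have h2 : ∀ i ∈ (Finset.univ : Finset (Fin n)),
      ‖(1 / ((n : ℝ) + 1)) • ((v (j.succAbove i)).1 - (v j).1)‖ ≤ 1 / ((n : ℝ) + 1) * δ := by
    intro i _
    rw [norm_smul, Real.norm_of_nonneg (by positivity)]
    refine mul_le_mul_of_nonneg_left ?_ (by positivity)
    rw [← dist_eq_norm, ← Subtype.dist_eq]
    exact hv _ _
  refine (Finset.sum_le_card_nsmul _ _ _ h2).trans (le_of_eq ?_)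
  rw [Finset.card_univ, Fintype.card_fin, nsmul_eq_mul]
  ring

/-- Barycentric subdivision of a simplex with `n` vertices shrinks the diameter at least by the
factor `(n - 1) / n`. -/
theorem subdiv_mem_smallTup {m : ℕ} (δ : ℝ) (hδ : 0 ≤ δ) (n : ℕ) :
    ∀ (C : Set (Fin (m + 1) → ℝ)), Convex ℝ C → ∀ c : (tup (Simp m)).obj n →₀ R,
      c ∈ Finsupp.supported R R (smallTup m C δ n) →
      subdiv R bary n c ∈ Finsupp.supported R R (smallTup m C (((n : ℝ) - 1) / n * δ) n) := by
  induction n with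
  | zero =>
    intro C _ c _
    exact fun v _ => ⟨fun i => i.elim0, fun i => i.elim0⟩
  | succ n ih =>
    intro C hC c hc
    refine map_mem_of_supported _ (fun v hv => ?_) hc
    have hr : (((n + 1 : ℕ) : ℝ) - 1) / ((n + 1 : ℕ) : ℝ) * δ = (n : ℝ) / (n + 1) * δ := by
      push_cast
      rw [add_sub_cancel_right]
    rw [subdiv_single, hr]
    set r := (n : ℝ) / (n + 1) * δ with hrdef
    have hr0 : 0 ≤ r := by positivity
    have hb : (bary v).1 ∈ C :=
      hC.sum_mem (fun i _ => (stdSimplex.barycenter : Simp n).2.1 i)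
        (stdSimplex.sum_eq_one (stdSimplex.barycenter : Simp n)) fun i _ => hv.2 i
    have hκ : ((n : ℝ) - 1) / n * δ ≤ r := by
      refine mul_le_mul_of_nonneg_right ?_ hδ
      rcases Nat.eq_zero_or_pos n with rfl | hn
      · simp
      · have hn' : (0 : ℝ) < n := by exact_mod_cast hn
        rw [div_le_div_iff₀ hn' (by positivity)]
        nlinarith
    have hface : bd R (tup (Simp m)) n (Finsupp.single v 1) ∈ Finsupp.supported R R
        (smallTup m (C ∩ Metric.closedBall (bary v).1 r) δ n) := by
      rw [bd_single]
      refine Submodule.sum_mem _ fun j _ => ?_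
      rw [← Int.cast_smul_eq_zsmul R]
      refine Submodule.smul_mem _ _ (Finsupp.single_mem_supported _ _
        ⟨fun _ _ => hv.1 _ _, fun i => ⟨hv.2 _, ?_⟩⟩)
      rw [Metric.mem_closedBall, dist_comm]
      exact dist_bary_le hv.1 _
    refine map_mem_of_supported _ (fun w hw => ?_)
      (ih _ (hC.inter (convex_closedBall _ _)) _ hface)
    rw [cone_single]
    refine Finsupp.single_mem_supported _ _ ⟨fun i j => ?_, fun i => ?_⟩
    · refine Fin.cases ?_ (fun i => ?_) i <;> refine Fin.cases ?_ (fun j => ?_) j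
      · simpa using hr0
      · have := (hw.2 j).2
        rw [Metric.mem_closedBall, dist_comm] at this
        exact this
      · exact (hw.2 i).2
      · exact (hw.1 i j).trans hκ
    · refine Fin.cases ?_ (fun i => ?_) i
      · exact hb
      · exact (hw.2 i).1

variable (R) in
/-- The chains of simplices each of which is contained in a member of the family `U`. -/
def smallChains {ι : Type*} (U : ι → Set X) (n : ℕ) : Submodule R ((sg X).obj n →₀ R) :=
  Finsupp.supported R R (⋃ i, inSet (U i) n)

/-- Sufficiently often subdivided chains are small: each simplex of the chain has a Lebesgue number
for the cover, and subdivision shrinks the edges by a factor smaller than `1`. -/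
theorem exists_iterate_small {ι : Type*} [Nonempty ι] {U : ι → Set X} (hU : ∀ i, IsOpen (U i))
    {n : ℕ} {c : (sg X).obj n →₀ R} (hc : c ∈ supp R (⋃ i, U i) n) :
    ∃ N : ℕ, ∀ k, N ≤ k → (singSd X R n)^[k] c ∈ smallChains R U n := by
  match n with
  | 0 =>
    exact ⟨0, fun k _ => fun _ _ => Set.mem_iUnion.mpr ⟨Classical.arbitrary ι, trivial⟩⟩
  | n + 1 =>
    rw [supp, Finsupp.supported_eq_span_single] at hc
    simp only [← Module.End.pow_apply]
    induction hc using Submodule.span_induction with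
    | zero => exact ⟨0, fun k _ => by rw [map_zero]; exact Submodule.zero_mem _⟩
    | add x y _ _ hx hy =>
      obtain ⟨N, hN⟩ := hx
      obtain ⟨N', hN'⟩ := hy
      refine ⟨max N N', fun k hk => ?_⟩
      rw [map_add]
      exact Submodule.add_mem _ (hN k (le_of_max_le_left hk)) (hN' k (le_of_max_le_right hk))
    | smul r x _ hx =>
      obtain ⟨N, hN⟩ := hx
      exact ⟨N, fun k hk => by rw [map_smul]; exact Submodule.smul_mem _ _ (hN k hk)⟩
    | mem x hx =>
      obtain ⟨σ, hσ, rfl⟩ := hx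
      have hcov : (Set.univ : Set (Simp n)) ⊆ ⋃ i, toMap σ ⁻¹' U i := fun p _ => by
        have := hσ p
        simpa using this
      -- a Lebesgue number for the cover of the simplex by the preimages of the `U i`
      obtain ⟨δ, hδ, hδU⟩ := lebesgue_number_lemma_of_metric isCompact_univ
        (fun i => (hU i).preimage (toMap σ).continuous) hcov
      set κ : ℝ := (((n + 1 : ℕ) : ℝ) - 1) / ((n + 1 : ℕ) : ℝ) with hκ
      have hκ0 : 0 ≤ κ := by
        rw [hκ]; push_cast; rw [add_sub_cancel_right]; positivity
      have hκ1 : κ < 1 := by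
        rw [hκ]; push_cast; rw [add_sub_cancel_right, div_lt_one (by positivity)]; linarith
      set δ₀ : ℝ := Metric.diam (Set.univ : Set (Simp n))
      have hδ₀ : 0 ≤ δ₀ := Metric.diam_nonneg
      have key : ∀ k : ℕ, ∃ e : (tup (Simp n)).obj (n + 1) →₀ R,
          e ∈ Finsupp.supported R R (smallTup n Set.univ (κ ^ k * δ₀) (n + 1)) ∧
          ((singSd X R (n + 1)) ^ k) (Finsupp.single σ 1) =
            push R (sgMap (toMap σ)) (n + 1) (push R (affHom n) (n + 1) e) := by
        intro k
        induction k with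
        | zero =>
          refine ⟨vertChain R n, ?_, ?_⟩
          · refine Finsupp.single_mem_supported _ _ ⟨fun i j => ?_, fun _ => trivial⟩
            rw [pow_zero, one_mul]
            exact Metric.dist_le_diam_of_mem isCompact_univ.isBounded trivial trivial
          · rw [pow_zero, push_vertChain]
            rfl
        | succ k ih =>
          obtain ⟨e, he, h⟩ := ih
          refine ⟨subdiv R bary (n + 1) e, ?_, ?_⟩
          · rw [pow_succ', mul_assoc]
            exact subdiv_mem_smallTup _ (by positivity) _ _ convex_univ _ he
          · rw [pow_succ', Module.End.mul_apply, h, singSd_affine]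
      obtain ⟨N, hN⟩ : ∃ N : ℕ, κ ^ N * δ₀ < δ := by
        have := (tendsto_pow_atTop_nhds_zero_of_lt_one hκ0 hκ1).mul_const δ₀
        rw [zero_mul] at this
        exact (this.eventually (gt_mem_nhds hδ)).exists
      refine ⟨N, fun k hk => ?_⟩
      obtain ⟨e, he, h⟩ := key k
      rw [h, ← push_comp]
      refine map_mem_of_supported _ (fun w hw => ?_) he
      rw [push_single]
      refine Finsupp.single_mem_supported _ _ ?_
      obtain ⟨i, hi⟩ := hδU (w 0) trivial
      refine Set.mem_iUnion.mpr ⟨i, fun p => hi ?_⟩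
      change dist (aff w p) (w 0) < δ
      have hlt : κ ^ k * δ₀ < δ :=
        lt_of_le_of_lt (mul_le_mul_of_nonneg_right (pow_le_pow_of_le_one hκ0 hκ1.le hk) hδ₀) hN
      have : (aff w p).1 ∈ Metric.ball (w 0).1 δ :=
        (convex_ball _ _).sum_mem (fun i _ => p.2.1 i) (stdSimplex.sum_eq_one p)
          fun i _ => lt_of_le_of_lt (hw.1 i 0) hlt
      exact this

/-- The theorem on small simplices: up to a chain homotopy `D` that preserves the chains supported
in any given subset, a chain in the union of the open sets `U i` is a chain of simplices each of
which is contained in one of the `U i`. -/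
theorem exists_small {ι : Type*} [Nonempty ι] {U : ι → Set X} (hU : ∀ i, IsOpen (U i))
    {n : ℕ} {c : (sg X).obj (n + 1) →₀ R} (hc : c ∈ supp R (⋃ i, U i) (n + 1)) :
    ∃ D : ∀ k : ℕ, ((sg X).obj k →₀ R) →ₗ[R] ((sg X).obj (k + 1) →₀ R),
      (∀ (V : Set X) (k : ℕ), ∀ e ∈ supp R V k, D k e ∈ supp R V (k + 1)) ∧
      c - bd R (sg X) (n + 1) (D (n + 1) c) - D n (bd R (sg X) n c) ∈ smallChains R U (n + 1) := by
  obtain ⟨N, hN⟩ := exists_iterate_small hU hc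
  have key : ∀ k : ℕ, ∃ D : ∀ k : ℕ, ((sg X).obj k →₀ R) →ₗ[R] ((sg X).obj (k + 1) →₀ R),
      (∀ (V : Set X) (k : ℕ), ∀ e ∈ supp R V k, D k e ∈ supp R V (k + 1)) ∧
      c - bd R (sg X) (n + 1) (D (n + 1) c) - D n (bd R (sg X) n c) =
        ((singSd X R (n + 1)) ^ k) c := by
    intro k
    induction k with
    | zero => exact ⟨fun _ => 0, fun V k e _ => Submodule.zero_mem _, by simp⟩
    | succ k ih =>
      obtain ⟨D, hD, h⟩ := ih
      have hb : bd R (sg X) n (((singSd X R (n + 1)) ^ k) c) =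
          ((singSd X R n) ^ k) (bd R (sg X) n c) := by
        clear h
        induction k with
        | zero => rfl
        | succ k ih => rw [pow_succ', pow_succ', Module.End.mul_apply, Module.End.mul_apply,
            bd_singSd, ih]
      refine ⟨fun i => D i + singT X R i ∘ₗ ((singSd X R i) ^ k), fun V i e he => ?_, ?_⟩
      · refine Submodule.add_mem _ (hD V i e he) (singT_mem_supp ?_)
        induction k with
        | zero => exact he
        | succ k ih' =>
          have : ∀ k : ℕ, ((singSd X R i) ^ k) e ∈ supp R V i := fun k => by
            induction k with
            | zero => exact he
            | succ k ih =>
              rw [pow_succ', Module.End.mul_apply]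
              exact singSd_mem_supp ih
          exact this _
      · rw [pow_succ', Module.End.mul_apply, singSd_succ, hb]
        simp only [LinearMap.add_apply, LinearMap.comp_apply, map_add]
        rw [← sub_eq_zero] at h ⊢
        rw [← h]
        abel
  obtain ⟨D, hD, h⟩ := key N
  refine ⟨D, hD, ?_⟩
  rw [h, Module.End.pow_apply]
  exact hN N le_rfl

/-- A chain of simplices each of which is contained in `U` or in `V` is a sum of a chain in `U` and
a chain in `V`. -/
theorem exists_add_of_small {U V : Set X} {n : ℕ} {c : (sg X).obj n →₀ R}
    (hc : c ∈ smallChains R (fun b : Bool => cond b U V) n) :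
    ∃ a ∈ supp R U n, ∃ b ∈ supp R V n, c = a + b := by
  have h : smallChains R (fun b : Bool => cond b U V) n = supp R U n ⊔ supp R V n := by
    rw [supp, supp, ← Finsupp.supported_union, smallChains]
    congr 1
    ext σ
    simp only [Set.mem_iUnion, Bool.exists_bool, Set.mem_union]
    exact or_comm
  rw [h] at hc
  obtain ⟨a, ha, b, hb, rfl⟩ := Submodule.mem_sup.mp hc
  exact ⟨a, ha, b, hb, rfl⟩

end Singular

/-! ### Natural homotopies and the prism operator -/

/-- A natural homotopy: a family of maps `Δⁿ × [0,1] → Y`, one for each singular simplex of `X`,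
compatible with faces. -/
structure NatHtpy (X : Type u) (Y : Type v) [TopologicalSpace X] [TopologicalSpace Y] where
  H : ∀ {n : ℕ}, C(Simp n, X) → C(Simp n × unitInterval, Y)
  nat : ∀ {n : ℕ} (j : Fin (n + 2)) (σ : C(Simp (n + 1), X)),
    H (σ.comp (coface j)) = (H σ).comp ((coface j).prodMap (ContinuousMap.id _))

section Homotopy

variable {X : Type u} {Y : Type v} {Z : Type w} [TopologicalSpace X] [TopologicalSpace Y]
  [TopologicalSpace Z]

/-- The inclusion of the slice `X × {t}` of `X × [0,1]`. -/
def slice (X : Type u) [TopologicalSpace X] (t : unitInterval) : C(X, X × unitInterval) :=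
  (ContinuousMap.id X).prodMk (ContinuousMap.const X t)

/-- The natural homotopy defined by a homotopy between continuous maps. -/
def NatHtpy.ofMap (G : C(X × unitInterval, Y)) : NatHtpy X Y where
  H σ := G.comp (σ.prodMap (ContinuousMap.id _))
  nat _ _ := rfl

/-- The morphism at time `t` of a natural homotopy. -/
def NatHtpy.at (h : NatHtpy X Y) (t : unitInterval) : Hom (sg X) (sg Y) :=
  sgHom (fun n σ => (h.H (toMap σ)).comp (slice (Simp n) t)) fun n j σ => by
    rw [toMap_face, h.nat]
    rfl

theorem NatHtpy.at_app (h : NatHtpy X Y) (t : unitInterval) {n : ℕ} (σ : (sg X).obj (n + 1)) :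
    (h.at t).app σ = HatComplex.ofMap ((h.H (toMap σ)).comp (slice (Simp n) t)) := rfl

theorem NatHtpy.ofMap_at (G : C(X × unitInterval, Y)) (t : unitInterval) :
    (NatHtpy.ofMap G).at t = sgMap (G.comp (slice X t)) :=
  hom_sg_ext fun _ _ => rfl

variable (R : Type*) [CommRing R]

/-- The prism operator of a natural homotopy. -/
def NatHtpy.prism (h : NatHtpy X Y) : ∀ n : ℕ, ((sg X).obj n →₀ R) →ₗ[R] ((sg Y).obj (n + 1) →₀ R)
  | 0 => 0
  | n + 1 => Finsupp.linearCombination R fun σ : (sg X).obj (n + 1) =>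
      push R (sgMap (h.H (toMap σ))) (n + 2) (push R (affPHom n) (n + 2)
        (HatComplex.prism R 0 1 (n + 1) (vertChain R n)))

theorem NatHtpy.prism_single (h : NatHtpy X Y) {n : ℕ} (σ : (sg X).obj (n + 1)) :
    h.prism R (n + 1) (Finsupp.single σ 1) =
      push R (sgMap (h.H (toMap σ))) (n + 2) (push R (affPHom n) (n + 2)
        (HatComplex.prism R 0 1 (n + 1) (vertChain R n))) := by
  simp only [NatHtpy.prism]
  rw [Finsupp.linearCombination_single, one_smul]

theorem bd_vertChain (n : ℕ) : bd R (tup (Simp (n + 1))) (n + 1) (vertChain R (n + 1)) =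
    ∑ j : Fin (n + 2), ((-1 : ℤ) ^ (j : ℕ)) • push R (tupMap (coface j)) (n + 1) (vertChain R n) := by
  rw [vertChain, bd_single]
  refine Finset.sum_congr rfl fun j _ => ?_
  rw [vertChain, push_single]
  congr 2
  funext k
  exact (coface_vert j k).symm

/-- The prism operator of a natural homotopy of simplices is a chain homotopy. -/
theorem NatHtpy.bd_prism (h : NatHtpy X Y) (n : ℕ) (c : (sg X).obj (n + 1) →₀ R) :
    bd R (sg Y) (n + 1) (h.prism R (n + 1) c) =
      push R (h.at 1) (n + 1) c - push R (h.at 0) (n + 1) c - h.prism R n (bd R (sg X) n c) := by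
  induction c using Finsupp.induction_linear with
  | zero => simp
  | add x y hx hy => simp only [map_add, hx, hy]; abel
  | single σ r =>
    rw [← mul_one r, ← smul_eq_mul, ← Finsupp.smul_single]
    simp only [map_smul, ← smul_sub]
    congr 1
    rw [h.prism_single R, bd_push, bd_push, HatComplex.bd_prism, map_sub, map_sub, map_sub, map_sub]
    have hend : ∀ t : unitInterval, push R (sgMap (h.H (toMap σ))) (n + 1) (push R (affPHom n) (n + 1)
        (push R (tupMap fun x => (x, t)) (n + 1) (vertChain R n))) =
        push R (h.at t) (n + 1) (Finsupp.single σ 1) := fun t => by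
      rw [vertChain, push_single, push_single, push_single, push_single]
      congr 1
      change HatComplex.ofMap ((h.H (toMap σ)).comp (affP fun k => (vert k, t))) = _
      rw [h.at_app]
      congr 2
      ext1 w
      rw [affP_const]
      rw [show aff (fun k => (vert k : Simp n)) = ContinuousMap.id _ from aff_verts n]
      rfl
    rw [hend, hend]
    congr 1
    match n, σ with
    | 0, σ => simp [NatHtpy.prism, HatComplex.prism]
    | n + 1, σ =>
      rw [bd_vertChain, bd_single]
      simp only [map_sum, map_zsmul]
      refine Finset.sum_congr rfl fun j _ => ?_
      congr 1
      rw [h.prism_single R, ← push_prism, toMap_face, h.nat, push_sgMap_comp, coface_eq_aff, push_affP]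

variable {R}

theorem NatHtpy.prism_mem_supp (h : NatHtpy X Y) {U : Set X} {V : Set Y}
    (hUV : ∀ (n : ℕ) (σ : C(Simp n, X)), (∀ p, σ p ∈ U) → ∀ q, h.H σ q ∈ V) {n : ℕ}
    {c : (sg X).obj n →₀ R} (hc : c ∈ supp R U n) : h.prism R n c ∈ supp R V (n + 1) := by
  match n with
  | 0 => simp [NatHtpy.prism]
  | n + 1 =>
    refine map_mem_of_supported _ (fun σ hσ => ?_) hc
    rw [prism_single]
    exact push_mem_supp _ (fun q _ => hUV _ _ hσ q) (mem_supp_univ _ _)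

/-- The simplices whose vertices lie in `V`. -/
def vertsIn (V : Set X) : ∀ n : ℕ, Set ((sg X).obj n)
  | 0 => Set.univ
  | _ + 1 => {σ | ∀ k, toMap σ (vert k) ∈ V}

/-- The prism operator of a homotopy that moves the vertices of the simplices in question inside `V`
at the times `0` and `1` yields simplices with vertices in `V`. -/
theorem NatHtpy.prism_mem_vertsIn (h : NatHtpy X Y) {n : ℕ} {A : Set ((sg X).obj (n + 1))}
    {V : Set Y} (h0 : ∀ σ ∈ A, ∀ k, h.H (toMap σ) (vert k, 0) ∈ V)
    (h1 : ∀ σ ∈ A, ∀ k, h.H (toMap σ) (vert k, 1) ∈ V) {c : (sg X).obj (n + 1) →₀ R}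
    (hc : c ∈ Finsupp.supported R R A) :
    h.prism R (n + 1) c ∈ Finsupp.supported R R (vertsIn V (n + 2)) := by
  refine map_mem_of_supported _ (fun σ hσ => ?_) hc
  rw [prism_single]
  have hv : vertChain R n ∈ Finsupp.supported R R
      {v : Fin (n + 1) → Simp n | ∀ k, ∃ l, v k = vert l} :=
    Finsupp.single_mem_supported _ _ fun k => ⟨k, rfl⟩
  rw [← push_comp]
  refine map_mem_of_supported _ (fun w hw => ?_)
    (prism_mem_supported R (0 : unitInterval) 1 (n + 1) (Q := fun p => ∃ l, p = vert l) hv)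
  rw [push_single]
  refine Finsupp.single_mem_supported _ _ fun k => ?_
  change h.H (toMap σ) (affP w (vert k)) ∈ V
  rw [affP_vert]
  obtain ⟨⟨l, hl⟩, ht | ht⟩ := hw k
  · rw [show w k = (vert l, 0) from Prod.ext hl ht]; exact h0 σ hσ l
  · rw [show w k = (vert l, 1) from Prod.ext hl ht]; exact h1 σ hσ l

/-! ### Cone operators -/

/-- A cone operator over a morphism `f : T → S`: it assigns to each simplex of `T` a simplex of `S`
with one more vertex, added at the end. -/
structure ConeOp {T : ASet.{u}} {S : ASet.{v}} (f : Hom T S) where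
  k : ∀ {n : ℕ}, T.obj n → S.obj (n + 1)
  face_castSucc : ∀ {n : ℕ} (j : Fin (n + 1)) (s : T.obj (n + 1)),
    S.face j.castSucc (k s) = k (T.face j s)
  face_last : ∀ {n : ℕ} (s : T.obj n), S.face (Fin.last n) (k s) = f.app s

variable (R) in
/-- The linear extension of a cone operator. -/
def ConeOp.map {T : ASet.{u}} {S : ASet.{v}} {f : Hom T S} (K : ConeOp f) (n : ℕ) :
    (T.obj n →₀ R) →ₗ[R] (S.obj (n + 1) →₀ R) :=
  Finsupp.lmapDomain R R (K.k (n := n))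

theorem ConeOp.map_single {T : ASet.{u}} {S : ASet.{v}} {f : Hom T S} (K : ConeOp f) (n : ℕ)
    (s : T.obj n) (r : R) : K.map R n (Finsupp.single s r) = Finsupp.single (K.k s) r := by
  simp [ConeOp.map, Finsupp.mapDomain_single]

/-- The boundary of the cone over the empty simplex, which has no cone term. -/
theorem ConeOp.bd_map_zero {T : ASet.{u}} {S : ASet.{v}} {f : Hom T S} (K : ConeOp f)
    (c : T.obj 0 →₀ R) : bd R S 0 (K.map R 0 c) = push R f 0 c := by
  induction c using Finsupp.induction_linear with
  | zero => simp
  | add x y hx hy => simp only [map_add, hx, hy]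
  | single s r =>
    rw [K.map_single, bd_single, Fin.sum_univ_one, push_single, ← K.face_last s]
    simp

/-- The boundary of a cone, whose last vertex is the cone point: the face opposite to it is the last
one, whence the sign. -/
theorem ConeOp.bd_map {T : ASet.{u}} {S : ASet.{v}} {f : Hom T S} (K : ConeOp f) (n : ℕ)
    (c : T.obj (n + 1) →₀ R) :
    bd R S (n + 1) (K.map R (n + 1) c) =
      K.map R n (bd R T n c) + ((-1 : ℤ) ^ (n + 1)) • push R f (n + 1) c := by
  induction c using Finsupp.induction_linear with
  | zero => simp
  | add x y hx hy => simp only [map_add, hx, hy, smul_add]; abel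
  | single s r =>
    rw [K.map_single, bd_single, Fin.sum_univ_castSucc, push_single, K.face_last, bd_single, map_sum]
    congr 1
    refine Finset.sum_congr rfl fun j _ => ?_
    rw [map_zsmul, K.map_single, K.face_castSucc, Fin.val_castSucc]

/-- A chain whose image under `f` is a cycle up to sign bounds its cone. -/
theorem ConeOp.exists_bd {T : ASet.{u}} {S : ASet.{v}} {f : Hom T S} (K : ConeOp f) (n : ℕ)
    {c : T.obj (n + 1) →₀ R} (hc : bd R T n c = 0) :
    push R f (n + 1) c = bd R S (n + 1) (((-1 : ℤ) ^ (n + 1)) • K.map R (n + 1) c) := by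
  rw [map_zsmul, K.bd_map, hc, map_zero, zero_add, smul_smul, ← mul_pow]
  simp

theorem contract_factors {G : C(X × unitInterval, Y)} {y : Y} (hG : ∀ x, G (x, 1) = y) {n : ℕ}
    (τ : C(Simp n, X)) : Function.FactorsThrough
      (G.comp (τ.prodMap (ContinuousMap.id unitInterval))) (joinPt (n := n)) := by
  rintro ⟨v, t⟩ ⟨w, t'⟩ h
  have ht : t = t' := by
    have := congr_arg (fun p => p (Fin.last (n + 1))) h
    simpa [Subtype.ext_iff] using this
  subst ht
  by_cases h1 : t = 1
  · subst h1
    exact (hG _).trans (hG _).symm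
  · have hv : v = w := by
      ext k
      have := congr_arg (fun p => p k.castSucc) h
      simp only [joinPt_castSucc] at this
      exact mul_left_cancel₀ (sub_ne_zero.mpr fun h => h1 (Subtype.ext h.symm)) this
    rw [hv]

/-- The cone over a singular simplex defined by a contraction `G` of `X` to the point `y` of `Y`. -/
def contractK (G : C(X × unitInterval, Y)) {y : Y} (hG : ∀ x, G (x, 1) = y) :
    ∀ {n : ℕ}, (sg X).obj n → (sg Y).obj (n + 1)
  | 0, _ => HatComplex.ofMap (ContinuousMap.const _ y)
  | _ + 1, τ => HatComplex.ofMap (joinPt_isQuotientMap.lift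
      (G.comp ((toMap τ).prodMap (ContinuousMap.id unitInterval))) (contract_factors hG _))

theorem contractK_joinPt (G : C(X × unitInterval, Y)) {y : Y} (hG : ∀ x, G (x, 1) = y) {n : ℕ}
    (τ : (sg X).obj (n + 1)) (v : Simp n) (t : unitInterval) :
    toMap (contractK G hG τ) (joinPt (v, t)) = G (toMap τ v, t) :=
  DFunLike.congr_fun (joinPt_isQuotientMap.lift_comp _ (contract_factors hG (toMap τ))) (v, t)

/-- The cone operator on singular simplices defined by a contraction. -/
def contractOp (G : C(X × unitInterval, Y)) {y : Y} (hG : ∀ x, G (x, 1) = y) :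
    ConeOp (sgMap (G.comp (slice X 0))) where
  k := contractK G hG
  face_castSucc {n} j τ := by
    match n with
    | 0 =>
      change (toMap (contractK G hG τ)).comp (coface j.castSucc) = toMap (contractK G hG default)
      ext v
      obtain rfl : j = 0 := Fin.fin_one_eq_zero j
      rw [ContinuousMap.comp_apply, Fin.castSucc_zero, coface_zero_eq v v, contractK_joinPt, hG]
      rfl
    | n + 1 =>
      change (toMap (contractK G hG τ)).comp (coface j.castSucc) =
        toMap (contractK G hG ((sg X).face j τ))
      ext p
      obtain ⟨⟨v, t⟩, rfl⟩ := joinPt_surjective p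
      rw [ContinuousMap.comp_apply, coface_castSucc_joinPt, contractK_joinPt, contractK_joinPt]
      rfl
  face_last {n} τ := by
    match n with
    | 0 => exact Subsingleton.elim _ _
    | n + 1 =>
      change (toMap (contractK G hG τ)).comp (coface (Fin.last (n + 1))) =
        (G.comp (slice X 0)).comp (toMap τ)
      ext v
      rw [ContinuousMap.comp_apply, coface_last_eq, contractK_joinPt]
      rfl

theorem contractOp_mem_supp {G : C(X × unitInterval, Y)} {y : Y} (hG : ∀ x, G (x, 1) = y)
    {V : Set Y} (hV : ∀ q, G q ∈ V) (hy : y ∈ V) (n : ℕ) (c : (sg X).obj n →₀ R) :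
    (contractOp G hG).map R n c ∈ supp R V (n + 1) := by
  induction c using Finsupp.induction_linear with
  | zero => simp
  | add x y hx hy => rw [map_add]; exact Submodule.add_mem _ hx hy
  | single σ r =>
    rw [ConeOp.map_single]
    refine single_mem_supp (fun p => ?_) _
    match n, σ with
    | 0, σ => exact hy
    | n + 1, σ =>
      obtain ⟨⟨v, t⟩, rfl⟩ := joinPt_surjective p
      change toMap (contractK G hG σ) (joinPt (v, t)) ∈ V
      rw [contractK_joinPt]
      exact hV _

/-! ### Relative cycles and boundaries -/

variable (R) in
/-- The relative cycles of dimension `n` of the pair `(X, U)`. -/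
def relCyc (U : Set X) (n : ℕ) : Submodule R ((sg X).obj (n + 1) →₀ R) :=
  (supp R U n).comap (bd R (sg X) n)

variable (R) in
/-- The relative boundaries of dimension `n` of the pair `(X, U)`. -/
def relBd (U : Set X) (n : ℕ) : Submodule R ((sg X).obj (n + 1) →₀ R) :=
  LinearMap.range (bd R (sg X) (n + 1)) ⊔ supp R U (n + 1)

theorem mem_relCyc {U : Set X} {n : ℕ} {z : (sg X).obj (n + 1) →₀ R} :
    z ∈ relCyc R U n ↔ bd R (sg X) n z ∈ supp R U n := Iff.rfl

theorem mem_relBd {U : Set X} {n : ℕ} {z : (sg X).obj (n + 1) →₀ R} :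
    z ∈ relBd R U n ↔ ∃ b, ∃ w ∈ supp R U (n + 1), z = bd R (sg X) (n + 1) b + w := by
  rw [relBd, Submodule.mem_sup]
  constructor
  · rintro ⟨_, ⟨b, rfl⟩, w, hw, h⟩
    exact ⟨b, w, hw, h.symm⟩
  · rintro ⟨b, w, hw, rfl⟩
    exact ⟨_, ⟨b, rfl⟩, w, hw, rfl⟩

theorem bd_mem_relBd (U : Set X) (n : ℕ) (b : (sg X).obj (n + 2) →₀ R) :
    bd R (sg X) (n + 1) b ∈ relBd R U n :=
  Submodule.mem_sup_left ⟨b, rfl⟩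

theorem supp_le_relBd (U : Set X) (n : ℕ) : supp R U (n + 1) ≤ relBd R U n := le_sup_right

theorem relCyc_mono {U V : Set X} (h : U ⊆ V) (n : ℕ) : relCyc R U n ≤ relCyc R V n :=
  fun _ hz => supp_mono h _ hz

theorem relBd_mono {U V : Set X} (h : U ⊆ V) (n : ℕ) : relBd R U n ≤ relBd R V n :=
  sup_le_sup le_rfl (supp_mono h _)

theorem relBd_le_relCyc (U : Set X) (n : ℕ) : relBd R U n ≤ relCyc R U n := by
  intro z hz
  obtain ⟨b, w, hw, rfl⟩ := mem_relBd.mp hz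
  rw [mem_relCyc, map_add, bd_bd, zero_add]
  exact bd_mem_supp hw

theorem push_mem_relCyc (f : C(X, Y)) {U : Set X} {V : Set Y} (h : Set.MapsTo f U V) {n : ℕ}
    {z : (sg X).obj (n + 1) →₀ R} (hz : z ∈ relCyc R U n) :
    push R (sgMap f) (n + 1) z ∈ relCyc R V n := by
  rw [mem_relCyc, bd_push]
  exact push_mem_supp f h hz

theorem push_mem_relBd (f : C(X, Y)) {U : Set X} {V : Set Y} (h : Set.MapsTo f U V) {n : ℕ}
    {z : (sg X).obj (n + 1) →₀ R} (hz : z ∈ relBd R U n) :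
    push R (sgMap f) (n + 1) z ∈ relBd R V n := by
  obtain ⟨b, w, hw, rfl⟩ := mem_relBd.mp hz
  rw [map_add, ← bd_push]
  exact Submodule.add_mem _ (bd_mem_relBd _ _ _) (supp_le_relBd _ _ (push_mem_supp f h hw))

/-- Homotopic maps of pairs agree on relative homology. -/
theorem push_sub_push_mem_relBd (G : C(X × unitInterval, Y)) {U : Set X} {V : Set Y}
    (h : ∀ x ∈ U, ∀ t, G (x, t) ∈ V) {n : ℕ} {z : (sg X).obj (n + 1) →₀ R}
    (hz : z ∈ relCyc R U n) :
    push R (sgMap (G.comp (slice X 1))) (n + 1) z - push R (sgMap (G.comp (slice X 0))) (n + 1) z ∈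
      relBd R V n := by
  have h1 := (NatHtpy.ofMap G).bd_prism R n z
  rw [NatHtpy.ofMap_at, NatHtpy.ofMap_at, eq_sub_iff_add_eq] at h1
  rw [← h1]
  refine Submodule.add_mem _ (bd_mem_relBd _ _ _) (supp_le_relBd _ _ ?_)
  exact NatHtpy.prism_mem_supp _ (fun n σ hσ q => h _ (hσ _) _) hz

/-! ### Mayer–Vietoris arguments -/

/-- A chain in the union of the open sets `U` and `V`, whose boundary is a sum of a chain in `U` and
a chain in `V`, is itself such a sum up to a boundary in `U ∪ V`. -/
theorem exists_add_add_bd {U V : Set X} (hU : IsOpen U) (hV : IsOpen V) {n : ℕ}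
    {w : (sg X).obj (n + 1) →₀ R} (hw : w ∈ supp R (U ∪ V) (n + 1)) {a b : (sg X).obj n →₀ R}
    (ha : a ∈ supp R U n) (hb : b ∈ supp R V n) (h : bd R (sg X) n w = a + b) :
    ∃ a' ∈ supp R U (n + 1), ∃ b' ∈ supp R V (n + 1), ∃ e ∈ supp R (U ∪ V) (n + 2),
      w = a' + b' + bd R (sg X) (n + 1) e := by
  have hopen : ∀ i : Bool, IsOpen (cond i U V) := fun i => match i with
    | true => hU
    | false => hV
  have hun : U ∪ V ⊆ ⋃ i : Bool, cond i U V := fun x hx =>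
    hx.elim (fun h => Set.mem_iUnion.mpr ⟨true, h⟩) fun h => Set.mem_iUnion.mpr ⟨false, h⟩
  obtain ⟨D, hD, hs⟩ := exists_small hopen (supp_mono hun _ hw)
  obtain ⟨a₁, ha₁, b₁, hb₁, h₁⟩ := exists_add_of_small hs
  refine ⟨a₁ + D n a, Submodule.add_mem _ ha₁ (hD _ _ _ ha), b₁ + D n b,
    Submodule.add_mem _ hb₁ (hD _ _ _ hb), D (n + 1) w, hD _ _ _ hw, ?_⟩
  rw [h, map_add, sub_eq_iff_eq_add, sub_eq_iff_eq_add] at h₁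
  refine h₁.trans ?_
  abel

variable (R) in
/-- The closed set `K` has no relative homology `H_i(X, X - K)` in degrees `i > d`, and
`H_d(X, X - K)` is detected by the points of `K`. -/
def Detected (d : ℕ) (K : Set X) : Prop :=
  (∀ i, d < i → relCyc R Kᶜ i ≤ relBd R Kᶜ i) ∧
    ∀ z ∈ relCyc R Kᶜ d, (∀ p ∈ K, z ∈ relBd R {p}ᶜ d) → z ∈ relBd R Kᶜ d

/-- Cycles relative to `U ∩ V` which bound relative to `U` and relative to `V` bound relative to
`U ∩ V`, provided that relative cycles of `U ∪ V` one dimension higher bound. -/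
theorem mem_relBd_inter {U V : Set X} (hU : IsOpen U) (hV : IsOpen V) {n : ℕ}
    (hUV : relCyc R (U ∪ V) (n + 1) ≤ relBd R (U ∪ V) (n + 1))
    {z : (sg X).obj (n + 1) →₀ R} (h1 : z ∈ relBd R U n) (h2 : z ∈ relBd R V n) :
    z ∈ relBd R (U ∩ V) n := by
  obtain ⟨a, u, hu, hza⟩ := mem_relBd.mp h1
  obtain ⟨b, v, hv, hzb⟩ := mem_relBd.mp h2
  have hab : bd R (sg X) (n + 1) (a - b) = v + -u := by
    rw [map_sub, ← sub_eq_zero]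
    have := hza.symm.trans hzb
    rw [← sub_eq_zero] at this
    rw [← this]
    abel
  have hab' : a - b ∈ relCyc R (U ∪ V) (n + 1) := by
    rw [mem_relCyc, hab]
    exact Submodule.add_mem _ (supp_mono Set.subset_union_right _ hv)
      (Submodule.neg_mem _ (supp_mono Set.subset_union_left _ hu))
  obtain ⟨c, w, hw, hcw⟩ := mem_relBd.mp (hUV hab')
  have hbw : bd R (sg X) (n + 1) w = -u + v := by
    rw [hcw, map_add, bd_bd, zero_add] at hab
    exact hab.trans (add_comm _ _)
  obtain ⟨a', ha', b', hb', e, -, hw'⟩ := exists_add_add_bd hU hV hw (Submodule.neg_mem _ hu) hv hbw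
  rw [hw', map_add, map_add, bd_bd, add_zero] at hbw
  have key : u + bd R (sg X) (n + 1) a' = v - bd R (sg X) (n + 1) b' := by
    rw [← sub_eq_zero] at hbw ⊢
    rw [← hbw]
    abel
  refine mem_relBd.mpr ⟨a - a', u + bd R (sg X) (n + 1) a', ?_, ?_⟩
  · rw [supp_inter]
    refine ⟨Submodule.add_mem _ hu (bd_mem_supp ha'), ?_⟩
    rw [key]
    exact Submodule.sub_mem _ hv (bd_mem_supp hb')
  · rw [hza, map_sub]
    abel

/-- The Mayer–Vietoris step for detection by points. -/
theorem Detected.union {d : ℕ} {K L : Set X} (hK : IsClosed K) (hL : IsClosed L)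
    (h1 : Detected R d K) (h2 : Detected R d L) (h12 : Detected R d (K ∩ L)) :
    Detected R d (K ∪ L) := by
  have hUV : ∀ i, d ≤ i → relCyc R (Kᶜ ∪ Lᶜ) (i + 1) ≤ relBd R (Kᶜ ∪ Lᶜ) (i + 1) := by
    intro i hi
    rw [← Set.compl_inter]
    exact h12.1 _ (Nat.lt_succ_of_le hi)
  refine ⟨fun i hi z hz => ?_, fun z hz hp => ?_⟩
  · rw [Set.compl_union] at hz ⊢
    exact mem_relBd_inter hK.isOpen_compl hL.isOpen_compl (hUV i hi.le)
      (h1.1 i hi (relCyc_mono Set.inter_subset_left _ hz))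
      (h2.1 i hi (relCyc_mono Set.inter_subset_right _ hz))
  · rw [Set.compl_union] at hz ⊢
    exact mem_relBd_inter hK.isOpen_compl hL.isOpen_compl (hUV d le_rfl)
      (h1.2 z (relCyc_mono Set.inter_subset_left _ hz) fun p hp' => hp p (Or.inl hp'))
      (h2.2 z (relCyc_mono Set.inter_subset_right _ hz) fun p hp' => hp p (Or.inr hp'))

theorem detected_empty (d : ℕ) : Detected R d (∅ : Set X) := by
  refine ⟨fun i _ z _ => ?_, fun z _ _ => ?_⟩ <;>
  · rw [Set.compl_empty]
    exact supp_le_relBd _ _ (mem_supp_univ _ _)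

/-- Gluing relative cycles: classes relative to `U` and to `V` which agree relative to `U ∪ V` come
from a common class relative to `U ∩ V`. -/
theorem exists_glue {U V : Set X} (hU : IsOpen U) (hV : IsOpen V) {n : ℕ}
    {x y : (sg X).obj (n + 1) →₀ R} (hx : x ∈ relCyc R U n) (hy : y ∈ relCyc R V n)
    (hxy : x - y ∈ relBd R (U ∪ V) n) :
    ∃ z ∈ relCyc R (U ∩ V) n, z - x ∈ relBd R U n ∧ z - y ∈ relBd R V n := by
  obtain ⟨c, w, hw, hcw⟩ := mem_relBd.mp hxy
  have hbw : bd R (sg X) n w = bd R (sg X) n x + -bd R (sg X) n y := by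
    have := congr_arg (bd R (sg X) n) hcw
    rw [map_add, bd_bd, zero_add, map_sub] at this
    rw [← this, sub_eq_add_neg]
  obtain ⟨a, ha, b, hb, e, -, hw'⟩ := exists_add_add_bd hU hV hw hx (Submodule.neg_mem _ hy) hbw
  have key : x - a = y + b + bd R (sg X) (n + 1) (c + e) := by
    rw [hw'] at hcw
    rw [map_add, ← sub_eq_zero]
    rw [← sub_eq_zero] at hcw
    rw [← hcw]
    abel
  refine ⟨x - a, ?_, ?_, ?_⟩
  · rw [mem_relCyc, supp_inter]
    constructor
    · rw [map_sub]
      exact Submodule.sub_mem _ hx (bd_mem_supp ha)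
    · rw [key, map_add, bd_bd, add_zero, map_add]
      exact Submodule.add_mem _ hy (bd_mem_supp hb)
  · rw [sub_sub_cancel_left]
    exact supp_le_relBd _ _ (Submodule.neg_mem _ ha)
  · rw [key, add_assoc, add_sub_cancel_left]
    exact Submodule.add_mem _ (supp_le_relBd _ _ hb) (bd_mem_relBd _ _ _)

/-! ### Excision -/

/-- A chain in an open set `O` that bounds relative to the complement of a closed set `K ⊆ O` bounds
so within `O`. -/
theorem exists_bd_in_open {O K : Set X} (hO : IsOpen O) (hK : IsClosed K) (hKO : K ⊆ O) {n : ℕ}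
    {z : (sg X).obj (n + 1) →₀ R} (hz : z ∈ supp R O (n + 1)) (h : z ∈ relBd R Kᶜ n) :
    ∃ b ∈ supp R O (n + 2), ∃ w ∈ supp R (O ∩ Kᶜ) (n + 1), z = bd R (sg X) (n + 1) b + w := by
  obtain ⟨b, w, hw, hzb⟩ := mem_relBd.mp h
  have hun : O ∪ Kᶜ = Set.univ := by
    rw [Set.eq_univ_iff_forall]
    intro x
    by_cases hx : x ∈ K
    · exact Or.inl (hKO hx)
    · exact Or.inr hx
  obtain ⟨b₁, hb₁, b₂, hb₂, e, -, he⟩ := exists_add_add_bd hO hK.isOpen_compl (w := b)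
    (hun ▸ mem_supp_univ _ _) hz (Submodule.neg_mem _ hw) (by rw [hzb]; abel)
  have key : z - bd R (sg X) (n + 1) b₁ = w + bd R (sg X) (n + 1) b₂ := by
    rw [hzb, he, map_add, map_add, bd_bd]
    abel
  refine ⟨b₁, hb₁, z - bd R (sg X) (n + 1) b₁, ?_, by abel⟩
  rw [supp_inter]
  refine ⟨Submodule.sub_mem _ hz (bd_mem_supp hb₁), ?_⟩
  rw [key]
  exact Submodule.add_mem _ hw (bd_mem_supp hb₂)

/-- A relative cycle modulo the complement of a closed set `K` contained in the open set `O` is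
homologous to one in `O`. -/
theorem exists_relCyc_in_open {O K : Set X} (hO : IsOpen O) (hK : IsClosed K) (hKO : K ⊆ O) {n : ℕ}
    {z : (sg X).obj (n + 1) →₀ R} (hz : z ∈ relCyc R Kᶜ n) :
    ∃ z' ∈ supp R O (n + 1), z' ∈ relCyc R Kᶜ n ∧ z - z' ∈ relBd R Kᶜ n := by
  have hun : O ∪ Kᶜ = Set.univ := by
    rw [Set.eq_univ_iff_forall]
    intro x
    by_cases hx : x ∈ K
    · exact Or.inl (hKO hx)
    · exact Or.inr hx
  obtain ⟨a, ha, b, hb, e, -, he⟩ := exists_add_add_bd hO hK.isOpen_compl (w := z)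
    (hun ▸ mem_supp_univ _ _) (Submodule.zero_mem _) hz (by rw [zero_add])
  have h : z - a ∈ relBd R Kᶜ n := by
    rw [he, add_assoc, add_sub_cancel_left]
    exact Submodule.add_mem _ (supp_le_relBd _ _ hb) (bd_mem_relBd _ _ _)
  refine ⟨a, ha, ?_, h⟩
  rw [← sub_sub_cancel z a]
  exact Submodule.sub_mem _ hz (relBd_le_relCyc _ _ h)

/-- Chains in the image of a topological embedding lift. -/
theorem exists_lift {f : C(X, Y)} (hf : Topology.IsEmbedding f) {U : Set Y}
    (hU : U ⊆ Set.range f) {n : ℕ} {c : (sg Y).obj n →₀ R} (hc : c ∈ supp R U n) :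
    ∃ c' ∈ supp R (f ⁻¹' U) n, push R (sgMap f) n c' = c := by
  have key : supp R U n ≤ (supp R (f ⁻¹' U) n).map (push R (sgMap f) n) := by
    intro c hc
    rw [← LinearMap.id_apply (R := R) c]
    refine map_mem_of_supported _ (fun σ hσ => ?_) hc
    match n, σ with
    | 0, σ => exact ⟨Finsupp.single default 1, mem_supp_zero _ _, by
        rw [push_single, LinearMap.id_apply]; rfl⟩
    | n + 1, σ =>
      refine ⟨Finsupp.single (HatComplex.ofMap ⟨fun p => (hU (hσ p)).choose, ?_⟩) 1, ?_, ?_⟩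
      · rw [hf.continuous_iff]
        convert (toMap σ).continuous using 1
        funext p
        exact (hU (hσ p)).choose_spec
      · refine single_mem_supp (fun p => ?_) _
        rw [Set.mem_preimage]
        convert hσ p using 1
        exact (hU (hσ p)).choose_spec
      · rw [push_single, LinearMap.id_apply]
        congr 1
        exact ContinuousMap.ext fun p => (hU (hσ p)).choose_spec
  obtain ⟨c', hc', h⟩ := key hc
  exact ⟨c', hc', h⟩

theorem push_injective {f : C(X, Y)} (hf : Function.Injective f) (n : ℕ) :
    Function.Injective (push R (sgMap f) n) := by
  refine Finsupp.mapDomain_injective fun σ τ h => ?_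
  match n, σ, τ with
  | 0, σ, τ => exact Subsingleton.elim _ _
  | n + 1, σ, τ => exact ContinuousMap.ext fun p => hf (DFunLike.congr_fun (F := C(Simp n, Y)) h p)

/-- Excision: an open embedding induces an isomorphism of local homology along a closed set, here
the surjectivity. -/
theorem exists_push_sub_mem_relBd {f : C(X, Y)} (hf : Topology.IsOpenEmbedding f) {K : Set X}
    (hK : IsClosed (f '' K)) {n : ℕ} {z : (sg Y).obj (n + 1) →₀ R}
    (hz : z ∈ relCyc R (f '' K)ᶜ n) :
    ∃ z' ∈ relCyc R Kᶜ n, z - push R (sgMap f) (n + 1) z' ∈ relBd R (f '' K)ᶜ n := by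
  obtain ⟨z₁, hz₁, hc, h⟩ := exists_relCyc_in_open hf.isOpen_range hK (Set.image_subset_range f K) hz
  obtain ⟨z', -, rfl⟩ := exists_lift hf.isEmbedding subset_rfl hz₁
  refine ⟨z', ?_, h⟩
  rw [mem_relCyc, bd_push] at hc
  have h2 : push R (sgMap f) n (bd R (sg X) n z') ∈ supp R ((f '' K)ᶜ ∩ Set.range f) n := by
    rw [supp_inter]
    exact ⟨hc, push_mem_supp f (U := Set.univ) (fun x _ => Set.mem_range_self x) (mem_supp_univ _ _)⟩
  obtain ⟨e, he, h3⟩ := exists_lift hf.isEmbedding Set.inter_subset_right h2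
  rw [mem_relCyc, ← push_injective hf.injective n h3]
  refine supp_mono ?_ _ he
  exact fun x hx hxK => hx.1 ⟨x, hxK, rfl⟩

/-- Excision, injectivity. -/
theorem mem_relBd_of_push {f : C(X, Y)} (hf : Topology.IsOpenEmbedding f) {K : Set X}
    (hK : IsClosed (f '' K)) {n : ℕ} {z : (sg X).obj (n + 1) →₀ R}
    (h : push R (sgMap f) (n + 1) z ∈ relBd R (f '' K)ᶜ n) : z ∈ relBd R Kᶜ n := by
  obtain ⟨b, hb, w, hw, hbw⟩ := exists_bd_in_open hf.isOpen_range hK (Set.image_subset_range f K)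
    (push_mem_supp f (U := Set.univ) (fun x _ => Set.mem_range_self x) (mem_supp_univ _ _)) h
  obtain ⟨b', -, rfl⟩ := exists_lift hf.isEmbedding subset_rfl hb
  obtain ⟨w', hw', rfl⟩ := exists_lift hf.isEmbedding Set.inter_subset_left hw
  rw [bd_push, ← map_add] at hbw
  refine mem_relBd.mpr ⟨b', w', supp_mono ?_ _ hw', push_injective hf.injective _ hbw⟩
  exact fun x hx hxK => hx.2 ⟨x, hxK, rfl⟩

end Homotopy

section Link

variable {X : Type u} [TopologicalSpace X] {R : Type*} [CommRing R]

/-! ### The Mayer–Vietoris boundary -/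

variable (R) in
/-- The relation between a relative cycle `z` of `(X, U ∪ V)` and a representative `u` of its image
under the Mayer–Vietoris boundary operator: up to a boundary in `U ∪ V`, the boundary of `z` is the
sum of the chain `u` in `U` and of a chain in `V`. -/
def Link (U V : Set X) (n : ℕ) (z : (sg X).obj (n + 2) →₀ R) (u : (sg X).obj (n + 1) →₀ R) : Prop :=
  u ∈ supp R U (n + 1) ∧ ∃ v ∈ supp R V (n + 1), ∃ q ∈ supp R (U ∪ V) (n + 2),
    bd R (sg X) (n + 1) z = u + v + bd R (sg X) (n + 1) q

theorem Link.sub_smul {U V : Set X} {n : ℕ} {z z' : (sg X).obj (n + 2) →₀ R}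
    {u u' : (sg X).obj (n + 1) →₀ R} (h : Link R U V n z u) (h' : Link R U V n z' u') (r : R) :
    Link R U V n (z - r • z') (u - r • u') := by
  obtain ⟨hu, v, hv, q, hq, e⟩ := h
  obtain ⟨hu', v', hv', q', hq', e'⟩ := h'
  refine ⟨Submodule.sub_mem _ hu (Submodule.smul_mem _ _ hu'), v - r • v',
    Submodule.sub_mem _ hv (Submodule.smul_mem _ _ hv'), q - r • q',
    Submodule.sub_mem _ hq (Submodule.smul_mem _ _ hq'), ?_⟩
  rw [map_sub, map_smul, e, e', map_sub, map_smul, smul_add, smul_add]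
  abel

theorem Link.mono {U V U' V' : Set X} {n : ℕ} {z : (sg X).obj (n + 2) →₀ R}
    {u : (sg X).obj (n + 1) →₀ R} (h : Link R U V n z u) (hU : U ⊆ U') (hV : V ⊆ V') :
    Link R U' V' n z u := by
  obtain ⟨hu, v, hv, q, hq, e⟩ := h
  exact ⟨supp_mono hU _ hu, v, supp_mono hV _ hv, q, supp_mono (Set.union_subset_union hU hV) _ hq, e⟩

/-- The value of the Mayer–Vietoris boundary is a relative cycle of `U ∩ V`. -/
theorem Link.mem_relCyc {U V : Set X} {n : ℕ} {z : (sg X).obj (n + 2) →₀ R}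
    {u : (sg X).obj (n + 1) →₀ R} (h : Link R U V n z u) : u ∈ relCyc R (U ∩ V) n := by
  obtain ⟨hu, v, hv, q, hq, e⟩ := h
  have h0 : bd R (sg X) n u = -bd R (sg X) n v := by
    have := congr_arg (bd R (sg X) n) e
    rw [map_add, map_add, bd_bd, bd_bd, add_zero] at this
    rw [eq_neg_iff_add_eq_zero, ← this]
  rw [HatComplex.mem_relCyc, supp_inter]
  refine ⟨bd_mem_supp hu, ?_⟩
  rw [h0]
  exact Submodule.neg_mem _ (bd_mem_supp hv)

/-- The Mayer–Vietoris boundary is defined on all relative cycles of `U ∪ V`. -/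
theorem exists_link {U V : Set X} (hU : IsOpen U) (hV : IsOpen V) {n : ℕ}
    {z : (sg X).obj (n + 2) →₀ R} (hz : z ∈ relCyc R (U ∪ V) (n + 1)) : ∃ u, Link R U V n z u := by
  obtain ⟨u, hu, v, hv, q, hq, h⟩ := exists_add_add_bd hU hV hz (Submodule.zero_mem _)
    (Submodule.zero_mem _) (by rw [bd_bd, add_zero])
  exact ⟨u, hu, v, hv, q, hq, h⟩

/-- The Mayer–Vietoris boundary is injective if `U` and `V` have trivial relative homology. -/
theorem Link.mem_relBd {U V : Set X} {n : ℕ}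
    (hU : ∀ i, relCyc R U i ≤ relBd R U i) (hV : ∀ i, relCyc R V i ≤ relBd R V i)
    {z : (sg X).obj (n + 2) →₀ R} {u : (sg X).obj (n + 1) →₀ R} (h : Link R U V n z u)
    (hu' : u ∈ relBd R (U ∩ V) n) : z ∈ relBd R (U ∪ V) (n + 1) := by
  obtain ⟨hu, v, hv, q, hq, e⟩ := h
  obtain ⟨c, w, hw, rfl⟩ := HatComplex.mem_relBd.mp hu'
  rw [supp_inter] at hw
  have hc : c ∈ relCyc R U (n + 1) := by
    rw [HatComplex.mem_relCyc, ← add_sub_cancel_right (bd R (sg X) (n + 1) c) w]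
    exact Submodule.sub_mem _ hu hw.1
  obtain ⟨c', f, hf, hcf⟩ := HatComplex.mem_relBd.mp (hU _ hc)
  have hd : z - q - c ∈ relCyc R V (n + 1) := by
    have : bd R (sg X) (n + 1) (z - q - c) = w + v := by
      rw [map_sub, map_sub, e]
      abel
    rw [HatComplex.mem_relCyc, this]
    exact Submodule.add_mem _ hw.2 hv
  have hz : z = (z - q - c) + q + c := by abel
  rw [hz, hcf]
  refine Submodule.add_mem _ (Submodule.add_mem _ (relBd_mono Set.subset_union_right _ ?_)
    (supp_le_relBd _ _ hq)) (Submodule.add_mem _ (bd_mem_relBd _ _ _)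
      (supp_le_relBd _ _ (supp_mono Set.subset_union_left _ hf)))
  rw [← hcf]
  exact hV _ hd

/-- The Mayer–Vietoris boundary is surjective if `U` and `V` have trivial relative homology. -/
theorem exists_link_of_relCyc {U V : Set X} {n : ℕ}
    (hU : relCyc R U n ≤ relBd R U n) (hV : relCyc R V n ≤ relBd R V n)
    {u : (sg X).obj (n + 1) →₀ R} (hu : u ∈ relCyc R (U ∩ V) n) :
    ∃ z ∈ relCyc R (U ∪ V) (n + 1), ∃ u', Link R U V n z u' ∧ u - u' ∈ relBd R (U ∩ V) n := by
  obtain ⟨a, f, hf, ha⟩ := mem_relBd.mp (hU (relCyc_mono Set.inter_subset_left _ hu))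
  obtain ⟨b, g, hg, hb⟩ := mem_relBd.mp (hV (relCyc_mono Set.inter_subset_right _ hu))
  have e : bd R (sg X) (n + 1) (b - a) = f + -g := by
    rw [map_sub, ← sub_eq_zero]
    have := ha.symm.trans hb
    rw [← sub_eq_zero] at this
    rw [← neg_eq_zero, ← this]
    abel
  -- the two fillings of `u` glue to the relative cycle `b - a`
  refine ⟨b - a, ?_, f, ⟨hf, -g, Submodule.neg_mem _ hg, 0, Submodule.zero_mem _, ?_⟩, ?_⟩
  · rw [mem_relCyc, e]
    exact Submodule.add_mem _ (supp_mono Set.subset_union_left _ hf)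
      (Submodule.neg_mem _ (supp_mono Set.subset_union_right _ hg))
  · rw [e, map_zero, add_zero]
  · rw [ha, add_sub_cancel_right]
    exact bd_mem_relBd _ _ _

/-- The Mayer–Vietoris boundary is well defined on relative homology. -/
theorem Link.mem_relBd_inter {U V : Set X} (hU : IsOpen U) (hV : IsOpen V) {n : ℕ}
    {z : (sg X).obj (n + 2) →₀ R} {u : (sg X).obj (n + 1) →₀ R} (h : Link R U V n z u)
    (hz : z ∈ relBd R (U ∪ V) (n + 1)) : u ∈ relBd R (U ∩ V) n := by
  obtain ⟨hu, v, hv, q, hq, e⟩ := h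
  obtain ⟨c, w, hw, rfl⟩ := HatComplex.mem_relBd.mp hz
  rw [map_add, bd_bd, zero_add] at e
  have e' : bd R (sg X) (n + 1) (w - q) = u + v := by rw [map_sub, e, add_sub_cancel_right]
  obtain ⟨a, ha, b, hb, y, -, h⟩ := exists_add_add_bd hU hV (Submodule.sub_mem _ hw hq) hu hv e'
  rw [h, map_add, map_add, bd_bd, add_zero] at e'
  have key : u - bd R (sg X) (n + 1) a = bd R (sg X) (n + 1) b - v := by
    rw [← sub_eq_zero] at e' ⊢
    rw [← neg_eq_zero, ← e']
    abel
  refine HatComplex.mem_relBd.mpr ⟨a, u - bd R (sg X) (n + 1) a, ?_, by abel⟩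
  rw [supp_inter]
  refine ⟨Submodule.sub_mem _ hu (bd_mem_supp ha), ?_⟩
  rw [key]
  exact Submodule.sub_mem _ (bd_mem_supp hb) hv

/-- Chains have compact support. -/
theorem exists_isCompact_supp {U : Set X} {n : ℕ} {c : (sg X).obj n →₀ R} (hc : c ∈ supp R U n) :
    ∃ S ⊆ U, IsCompact S ∧ c ∈ supp R S n := by
  match n with
  | 0 => exact ⟨∅, Set.empty_subset _, isCompact_empty, mem_supp_zero _ _⟩
  | n + 1 =>
    refine ⟨⋃ σ ∈ c.support, Set.range (toMap σ), ?_, ?_, ?_⟩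
    · exact Set.iUnion₂_subset fun σ hσ => Set.range_subset_iff.mpr (hc hσ)
    · exact c.support.isCompact_biUnion fun σ _ => isCompact_range (toMap σ).continuous
    · exact fun σ hσ p => Set.mem_biUnion hσ (Set.mem_range_self p)

theorem supp_empty (n : ℕ) : supp R (∅ : Set X) (n + 1) = ⊥ := by
  rw [eq_bot_iff]
  intro c hc
  rw [Submodule.mem_bot, ← Finsupp.support_eq_empty, Finset.eq_empty_iff_forall_notMem]
  exact fun σ hσ => hc hσ (vert 0)

end Link

/-! ### Local homology of Euclidean space -/

section Euclidean

variable {R : Type*} [CommRing R] {d : ℕ}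

/-- If the open set `U` is stable under positive translations along `e`, and every compact set is
eventually moved into it, then the relative homology of the pair `(ℝᵈ, U)` vanishes. -/
theorem relCyc_le_relBd_of_translation {U : Set (Fin d → ℝ)} (e : Fin d → ℝ)
    (h1 : ∀ y ∈ U, ∀ t : ℝ, 0 ≤ t → y + t • e ∈ U)
    (h2 : ∀ S : Set (Fin d → ℝ), IsCompact S → ∃ t : ℝ, 0 ≤ t ∧ ∀ y ∈ S, y + t • e ∈ U) (n : ℕ) :
    relCyc R U n ≤ relBd R U n := by
  intro z hz
  obtain ⟨S, -, hS, hzS⟩ := exists_isCompact_supp (mem_supp_univ _ z)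
  obtain ⟨t, ht, hSt⟩ := h2 S hS
  let G : C((Fin d → ℝ) × unitInterval, Fin d → ℝ) :=
    ⟨fun q => q.1 + ((q.2 : ℝ) * t) • e, by fun_prop⟩
  have h := push_sub_push_mem_relBd G (U := U) (V := U)
    (fun x hx s => h1 x hx _ (mul_nonneg s.2.1 ht)) hz
  have hG0 : G.comp (slice (Fin d → ℝ) 0) = ContinuousMap.id _ := by
    ext1 y
    change y + ((0 : ℝ) * t) • e = y
    rw [zero_mul, zero_smul, add_zero]
  rw [hG0, push_sgMap_id] at h
  have h3 : push R (sgMap (G.comp (slice (Fin d → ℝ) 1))) (n + 1) z ∈ supp R U (n + 1) := by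
    refine push_mem_supp _ (fun y hy => ?_) hzS
    change y + ((1 : ℝ) * t) • e ∈ U
    rw [one_mul]
    exact hSt y hy
  rw [← sub_sub_cancel (push R (sgMap (G.comp (slice (Fin d → ℝ) 1))) (n + 1) z) z]
  exact Submodule.sub_mem _ (supp_le_relBd _ _ h3) h

/-- The set of points whose first `k` coordinates satisfy the bounds `a ≤ y ≤ b`. -/
def pbox (k : ℕ) (a b : Fin d → ℝ) : Set (Fin d → ℝ) :=
  {y | ∀ j : Fin d, (j : ℕ) < k → a j ≤ y j ∧ y j ≤ b j}

theorem isClosed_pbox (k : ℕ) (a b : Fin d → ℝ) : IsClosed (pbox k a b) := by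
  simp only [pbox, Set.ofPred_forall]
  refine isClosed_iInter fun j => isClosed_iInter fun _ => IsClosed.and ?_ ?_
  · exact isClosed_le continuous_const (continuous_apply j)
  · exact isClosed_le (continuous_apply j) continuous_const

theorem pbox_mono (k : ℕ) {a b a' b' : Fin d → ℝ} (ha : a ≤ a') (hb : b' ≤ b) :
    pbox k a' b' ⊆ pbox k a b :=
  fun _ hy j hj => ⟨(ha j).trans (hy j hj).1, (hy j hj).2.trans (hb j)⟩

/-- The part of `pbox k a b` above, or (for `up = false`) below, a bound for the `k`-th
coordinate. -/
def halfBox (up : Bool) (k : Fin d) (a b : Fin d → ℝ) : Set (Fin d → ℝ) :=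
  pbox k a b ∩ cond up {y | a k ≤ y k} {y | y k ≤ b k}

theorem isClosed_halfBox (up : Bool) (k : Fin d) (a b : Fin d → ℝ) : IsClosed (halfBox up k a b) := by
  refine (isClosed_pbox _ _ _).inter ?_
  cases up
  · exact isClosed_le (continuous_apply k) continuous_const
  · exact isClosed_le continuous_const (continuous_apply k)

theorem halfBox_mono (up : Bool) (k : Fin d) {a b a' b' : Fin d → ℝ} (ha : a ≤ a') (hb : b' ≤ b) :
    halfBox up k a' b' ⊆ halfBox up k a b := by
  refine Set.inter_subset_inter (pbox_mono _ ha hb) ?_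
  cases up
  · exact fun y hy => le_trans hy (hb k)
  · exact fun y hy => (ha k).trans hy

theorem halfBox_union (k : Fin d) {a b : Fin d → ℝ} (hab : a ≤ b) :
    (halfBox true k a b)ᶜ ∩ (halfBox false k a b)ᶜ = (pbox k a b)ᶜ := by
  rw [← Set.compl_union, halfBox, halfBox, ← Set.inter_union_distrib_left]
  congr 1
  rw [Set.inter_eq_left]
  intro y _
  rcases le_total (a k) (y k) with h | h
  · exact Or.inl h
  · exact Or.inr (h.trans (hab k))

theorem halfBox_inter (k : Fin d) (a b : Fin d → ℝ) :
    (halfBox true k a b)ᶜ ∪ (halfBox false k a b)ᶜ = (pbox ((k : ℕ) + 1) a b)ᶜ := by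
  rw [← Set.compl_inter]
  congr 1
  ext y
  constructor
  · rintro ⟨⟨h, h1⟩, -, h2⟩ j hj
    rcases Nat.lt_succ_iff_lt_or_eq.mp hj with hj | hj
    · exact h j hj
    · obtain rfl : j = k := Fin.ext hj
      exact ⟨h1, h2⟩
  · intro h
    have h' : y ∈ pbox k a b := fun j hj => h j (Nat.lt_succ_of_lt hj)
    exact ⟨⟨h', (h k (Nat.lt_succ_self _)).1⟩, h', (h k (Nat.lt_succ_self _)).2⟩

/-- There is no homology relative to the complement of a half box: chains can be translated off it
in its unbounded direction. -/
theorem relCyc_halfBox_le (up : Bool) (k : Fin d) (a b : Fin d → ℝ) (n : ℕ) :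
    relCyc R (halfBox up k a b)ᶜ n ≤ relBd R (halfBox up k a b)ᶜ n := by
  have hbound : ∀ S : Set (Fin d → ℝ), IsCompact S → ∃ C : ℝ, 0 ≤ C ∧ ∀ y ∈ S, |y k| ≤ C := by
    intro S hS
    obtain ⟨C, hC⟩ := (hS.image (continuous_apply k)).isBounded.exists_norm_le
    exact ⟨max C 0, le_max_right _ _, fun y hy =>
      (hC _ ⟨y, hy, rfl⟩).trans (le_max_left _ _)⟩
  have hfix : ∀ (c t : ℝ) (y : Fin d → ℝ),
      (y + t • (Pi.single k c : Fin d → ℝ) ∈ pbox k a b) ↔ y ∈ pbox k a b := by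
    intro c t y
    refine forall₂_congr fun j hj => ?_
    have : j ≠ k := fun h => (h ▸ hj).ne rfl
    simp [Pi.single_eq_of_ne this]
  refine relCyc_le_relBd_of_translation (Pi.single k (cond up (-1) 1)) ?_ ?_ n
  · rintro y hy t ht ⟨h1, h2⟩
    rw [hfix] at h1
    refine hy ⟨h1, ?_⟩
    cases up <;> simp only [cond_true, cond_false, Set.mem_ofPred_eq, Pi.add_apply, Pi.smul_apply,
      Pi.single_eq_same, smul_eq_mul] at h2 ⊢ <;> linarith
  · intro S hS
    obtain ⟨C, hC, hSC⟩ := hbound S hS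
    refine ⟨C + |a k| + |b k| + 1, by positivity, ?_⟩
    rintro y hy ⟨-, h2⟩
    have h3 := abs_le.mp (hSC y hy)
    have h4 := neg_abs_le (a k)
    have h5 := le_abs_self (b k)
    have h6 := abs_nonneg (a k)
    have h7 := abs_nonneg (b k)
    cases up <;> simp only [cond_true, cond_false, Set.mem_ofPred_eq, Pi.add_apply, Pi.smul_apply,
      Pi.single_eq_same, smul_eq_mul] at h2 <;> linarith

/-- The chain `μ` generates freely the relative homology of dimension `k` of the complement of `K`. -/
def Generates (R : Type*) [CommRing R] {X : Type u} [TopologicalSpace X] (k : ℕ) (K : Set X)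
    (μ : (sg X).obj (k + 1) →₀ R) : Prop :=
  (∀ z ∈ relCyc R Kᶜ k, ∃ r : R, z - r • μ ∈ relBd R Kᶜ k) ∧ ∀ r : R, r • μ ∈ relBd R Kᶜ k → r = 0

theorem pbox_zero (a b : Fin d → ℝ) : pbox 0 a b = Set.univ :=
  Set.eq_univ_of_forall fun _ _ hj => absurd hj (Nat.not_lt_zero _)

/-- The homology of `ℝᵈ` relative to the complement of a product of `k` intervals and `d - k` lines
is free of rank one in dimension `k` and vanishes in higher dimensions, and it does not depend on
the intervals. -/
theorem exists_generator_pbox (k : ℕ) (hk : k ≤ d) (a b : Fin d → ℝ) (hab : a ≤ b) :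
    (∀ i, k < i → relCyc R (pbox k a b)ᶜ i ≤ relBd R (pbox k a b)ᶜ i) ∧
    ∃ μ ∈ relCyc R (pbox k a b)ᶜ k, ∀ a' b', a ≤ a' → a' ≤ b' → b' ≤ b →
      Generates R k (pbox k a' b') μ := by
  induction k with
  | zero =>
    simp only [pbox_zero, Set.compl_univ]
    let G : C((Fin d → ℝ) × unitInterval, Fin d → ℝ) :=
      ⟨fun q => (1 - (q.2 : ℝ)) • q.1, by fun_prop⟩
    have hG : ∀ x, G (x, 1) = 0 := fun x => by
      change (1 - (1 : ℝ)) • x = 0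
      rw [sub_self, zero_smul]
    have hG0 : G.comp (slice (Fin d → ℝ) 0) = ContinuousMap.id _ := by
      ext1 y
      change (1 - (0 : ℝ)) • y = y
      rw [sub_zero, one_smul]
    have hcyc : ∀ (n : ℕ) (c : (sg (Fin d → ℝ)).obj (n + 1) →₀ R), bd R _ n c = 0 →
        c ∈ relBd R ∅ n := by
      intro n c hc
      have := (contractOp G hG).exists_bd n hc
      have h0 : push R (sgMap (G.comp (slice (Fin d → ℝ) 0))) (n + 1) c = c := by
        rw [hG0, push_sgMap_id]
      rw [h0.symm.trans this]
      exact bd_mem_relBd _ _ _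
    let pt : (sg (Fin d → ℝ)).obj 1 := ofMap (ContinuousMap.const _ 0)
    have hpt : ∀ r : R, bd R _ 0 (Finsupp.single pt r) = Finsupp.single default r := fun r => by
      rw [bd_single, Fin.sum_univ_one, Fin.val_zero, pow_zero, one_smul]
      rfl
    refine ⟨fun i hi z hz => ?_, Finsupp.single pt 1, mem_supp_zero _ _,
      fun a' b' _ _ _ => ⟨fun z _ => ?_, fun r hr => ?_⟩⟩
    · obtain ⟨i, rfl⟩ : ∃ j, i = j + 1 := ⟨i - 1, by omega⟩
      rw [mem_relCyc, supp_empty, Submodule.mem_bot] at hz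
      exact hcyc _ _ hz
    · rw [Set.compl_univ]
      refine ⟨bd R _ 0 z default, hcyc _ _ ?_⟩
      rw [map_sub, Finsupp.smul_single, smul_eq_mul, mul_one, hpt, sub_eq_zero]
      refine Finsupp.ext fun s => ?_
      rw [Subsingleton.elim s default, Finsupp.single_eq_same]
    · rw [Set.compl_univ] at hr
      obtain ⟨c, w, hw, h⟩ := mem_relBd.mp hr
      rw [supp_empty, Submodule.mem_bot] at hw
      have := congr_arg (fun x => bd R _ 0 x default) h
      rw [hw, add_zero, bd_bd, Finsupp.smul_single, smul_eq_mul, mul_one] at this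
      simp only [hpt, Finsupp.single_eq_same] at this
      exact this
  | succ k ih =>
    obtain ⟨hvan, μ, hμ, hgen⟩ := ih (Nat.le_of_succ_le hk)
    let j : Fin d := ⟨k, hk⟩
    have hop : ∀ up (a b : Fin d → ℝ), IsOpen (halfBox up j a b)ᶜ := fun up a b =>
      (isClosed_halfBox up j a b).isOpen_compl
    have hz0 : ∀ up (a b : Fin d → ℝ) (i : ℕ),
        relCyc R (halfBox up j a b)ᶜ i ≤ relBd R (halfBox up j a b)ᶜ i := fun up a b i =>
      relCyc_halfBox_le up j a b i
    have hun : ∀ a b : Fin d → ℝ, (pbox (k + 1) a b)ᶜ =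
        (halfBox true j a b)ᶜ ∪ (halfBox false j a b)ᶜ := fun a b => (halfBox_inter j a b).symm
    have hin : ∀ a b : Fin d → ℝ, a ≤ b → (pbox k a b)ᶜ =
        (halfBox true j a b)ᶜ ∩ (halfBox false j a b)ᶜ := fun a b h => (halfBox_union j h).symm
    rw [hin a b hab] at hvan hμ
    refine ⟨fun i hi z hz => ?_, ?_⟩
    · obtain ⟨i, rfl⟩ : ∃ l, i = l + 1 := ⟨i - 1, by omega⟩
      rw [hun] at hz ⊢
      obtain ⟨u, hu⟩ := exists_link (hop _ _ _) (hop _ _ _) hz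
      exact hu.mem_relBd (hz0 _ _ _) (hz0 _ _ _) (hvan i (by omega) hu.mem_relCyc)
    · obtain ⟨ν, hν, μ', hlink, hμ'⟩ := exists_link_of_relCyc (hz0 _ _ _ _) (hz0 _ _ _ _) hμ
      refine ⟨ν, by rw [hun]; exact hν, fun a' b' ha hab' hb => ?_⟩
      have hsub : ∀ up, (halfBox up j a b)ᶜ ⊆ (halfBox up j a' b')ᶜ := fun up =>
        Set.compl_subset_compl.mpr (halfBox_mono up j ha hb)
      have hlink' := hlink.mono (hsub _) (hsub _)
      have hμ'' := relBd_mono (Set.inter_subset_inter (hsub true) (hsub false)) _ hμ'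
      obtain ⟨hg1, hg2⟩ := hgen a' b' ha hab' hb
      rw [hin a' b' hab'] at hg1 hg2
      refine ⟨fun z hz => ?_, fun r hr => ?_⟩
      · rw [hun] at hz ⊢
        obtain ⟨u, hu⟩ := exists_link (hop _ _ _) (hop _ _ _) hz
        obtain ⟨r, hr⟩ := hg1 u hu.mem_relCyc
        refine ⟨r, (hu.sub_smul hlink' r).mem_relBd (hz0 _ _ _) (hz0 _ _ _) ?_⟩
        have : u - r • μ' = (u - r • μ) + r • (μ - μ') := by rw [smul_sub]; abel
        rw [this]
        exact Submodule.add_mem _ hr (Submodule.smul_mem _ _ hμ'')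
      · rw [hun] at hr
        have h0 : Link R (halfBox true j a' b')ᶜ (halfBox false j a' b')ᶜ k 0 0 :=
          ⟨Submodule.zero_mem _, 0, Submodule.zero_mem _, 0, Submodule.zero_mem _, by simp⟩
        have h1 := h0.sub_smul hlink' (-r)
        rw [neg_smul, neg_smul, zero_sub, zero_sub, neg_neg, neg_neg] at h1
        refine hg2 r ?_
        have : r • μ = r • μ' + r • (μ - μ') := by rw [smul_sub]; abel
        rw [this]
        exact Submodule.add_mem _ (h1.mem_relBd_inter (hop _ _ _) (hop _ _ _) hr)
          (Submodule.smul_mem _ _ hμ'')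

theorem pbox_top (a b : Fin d → ℝ) : pbox d a b = Set.Icc a b := by
  ext y
  simp [pbox, Pi.le_def, forall_and]

theorem exists_generator_Icc (a b : Fin d → ℝ) (hab : a ≤ b) :
    (∀ i, d < i → relCyc R (Set.Icc a b)ᶜ i ≤ relBd R (Set.Icc a b)ᶜ i) ∧
    ∃ μ ∈ relCyc R (Set.Icc a b)ᶜ d, ∀ a' b', a ≤ a' → a' ≤ b' → b' ≤ b →
      Generates R d (Set.Icc a' b') μ := by
  have h := exists_generator_pbox (R := R) d le_rfl a b hab
  simp only [pbox_top] at h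
  exact h

/-- A class relative to the complement of a box that vanishes at one point of the box vanishes. -/
theorem mem_relBd_Icc {a b p : Fin d → ℝ} (hp : p ∈ Set.Icc a b)
    {z : (sg (Fin d → ℝ)).obj (d + 1) →₀ R} (hz : z ∈ relCyc R (Set.Icc a b)ᶜ d)
    (h : z ∈ relBd R {p}ᶜ d) : z ∈ relBd R (Set.Icc a b)ᶜ d := by
  obtain ⟨-, μ, -, hgen⟩ := exists_generator_Icc (R := R) a b (hp.1.trans hp.2)
  obtain ⟨r, hr⟩ := (hgen a b le_rfl (hp.1.trans hp.2) le_rfl).1 z hz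
  have hp' := (hgen p p hp.1 le_rfl hp.2).2
  rw [Set.Icc_self] at hp'
  have h2 : r • μ ∈ relBd R {p}ᶜ d := by
    rw [← sub_sub_cancel z (r • μ)]
    refine Submodule.sub_mem _ h (relBd_mono ?_ _ hr)
    exact Set.compl_subset_compl.mpr (Set.singleton_subset_iff.mpr hp)
  rw [hp' r h2, zero_smul, sub_zero] at hr
  exact hr

/-- The homology of `ℝᵈ` relative to the complement of a box is detected by points. -/
theorem detected_Icc (a b : Fin d → ℝ) : Detected R d (Set.Icc a b) := by
  by_cases hab : a ≤ b
  · exact ⟨(exists_generator_Icc a b hab).1, fun z hz h =>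
      mem_relBd_Icc (Set.left_mem_Icc.mpr hab) hz (h a (Set.left_mem_Icc.mpr hab))⟩
  · rw [Set.Icc_eq_empty hab]
    exact detected_empty d

theorem isClosed_biUnion_Icc (l : List ((Fin d → ℝ) × (Fin d → ℝ))) :
    IsClosed (⋃ q ∈ l, Set.Icc q.1 q.2) :=
  Set.Finite.isClosed_biUnion (List.finite_toSet l) fun _ _ => isClosed_Icc

/-- Finite unions of boxes are treated by Mayer–Vietoris: the intersection of one box with the union
of the others is again a union of fewer boxes. -/
theorem detected_biUnion_Icc (n : ℕ) : ∀ l : List ((Fin d → ℝ) × (Fin d → ℝ)), l.length = n →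
    Detected R d (⋃ q ∈ l, Set.Icc q.1 q.2) := by
  induction n with
  | zero =>
    intro l hl
    obtain rfl := List.length_eq_zero_iff.mp hl
    simpa using detected_empty d
  | succ n ih =>
    intro l hl
    match l, hl with
    | q :: t, hl =>
      have ht : t.length = n := by simpa using hl
      have h1 : ⋃ p ∈ q :: t, Set.Icc p.1 p.2 = Set.Icc q.1 q.2 ∪ ⋃ p ∈ t, Set.Icc p.1 p.2 := by
        ext y
        simp
      have h2 : Set.Icc q.1 q.2 ∩ ⋃ p ∈ t, Set.Icc p.1 p.2 =
          ⋃ p ∈ t.map (fun p => (q.1 ⊔ p.1, q.2 ⊓ p.2)), Set.Icc p.1 p.2 := by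
        ext y
        simp only [Set.mem_inter_iff, Set.mem_iUnion, List.mem_map, Set.mem_Icc]
        constructor
        · rintro ⟨h, p, hp, h'⟩
          exact ⟨_, ⟨p, hp, rfl⟩, sup_le h.1 h'.1, le_inf h.2 h'.2⟩
        · rintro ⟨_, ⟨p, hp, rfl⟩, h⟩
          exact ⟨⟨le_sup_left.trans h.1, h.2.trans inf_le_left⟩, p, hp, le_sup_right.trans h.1,
            h.2.trans inf_le_right⟩
      rw [h1]
      refine (detected_Icc q.1 q.2).union isClosed_Icc (isClosed_biUnion_Icc t) (ih t ht) ?_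
      rw [h2]
      exact ih _ (by rw [List.length_map, ht])

/-- The homology of `ℝᵈ` relative to the complement of a compact set is detected by points. -/
theorem detected_of_isCompact {K : Set (Fin d → ℝ)} (hK : IsCompact K) : Detected R d K := by
  have key : ∀ (i : ℕ) (z : (sg (Fin d → ℝ)).obj (i + 1) →₀ R), z ∈ relCyc R Kᶜ i →
      ∃ l : List ((Fin d → ℝ) × (Fin d → ℝ)), (∀ q ∈ l, ∃ p ∈ K, p ∈ Set.Icc q.1 q.2) ∧
        K ⊆ (⋃ q ∈ l, Set.Icc q.1 q.2) ∧ z ∈ relCyc R (⋃ q ∈ l, Set.Icc q.1 q.2)ᶜ i := by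
    intro i z hz
    -- the boundary of `z` avoids a neighbourhood of `K`, so it avoids finitely many small cubes
    -- covering `K`
    obtain ⟨S, hSK, hS, hzS⟩ := exists_isCompact_supp hz
    obtain ⟨δ, hδ, hδS⟩ := hK.exists_cthickening_subset_open hS.isClosed.isOpen_compl
      (Set.subset_compl_comm.mp hSK)
    obtain ⟨t, htK, htfin, ht⟩ := hK.finite_cover_balls hδ
    have hball : ∀ x : Fin d → ℝ, Set.Icc (x - fun _ => δ) (x + fun _ => δ) =
        Metric.closedBall x δ := by
      intro x
      ext y
      rw [Metric.mem_closedBall, dist_pi_le_iff hδ.le, Set.mem_Icc, Pi.le_def, Pi.le_def,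
        ← forall_and]
      refine forall_congr' fun j => ?_
      rw [Real.dist_eq, abs_le, Pi.sub_apply, Pi.add_apply]
      constructor <;> rintro ⟨h, h'⟩ <;> constructor <;> linarith
    have hmem : ∀ y, (y ∈ ⋃ q ∈ htfin.toFinset.toList.map
        (fun x => ((x - fun _ => δ : Fin d → ℝ), (x + fun _ => δ : Fin d → ℝ))),
        Set.Icc q.1 q.2) ↔ ∃ x ∈ t, y ∈ Metric.closedBall x δ := by
      intro y
      simp only [Set.mem_iUnion, List.mem_map, Finset.mem_toList, Set.Finite.mem_toFinset]
      constructor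
      · rintro ⟨_, ⟨x, hx, rfl⟩, h⟩
        exact ⟨x, hx, hball x ▸ h⟩
      · rintro ⟨x, hx, h⟩
        exact ⟨_, ⟨x, hx, rfl⟩, (hball x).symm ▸ h⟩
    refine ⟨htfin.toFinset.toList.map
        (fun x => ((x - fun _ => δ : Fin d → ℝ), (x + fun _ => δ : Fin d → ℝ))), ?_, ?_, ?_⟩
    · intro q hq
      simp only [List.mem_map, Finset.mem_toList, Set.Finite.mem_toFinset] at hq
      obtain ⟨x, hx, rfl⟩ := hq
      refine ⟨x, htK hx, ?_⟩
      rw [hball]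
      exact Metric.mem_closedBall_self hδ.le
    · intro y hy
      obtain ⟨x, hx, h⟩ := Set.mem_iUnion₂.mp (ht hy)
      exact (hmem y).mpr ⟨x, hx, Metric.ball_subset_closedBall h⟩
    · refine supp_mono ?_ _ hzS
      intro y hy hy'
      obtain ⟨x, hx, h⟩ := (hmem y).mp hy'
      exact hδS (Metric.closedBall_subset_cthickening (htK hx) _ h) hy
  refine ⟨fun i hi z hz => ?_, fun z hz hp => ?_⟩
  · obtain ⟨l, -, hl, hzl⟩ := key i z hz
    exact relBd_mono (Set.compl_subset_compl.mpr hl) _ ((detected_biUnion_Icc _ l rfl).1 i hi hzl)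
  · obtain ⟨l, hlK, hl, hzl⟩ := key d z hz
    refine relBd_mono (Set.compl_subset_compl.mpr hl) _
      ((detected_biUnion_Icc _ l rfl).2 z hzl fun y hy => ?_)
    obtain ⟨q, hq, hyq⟩ := Set.mem_iUnion₂.mp hy
    obtain ⟨p, hpK, hpq⟩ := hlK q hq
    have hsub : (⋃ q ∈ l, Set.Icc q.1 q.2)ᶜ ⊆ (Set.Icc q.1 q.2)ᶜ :=
      Set.compl_subset_compl.mpr fun y hy => Set.mem_iUnion₂.mpr ⟨q, hq, hy⟩
    refine relBd_mono ?_ _ (mem_relBd_Icc hpq (relCyc_mono hsub _ hzl) (hp p hpK))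
    exact Set.compl_subset_compl.mpr (Set.singleton_subset_iff.mpr hyq)

end Euclidean

/-! ### The topology of disjoint cones -/

namespace DCone

section Lift

variable {Y : Type u} [TopologicalSpace Y] {s : ℕ} {A : Fin s → Set Y} {Z : Type v}
  [TopologicalSpace Z]

theorem ind {P : DCone A → Prop} (h1 : ∀ m, P (of A m)) (h2 : ∀ i q, P (cyl A i q))
    (h3 : ∀ i, P (apex A i)) (z : DCone A) : P z := by
  obtain ⟨z, rfl⟩ := Quot.exists_rep z
  rcases z with m | ⟨i, q | ⟨⟩⟩
  · exact h1 m
  · exact h2 i q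
  · exact h3 i

/-- The universal property of the disjoint cone. -/
def lift (f : C(Y, Z)) (g : ∀ i, C(A i × unitInterval, Z)) (c : Fin s → Z)
    (h0 : ∀ i a, g i (a, 0) = f a) (h1 : ∀ i a, g i (a, 1) = c i) : C(DCone A, Z) where
  toFun := Quot.lift (Sum.elim f fun q => Sum.elim (g q.1) (fun _ => c q.1) q.2) (by
    rintro _ _ (⟨i, a⟩ | ⟨i, a⟩)
    · exact (h0 i a).symm
    · exact h1 i a)
  continuous_toFun := by
    refine continuous_quot_lift _ (continuous_sum_dom.mpr ⟨f.continuous, ?_⟩)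
    exact continuous_sigma fun i => continuous_sum_dom.mpr
      ⟨(g i).continuous, (continuous_const : Continuous fun _ : PUnit => c i)⟩

section

variable (f : C(Y, Z)) (g : ∀ i, C(A i × unitInterval, Z)) (c : Fin s → Z)
    (h0 : ∀ i a, g i (a, 0) = f a) (h1 : ∀ i a, g i (a, 1) = c i)

@[simp] theorem lift_of (m : Y) : lift f g c h0 h1 (of A m) = f m := rfl
@[simp] theorem lift_cyl (i : Fin s) (q : A i × unitInterval) :
    lift f g c h0 h1 (cyl A i q) = g i q := rfl
@[simp] theorem lift_apex (i : Fin s) : lift f g c h0 h1 (apex A i) = c i := rfl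

end

/-- The height of a point in the `i`-th cone: `0` outside that cone, `1` at the cone point. -/
def height (i : Fin s) : C(DCone A, ℝ) :=
  lift (ContinuousMap.const _ 0)
    (fun j => ⟨fun q => if j = i then (q.2 : ℝ) else 0, by split_ifs <;> fun_prop⟩)
    (fun j => if j = i then 1 else 0) (fun j a => by simp) (fun j a => by simp)

@[simp] theorem height_of (i : Fin s) (m : Y) : height i (of A m) = 0 := rfl
theorem height_cyl (i j : Fin s) (q : A j × unitInterval) :
    height i (cyl A j q) = if j = i then (q.2 : ℝ) else 0 := rfl
theorem height_apex (i j : Fin s) : height i (apex A j) = if j = i then 1 else 0 := rfl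
@[simp] theorem height_cyl_self (i : Fin s) (q : A i × unitInterval) :
    height i (cyl A i q) = q.2 := by simp [height_cyl]
@[simp] theorem height_apex_self (i : Fin s) : height i (apex A i) = 1 := by simp [height_apex]

theorem height_nonneg (i : Fin s) (z : DCone A) : 0 ≤ height i z := by
  induction z using ind with
  | h1 m => simp
  | h2 j q =>
    rw [height_cyl]
    split_ifs
    · exact q.2.2.1
    · exact le_rfl
  | h3 j => rw [height_apex]; split_ifs <;> norm_num

/-- The base point in `Y` of a point of the disjoint cone; cone points have none. -/
def base : DCone A → Option Y :=
  Quot.lift (Sum.elim some fun q => Sum.elim (fun a => if a.2 = 1 then none else some (a.1 : Y))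
    (fun _ => none) q.2) (by
    rintro _ _ (⟨i, a⟩ | ⟨i, a⟩)
    · simp
    · simp)

@[simp] theorem base_of (m : Y) : base (of A m) = some m := rfl
theorem base_cyl (i : Fin s) (q : A i × unitInterval) :
    base (cyl A i q) = if q.2 = 1 then none else some (q.1 : Y) := rfl
@[simp] theorem base_apex (i : Fin s) : base (apex A i) = none := rfl

theorem isOpen_base {W : Set Y} (hW : IsOpen W) : IsOpen {z : DCone A | ∃ m ∈ W, base z = some m} := by
  change IsOpen (Quot.mk (DConeRel A) ⁻¹' _)
  rw [isOpen_sum_iff]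
  refine ⟨?_, ?_⟩
  · convert hW using 1
    ext m
    change (∃ m' ∈ W, base (of A m) = some m') ↔ _
    simp
  · rw [isOpen_sigma_iff]
    intro i
    rw [isOpen_sum_iff]
    constructor
    · have : IsOpen {q : A i × unitInterval | (q.1 : Y) ∈ W ∧ q.2 ≠ 1} :=
        (hW.preimage (by fun_prop)).inter (isOpen_ne.preimage continuous_snd)
      convert this using 1
      ext q
      change (∃ m' ∈ W, base (cyl A i q) = some m') ↔ _
      rw [base_cyl]
      by_cases h : q.2 = 1 <;> simp [h]
    · convert isOpen_empty using 1
      ext q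
      change (∃ m' ∈ W, base (apex A i) = some m') ↔ _
      simp

theorem eq_apex_of_base {z : DCone A} (h : base z = none) : ∃ i, z = apex A i := by
  induction z using ind with
  | h1 m => simp at h
  | h2 i q =>
    rw [base_cyl] at h
    by_cases h1 : q.2 = 1
    · refine ⟨i, ?_⟩
      rw [← cyl_one A i q.1, ← h1]
    · simp [h1] at h
  | h3 i => exact ⟨i, rfl⟩

theorem eq_cyl_of_height {i : Fin s} {z : DCone A} (h : 0 < height i z) :
    z = apex A i ∨ ∃ q, z = cyl A i q := by
  induction z using ind with
  | h1 m => simp at h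
  | h2 j q =>
    rw [height_cyl] at h
    split_ifs at h with hj
    · subst hj
      exact Or.inr ⟨q, rfl⟩
    · exact absurd h (lt_irrefl 0)
  | h3 j =>
    rw [height_apex] at h
    split_ifs at h with hj
    · subst hj
      exact Or.inl rfl
    · exact absurd h (lt_irrefl 0)

theorem height_unique {i j : Fin s} {z : DCone A} (hi : 0 < height i z) (hj : 0 < height j z) :
    i = j := by
  rcases eq_cyl_of_height hi with rfl | ⟨q, rfl⟩
  · rw [height_apex] at hj
    by_contra h
    simp [h] at hj
  · rw [height_cyl] at hj
    by_contra h
    simp [h] at hj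

theorem eq_of_of_height {z : DCone A} (h : ∀ i, height i z = 0) : ∃ m, z = of A m := by
  induction z using ind with
  | h1 m => exact ⟨m, rfl⟩
  | h2 i q =>
    have := h i
    rw [height_cyl_self] at this
    refine ⟨q.1, ?_⟩
    rw [← cyl_zero A i q.1]
    congr 1
    exact Prod.ext rfl (Subtype.ext this)
  | h3 i =>
    have := h i
    simp at this

theorem cyl_mem_range_of {i : Fin s} {q : A i × unitInterval} (h : (q.2 : ℝ) = 0) :
    cyl A i q = of A q.1 := by
  rw [← cyl_zero A i q.1]
  congr 1
  exact Prod.ext rfl (Subtype.ext h)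

theorem ext_height {z z' : DCone A} (hh : ∀ i, height i z = height i z') (hb : base z = base z') :
    z = z' := by
  match h : base z with
  | none =>
    obtain ⟨i, rfl⟩ := eq_apex_of_base h
    obtain ⟨j, rfl⟩ := eq_apex_of_base (hb ▸ h)
    have := hh i
    rw [height_apex_self, height_apex] at this
    split_ifs at this with hij
    · rw [hij]
    · norm_num at this
  | some m =>
    by_cases h0 : ∀ i, height i z = 0
    · obtain ⟨m, rfl⟩ := eq_of_of_height h0
      obtain ⟨m', rfl⟩ := eq_of_of_height fun i => (hh i).symm.trans (h0 i)
      simp only [base_of, Option.some.injEq] at hb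
      rw [hb]
    · push Not at h0
      obtain ⟨i, hi⟩ := h0
      have hi' := lt_of_le_of_ne (height_nonneg i z) (Ne.symm hi)
      rcases eq_cyl_of_height hi' with rfl | ⟨q, rfl⟩
      · simp at h
      rcases eq_cyl_of_height (hh i ▸ hi') with rfl | ⟨q', rfl⟩
      · rw [h] at hb; simp at hb
      have h2 := hh i
      rw [height_cyl_self, height_cyl_self] at h2
      rw [base_cyl, base_cyl] at hb
      rw [base_cyl] at h
      have h2' : q.2 = q'.2 := Subtype.ext h2
      have hq : q.2 ≠ 1 := fun h' => by simp [h'] at h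
      rw [← h2', if_neg hq, if_neg hq, Option.some.injEq] at hb
      rw [Prod.ext (Subtype.ext hb) h2']

instance [T2Space Y] : T2Space (DCone A) := by
  refine ⟨fun z z' hz => ?_⟩
  by_cases hh : ∀ i, height i z = height i z'
  · have hb : base z ≠ base z' := fun h => hz (ext_height hh h)
    match h : base z, h' : base z' with
    | none, none => exact absurd (h.trans h'.symm) hb
    | some m, none =>
      obtain ⟨i, rfl⟩ := eq_apex_of_base h'
      have := hh i
      rw [height_apex_self] at this
      rcases eq_cyl_of_height (i := i) (z := z) (by rw [this]; exact one_pos) with rfl | ⟨q, rfl⟩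
      · simp at h
      · rw [height_cyl_self] at this
        rw [base_cyl, if_pos (Subtype.ext this)] at h
        simp at h
    | none, some m =>
      obtain ⟨i, rfl⟩ := eq_apex_of_base h
      have := (hh i).symm
      rw [height_apex_self] at this
      rcases eq_cyl_of_height (i := i) (z := z') (by rw [this]; exact one_pos) with rfl | ⟨q, rfl⟩
      · simp at h'
      · rw [height_cyl_self] at this
        rw [base_cyl, if_pos (Subtype.ext this)] at h'
        simp at h'
    | some m, some m' =>
      have hm : m ≠ m' := fun e => hb (by rw [h, h', e])
      obtain ⟨W, W', hW, hW', hm1, hm2, hd⟩ := t2_separation hm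
      refine ⟨_, _, isOpen_base hW, isOpen_base hW', ⟨m, hm1, h⟩, ⟨m', hm2, h'⟩, ?_⟩
      rw [Set.disjoint_left]
      rintro p ⟨a, ha, hpa⟩ ⟨b, hb, hpb⟩
      rw [hpa, Option.some.injEq] at hpb
      exact Set.disjoint_left.mp hd ha (hpb ▸ hb)
  · push Not at hh
    obtain ⟨i, hi⟩ := hh
    exact separated_by_continuous (height i).continuous hi

theorem isEmbedding_of : Topology.IsEmbedding (of A) := by
  refine ⟨⟨?_⟩, fun m m' h => ?_⟩
  · refine le_antisymm (of A).continuous.le_induced fun W hW => ?_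
    refine ⟨_, isOpen_base (A := A) hW, ?_⟩
    ext m
    simp
  · have := congr_arg base h
    simpa using this

theorem range_of : Set.range (of A) = {z | ∀ i, height i z = 0} := by
  ext z
  constructor
  · rintro ⟨m, rfl⟩ i
    rfl
  · intro h
    obtain ⟨m, rfl⟩ := eq_of_of_height h
    exact Set.mem_range_self m

/-- The open cone of the points of positive height. -/
def openCone (A : Fin s → Set Y) (i : Fin s) : Set (DCone A) := {z | 0 < height i z}

theorem isOpen_openCone (i : Fin s) : IsOpen (openCone A i) :=
  isOpen_lt continuous_const (height i).continuous

theorem openCone_disjoint {i j : Fin s} (h : i ≠ j) : openCone A i ∩ openCone A j = ∅ :=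
  Set.eq_empty_of_forall_notMem fun _ hz => h (height_unique hz.1 hz.2)

theorem compl_range_of : (Set.range (of A))ᶜ = ⋃ i, openCone A i := by
  ext z
  rw [range_of, Set.mem_compl_iff, Set.mem_iUnion]
  change (¬ ∀ i, height i z = 0) ↔ ∃ i, 0 < height i z
  push Not
  exact exists_congr fun i => ⟨fun h => lt_of_le_of_ne (height_nonneg i z) (Ne.symm h), ne_of_gt⟩

/-- The points of height less than `1/2`: a neighbourhood of `Y` which deforms to `Y`. -/
def nearBase (A : Fin s → Set Y) : Set (DCone A) := {z | ∀ i, height i z < 1 / 2}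

theorem isOpen_nearBase : IsOpen (nearBase A) := by
  rw [nearBase, Set.ofPred_forall]
  exact isOpen_iInter_of_finite fun i => isOpen_lt (height i).continuous continuous_const

theorem mem_nearBase_or (z : DCone A) : z ∈ nearBase A ∨ ∃ i, z ∈ openCone A i := by
  by_cases h : ∃ i, z ∈ openCone A i
  · exact Or.inr h
  · refine Or.inl fun i => ?_
    push Not at h
    exact lt_of_le_of_lt (not_lt.mp (h i)) (by norm_num)

/-- The closed cone over `Aᵢ`. -/
def closedCone (A : Fin s → Set Y) (i : Fin s) : Set (DCone A) := Set.range (cyl A i)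

theorem cyl_mem_closedCone (i : Fin s) (q : A i × unitInterval) : cyl A i q ∈ closedCone A i :=
  Set.mem_range_self q

theorem apex_mem_closedCone {i : Fin s} (a : A i) : apex A i ∈ closedCone A i :=
  ⟨(a, 1), cyl_one A i a⟩

theorem openCone_subset_closedCone {i : Fin s} (a : A i) : openCone A i ⊆ closedCone A i := by
  intro z hz
  rcases eq_cyl_of_height hz with rfl | ⟨q, rfl⟩
  · exact apex_mem_closedCone a
  · exact cyl_mem_closedCone i q

/-! ### Deformations of disjoint cones -/

/-- The heights at time `τ` of the deformation of a cone which pushes its lower half to the base. -/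
def pushDown : C(unitInterval × unitInterval, unitInterval) where
  toFun q := ⟨max 0 ((1 + (q.2 : ℝ)) * q.1 - q.2), le_max_left _ _, max_le zero_le_one (by
    have h1 := q.1.2.2
    have h2 := q.2.2.1
    nlinarith)⟩
  continuous_toFun := by
    refine Continuous.subtype_mk ?_ _
    fun_prop

/-- The deformation of the disjoint cone which pushes the lower halves of the cones to `Y`. -/
def deform (A : Fin s → Set Y) : C(DCone A × unitInterval, DCone A) :=
  (lift (Z := C(unitInterval, DCone A)) (((of A).comp ContinuousMap.fst).curry)
    (fun i => ((cyl A i).comp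
      (⟨fun q => (q.1.1, pushDown (q.1.2, q.2)), by fun_prop⟩ :
        C((A i × unitInterval) × unitInterval, A i × unitInterval))).curry)
    (fun i => ContinuousMap.const _ (apex A i))
    (fun i a => by
      ext τ
      change cyl A i (a, pushDown (0, τ)) = of A a
      refine cyl_mem_range_of ?_
      change max 0 ((1 + (τ : ℝ)) * (0 : ℝ) - τ) = 0
      refine max_eq_left ?_
      have := τ.2.1
      linarith)
    (fun i a => by
      ext τ
      change cyl A i (a, pushDown (1, τ)) = apex A i
      rw [← cyl_one A i a]
      congr 1
      refine Prod.ext rfl (Subtype.ext ?_)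
      change max 0 ((1 + (τ : ℝ)) * (1 : ℝ) - τ) = 1
      rw [mul_one, add_sub_cancel_right]
      exact max_eq_right zero_le_one)).uncurry

theorem deform_cyl (i : Fin s) (q : A i × unitInterval) (τ : unitInterval) :
    deform A (cyl A i q, τ) = cyl A i (q.1, pushDown (q.2, τ)) := rfl

theorem deform_zero : (deform A).comp (slice (DCone A) 0) = ContinuousMap.id _ := by
  ext z
  change deform A (z, 0) = z
  induction z using ind with
  | h1 m => rfl
  | h2 i q =>
    rw [deform_cyl]
    congr 1
    refine Prod.ext rfl (Subtype.ext ?_)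
    change max 0 ((1 + (0 : ℝ)) * q.2 - 0) = q.2
    rw [add_zero, one_mul, sub_zero]
    exact max_eq_right q.2.2.1
  | h3 i => rfl

theorem deform_mem_closedCone {i : Fin s} {z : DCone A} (hz : z ∈ closedCone A i) (τ : unitInterval) :
    deform A (z, τ) ∈ closedCone A i := by
  obtain ⟨q, rfl⟩ := hz
  rw [deform_cyl]
  exact cyl_mem_closedCone _ _

theorem deform_one_of_lt {i : Fin s} {q : A i × unitInterval} (h : (q.2 : ℝ) < 1 / 2) :
    deform A (cyl A i q, 1) = of A q.1 := by
  rw [deform_cyl]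
  refine cyl_mem_range_of ?_
  change max 0 ((1 + (1 : ℝ)) * q.2 - 1) = 0
  refine max_eq_left ?_
  linarith

theorem deform_one_mem_range {z : DCone A} (hz : z ∈ nearBase A) :
    deform A (z, 1) ∈ Set.range (of A) := by
  induction z using ind with
  | h1 m => exact Set.mem_range_self m
  | h2 i q =>
    rw [deform_one_of_lt (by simpa using hz i)]
    exact Set.mem_range_self _
  | h3 i =>
    have := hz i
    rw [height_apex_self] at this
    norm_num at this

theorem cyl_eq_cyl {i : Fin s} {q q' : A i × unitInterval} (h : cyl A i q = cyl A i q') :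
    q.2 = q'.2 ∧ (q.2 = 1 ∨ q.1 = q'.1) := by
  have h1 := congr_arg (height i) h
  rw [height_cyl_self, height_cyl_self] at h1
  have h1' : q.2 = q'.2 := Subtype.ext h1
  refine ⟨h1', ?_⟩
  by_cases h2 : q.2 = 1
  · exact Or.inl h2
  · have h3 := congr_arg base h
    rw [base_cyl, base_cyl, ← h1', if_neg h2, if_neg h2, Option.some.injEq] at h3
    exact Or.inr (Subtype.ext h3)

end Lift

section Contract

variable {Y : Type u} [TopologicalSpace Y] {s : ℕ} {A : Fin s → Set Y}

/-- The contraction of a cylinder to its top, as a family of paths in the cone. -/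
def cylUp (A : Fin s → Set Y) (i : Fin s) : C(A i × unitInterval, C(unitInterval, DCone A)) :=
  ((cyl A i).comp (⟨fun q => (q.1.1, max q.1.2 q.2), by fun_prop⟩ :
    C((A i × unitInterval) × unitInterval, A i × unitInterval))).curry

theorem cylUp_factors {i : Fin s} (q q' : A i × unitInterval)
    (h : Set.rangeFactorization (cyl A i) q = Set.rangeFactorization (cyl A i) q') :
    cylUp A i q = cylUp A i q' := by
  ext τ
  obtain ⟨h1, h2⟩ := cyl_eq_cyl (congr_arg Subtype.val h)
  change cyl A i (q.1, max q.2 τ) = cyl A i (q'.1, max q'.2 τ)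
  rw [← h1]
  rcases h2 with h2 | h2
  · rw [h2, max_eq_left unitInterval.le_one', cyl_one, cyl_one]
  · rw [h2]

variable [T2Space Y] [CompactSpace Y]

theorem isQuotientMap_cyl {i : Fin s} (hA : IsClosed (A i)) :
    Topology.IsQuotientMap (Set.rangeFactorization (cyl A i)) := by
  have : CompactSpace (A i) := isCompact_iff_compactSpace.mp hA.isCompact
  have hc : Continuous (Set.rangeFactorization (cyl A i)) :=
    (cyl A i).continuous.subtype_mk _
  exact hc.isClosedMap.isQuotientMap hc Set.rangeFactorization_surjective

/-- The contraction of the closed cone over `Aᵢ` to its cone point. -/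
def contract {i : Fin s} (hA : IsClosed (A i)) : C(closedCone A i × unitInterval, DCone A) :=
  ((isQuotientMap_cyl hA).lift (f := ⟨Set.rangeFactorization (cyl A i),
      (isQuotientMap_cyl hA).continuous⟩)
    (cylUp A i) fun q q' h => cylUp_factors q q' h).uncurry

theorem contract_cyl {i : Fin s} (hA : IsClosed (A i)) (q : A i × unitInterval) (τ : unitInterval) :
    contract hA (⟨cyl A i q, Set.mem_range_self q⟩, τ) = cyl A i (q.1, max q.2 τ) :=
  DFunLike.congr_fun (DFunLike.congr_fun ((isQuotientMap_cyl hA).lift_comp (f :=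
    ⟨Set.rangeFactorization (cyl A i), (isQuotientMap_cyl hA).continuous⟩) (cylUp A i)
      fun q q' h => cylUp_factors q q' h) q) τ

theorem contract_one {i : Fin s} (hA : IsClosed (A i)) (z : closedCone A i) :
    contract hA (z, 1) = apex A i := by
  obtain ⟨z, q, rfl⟩ := z
  rw [contract_cyl, max_eq_right unitInterval.le_one', cyl_one]

theorem contract_zero {i : Fin s} (hA : IsClosed (A i)) (z : closedCone A i) :
    contract hA (z, 0) = z := by
  obtain ⟨z, q, rfl⟩ := z
  rw [contract_cyl, max_eq_left unitInterval.nonneg']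

theorem contract_mem_openCone {i : Fin s} (hA : IsClosed (A i)) {z : closedCone A i}
    (hz : (z : DCone A) ∈ openCone A i) (τ : unitInterval) :
    contract hA (z, τ) ∈ openCone A i := by
  obtain ⟨z, q, rfl⟩ := z
  rw [contract_cyl]
  change 0 < height i (cyl A i q) at hz
  change 0 < height i (cyl A i _)
  rw [height_cyl_self] at hz ⊢
  exact lt_of_lt_of_le hz (Subtype.coe_le_coe.mpr (le_max_left q.2 τ))

theorem exists_bd_of_closedCone {R : Type*} [CommRing R] {i : Fin s} (hA : IsClosed (A i)) {n : ℕ}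
    {b : (sg (DCone A)).obj (n + 1) →₀ R} (hb : b ∈ supp R (closedCone A i) (n + 1))
    (hb0 : bd R _ n b = 0) : ∃ c, b = bd R _ (n + 1) c := by
  let f : C(closedCone A i, DCone A) := ⟨Subtype.val, continuous_subtype_val⟩
  have hf : Topology.IsEmbedding f := Topology.IsEmbedding.subtypeVal
  obtain ⟨b', -, rfl⟩ := exists_lift hf (by simp [f]) hb
  have h0 : bd R _ n b' = 0 := by
    refine push_injective hf.injective n ?_
    rw [map_zero, ← bd_push, hb0]
  have h := (contractOp (contract hA) (contract_one hA)).exists_bd n h0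
  have hs : (contract hA).comp (slice (closedCone A i) 0) = f :=
    ContinuousMap.ext fun z => contract_zero hA z
  exact ⟨_, (congr_arg (fun g => push R (sgMap g) (n + 1) b') hs).symm.trans h⟩

theorem exists_bd_of_openCone {R : Type*} [CommRing R] {i : Fin s} (hA : IsClosed (A i)) (a : A i)
    {n : ℕ} {b : (sg (DCone A)).obj (n + 1) →₀ R} (hb : b ∈ supp R (openCone A i) (n + 1))
    (hb0 : bd R _ n b = 0) :
    ∃ c ∈ supp R (openCone A i) (n + 2), b = bd R _ (n + 1) c := by
  let f : C(openCone A i, DCone A) := ⟨Subtype.val, continuous_subtype_val⟩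
  have hf : Topology.IsEmbedding f := Topology.IsEmbedding.subtypeVal
  obtain ⟨b', -, rfl⟩ := exists_lift hf (by simp [f]) hb
  have h0 : bd R _ n b' = 0 := by
    refine push_injective hf.injective n ?_
    rw [map_zero, ← bd_push, hb0]
  let G : C(openCone A i × unitInterval, DCone A) := (contract hA).comp
    ⟨fun q => (⟨q.1, openCone_subset_closedCone a q.1.2⟩, q.2), by fun_prop⟩
  have hG : ∀ z, G (z, 1) = apex A i := fun z => contract_one hA _
  have h := (contractOp G hG).exists_bd n h0
  have hs : G.comp (slice (openCone A i) 0) = f :=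
    ContinuousMap.ext fun z => contract_zero hA _
  refine ⟨_, ?_, (congr_arg (fun g => push R (sgMap g) (n + 1) b') hs).symm.trans h⟩
  rw [← Int.cast_smul_eq_zsmul R]
  refine Submodule.smul_mem _ _ (contractOp_mem_supp hG (fun q => ?_) ?_ _ _)
  · exact contract_mem_openCone hA q.1.2 q.2
  · change 0 < height i (apex A i)
    simp

end Contract

theorem pathConnectedSpace {Y : Type u} [TopologicalSpace Y] {s : ℕ} {A : Fin s → Set Y}
    [PathConnectedSpace Y] (hA : ∀ i, (A i).Nonempty) : PathConnectedSpace (DCone A) := by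
  obtain ⟨m₀⟩ := (inferInstance : Nonempty Y)
  have key : ∀ z : DCone A, Joined (of A m₀) z := by
    have hof : ∀ m, Joined (of A m₀) (of A m) := fun m =>
      ⟨(PathConnectedSpace.somePath m₀ m).map (of A).continuous⟩
    have hcyl : ∀ i (q : A i × unitInterval), Joined (of A m₀) (cyl A i q) := fun i q => by
      refine (hof q.1).trans ⟨⟨⟨fun t => cyl A i (q.1, t * q.2), by fun_prop⟩, ?_, ?_⟩⟩
      · change cyl A i (q.1, 0 * q.2) = _
        rw [zero_mul, cyl_zero]
      · change cyl A i (q.1, 1 * q.2) = _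
        rw [one_mul]
    intro z
    induction z using ind with
    | h1 m => exact hof m
    | h2 i q => exact hcyl i q
    | h3 i =>
      obtain ⟨a, ha⟩ := hA i
      rw [← cyl_one A i ⟨a, ha⟩]
      exact hcyl i _
  exact ⟨⟨of A m₀⟩, fun z z' => (key z).symm.trans (key z')⟩

end DCone

/-! ### Comparison of the chains of a disjoint cone with the disjoint cone of chains -/

section Cycles

variable (R : Type*) [CommRing R]

/-- The cycles of the augmented chain complex; every chain of `0` vertices is a cycle. -/
def aCyc (S : ASet.{u}) : ∀ n, Submodule R (S.obj n →₀ R)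
  | 0 => ⊤
  | n + 1 => LinearMap.ker (bd R S n)

variable {R}

theorem bd_mem_aCyc {S : ASet.{u}} (n : ℕ) (c : S.obj (n + 1) →₀ R) : bd R S n c ∈ aCyc R S n :=
  match n with
  | 0 => Submodule.mem_top
  | n + 1 => bd_bd R S n c

/-- Reduced cycles can be recognized after an injective map. -/
theorem mem_aCyc_of_push {S : ASet.{u}} {T : ASet.{v}} (f : Hom S T)
    (hf : ∀ n, Function.Injective (push R f n)) {n : ℕ} {c : S.obj n →₀ R}
    (hc : push R f n c ∈ aCyc R T n) : c ∈ aCyc R S n := by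
  match n with
  | 0 => exact Submodule.mem_top
  | n + 1 =>
    refine LinearMap.mem_ker.mpr (hf n ?_)
    rw [map_zero, ← bd_push]
    exact hc

/-- The cone over a reduced cycle `c` bounds `c` up to sign, for `0` vertices as well. -/
theorem ConeOp.bd_map_of_mem_aCyc {T : ASet.{u}} {S : ASet.{v}} {f : Hom T S} (K : ConeOp f) (n : ℕ)
    {c : T.obj n →₀ R} (hc : c ∈ aCyc R T n) :
    bd R S n (K.map R n c) = ((-1 : ℤ) ^ n) • push R f n c := by
  match n with
  | 0 => rw [K.bd_map_zero, pow_zero, one_smul]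
  | n + 1 => rw [K.bd_map, LinearMap.mem_ker.mp hc, map_zero, zero_add]

/-- The prism over a boundary bounds its two ends; unlike `NatHtpy.bd_prism`, this covers chains of
`0` vertices as well. -/
theorem NatHtpy.bd_prism_bd {X : Type u} {Y : Type v} [TopologicalSpace X] [TopologicalSpace Y]
    (h : NatHtpy X Y) (n : ℕ) (c : (sg X).obj (n + 1) →₀ R) :
    bd R (sg Y) n (h.prism R n (bd R (sg X) n c)) =
      push R (h.at 1) n (bd R (sg X) n c) - push R (h.at 0) n (bd R (sg X) n c) := by
  match n with
  | 0 =>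
    rw [show h.prism R 0 = 0 from rfl, LinearMap.zero_apply, map_zero, eq_comm, sub_eq_zero]
    have h01 : ∀ t, push R (h.at t) 0 (bd R (sg X) 0 c) = push R (h.at 0) 0 (bd R (sg X) 0 c) :=
      fun t => rfl
    exact h01 1
  | n + 1 => rw [h.bd_prism R, bd_bd, map_zero, sub_zero]

end Cycles

section Dcone

variable {Y : Type u} [TopologicalSpace Y] {s : ℕ} (A : Fin s → Set Y) {R : Type*} [CommRing R]

/-- The augmented quasisimplicial set `Dcone(⋃ᵢ sing Aᵢ → sing Y)`. -/
def dcA : ASet.{u} := (dconeSing A).toA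

/-- The inclusion of the singular simplices of `Y`. -/
def dcInl : Hom (sg Y) (dcA A) := QSet.homA
  { app := fun {n} (σ : (sing Y).obj n) => (.inl σ : (sing Y).obj n ⊕ (Σ i, (sing (A i)).aug n))
    app_face := fun _ _ => rfl }

/-- The cone operator of `Dcone(⋃ᵢ sing Aᵢ → sing Y)` on the simplices of `Aᵢ`. -/
def dcCone (i : Fin s) : ConeOp ((dcInl A).comp (sgMap (incl A i))) where
  k {n} t := (.inr ⟨i, t⟩ : (sing Y).obj n ⊕ (Σ i, (sing (A i)).aug n))
  face_castSucc {_} j t :=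
    QSet.dconeFace_castSucc (sing Y) (fun i : Fin s => sing (A i)) (fun i => singMap (incl A i)) j i t
  face_last {n} t := match n, t with
    | 0, _ => rfl
    | _ + 1, t => QSet.dconeFace_last (sing Y) (fun i : Fin s => sing (A i))
        (fun i => singMap (incl A i)) i t

/-- The inclusion into the singular simplices of the topological disjoint cone. -/
def dcIncl : Hom (dcA A) (sg (DCone A)) := QSet.homA (dconeSingIncl A)

variable {A}

theorem push_dcIncl_inl (n : ℕ) (m : (sg Y).obj n →₀ R) :
    push R (dcIncl A) n (push R (dcInl A) n m) = push R (sgMap (DCone.of A)) n m := by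
  rw [← push_comp]
  have h : (dcIncl A).comp (dcInl A) = sgMap (DCone.of A) := hom_sg_ext fun _ _ => rfl
  rw [h]

theorem push_dcIncl_cone_mem {i : Fin s} (a : A i) (n : ℕ) (c : (sg (A i)).obj n →₀ R) :
    push R (dcIncl A) (n + 1) ((dcCone A i).map R n c) ∈ supp R (DCone.closedCone A i) (n + 1) := by
  induction c using Finsupp.induction_linear with
  | zero => simp
  | add x y hx hy => rw [map_add, map_add]; exact Submodule.add_mem _ hx hy
  | single σ r =>
    rw [ConeOp.map_single, push_single]
    refine single_mem_supp (fun p => ?_) _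
    match n, σ with
    | 0, σ => exact DCone.apex_mem_closedCone a
    | n + 1, σ =>
      obtain ⟨⟨v, t⟩, rfl⟩ := joinPt_surjective p
      have h := coneSimplex_joinPt i (toMap σ) v t
      exact h ▸ DCone.cyl_mem_closedCone i (toMap σ v, t)

theorem bd_push_dcIncl_cone {i : Fin s} (n : ℕ) {c : (sg (A i)).obj n →₀ R} (hc : c ∈ aCyc R _ n) :
    bd R _ n (push R (dcIncl A) (n + 1) ((dcCone A i).map R n c)) =
      ((-1 : ℤ) ^ n) • push R (sgMap ((DCone.of A).comp (incl A i))) n c := by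
  rw [bd_push, (dcCone A i).bd_map_of_mem_aCyc n hc, map_zsmul, push_comp, push_dcIncl_inl,
    push_sgMap_comp]

theorem dcA_cases {n : ℕ} (x : (dcA A).obj (n + 1)) :
    (∃ σ, x = (dcInl A).app σ) ∨ ∃ i t, x = (dcCone A i).k t := by
  rcases x with σ | ⟨i, t⟩
  · exact Or.inl ⟨σ, rfl⟩
  · exact Or.inr ⟨i, t, rfl⟩

theorem dcInl_ne_dcCone {n : ℕ} (σ : (sg Y).obj (n + 1)) {i : Fin s} (t : (sg (A i)).obj n) :
    (dcInl A).app σ ≠ (dcCone A i).k t := Sum.inl_ne_inr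

theorem dcCone_ne_dcCone {n : ℕ} {i j : Fin s} (h : j ≠ i) (t : (sg (A j)).obj n)
    (t' : (sg (A i)).obj n) : (dcCone A j).k t ≠ (dcCone A i).k t' :=
  fun h' => h (congr_arg Sigma.fst (Sum.inr_injective h'))

theorem dcCone_injective {n : ℕ} (i : Fin s) :
    Function.Injective ((dcCone A i).k (n := n)) := fun t t' h => by
  exact eq_of_heq (Sigma.mk.inj (Sum.inr_injective h)).2

/-- A chain of the algebraic cone is the sum of a chain of `Y` and of cones over chains of the
`A i`. -/
theorem dcone_exists_eq (n : ℕ) (l : (dcA A).obj (n + 1) →₀ R) :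
    ∃ (m : (sg Y).obj (n + 1) →₀ R) (a : ∀ i, (sg (A i)).obj n →₀ R),
      l = push R (dcInl A) (n + 1) m + ∑ i, (dcCone A i).map R n (a i) := by
  classical
  induction l using Finsupp.induction_linear with
  | zero => exact ⟨0, 0, by simp⟩
  | add x y hx hy =>
    obtain ⟨m, a, rfl⟩ := hx
    obtain ⟨m', a', rfl⟩ := hy
    refine ⟨m + m', a + a', ?_⟩
    simp only [map_add, Pi.add_apply, Finset.sum_add_distrib]
    abel
  | single σ r =>
    rcases dcA_cases σ with ⟨σ, rfl⟩ | ⟨i, t, rfl⟩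
    · refine ⟨Finsupp.single σ r, 0, ?_⟩
      simp only [Pi.zero_apply, map_zero, Finset.sum_const_zero, add_zero]
      rw [push_single]
    · refine ⟨0, Pi.single i (Finsupp.single t r), ?_⟩
      rw [map_zero, zero_add, Finset.sum_eq_single i]
      · rw [Pi.single_eq_same, ConeOp.map_single]
      · intro j _ hj
        rw [Pi.single_eq_of_ne hj, map_zero]
      · simp

theorem dcInl_injective (n : ℕ) : Function.Injective (push R (dcInl A) n) := by
  refine Finsupp.mapDomain_injective fun σ τ h => ?_
  match n, σ, τ with
  | 0, _, _ => exact Subsingleton.elim _ _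
  | n + 1, σ, τ => exact Sum.inl_injective h

/-- The decomposition of `dcone_exists_eq` is unique. -/
theorem dcone_eq_zero {n : ℕ} {m : (sg Y).obj (n + 1) →₀ R} {a : ∀ i, (sg (A i)).obj n →₀ R}
    (h : push R (dcInl A) (n + 1) m + ∑ i, (dcCone A i).map R n (a i) = 0) :
    m = 0 ∧ ∀ i, a i = 0 := by
  have ha : ∀ i, a i = 0 := by
    intro i
    refine Finsupp.ext fun t => ?_
    have := DFunLike.congr_fun h ((dcCone A i).k t)
    rw [Finsupp.add_apply, Finsupp.finsetSum_apply, Finset.sum_eq_single i] at this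
    · have h1 : push R (dcInl A) (n + 1) m ((dcCone A i).k t) = 0 := by
        refine Finsupp.mapDomain_of_notMem_range _ _ ?_
        rintro ⟨σ, hσ⟩
        exact dcInl_ne_dcCone σ t hσ
      have h2 : (dcCone A i).map R n (a i) ((dcCone A i).k t) = a i t :=
        Finsupp.mapDomain_apply (dcCone_injective i) _ t
      rw [h1, h2, zero_add] at this
      exact this
    · intro j _ hj
      refine Finsupp.mapDomain_of_notMem_range _ _ ?_
      rintro ⟨σ, hσ⟩
      exact dcCone_ne_dcCone hj σ t hσ
    · simp
  refine ⟨?_, ha⟩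
  simp only [ha, map_zero, Finset.sum_const_zero, add_zero] at h
  exact dcInl_injective _ (h.trans (map_zero _).symm)

/-- The cycles of `Dcone(⊕ᵢ C_*(Aᵢ) → C_*(Y))`. -/
theorem dcone_cycle {n : ℕ} {m : (sg Y).obj (n + 1) →₀ R} {a : ∀ i, (sg (A i)).obj n →₀ R}
    (h : bd R (dcA A) n (push R (dcInl A) (n + 1) m + ∑ i, (dcCone A i).map R n (a i)) = 0) :
    (∀ i, a i ∈ aCyc R (sg (A i)) n) ∧
      bd R (sg Y) n m + ((-1 : ℤ) ^ n) • ∑ i, push R (sgMap (incl A i)) n (a i) = 0 := by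
  have ha : ∀ i, a i ∈ aCyc R (sg (A i)) n := by
    match n, m, a, h with
    | 0, m, a, h => exact fun i => Submodule.mem_top
    | n + 1, m, a, h =>
      rw [map_add, map_sum, bd_push] at h
      simp only [ConeOp.bd_map, push_comp] at h
      rw [Finset.sum_add_distrib, ← Finset.smul_sum, ← map_sum, ← map_zsmul, add_left_comm, ← map_add] at h
      exact fun i =>
        (dcone_eq_zero (a := fun i => bd R _ n (a i)) ((add_comm _ _).trans h)).2 i
  refine ⟨ha, dcInl_injective (A := A) n ?_⟩
  rw [map_zero, ← h, map_add, map_add, map_sum, ← bd_push, map_zsmul, map_sum, Finset.smul_sum]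
  congr 1
  refine Finset.sum_congr rfl fun i _ => ?_
  rw [ConeOp.bd_map_of_mem_aCyc _ n (ha i), push_comp]

/-- If a sum of chains lies in `U`, then so do the summands, provided they lie in sets whose pairwise
intersections are contained in `U`. -/
theorem mem_supp_of_sum {X : Type v} [TopologicalSpace X] {U : Set X} {V : Fin s → Set X}
    (hV : ∀ i j, i ≠ j → V i ∩ V j ⊆ U) {n : ℕ} {w : Fin s → (sg X).obj n →₀ R}
    (hw : ∀ i, w i ∈ supp R (V i) n) (hs : ∑ i, w i ∈ supp R U n) (i : Fin s) :
    w i ∈ supp R U n := by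
  match n with
  | 0 => exact mem_supp_zero _ _
  | n + 1 =>
    intro σ hσ
    by_contra hU
    have h1 : ∀ j, j ≠ i → w j σ = 0 := by
      intro j hj
      by_contra h
      have hj' := hw j (Finsupp.mem_support_iff.mpr h)
      exact hU fun p => hV j i hj ⟨hj' p, hw i hσ p⟩
    have h2 : (∑ j, w j) σ = 0 := by
      by_contra h
      exact hU (hs (Finsupp.mem_support_iff.mpr h))
    rw [Finsupp.finsetSum_apply, Finset.sum_eq_single i (fun j _ hj => h1 j hj) (by simp)] at h2
    exact (Finsupp.mem_support_iff.mp hσ) h2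

theorem DCone.closedCone_inter_subset {i j : Fin s} (h : i ≠ j) :
    closedCone A i ∩ closedCone A j ⊆ nearBase A := by
  rintro z ⟨⟨q, rfl⟩, ⟨q', hq⟩⟩ k
  have h1 : height j (cyl A i q) = 0 := by rw [height_cyl, if_neg h]
  have h0 : (q'.2 : ℝ) = 0 := by rw [← hq, height_cyl_self] at h1; exact h1
  rw [← hq, cyl_mem_range_of h0, height_of]
  norm_num

/-- The deformation moves points near the base of the `i`-th cone into `A i`. -/
theorem DCone.deform_one_mem_image {i : Fin s} {z : DCone A} (hz : z ∈ nearBase A)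
    (hz' : z ∈ closedCone A i) : deform A (z, 1) ∈ of A '' A i := by
  obtain ⟨q, rfl⟩ := hz'
  rw [deform_one_of_lt (by simpa using hz i)]
  exact ⟨q.1, q.1.2, rfl⟩

/-- Up to a chain homotopy preserving supports, a chain of the disjoint cone is a sum of a chain
near `Y` and of chains in the open cones. -/
theorem exists_dcone_small {n : ℕ} (c : (sg (DCone A)).obj (n + 1) →₀ R) :
    ∃ D : ∀ k : ℕ, ((sg (DCone A)).obj k →₀ R) →ₗ[R] ((sg (DCone A)).obj (k + 1) →₀ R),
      (∀ (V : Set (DCone A)) (k : ℕ), ∀ e ∈ supp R V k, D k e ∈ supp R V (k + 1)) ∧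
      ∃ u ∈ supp R (DCone.nearBase A) (n + 1), ∃ v : Fin s → (sg (DCone A)).obj (n + 1) →₀ R,
        (∀ i, v i ∈ supp R (DCone.openCone A i) (n + 1)) ∧
        c - bd R _ (n + 1) (D (n + 1) c) - D n (bd R _ n c) = u + ∑ i, v i := by
  let U : Option (Fin s) → Set (DCone A) := fun o => o.elim (DCone.nearBase A) (DCone.openCone A)
  have hU : ∀ o, IsOpen (U o) := fun o => match o with
    | none => DCone.isOpen_nearBase
    | some i => DCone.isOpen_openCone i
  have hun : ⋃ o, U o = Set.univ := by
    rw [Set.eq_univ_iff_forall]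
    intro z
    rcases DCone.mem_nearBase_or z with h | ⟨i, h⟩
    · exact Set.mem_iUnion.mpr ⟨none, h⟩
    · exact Set.mem_iUnion.mpr ⟨some i, h⟩
  obtain ⟨D, hD, h⟩ := exists_small hU (hun.symm ▸ mem_supp_univ _ c)
  refine ⟨D, hD, ?_⟩
  rw [smallChains, Finsupp.supported_iUnion, Submodule.mem_iSup_iff_exists_finsupp] at h
  obtain ⟨f, hf, h⟩ := h
  refine ⟨f none, hf none, fun i => f (some i), fun i => hf (some i), ?_⟩
  rw [← h, ← Fintype.sum_option (f := fun o => f o)]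
  exact Finset.sum_subset (Finset.subset_univ _) fun o _ ho => Finsupp.notMem_support_iff.mp ho

theorem push_deform_of (n : ℕ) (m : (sg Y).obj n →₀ R) (t : unitInterval) :
    push R (sgMap ((DCone.deform A).comp (slice _ t))) n (push R (sgMap (DCone.of A)) n m) =
      push R (sgMap (DCone.of A)) n m := by
  rw [← push_sgMap_comp]
  rfl

/-- `Dcone(⊕ᵢ C_*(Aᵢ) → C_*(Y)) → C_*(Dcone(⋃ᵢ Aᵢ → Y))` is surjective on reduced homology. -/
theorem exists_dcone_cycle [T2Space Y] [CompactSpace Y] (hA : ∀ i, IsClosed (A i)) (a₀ : ∀ i, A i) {n : ℕ}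
    {z : (sg (DCone A)).obj (n + 1) →₀ R} (hz : bd R _ n z = 0) :
    ∃ l, bd R (dcA A) n l = 0 ∧ ∃ c, z - push R (dcIncl A) (n + 1) l = bd R _ (n + 1) c := by
  -- `z` is homologous to `u + ∑ i, v i` with `u` near `Y` and `v i` in the `i`-th cone
  obtain ⟨D, hD, u, hu, v, hv, h⟩ := exists_dcone_small z
  rw [hz, map_zero, sub_zero] at h
  let g := NatHtpy.ofMap (DCone.deform A)
  have hg0 : g.at 0 = sgMap (ContinuousMap.id _) := by
    rw [NatHtpy.ofMap_at, DCone.deform_zero]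
  have hb : bd R _ n u + ∑ i, bd R _ n (v i) = 0 := by
    rw [← map_sum, ← map_add, ← h, map_sub, bd_bd, hz, sub_zero]
  -- `∂ (v i)` also lies near `Y`, since the open cones are disjoint and `∑ i, ∂ (v i) = -∂ u`
  have hbv : ∀ i, bd R _ n (v i) ∈ supp R (DCone.nearBase A) n := by
    refine mem_supp_of_sum (V := DCone.openCone A) (fun i j hij => ?_)
      (fun i => bd_mem_supp (hv i)) ?_
    · rw [DCone.openCone_disjoint hij]
      exact Set.empty_subset _
    · rw [← neg_eq_iff_add_eq_zero.mpr hb, ← map_neg]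
      exact bd_mem_supp (Submodule.neg_mem _ hu)
  have hvc : ∀ i, v i ∈ supp R (DCone.closedCone A i) (n + 1) := fun i =>
    supp_mono (DCone.openCone_subset_closedCone (a₀ i)) _ (hv i)
  -- the deformation moves `u` to a chain `μ` of `Y` and `∂ (v i)` to a cycle `a i` of `A i`
  obtain ⟨μ, -, hμ⟩ := exists_lift DCone.isEmbedding_of subset_rfl
    (push_mem_supp ((DCone.deform A).comp (slice _ 1)) (V := Set.range (DCone.of A))
      (fun z hz => DCone.deform_one_mem_range hz) hu)
  have hemb : ∀ i, Topology.IsEmbedding ((DCone.of A).comp (incl A i)) := fun i =>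
    DCone.isEmbedding_of.comp Topology.IsEmbedding.subtypeVal
  have hlift : ∀ i, ∃ a : (sg (A i)).obj n →₀ R, push R (sgMap ((DCone.of A).comp (incl A i))) n a =
      push R (g.at 1) n (bd R _ n (v i)) := by
    intro i
    have h1 : bd R _ n (v i) ∈ supp R (DCone.nearBase A ∩ DCone.closedCone A i) n := by
      rw [supp_inter]
      exact ⟨hbv i, bd_mem_supp (hvc i)⟩
    obtain ⟨a, -, ha⟩ := exists_lift (hemb i) subset_rfl
      (push_mem_supp ((DCone.deform A).comp (slice _ 1))
        (V := Set.range ((DCone.of A).comp (incl A i))) (fun z hz => by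
          obtain ⟨m, hm, h⟩ := DCone.deform_one_mem_image hz.1 hz.2
          exact ⟨⟨m, hm⟩, h⟩) h1)
    exact ⟨a, ha⟩
  choose a ha using hlift
  have hac : ∀ i, a i ∈ aCyc R _ n := fun i => by
    refine mem_aCyc_of_push (sgMap ((DCone.of A).comp (incl A i)))
      (fun n => push_injective (hemb i).injective n) ?_
    rw [ha, ← bd_push]
    exact bd_mem_aCyc _ _
  have hμa : bd R _ n μ = -∑ i, push R (sgMap (incl A i)) n (a i) := by
    refine push_injective (f := DCone.of A) DCone.isEmbedding_of.injective n ?_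
    rw [map_neg, map_sum]
    simp only [← push_sgMap_comp, ha]
    rw [← bd_push, hμ, bd_push, ← map_sum, ← map_neg, neg_eq_of_add_eq_zero_left hb]
    rfl
  have hε : ∀ x : (sg (DCone A)).obj n →₀ R, ((-1 : ℤ) ^ n) • ((-1 : ℤ) ^ n) • x = x := fun x => by
    rw [smul_smul, ← mul_pow]
    simp
  -- the remaining difference between `v i` and the cone over `a i` is a cycle in the closed cone
  let b : Fin s → (sg (DCone A)).obj (n + 1) →₀ R := fun i =>
    v i + g.prism R n (bd R _ n (v i)) -
      ((-1 : ℤ) ^ n) • push R (dcIncl A) (n + 1) ((dcCone A i).map R n (a i))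
  have hb1 : ∀ i, b i ∈ supp R (DCone.closedCone A i) (n + 1) := fun i => by
    refine Submodule.sub_mem _ (Submodule.add_mem _ (hvc i) ?_) ?_
    · exact NatHtpy.prism_mem_supp _ (fun k σ hσ q => DCone.deform_mem_closedCone (hσ _) _)
        (bd_mem_supp (hvc i))
    · rw [← Int.cast_smul_eq_zsmul R]
      exact Submodule.smul_mem _ _ (push_dcIncl_cone_mem (a₀ i) _ _)
  have hb2 : ∀ i, bd R _ n (b i) = 0 := fun i => by
    rw [map_sub, map_add, g.bd_prism_bd, hg0, push_sgMap_id, map_zsmul,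
      bd_push_dcIncl_cone n (hac i), hε, ha]
    abel
  choose c hc using fun i => DCone.exists_bd_of_closedCone (hA i) (hb1 i) (hb2 i)
  refine ⟨push R (dcInl A) (n + 1) μ + ((-1 : ℤ) ^ n) • ∑ i, (dcCone A i).map R n (a i), ?_,
    D (n + 1) z - g.prism R (n + 1) u + ∑ i, c i, ?_⟩
  · rw [map_add, bd_push, hμa, map_zsmul, map_sum, map_neg, map_sum, neg_add_eq_zero, Finset.smul_sum]
    refine Finset.sum_congr rfl fun i _ => ?_
    rw [ConeOp.bd_map_of_mem_aCyc _ n (hac i), smul_smul, ← mul_pow, push_comp]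
    simp
  · have e1 : bd R _ (n + 1) (g.prism R (n + 1) u) = push R (g.at 1) (n + 1) u - u +
        ∑ i, g.prism R n (bd R _ n (v i)) := by
      rw [g.bd_prism R, hg0, push_sgMap_id, ← map_sum, eq_neg_of_add_eq_zero_left hb, map_neg, sub_neg_eq_add]
    have e2 : ∑ i, bd R _ (n + 1) (c i) = ∑ i, v i + ∑ i, g.prism R n (bd R _ n (v i)) -
        ((-1 : ℤ) ^ n) • ∑ i, push R (dcIncl A) (n + 1) ((dcCone A i).map R n (a i)) := by
      simp only [← hc, b]
      rw [Finset.sum_sub_distrib, Finset.sum_add_distrib, ← Finset.smul_sum]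
    have e3 : push R (dcIncl A) (n + 1) (push R (dcInl A) (n + 1) μ +
        ((-1 : ℤ) ^ n) • ∑ i, (dcCone A i).map R n (a i)) = push R (g.at 1) (n + 1) u +
        ((-1 : ℤ) ^ n) • ∑ i, push R (dcIncl A) (n + 1) ((dcCone A i).map R n (a i)) := by
      rw [map_add, push_dcIncl_inl, hμ, map_zsmul, map_sum]
      rfl
    rw [e3, map_add, map_sub, e1, map_sum, e2]
    generalize bd R _ (n + 1) (D (n + 1) z) = y at h ⊢
    rw [sub_eq_iff_eq_add.mp h]
    generalize ((-1 : ℤ) ^ n) • ∑ i, push R (dcIncl A) (n + 1) ((dcCone A i).map R n (a i)) = q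
    abel

/-- `Dcone(⊕ᵢ C_*(Aᵢ) → C_*(Y)) → C_*(Dcone(⋃ᵢ Aᵢ → Y))` is injective on reduced homology. -/
theorem exists_dcone_bd (a₀ : ∀ i, A i) {n : ℕ} {l : (dcA A).obj (n + 1) →₀ R}
    (hl : bd R (dcA A) n l = 0) {c : (sg (DCone A)).obj (n + 2) →₀ R}
    (hc : push R (dcIncl A) (n + 1) l = bd R _ (n + 1) c) : ∃ l', l = bd R (dcA A) (n + 1) l' := by
  obtain ⟨m, a, rfl⟩ := dcone_exists_eq n l
  obtain ⟨hac, hma⟩ := dcone_cycle hl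
  obtain ⟨D, hD, u, hu, v, hv, h⟩ := exists_dcone_small c
  let k : Fin s → (sg (DCone A)).obj (n + 1) →₀ R := fun i =>
    push R (dcIncl A) (n + 1) ((dcCone A i).map R n (a i))
  have hk : ∀ i, k i ∈ supp R (DCone.closedCone A i) (n + 1) := fun i =>
    push_dcIncl_cone_mem (a₀ i) _ _
  rw [map_add, map_sum, push_dcIncl_inl] at hc
  change push R (sgMap (DCone.of A)) (n + 1) m + ∑ i, k i = _ at hc
  let m' := push R (sgMap (DCone.of A)) (n + 1) m
  have hm' : m' ∈ supp R (DCone.nearBase A) (n + 1) := by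
    refine push_mem_supp (U := Set.univ) _ (fun y _ i => ?_) (mem_supp_univ _ _)
    rw [DCone.height_of]
    norm_num
  -- the homotopy terms of the subdivision are distributed among the summands, so that
  -- `∂ u' + ∑ i, ∂ (v' i) = m' + ∑ i, k i`
  let u' := u + D (n + 1) m'
  let v' := fun i => v i + D (n + 1) (k i)
  have hu' : u' ∈ supp R (DCone.nearBase A) (n + 2) := Submodule.add_mem _ hu (hD _ _ _ hm')
  have hv' : ∀ i, v' i ∈ supp R (DCone.closedCone A i) (n + 2) := fun i =>
    Submodule.add_mem _ (supp_mono (DCone.openCone_subset_closedCone (a₀ i)) _ (hv i))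
      (hD _ _ _ (hk i))
  let w := fun i => k i - bd R _ (n + 1) (v' i)
  have hw1 : ∀ i, w i ∈ supp R (DCone.closedCone A i) (n + 1) := fun i =>
    Submodule.sub_mem _ (hk i) (bd_mem_supp (hv' i))
  have huv : bd R _ (n + 1) u' + ∑ i, bd R _ (n + 1) (v' i) = m' + ∑ i, k i := by
    rw [← map_sum, ← map_add]
    have h1 : u' + ∑ i, v' i = c - bd R _ (n + 2) (D (n + 2) c) := by
      rw [← hc, map_add, map_sum, sub_eq_iff_eq_add] at h
      rw [h]
      simp only [u', v', Finset.sum_add_distrib]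
      abel
    rw [h1, map_sub, bd_bd, sub_zero, ← hc]
  have hws : bd R _ (n + 1) u' - m' = ∑ i, w i := by
    simp only [w, Finset.sum_sub_distrib]
    rw [sub_eq_sub_iff_add_eq_add]
    exact huv.trans (add_comm _ _)
  -- `w i` lies near `Y`, since distinct closed cones meet at most there
  have hw2 : ∀ i, w i ∈ supp R (DCone.nearBase A) (n + 1) := by
    refine mem_supp_of_sum (V := DCone.closedCone A)
      (fun i j hij => DCone.closedCone_inter_subset hij) hw1 ?_
    rw [← hws]
    exact Submodule.sub_mem _ (bd_mem_supp hu') hm'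
  have hemb : ∀ i, Topology.IsEmbedding ((DCone.of A).comp (incl A i)) := fun i =>
    DCone.isEmbedding_of.comp Topology.IsEmbedding.subtypeVal
  let g := sgMap ((DCone.deform A).comp (slice _ 1))
  have hlift : ∀ i, ∃ α : (sg (A i)).obj (n + 1) →₀ R,
      push R (sgMap ((DCone.of A).comp (incl A i))) (n + 1) α = push R g (n + 1) (w i) := by
    intro i
    have h1 : w i ∈ supp R (DCone.nearBase A ∩ DCone.closedCone A i) (n + 1) := by
      rw [supp_inter]
      exact ⟨hw2 i, hw1 i⟩
    obtain ⟨α, -, hα⟩ := exists_lift (hemb i) subset_rfl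
      (push_mem_supp ((DCone.deform A).comp (slice _ 1))
        (V := Set.range ((DCone.of A).comp (incl A i))) (fun z hz => by
          obtain ⟨m, hm, h⟩ := DCone.deform_one_mem_image hz.1 hz.2
          exact ⟨⟨m, hm⟩, h⟩) h1)
    exact ⟨α, hα⟩
  -- the deformation moves `w i` to a chain `α i` of `A i`, and `u'` to a chain `μ` of `Y`
  choose α hα using hlift
  obtain ⟨μ, -, hμ⟩ := exists_lift DCone.isEmbedding_of subset_rfl
    (push_mem_supp ((DCone.deform A).comp (slice _ 1)) (V := Set.range (DCone.of A))
      (fun z hz => DCone.deform_one_mem_range hz) hu')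
  have hbα : ∀ i, bd R _ n (α i) = ((-1 : ℤ) ^ n) • a i := fun i => by
    refine push_injective (hemb i).injective n ?_
    rw [← bd_push, hα, bd_push, map_sub, bd_bd, sub_zero, bd_push_dcIncl_cone n (hac i), map_zsmul,
      map_zsmul, push_sgMap_comp R (DCone.of A), push_deform_of]
  have hbμ : bd R _ (n + 1) μ = m + ∑ i, push R (sgMap (incl A i)) (n + 1) (α i) := by
    refine push_injective (f := DCone.of A) DCone.isEmbedding_of.injective _ ?_
    rw [← bd_push, hμ, bd_push, map_add (push R (sgMap (DCone.of A)) (n + 1)) m, map_sum]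
    simp only [← push_sgMap_comp, hα]
    rw [← map_sum, ← hws, map_sub, push_deform_of, add_sub_cancel]
  refine ⟨push R (dcInl A) (n + 2) μ + ∑ i, ((-1 : ℤ) ^ n) • (dcCone A i).map R (n + 1) (α i), ?_⟩
  rw [map_add, bd_push, hbμ, map_add, map_sum, map_sum, add_assoc, ← Finset.sum_add_distrib]
  congr 1
  refine Finset.sum_congr rfl fun i _ => ?_
  rw [map_zsmul, ConeOp.bd_map, hbα, map_zsmul, smul_add, smul_smul, smul_smul, pow_succ, mul_neg_one,
    mul_neg, ← mul_pow, push_comp]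
  simp

end Dcone

/-! ### Moving vertices to the base point -/

section Whisker

/-- The amount by which the coordinates are decreased in `shrink`. -/
def shrinkBy {n : ℕ} (q : Simp n × unitInterval) : ℝ := q.2 * (3 / 4) * ∑ l, q.1 l ^ 2

theorem shrinkBy_nonneg {n : ℕ} (q : Simp n × unitInterval) : 0 ≤ shrinkBy q :=
  mul_nonneg (mul_nonneg q.2.2.1 (by norm_num)) (Finset.sum_nonneg fun _ _ => sq_nonneg _)

/-- The largest coordinate is at least the sum of the squares, so it survives in `shrink`. -/
theorem exists_shrinkBy_lt {n : ℕ} (q : Simp n × unitInterval) : ∃ k, shrinkBy q < q.1 k := by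
  obtain ⟨k, -, hk⟩ := Finset.exists_max_image Finset.univ (fun k => q.1 k) Finset.univ_nonempty
  have hsum := stdSimplex.sum_eq_one q.1
  have h1 : ∑ l, q.1 l ^ 2 ≤ q.1 k := by
    calc ∑ l, q.1 l ^ 2 ≤ ∑ l, q.1 l * q.1 k :=
          Finset.sum_le_sum fun l _ => by
            rw [sq]; exact mul_le_mul_of_nonneg_left (hk l (Finset.mem_univ _)) (q.1.2.1 l)
      _ = q.1 k := by rw [← Finset.sum_mul, hsum, one_mul]
  have h2 : 0 < q.1 k := by
    by_contra h
    have : ∑ l, q.1 l ≤ 0 := Finset.sum_nonpos fun l hl => (hk l hl).trans (not_lt.mp h)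
    linarith
  have h3 : 0 ≤ ∑ l, q.1 l ^ 2 := Finset.sum_nonneg fun _ _ => sq_nonneg _
  refine ⟨k, ?_⟩
  have h4 : shrinkBy q ≤ 3 / 4 * q.1 k := by
    unfold shrinkBy
    have := q.2.2.2
    have := q.2.2.1
    nlinarith
  linarith

theorem continuous_coord {n : ℕ} (k : Fin (n + 1)) : Continuous fun p : Simp n => p k :=
  (continuous_apply k).comp continuous_subtype_val

theorem continuous_shrinkBy (n : ℕ) : Continuous (shrinkBy (n := n)) := by
  unfold shrinkBy
  refine ((continuous_subtype_val.comp continuous_snd).mul continuous_const).mul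
    (continuous_finsetSum _ fun l _ => ?_)
  exact ((continuous_coord l).comp continuous_fst).pow 2

theorem shrink_pos {n : ℕ} (q : Simp n × unitInterval) :
    0 < ∑ l, max 0 (q.1 l - shrinkBy q) := by
  obtain ⟨k, hk⟩ := exists_shrinkBy_lt q
  exact Finset.sum_pos' (fun _ _ => le_max_left _ _)
    ⟨k, Finset.mem_univ _, lt_max_of_lt_right (sub_pos.mpr hk)⟩

/-- The deformation of a simplex which collapses a neighbourhood of each vertex to that vertex. -/
def shrink (n : ℕ) : C(Simp n × unitInterval, Simp n) where
  toFun q := ⟨fun k => max 0 (q.1 k - shrinkBy q) / ∑ l, max 0 (q.1 l - shrinkBy q),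
    fun k => div_nonneg (le_max_left _ _) (shrink_pos q).le, by
      rw [← Finset.sum_div, div_self (shrink_pos q).ne']⟩
  continuous_toFun := by
    have h : ∀ l : Fin (n + 1), Continuous fun q : Simp n × unitInterval =>
        max 0 (q.1 l - shrinkBy q) := fun l =>
      continuous_const.max (((continuous_coord l).comp continuous_fst).sub (continuous_shrinkBy n))
    refine Continuous.subtype_mk (continuous_pi fun k => ?_) _
    exact (h k).div (continuous_finsetSum _ fun l _ => h l) fun q => (shrink_pos q).ne'

theorem shrink_apply {n : ℕ} (q : Simp n × unitInterval) (k : Fin (n + 1)) :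
    shrink n q k = max 0 (q.1 k - shrinkBy q) / ∑ l, max 0 (q.1 l - shrinkBy q) := rfl

theorem shrink_zero {n : ℕ} (p : Simp n) : shrink n (p, 0) = p := by
  have h0 : shrinkBy (p, (0 : unitInterval)) = 0 := by simp [shrinkBy]
  ext k
  rw [shrink_apply, h0]
  simp only [sub_zero]
  have h : ∀ l, max 0 (p l) = p l := fun l => max_eq_right (p.2.1 l)
  simp only [h]
  rw [stdSimplex.sum_eq_one, div_one]

theorem eq_vert_of_forall_ne {n : ℕ} {p : Simp n} {k : Fin (n + 1)} (h : ∀ l, l ≠ k → p l = 0) :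
    p = vert k := by
  have hk : p k = 1 := by
    have := stdSimplex.sum_eq_one p
    rwa [Finset.sum_eq_single k (fun l _ hl => h l hl) (by simp)] at this
  ext l
  rw [vert_apply]
  split_ifs with hl
  · rw [hl, hk]
  · exact h l hl

theorem coord_add_le_one {n : ℕ} (p : Simp n) {k l : Fin (n + 1)} (h : k ≠ l) : p k + p l ≤ 1 := by
  rw [← stdSimplex.sum_eq_one p, ← Finset.sum_pair h]
  exact Finset.sum_le_sum_of_subset_of_nonneg (Finset.subset_univ _) fun i _ _ => p.2.1 i

/-- Near a vertex, `shrink` is constant: this is the room used for the attached paths. If a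
coordinate is at least `2 / 3`, its square is at least `4 / 9`, and `t * (3 / 4) * (4 / 9)` is
`t / 3`, which bounds the other coordinates. -/
theorem shrink_eq_vert {n : ℕ} {q : Simp n × unitInterval} {k : Fin (n + 1)}
    (h : 1 - (q.2 : ℝ) / 3 ≤ q.1 k) : shrink n q = vert k := by
  refine eq_vert_of_forall_ne fun l hl => ?_
  rw [shrink_apply, max_eq_left, zero_div]
  have h1 := coord_add_le_one q.1 hl
  have h2 : q.1 k ^ 2 ≤ ∑ l, q.1 l ^ 2 :=
    Finset.single_le_sum (fun i _ => sq_nonneg (q.1 i)) (Finset.mem_univ k)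
  have h3 := q.2.2.1
  have h4 := q.2.2.2
  have h5 : (4 : ℝ) / 9 ≤ q.1 k ^ 2 := by nlinarith
  unfold shrinkBy
  nlinarith

theorem shrink_coface {n : ℕ} (j : Fin (n + 2)) (p : Simp n) (t : unitInterval) :
    shrink (n + 1) (coface j p, t) = coface j (shrink n (p, t)) := by
  have hb : shrinkBy (coface j p, t) = shrinkBy (p, t) := by
    simp only [shrinkBy]
    rw [Fin.sum_univ_succAbove _ j, coface_self]
    simp [coface_succAbove]
  have hb0 : max 0 (0 - shrinkBy (p, t)) = 0 :=
    max_eq_left (by have := shrinkBy_nonneg (p, t); linarith)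
  have hs : ∑ l, max 0 (coface j p l - shrinkBy (p, t)) = ∑ l, max 0 (p l - shrinkBy (p, t)) := by
    rw [Fin.sum_univ_succAbove _ j, coface_self, hb0, zero_add]
    simp [coface_succAbove]
  ext k
  rw [shrink_apply, hb]
  simp only
  rw [hs]
  induction k using Fin.succAboveCases j with
  | x => rw [coface_self, coface_self, hb0, zero_div]
  | p k => rw [coface_succAbove, coface_succAbove, shrink_apply]

variable {X : Type u} [TopologicalSpace X] {x : X} (γ : ∀ p, Path p x)

/-- The homotopy which attaches the whiskers `γ p` to the vertices `p` of a singular simplex. -/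
def whiskerFun {n : ℕ} (σ : C(Simp n, X)) (q : Simp n × unitInterval) : X :=
  open Classical in
  if h : ∃ k, 1 - (q.2 : ℝ) / 3 ≤ q.1 k then
    (γ (σ (vert h.choose))).extend (3 * q.1 h.choose - 3 + q.2)
  else σ (shrink n q)

theorem whiskerFun_of_le {n : ℕ} (σ : C(Simp n, X)) {q : Simp n × unitInterval} {k : Fin (n + 1)}
    (h : 1 - (q.2 : ℝ) / 3 ≤ q.1 k) :
    whiskerFun γ σ q = (γ (σ (vert k))).extend (3 * q.1 k - 3 + q.2) := by
  have h' : ∃ k, 1 - (q.2 : ℝ) / 3 ≤ q.1 k := ⟨k, h⟩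
  have hk : h'.choose = k := by
    by_contra hne
    have := coord_add_le_one q.1 hne
    have := h'.choose_spec
    have := q.2.2.2
    linarith
  rw [whiskerFun, dif_pos h', hk]

theorem whiskerFun_of_ge {n : ℕ} (σ : C(Simp n, X)) {q : Simp n × unitInterval}
    (h : ∀ k, q.1 k ≤ 1 - (q.2 : ℝ) / 3) : whiskerFun γ σ q = σ (shrink n q) := by
  by_cases h' : ∃ k, 1 - (q.2 : ℝ) / 3 ≤ q.1 k
  · obtain ⟨k, hk⟩ := h'
    rw [whiskerFun_of_le γ σ hk, shrink_eq_vert hk]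
    have : 3 * q.1 k - 3 + q.2 = 0 := by
      have := h k
      linarith
    rw [this, Path.extend_zero]
  · rw [whiskerFun, dif_neg h']

theorem continuous_whiskerFun {n : ℕ} (σ : C(Simp n, X)) : Continuous (whiskerFun γ σ) := by
  let S : Option (Fin (n + 1)) → Set (Simp n × unitInterval) := fun o =>
    o.elim {q | ∀ k, q.1 k ≤ 1 - (q.2 : ℝ) / 3} fun k => {q | 1 - (q.2 : ℝ) / 3 ≤ q.1 k}
  have hc : ∀ k : Fin (n + 1), Continuous fun q : Simp n × unitInterval => q.1 k := fun k =>
    (continuous_coord k).comp continuous_fst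
  refine (locallyFinite_of_finite S).continuous ?_ ?_ ?_
  · rw [Set.eq_univ_iff_forall]
    intro q
    by_cases h : ∀ k, q.1 k ≤ 1 - (q.2 : ℝ) / 3
    · exact Set.mem_iUnion.mpr ⟨none, h⟩
    · push Not at h
      obtain ⟨k, hk⟩ := h
      exact Set.mem_iUnion.mpr ⟨some k, hk.le⟩
  · rintro (_ | k)
    · change IsClosed {q : Simp n × unitInterval | ∀ k, q.1 k ≤ 1 - (q.2 : ℝ) / 3}
      rw [Set.ofPred_forall]
      exact isClosed_iInter fun k => isClosed_le (hc k) (by fun_prop)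
    · exact isClosed_le (by fun_prop) (hc k)
  · rintro (_ | k)
    · refine ContinuousOn.congr (f := fun q => σ (shrink n q)) (by fun_prop) fun q hq => ?_
      exact whiskerFun_of_ge γ σ hq
    · refine ContinuousOn.congr
        (f := fun q => (γ (σ (vert k))).extend (3 * q.1 k - 3 + q.2)) ?_ fun q hq => ?_
      · refine Continuous.continuousOn ?_
        refine (γ (σ (vert k))).continuous_extend.comp ?_
        exact ((continuous_const.mul (hc k)).sub continuous_const).add (by fun_prop)
      · exact whiskerFun_of_le γ σ hq

/-- The natural homotopy which attaches the whiskers `γ p` to the vertices `p` of the singular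
simplices, thereby moving all vertices to the base point. -/
def whisker : NatHtpy X X where
  H σ := ⟨whiskerFun γ σ, continuous_whiskerFun γ σ⟩
  nat {n} j σ := by
    ext ⟨p, t⟩
    change whiskerFun γ (σ.comp (coface j)) (p, t) = whiskerFun γ σ (coface j p, t)
    by_cases h : ∀ k, p k ≤ 1 - (t : ℝ) / 3
    · rw [whiskerFun_of_ge γ _ h, whiskerFun_of_ge, shrink_coface]
      · rfl
      · intro k
        induction k using Fin.succAboveCases j with
        | x =>
          change coface j p j ≤ 1 - (t : ℝ) / 3
          rw [coface_self]
          have := t.2.2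
          linarith
        | p k =>
          change coface j p _ ≤ 1 - (t : ℝ) / 3
          rw [coface_succAbove]
          exact h k
    · push Not at h
      obtain ⟨k, hk⟩ := h
      have hk' : 1 - (t : ℝ) / 3 ≤ coface j p (j.succAbove k) := by
        rw [coface_succAbove]
        exact hk.le
      rw [whiskerFun_of_le γ (q := (p, t)) _ hk.le, whiskerFun_of_le γ (q := (coface j p, t)) σ hk',
        ← coface_vert]
      simp only [coface_succAbove]
      rfl

/-- The path traced by a vertex `p` is `γ p`. -/
theorem whisker_vert {n : ℕ} (σ : C(Simp n, X)) (k : Fin (n + 1)) (t : unitInterval) :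
    (whisker γ).H σ (vert k, t) = γ (σ (vert k)) t := by
  change whiskerFun γ σ (vert k, t) = _
  have hk : (vert k : Simp n) k = 1 := by rw [vert_apply, if_pos rfl]
  rw [whiskerFun_of_le γ (k := k)]
  · simp only [hk]
    rw [mul_one, sub_self, zero_add, Path.extend_apply _ t.2]
  · simp only [hk]
    have := t.2.1
    linarith

theorem whisker_at_zero : (whisker γ).at 0 = sgMap (ContinuousMap.id X) := by
  refine hom_sg_ext fun n σ => ?_
  rw [NatHtpy.at_app]
  refine congr_arg ofMap (ContinuousMap.ext fun p => ?_)
  change whiskerFun γ (toMap σ) (p, 0) = toMap σ p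
  rw [whiskerFun_of_ge, shrink_zero]
  intro k
  change p k ≤ 1 - (0 : ℝ) / 3
  rw [zero_div, sub_zero, ← stdSimplex.sum_eq_one p]
  exact Finset.single_le_sum (fun i _ => p.2.1 i) (Finset.mem_univ k)

theorem whisker_at_one_mem {n : ℕ} (σ : (sg X).obj (n + 1)) :
    ((whisker γ).at 1).app σ ∈ vertsIn {x} (n + 1) := by
  intro k
  rw [NatHtpy.at_app]
  change (whisker γ).H (toMap σ) (vert k, 1) = x
  rw [whisker_vert, Path.target]

/-- The path attached to the base point itself can be chosen constant, which keeps simplices with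
all vertices in the base point among such simplices. -/
theorem exists_whiskers [PathConnectedSpace X] (x : X) :
    ∃ γ : ∀ p, Path p x, ∀ t, γ x t = x := by
  classical
  refine ⟨fun p => if h : p = x then (Path.refl x).cast h rfl else PathConnectedSpace.somePath p x,
    fun t => ?_⟩
  simp only [dif_pos]
  rfl

variable {R : Type*} [CommRing R]

theorem push_whisker_mem {n : ℕ} (c : (sg X).obj (n + 1) →₀ R) :
    push R ((whisker γ).at 1) (n + 1) c ∈ Finsupp.supported R R (vertsIn {x} (n + 1)) := by
  have hc : c ∈ Finsupp.supported R R Set.univ := fun _ _ => trivial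
  refine map_mem_of_supported _ (fun σ _ => ?_) hc
  rw [push_single]
  exact Finsupp.single_mem_supported _ _ (whisker_at_one_mem γ σ)

/-- The homotopy `whisker` preserves the chains with all vertices in the base point. -/
theorem whisker_prism_mem (hγ : ∀ t, γ x t = x) {n : ℕ} {c : (sg X).obj n →₀ R}
    (hc : c ∈ Finsupp.supported R R (vertsIn {x} n)) :
    (whisker γ).prism R n c ∈ Finsupp.supported R R (vertsIn {x} (n + 1)) := by
  match n with
  | 0 => simp [NatHtpy.prism]
  | n + 1 =>
    have h : ∀ t : unitInterval, ∀ σ ∈ vertsIn {x} (n + 1), ∀ k,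
        (whisker γ).H (toMap σ) (vert k, t) ∈ ({x} : Set X) := fun t σ hσ k => by
      have hσk : toMap σ (vert k) = x := hσ k
      rw [whisker_vert, hσk, hγ]
      exact Set.mem_singleton _
    exact NatHtpy.prism_mem_vertsIn _ (h 0) (h 1) hc

end Whisker

/-! ### The complex of simplices with vertices in the base point and the cone points -/

section Prepend

variable {X : Type u} [TopologicalSpace X]

/-- The retraction `z ↦ w` of the part `z₀ ≤ 1 - z₀ - zₙ₊₁` of `Δⁿ⁺¹` onto `Δⁿ`, where
`w_j = max 0 (z_{j+1} - z₀)` for `j < n`. -/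
def prependPt (n : ℕ) : C(Simp (n + 1), Simp n) where
  toFun z := ⟨Fin.snoc (α := fun _ => ℝ) (fun j : Fin n => max 0 (z j.castSucc.succ - z 0))
      (1 - ∑ j : Fin n, max 0 (z j.castSucc.succ - z 0)), by
    have h : ∑ j : Fin n, max 0 (z j.castSucc.succ - z 0) ≤ 1 := by
      rw [← stdSimplex.sum_eq_one z, Fin.sum_univ_succ, Fin.sum_univ_castSucc]
      have h1 : ∑ j : Fin n, max 0 (z j.castSucc.succ - z 0) ≤ ∑ j : Fin n, z j.castSucc.succ :=
        Finset.sum_le_sum fun j _ => max_le (z.2.1 _) (sub_le_self _ (z.2.1 0))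
      have h2 : 0 ≤ z 0 := z.2.1 0
      have h3 : 0 ≤ z (Fin.last n).succ := z.2.1 _
      linarith
    constructor
    · intro k
      induction k using Fin.lastCases with
      | last => simpa using h
      | cast k => simp
    · rw [Fin.sum_univ_castSucc]
      simp⟩
  continuous_toFun := by
    have h : ∀ j : Fin n, Continuous fun z : Simp (n + 1) => max 0 (z j.castSucc.succ - z 0) :=
      fun j => continuous_const.max ((continuous_coord _).sub (continuous_coord _))
    refine Continuous.subtype_mk (continuous_pi fun k => ?_) _
    induction k using Fin.lastCases with
    | last =>
      refine ((continuous_const (y := (1 : ℝ))).sub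
        (continuous_finsetSum Finset.univ fun j _ => h j)).congr fun z => ?_
      rw [Fin.snoc_last]
      rfl
    | cast k => simpa using h k

theorem prependPt_castSucc {n : ℕ} (z : Simp (n + 1)) (j : Fin n) :
    prependPt n z j.castSucc = max 0 (z j.castSucc.succ - z 0) := by
  change Fin.snoc (α := fun _ => ℝ) (fun j : Fin n => max 0 (z j.castSucc.succ - z 0)) _ j.castSucc = _
  rw [Fin.snoc_castSucc]

/-- The signed distance `z₀ - (1 - z₀ - zₙ₊₁)`. -/
def prependGap {n : ℕ} (z : Simp (n + 1)) : ℝ := 2 * z 0 + z (Fin.last (n + 1)) - 1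

theorem continuous_prependGap (n : ℕ) : Continuous (prependGap (n := n)) :=
  ((continuous_const.mul (continuous_coord _)).add (continuous_coord _)).sub continuous_const

theorem prependPt_eq_vert {n : ℕ} {z : Simp (n + 1)} (h : 0 ≤ prependGap z) :
    prependPt n z = vert (Fin.last n) := by
  refine eq_vert_of_forall_ne fun l hl => ?_
  induction l using Fin.lastCases with
  | last => exact absurd rfl hl
  | cast l =>
    rw [prependPt_castSucc]
    refine max_eq_left ?_
    have h1 := stdSimplex.sum_eq_one z
    rw [Fin.sum_univ_succ, Fin.sum_univ_castSucc, Fin.succ_last] at h1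
    have h2 : z l.castSucc.succ ≤ ∑ j : Fin n, z j.castSucc.succ :=
      Finset.single_le_sum (f := fun j : Fin n => z j.castSucc.succ) (fun i _ => z.2.1 _)
        (Finset.mem_univ l)
    unfold prependGap at h
    linarith

/-- A singular simplex, extended by a new first vertex, which is the starting point of a path `γ` to
the last vertex of the simplex. -/
def prepend {n : ℕ} {a b : X} (γ : Path a b) (σ : C(Simp n, X)) (h : σ (vert (Fin.last n)) = b) :
    C(Simp (n + 1), X) where
  toFun z := if 0 ≤ prependGap z then γ.extend (1 - prependGap z) else σ (prependPt n z)
  continuous_toFun := by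
    refine Continuous.if_le ?_ (by fun_prop) continuous_const (continuous_prependGap n) ?_
    · exact γ.continuous_extend.comp (continuous_const.sub (continuous_prependGap n))
    · intro z hz
      rw [← hz, sub_zero, Path.extend_one, prependPt_eq_vert hz.le, h]

variable {a b : X} (γ : Path a b)

theorem prepend_of_le {n : ℕ} {σ : C(Simp n, X)} (h : σ (vert (Fin.last n)) = b)
    {z : Simp (n + 1)} (hz : 0 ≤ prependGap z) :
    prepend γ σ h z = γ.extend (1 - prependGap z) := if_pos hz

theorem prepend_of_ge {n : ℕ} {σ : C(Simp n, X)} (h : σ (vert (Fin.last n)) = b)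
    {z : Simp (n + 1)} (hz : prependGap z ≤ 0) : prepend γ σ h z = σ (prependPt n z) := by
  rcases hz.lt_or_eq with h1 | h1
  · exact if_neg (not_le.mpr h1)
  · rw [prepend_of_le γ h h1.ge, h1, sub_zero, Path.extend_one, prependPt_eq_vert h1.ge, h]

theorem prependPt_coface_zero {n : ℕ} (p : Simp n) : prependPt n (coface 0 p) = p := by
  have h : ∀ l : Fin n, prependPt n (coface 0 p) l.castSucc = p l.castSucc := fun l => by
    rw [prependPt_castSucc, coface_self, sub_zero, ← Fin.succAbove_zero, coface_succAbove]
    exact max_eq_right (p.2.1 _)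
  ext l
  induction l using Fin.lastCases with
  | cast l => exact h l
  | last =>
    have h1 := stdSimplex.sum_eq_one (prependPt n (coface 0 p))
    have h2 := stdSimplex.sum_eq_one p
    rw [Fin.sum_univ_castSucc] at h1 h2
    simp only [h] at h1
    exact add_left_cancel (h1.trans h2.symm)

/-- The face opposite to the new vertex is the original simplex. -/
theorem prepend_face_zero {n : ℕ} {σ : C(Simp n, X)} (h : σ (vert (Fin.last n)) = b) :
    (prepend γ σ h).comp (coface 0) = σ := by
  ext p
  rw [ContinuousMap.comp_apply, prepend_of_ge, prependPt_coface_zero]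
  unfold prependGap
  rw [coface_self]
  have h1 : coface 0 p (Fin.last (n + 1)) ≤ 1 := by
    rw [← stdSimplex.sum_eq_one (coface 0 p)]
    exact Finset.single_le_sum (fun i _ => (coface 0 p).2.1 i) (Finset.mem_univ _)
  linarith

theorem castSucc_succAbove_last {n : ℕ} (j : Fin (n + 1)) :
    j.castSucc.succAbove (Fin.last n) = Fin.last (n + 1) := by
  simp [Fin.succAbove, Fin.lt_def, Fin.ext_iff]
  omega

theorem last_coface_castSucc {n : ℕ} (j : Fin (n + 1)) :
    (coface j.castSucc) (vert (Fin.last n)) = vert (Fin.last (n + 1)) := by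
  rw [coface_vert, castSucc_succAbove_last]

/-- Prepending commutes with the faces which keep the last vertex. -/
theorem prepend_face_succ {n : ℕ} {σ : C(Simp (n + 1), X)} (h : σ (vert (Fin.last (n + 1))) = b)
    (j : Fin (n + 1)) (h' : (σ.comp (coface j.castSucc)) (vert (Fin.last n)) = b) :
    (prepend γ σ h).comp (coface j.castSucc.succ) = prepend γ (σ.comp (coface j.castSucc)) h' := by
  ext p
  have h0 : coface j.castSucc.succ p 0 = p 0 := by
    rw [← coface_succAbove j.castSucc.succ p 0, Fin.succ_succAbove_zero]
  have hl : coface j.castSucc.succ p (Fin.last (n + 2)) = p (Fin.last (n + 1)) := by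
    rw [← coface_succAbove j.castSucc.succ p (Fin.last (n + 1)), Fin.succ_castSucc,
      castSucc_succAbove_last]
  have hg : prependGap (coface j.castSucc.succ p) = prependGap p := by
    unfold prependGap
    rw [h0, hl]
  have hp : prependPt (n + 1) (coface j.castSucc.succ p) = coface j.castSucc (prependPt n p) := by
    have h1 : ∀ l : Fin (n + 1), prependPt (n + 1) (coface j.castSucc.succ p) l.castSucc =
        coface j.castSucc (prependPt n p) l.castSucc := by
      intro l
      rw [prependPt_castSucc, h0]
      induction l using Fin.succAboveCases j with
      | x =>
        rw [coface_self, coface_self]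
        exact max_eq_left (sub_nonpos.mpr (p.2.1 0))
      | p l =>
        rw [← Fin.castSucc_succAbove_castSucc, coface_succAbove, prependPt_castSucc,
          ← Fin.succ_succAbove_succ, coface_succAbove]
    ext l
    induction l using Fin.lastCases with
    | cast l => exact h1 l
    | last =>
      have h2 := stdSimplex.sum_eq_one (prependPt (n + 1) (coface j.castSucc.succ p))
      have h3 := stdSimplex.sum_eq_one (coface j.castSucc (prependPt n p))
      rw [Fin.sum_univ_castSucc] at h2 h3
      simp only [h1] at h2
      exact add_left_cancel (h2.trans h3.symm)
  rw [ContinuousMap.comp_apply]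
  rcases le_total 0 (prependGap p) with h1 | h1
  · rw [prepend_of_le γ h (hg ▸ h1), prepend_of_le γ h' h1, hg]
  · rw [prepend_of_ge γ h (hg ▸ h1), prepend_of_ge γ h' h1, hp]
    rfl

theorem prepend_vert_zero {n : ℕ} {σ : C(Simp n, X)} (h : σ (vert (Fin.last n)) = b) :
    prepend γ σ h (vert 0) = a := by
  have hg : prependGap (vert 0 : Simp (n + 1)) = 1 := by
    unfold prependGap
    rw [vert_apply, vert_apply, if_pos rfl, if_neg (Fin.last_pos).ne']
    norm_num
  rw [prepend_of_le γ h (by rw [hg]; exact zero_le_one), hg, sub_self, Path.extend_zero]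

theorem prepend_vert_succ {n : ℕ} {σ : C(Simp n, X)} (h : σ (vert (Fin.last n)) = b)
    (k : Fin (n + 1)) : prepend γ σ h (vert k.succ) = σ (vert k) := by
  rw [← Fin.succAbove_zero, ← coface_vert, ← ContinuousMap.comp_apply, prepend_face_zero]

/-- The edge from the new vertex to the last one is the prepended path. -/
theorem prepend_segment_zero {n : ℕ} {σ : C(Simp n, X)} (h : σ (vert (Fin.last n)) = b)
    (t : unitInterval) :
    prepend γ σ h (segment (vert 0) (vert (Fin.last (n + 1))) t) = γ t := by
  have h0 : segment (vert 0) (vert (Fin.last (n + 1))) t 0 = 1 - (t : ℝ) := by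
    change (1 - (t : ℝ)) * (vert 0 : Simp (n + 1)) 0 + t * (vert (Fin.last _) : Simp (n + 1)) 0 = _
    rw [vert_apply, vert_apply, if_pos rfl, if_neg (Fin.last_pos).ne]
    ring
  have hl : segment (vert 0) (vert (Fin.last (n + 1))) t (Fin.last (n + 1)) = (t : ℝ) := by
    change (1 - (t : ℝ)) * (vert 0 : Simp (n + 1)) (Fin.last _) +
      t * (vert (Fin.last _) : Simp (n + 1)) (Fin.last _) = _
    rw [vert_apply, vert_apply, if_pos rfl, if_neg (Fin.last_pos).ne']
    ring
  have hg : prependGap (segment (vert 0) (vert (Fin.last (n + 1))) t) = 1 - (t : ℝ) := by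
    unfold prependGap
    rw [h0, hl]
    ring
  rw [prepend_of_le γ h (by rw [hg]; exact sub_nonneg.mpr t.2.2), hg, sub_sub_cancel,
    Path.extend_apply _ t.2]

end Prepend

/-! ### Homotopies of edges -/

section Edges

variable {X : Type u} [TopologicalSpace X]

instance (n : ℕ) : SimplyConnectedSpace (Simp n) := by
  have : ContractibleSpace (Simp n) := (convex_stdSimplex ℝ (Fin (n + 1))).contractibleSpace
    ⟨(vert 0 : Simp n).1, (vert 0 : Simp n).2⟩
  infer_instance

theorem edge_trans {n : ℕ} (σ : C(Simp n, X)) (p q r : Simp n) :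
    ((edge σ p q).trans (edge σ q r)).Homotopic (edge σ p r) := by
  unfold edge
  rw [← Path.map_trans]
  exact (SimplyConnectedSpace.paths_homotopic _ _).map σ

theorem homotopic_cast_of_eq {a b a' b' p q : X} {α : Path a b} {α' : Path a' b'} {γ : Path p q}
    (ha : a = p) (hb : b = q) (ha' : a' = p) (hb' : b' = q) (h : ∀ t, α' t = α t)
    (hα : α.Homotopic (γ.cast ha hb)) : α'.Homotopic (γ.cast ha' hb') := by
  subst ha hb ha' hb'
  obtain rfl : α' = α := Path.ext (funext h)
  exact hα

/-- The conjugate of an edge from `xᵢ` to `cᵢ`: the path attached to the last vertex is constant. -/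
theorem homotopic_conj {a b a' b' p q r : X} (g : Path a a') (ε : Path a' b') (h : Path b b')
    (α : Path p q) (β : Path q r) (ha : a = p) (hq : a' = q) (hr : b' = r) (hb : b = r)
    (hg : ∀ t, g t = α t) (hε : ∀ t, ε t = β t) (hh : ∀ t, h t = r) :
    ((g.trans ε).trans h.symm).Homotopic ((α.trans β).cast ha hb) := by
  subst ha hq hr hb
  obtain rfl : g = α := Path.ext (funext hg)
  obtain rfl : ε = β := Path.ext (funext hε)
  obtain rfl : h = Path.refl _ := Path.ext (funext hh)
  rw [Path.refl_symm]
  exact ⟨Path.Homotopy.transRefl _⟩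

/-- The conjugate of a constant edge at `xᵢ` is null homotopic. -/
theorem homotopic_conj_const {a b a' b' p q : X} (g : Path a a') (ε : Path a' b') (h : Path b b')
    (α : Path p q) (ha : a = p) (hb : b = p) (ha' : a' = q) (hb' : b' = q)
    (hg : ∀ t, g t = α t) (hε : ∀ t, ε t = q) (hh : ∀ t, h t = α t) :
    ((g.trans ε).trans h.symm).Homotopic ((Path.refl p).cast ha hb) := by
  subst ha hb ha' hb'
  obtain rfl : g = α := Path.ext (funext hg)
  obtain rfl : ε = Path.refl _ := Path.ext (funext hε)
  obtain rfl : h = g := Path.ext (funext hh)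
  exact (Path.Homotopic.hcomp ⟨Path.Homotopy.transRefl _⟩ (Path.Homotopic.refl _)).trans
    (Path.Homotopic.symm ⟨Path.Homotopy.reflTransSymm _⟩)

/-- In a triangle with two homotopic edges to the last vertex, the remaining edge is null
homotopic. -/
theorem homotopic_refl_of_trans {a b c p q : X} {α : Path a b} {β : Path b c} {δ : Path a c}
    {γ : Path p q} (ha : a = p) (hb : b = p) (hc : c = q) (h : (α.trans β).Homotopic δ)
    (hβ : β.Homotopic (γ.cast hb hc)) (hδ : δ.Homotopic (γ.cast ha hc)) :
    α.Homotopic ((Path.refl p).cast ha hb) := by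
  subst ha hb hc
  have h1 : (α.trans β).Homotopic β := (h.trans hδ).trans hβ.symm
  have h2 : (α.trans (β.trans β.symm)).Homotopic α :=
    (Path.Homotopic.hcomp (Path.Homotopic.refl _)
      (Path.Homotopic.symm ⟨Path.Homotopy.reflTransSymm _⟩)).trans ⟨Path.Homotopy.transRefl _⟩
  have h3 : ((α.trans β).trans β.symm).Homotopic (α.trans (β.trans β.symm)) :=
    ⟨Path.Homotopy.transAssoc _ _ _⟩
  exact ((h2.symm.trans h3.symm).trans (Path.Homotopic.hcomp h1 (Path.Homotopic.refl _))).trans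
    (Path.Homotopic.symm ⟨Path.Homotopy.reflTransSymm _⟩)

theorem segment_coface_apply {n : ℕ} (j : Fin (n + 2)) (p q : Simp n) (t : unitInterval) :
    segment (coface j p) (coface j q) t = coface j (segment p q t) := by
  rw [← segment_coface]
  rfl

theorem segment_castSucc {n : ℕ} (k l : Fin (n + 1)) (t : unitInterval) :
    segment (vert k.castSucc : Simp (n + 1)) (vert l.castSucc) t =
      joinPt (segment (vert k) (vert l) t, 0) := by
  have h : ∀ k : Fin (n + 1), (vert k.castSucc : Simp (n + 1)) =
      coface (Fin.last (n + 1)) (vert k) := fun k => by rw [coface_vert, Fin.succAbove_last]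
  rw [h, h, segment_coface_apply, coface_last_eq]

theorem segment_last {n : ℕ} (k : Fin (n + 1)) (t : unitInterval) :
    segment (vert k.castSucc : Simp (n + 1)) (vert (Fin.last (n + 1))) t = joinPt (vert k, t) := by
  ext l
  change (1 - (t : ℝ)) * (vert k.castSucc : Simp (n + 1)) l +
    t * (vert (Fin.last _) : Simp (n + 1)) l = _
  induction l using Fin.lastCases with
  | last =>
    rw [joinPt_last, vert_apply, vert_apply, if_pos rfl, if_neg (Fin.castSucc_lt_last k).ne']
    ring
  | cast l =>
    rw [joinPt_castSucc, vert_apply, vert_apply, if_neg (Fin.castSucc_lt_last l).ne, vert_apply]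
    simp

end Edges

/-! ### The hat complex -/

section Hat

variable {Y : Type u} [TopologicalSpace Y] {s : ℕ} {A : Fin s → Set Y}

theorem DCone.of_ne_apex (m : Y) (i : Fin s) : of A m ≠ apex A i := fun h => by
  have := congr_arg base h
  simp at this

theorem DCone.apex_injective {i j : Fin s} (h : apex A i = apex A j) : i = j := by
  by_contra hij
  have := congr_arg (height j) h
  rw [height_apex_self, height_apex, if_neg hij] at this
  norm_num at this

/-- The path from `x` to the cone point `cᵢ` along the reverse of the path `e` from `xᵢ` to `x`. -/
def conePath (i : Fin s) {x : Y} {xi : A i} (e : Path (xi : Y) x) :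
    Path (DCone.of A x) (DCone.apex A i) :=
  (e.symm.map (DCone.of A).continuous).trans
    ⟨⟨fun t => DCone.cyl A i (xi, t), by fun_prop⟩, DCone.cyl_zero A i xi, DCone.cyl_one A i xi⟩

/-- The simplices of `Ĉ_*^x(Y)` whose last vertex is the cone point `cᵢ`. -/
def IsConeHat (i : Fin s) {x : Y} {xi : A i} (e : Path (xi : Y) x) {n : ℕ}
    (σ : C(Simp n, DCone A)) : Prop :=
  ∃ (hx : ∀ k, k ≠ Fin.last n → σ (vert k) = DCone.of A x)
    (ha : σ (vert (Fin.last n)) = DCone.apex A i),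
    ∀ k (hk : k ≠ Fin.last n),
      (edge σ (vert k) (vert (Fin.last n))).Homotopic ((conePath i e).cast (hx k hk) ha)

/-- A generator of the hat complex has all vertices in `x`, or its last vertex is a cone point and
it is of the form `IsConeHat`. -/
theorem IsHat.cases {x : Y} {y : ∀ i, A i} {e : ∀ i, Path (y i : Y) x} {n : ℕ}
    {σ : C(Simp n, DCone A)} (h : IsHat x y e σ) :
    (∀ k, σ (vert k) = DCone.of A x) ∨ ∃ i, IsConeHat i (e i) σ := by
  rcases h with h | ⟨i, σ', ⟨hc, hv⟩, g, hg, hh⟩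
  · exact Or.inl h
  have hx : ∀ k, σ' (vert k) = DCone.of A (y i : Y) → σ (vert k) = DCone.of A x ∧
      ∀ t, g k t = DCone.of A ((e i).symm t) := by
    intro k hk
    rcases hg k with h | h
    · refine ⟨?_, h⟩
      have := h 0
      rwa [(g k).source, (e i).symm.source] at this
    · have := h 1
      rw [(g k).target, hk] at this
      exact absurd this (DCone.of_ne_apex _ _)
  rcases hv with hv | ⟨hv, hl⟩
  · exact Or.inl fun k => (hx k (hv k)).1
  · have hgl : ∀ t, g (Fin.last n) t = DCone.apex A i := by
      rcases hg (Fin.last n) with h | h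
      · have := h 1
        rw [(g _).target, hl] at this
        exact absurd this.symm (DCone.of_ne_apex _ _)
      · exact h
    have ha : σ (vert (Fin.last n)) = DCone.apex A i := by
      have := hgl 0
      rwa [(g _).source] at this
    refine Or.inr ⟨i, fun k hk => (hx k (hv k hk)).1, ha, fun k hk => ?_⟩
    refine (hh k _ (Fin.lt_last_iff_ne_last.mpr hk)).trans ?_
    refine homotopic_conj _ _ _ _ _ _ (hv k hk) hl _ (hx k (hv k hk)).2 (fun t => ?_) hgl
    rcases hc with ⟨τ, rfl⟩ | ⟨τ, rfl⟩
    · exact absurd hl (DCone.of_ne_apex _ _)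
    match n, σ, k, τ, hk, hv with
    | 0, _, k, _, hk, _ => exact absurd (Subsingleton.elim (α := Fin 1) _ _) hk
    | n + 1, _, k, τ, hk, hv =>
      obtain ⟨k, rfl⟩ := Fin.exists_castSucc_eq.mpr hk
      change coneSimplex i τ (segment (vert k.castSucc) (vert (Fin.last (n + 1))) t) =
        DCone.cyl A i (y i, t)
      have h1 := hv k.castSucc hk
      have h2 : (vert k.castSucc : Simp (n + 1)) = joinPt (vert k, 0) := by
        rw [← coface_last_eq, coface_vert, Fin.succAbove_last]
      rw [h2] at h1
      have h3 := (coneSimplex_joinPt i (toMap τ) (vert k) 0).symm.trans h1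
      rw [DCone.cyl_zero] at h3
      have h4 : toMap τ (vert k) = y i := Subtype.ext (DCone.isEmbedding_of.injective h3)
      rw [segment_last]
      refine (coneSimplex_joinPt i (toMap τ) (vert k) t).trans ?_
      rw [h4]

/-- The edges not meeting the cone point are null homotopic. -/
theorem IsConeHat.edge_homotopic {i : Fin s} {x : Y} {xi : A i} {e : Path (xi : Y) x} {n : ℕ}
    {σ : C(Simp n, DCone A)} (h : IsConeHat i e σ) {k l : Fin (n + 1)} (hk : k ≠ Fin.last n)
    (hl : l ≠ Fin.last n) : (edge σ (vert k) (vert l)).Homotopic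
      ((Path.refl (DCone.of A x)).cast (h.choose k hk) (h.choose l hl)) := by
  obtain ⟨hx, ha, h⟩ := h
  exact homotopic_refl_of_trans (hx k hk) (hx l hl) ha (edge_trans σ _ _ _) (h l hl) (h k hk)

/-- Conversely, such simplices are generators: they correspond to the cone over a constant
simplex. -/
theorem IsConeHat.isHat {x : Y} {y : ∀ i, A i} {e : ∀ i, Path (y i : Y) x} {n : ℕ}
    {σ : C(Simp n, DCone A)} {i : Fin s} (h : IsConeHat i (e i) σ) : IsHat x y e σ := by
  have key : ∃ τ : (sing (A i)).aug n,
      (∀ k l, k ≠ Fin.last n → l ≠ Fin.last n → ∀ t,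
        coneSimplex i τ (segment (vert k) (vert l) t) = DCone.of A (y i : Y)) ∧
      (∀ k, k ≠ Fin.last n → ∀ t, coneSimplex i τ (segment (vert k) (vert (Fin.last n)) t) =
        DCone.cyl A i (y i, t)) ∧ coneSimplex i τ (vert (Fin.last n)) = DCone.apex A i := by
    match n with
    | 0 => exact ⟨PUnit.unit, fun k _ hk => absurd (Subsingleton.elim (α := Fin 1) _ _) hk,
        fun k hk => absurd (Subsingleton.elim (α := Fin 1) _ _) hk, rfl⟩
    | n + 1 =>
      let τ : C(Simp n, A i) := ContinuousMap.const _ (y i)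
      refine ⟨τ, fun k l hk hl t => ?_, fun k hk t => ?_, ?_⟩
      · obtain ⟨k, rfl⟩ := Fin.exists_castSucc_eq.mpr hk
        obtain ⟨l, rfl⟩ := Fin.exists_castSucc_eq.mpr hl
        rw [segment_castSucc]
        exact (coneSimplex_joinPt i τ _ _).trans (DCone.cyl_zero A i (y i))
      · obtain ⟨k, rfl⟩ := Fin.exists_castSucc_eq.mpr hk
        rw [segment_last]
        exact coneSimplex_joinPt i τ _ _
      · have h1 : (vert (Fin.last (n + 1)) : Simp (n + 1)) = joinPt (vert 0, 1) := by
          rw [← segment_last, Path.target]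
        rw [h1]
        exact (coneSimplex_joinPt i τ _ _).trans (DCone.cyl_one A i (y i))
  obtain ⟨τ, h1, h2, h3⟩ := key
  have hv : ∀ k, k ≠ Fin.last n → coneSimplex i τ (vert k) = DCone.of A (y i : Y) := fun k hk => by
    have := h1 k k hk hk 0
    rwa [Path.source] at this
  have h' := h
  obtain ⟨hx, ha, hh⟩ := h'
  have hg : ∀ k : Fin (n + 1), ∃ g : Path (σ (vert k)) (coneSimplex i τ (vert k)),
      (k = Fin.last n → ∀ t, g t = DCone.apex A i) ∧
      (k ≠ Fin.last n → ∀ t, g t = DCone.of A ((e i).symm t)) := by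
    intro k
    by_cases hk : k = Fin.last n
    · subst hk
      exact ⟨(Path.refl (DCone.apex A i)).cast ha h3, fun _ _ => rfl, fun h => absurd rfl h⟩
    · exact ⟨((e i).symm.map (DCone.of A).continuous).cast (hx k hk) (hv k hk),
        fun h => absurd h hk, fun _ _ => rfl⟩
  choose g hgl hgx using hg
  refine Or.inr ⟨i, coneSimplex i τ, ⟨Or.inr ⟨τ, rfl⟩, Or.inr ⟨hv, h3⟩⟩, g, fun k => ?_,
    fun k l hkl => ?_⟩
  · by_cases hk : k = Fin.last n
    · exact Or.inr (hgl k hk)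
    · exact Or.inl (hgx k hk)
  · have hk : k ≠ Fin.last n := (hkl.trans_le (Fin.le_last l)).ne
    by_cases hl : l = Fin.last n
    · subst hl
      refine (hh k hk).trans (Path.Homotopic.symm ?_)
      exact homotopic_conj _ _ _ _ _ _ (hv k hk) h3 _ (hgx k hk) (fun t => h2 k hk t)
        (hgl _ rfl)
    · refine (h.edge_homotopic hk hl).trans (Path.Homotopic.symm ?_)
      exact homotopic_conj_const _ _ _ ((e i).symm.map (DCone.of A).continuous) _ _ (hv k hk)
        (hv l hl) (hgx k hk) (fun t => h1 k l hk hl t) (hgx l hl)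

/-- The new edges arising from prepending the path are the path itself, so the result is again a
generator of the hat complex. -/
theorem IsConeHat.prepend {i : Fin s} {x : Y} {xi : A i} {e : Path (xi : Y) x} {n : ℕ}
    {σ : C(Simp n, DCone A)} (h : IsConeHat i e σ) :
    IsConeHat i e (prepend (conePath i e) σ h.choose_spec.choose) := by
  obtain ⟨hx, ha, hh⟩ := h
  have hx' : ∀ k, k ≠ Fin.last (n + 1) →
      HatComplex.prepend (conePath i e) σ ha (vert k) = DCone.of A x := by
    intro k hk
    induction k using Fin.cases with
    | zero => exact prepend_vert_zero _ ha
    | succ k =>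
      rw [prepend_vert_succ]
      exact hx k fun h => hk (by rw [h, Fin.succ_last])
  have ha' : HatComplex.prepend (conePath i e) σ ha (vert (Fin.last (n + 1))) = DCone.apex A i := by
    rw [← Fin.succ_last, prepend_vert_succ, ha]
  refine ⟨hx', ha', fun k hk => ?_⟩
  induction k using Fin.cases with
  | zero =>
    exact homotopic_cast_of_eq rfl rfl _ _ (fun t => prepend_segment_zero _ ha t)
      (Path.Homotopic.refl _)
  | succ k =>
    have hk' : k ≠ Fin.last n := fun h => hk (by rw [h, Fin.succ_last])
    refine homotopic_cast_of_eq (hx k hk') ha _ _ (fun t => ?_) (hh k hk')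
    change HatComplex.prepend (conePath i e) σ ha (segment (vert k.succ) (vert (Fin.last (n + 1))) t) =
      σ (segment (vert k) (vert (Fin.last n)) t)
    have h1 : ∀ k : Fin (n + 1), (vert k.succ : Simp (n + 1)) = coface 0 (vert k) := fun k => by
      rw [coface_vert, Fin.succAbove_zero]
    rw [← Fin.succ_last, h1, h1, segment_coface_apply]
    exact DFunLike.congr_fun (prepend_face_zero (conePath i e) ha) _

variable (R : Type*) [CommRing R] (x : Y) (y : ∀ i, A i) (e : ∀ i, Path (y i : Y) x)

/-- The generators of `Ĉ_*^x(Y)` and the empty simplex. -/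
def hatSet : ∀ n, Set ((sg (DCone A)).obj n)
  | 0 => Set.univ
  | _ + 1 => {σ | IsHat x y e (toMap σ)}

theorem vertsIn_subset_hatSet (n : ℕ) :
    vertsIn {DCone.of A x} n ⊆ hatSet x y e n := by
  match n with
  | 0 => exact fun _ _ => trivial
  | n + 1 => exact fun σ hσ => Or.inl hσ

/-- The operator which prepends the path from `x` to the cone point to a simplex whose last vertex is
a cone point, and which vanishes on the other simplices. -/
def hatPrepend : ∀ n, ((sg (DCone A)).obj n →₀ R) →ₗ[R] ((sg (DCone A)).obj (n + 1) →₀ R)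
  | 0 => 0
  | n + 1 => Finsupp.linearCombination R fun σ : (sg (DCone A)).obj (n + 1) =>
      open Classical in
      if h : ∃ i, toMap σ (vert (Fin.last n)) = DCone.apex A i then
        Finsupp.single (ofMap (prepend (conePath h.choose (e h.choose)) (toMap σ) h.choose_spec)) 1
      else 0

variable {x y}

theorem hatPrepend_single {n : ℕ} {σ : (sg (DCone A)).obj (n + 1)} {i : Fin s}
    (h : toMap σ (vert (Fin.last n)) = DCone.apex A i) (r : R) :
    hatPrepend R x y e (n + 1) (Finsupp.single σ r) =
      Finsupp.single (ofMap (prepend (conePath i (e i)) (toMap σ) h)) r := by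
  have h' : ∃ i, toMap σ (vert (Fin.last n)) = DCone.apex A i := ⟨i, h⟩
  rw [hatPrepend, Finsupp.linearCombination_single, dif_pos h', Finsupp.smul_single, smul_eq_mul,
    mul_one]
  have hi : h'.choose = i := DCone.apex_injective (h'.choose_spec.symm.trans h)
  congr 2
  have : ∀ j (hj : j = i) (hj' : toMap σ (vert (Fin.last n)) = DCone.apex A j),
      prepend (conePath j (e j)) (toMap σ) hj' = prepend (conePath i (e i)) (toMap σ) h := by
    rintro j rfl _
    rfl
  exact this _ hi _

theorem hatPrepend_single_of_ne {n : ℕ} {σ : (sg (DCone A)).obj (n + 1)}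
    (h : toMap σ (vert (Fin.last n)) = DCone.of A x) (r : R) :
    hatPrepend R x y e (n + 1) (Finsupp.single σ r) = 0 := by
  rw [hatPrepend, Finsupp.linearCombination_single, dif_neg, smul_zero]
  rintro ⟨i, hi⟩
  exact DCone.of_ne_apex _ _ (h.symm.trans hi)

variable {R}

/-- The homotopy `hatPrepend` preserves the hat complex. -/
theorem hatPrepend_mem {n : ℕ} {c : (sg (DCone A)).obj n →₀ R}
    (hc : c ∈ Finsupp.supported R R (hatSet x y e n)) :
    hatPrepend R x y e n c ∈ Finsupp.supported R R (hatSet x y e (n + 1)) := by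
  match n with
  | 0 => exact Submodule.zero_mem _
  | n + 1 =>
    refine map_mem_of_supported _ (fun σ hσ => ?_) hc
    rcases IsHat.cases hσ with h | ⟨i, h⟩
    · rw [hatPrepend_single_of_ne R e (h _)]
      exact Submodule.zero_mem _
    · rw [hatPrepend_single R e h.choose_spec.choose]
      exact Finsupp.single_mem_supported _ _ h.prepend.isHat

/-- Up to the chain homotopy `hatPrepend`, the identity of `Ĉ_*^x(Y)` takes values in the chains with
all vertices in `x`. -/
theorem hatPrepend_homotopy {n : ℕ} {c : (sg (DCone A)).obj (n + 1) →₀ R}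
    (hc : c ∈ Finsupp.supported R R (hatSet x y e (n + 1))) :
    bd R _ (n + 1) (hatPrepend R x y e (n + 1) c) + hatPrepend R x y e n (bd R _ n c) - c ∈
      Finsupp.supported R R (vertsIn {DCone.of A x} (n + 1)) := by
  let L := (bd R _ (n + 1)) ∘ₗ (hatPrepend R x y e (n + 1)) + (hatPrepend R x y e n) ∘ₗ (bd R _ n) -
    LinearMap.id
  change L c ∈ _
  refine map_mem_of_supported L (fun σ hσ => ?_) hc
  change bd R _ (n + 1) (hatPrepend R x y e (n + 1) (Finsupp.single σ 1)) +
    hatPrepend R x y e n (bd R _ n (Finsupp.single σ 1)) - Finsupp.single σ 1 ∈ _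
  rcases IsHat.cases hσ with h | ⟨i, h⟩
  · have h0 : hatPrepend R x y e n (bd R _ n (Finsupp.single σ 1)) = 0 := by
      match n, σ, h with
      | 0, σ, h => rfl
      | n + 1, σ, h =>
        rw [bd_single, map_sum]
        refine Finset.sum_eq_zero fun j _ => ?_
        rw [map_zsmul, hatPrepend_single_of_ne R e, smul_zero]
        rw [toMap_face, ContinuousMap.comp_apply, coface_vert]
        exact h _
    rw [hatPrepend_single_of_ne R e (h _), map_zero, h0, zero_add, zero_sub]
    exact Submodule.neg_mem _ (Finsupp.single_mem_supported _ _ h)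
  · have ha := h.choose_spec.choose
    have hx := h.choose
    rw [hatPrepend_single R e ha, bd_single, Fin.sum_univ_succ, Fin.val_zero, pow_zero, one_smul,
      face_ofMap, prepend_face_zero]
    have hlast : ∀ k, toMap ((sg (DCone A)).face (Fin.last (n + 1))
        (ofMap (prepend (conePath i (e i)) (toMap σ) ha))) (vert k) ∈ ({DCone.of A x} : Set _) := by
      intro k
      rw [toMap_face, toMap_ofMap, ContinuousMap.comp_apply, coface_vert, Fin.succAbove_last]
      exact h.prepend.choose _ (Fin.castSucc_lt_last k).ne
    rw [ofMap_toMap, add_assoc, add_sub_cancel_left, Fin.sum_univ_castSucc, Fin.succ_last, add_right_comm]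
    refine Submodule.add_mem _ ?_ ?_
    · match n, σ, h, ha, hx with
      | 0, σ, h, ha, hx =>
        rw [Fin.sum_univ_zero]
        exact Submodule.add_mem _ (Submodule.zero_mem _) (Submodule.zero_mem _)
      | n + 1, σ, h, ha, hx =>
        have hj : ∀ j : Fin (n + 1),
            toMap ((sg (DCone A)).face j.castSucc σ) (vert (Fin.last n)) = DCone.apex A i := by
          intro j
          rw [toMap_face, ContinuousMap.comp_apply, last_coface_castSucc]
          exact ha
        have hk : hatPrepend R x y e (n + 1) (bd R (sg (DCone A)) (n + 1) (Finsupp.single σ 1)) =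
            ∑ j : Fin (n + 1), ((-1 : ℤ) ^ (j : ℕ)) • Finsupp.single
              (ofMap (prepend (conePath i (e i)) (toMap ((sg (DCone A)).face j.castSucc σ)) (hj j)))
              1 := by
          rw [bd_single, Fin.sum_univ_castSucc, map_add, map_sum, map_zsmul,
            hatPrepend_single_of_ne R e, smul_zero, add_zero]
          · refine Finset.sum_congr rfl fun j _ => ?_
            rw [map_zsmul, hatPrepend_single R e (hj j), Fin.val_castSucc]
          · rw [toMap_face, ContinuousMap.comp_apply, coface_vert, Fin.succAbove_last]
            exact hx _ (Fin.castSucc_lt_last _).ne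
        rw [hk, ← Finset.sum_add_distrib]
        refine Submodule.sum_mem _ fun j _ => ?_
        convert Submodule.zero_mem _ using 1
        have hp : (sg (DCone A)).face j.castSucc.succ
            (ofMap (prepend (conePath i (e i)) (toMap σ) ha)) =
            ofMap (prepend (conePath i (e i)) (toMap ((sg (DCone A)).face j.castSucc σ)) (hj j)) := by
          rw [face_ofMap]
          exact congr_arg ofMap (prepend_face_succ (conePath i (e i)) ha j (hj j))
        rw [hp, Fin.val_succ, Fin.val_castSucc, pow_succ, mul_neg_one, neg_smul, neg_add_cancel]
    · rw [← Int.cast_smul_eq_zsmul R]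
      exact Submodule.smul_mem _ _ (Finsupp.single_mem_supported _ _ hlast)

/-- A chain of `Ĉ_*^x(Y)` which bounds in `Dcone(⋃ᵢ Aᵢ → Y)` bounds in `Ĉ_*^x(Y)`. -/
theorem exists_hat_bd [PathConnectedSpace (DCone A)] {n : ℕ} {c : (sg (DCone A)).obj (n + 1) →₀ R}
    (hc : c ∈ Finsupp.supported R R (hatSet x y e (n + 1))) {b : (sg (DCone A)).obj (n + 2) →₀ R}
    (hb : c = bd R _ (n + 1) b) :
    ∃ b' ∈ Finsupp.supported R R (hatSet x y e (n + 2)), c = bd R _ (n + 1) b' := by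
  obtain ⟨γ, hγ⟩ := exists_whiskers (DCone.of A x)
  have hz : bd R _ n c = 0 := by rw [hb, bd_bd]
  have h1 := hatPrepend_homotopy e hc
  rw [hz, map_zero, add_zero] at h1
  have hsub : ∀ k, Finsupp.supported R R (vertsIn {DCone.of A x} k) ≤
      Finsupp.supported R R (hatSet x y e k) := fun k =>
    Finsupp.supported_mono (vertsIn_subset_hatSet x y e k)
  set kc := hatPrepend R x y e (n + 1) c with hkc
  set w := bd R _ (n + 1) kc - c with hw
  have h2 := (whisker γ).bd_prism R n w
  have hbw : bd R _ n w = 0 := by rw [hw, map_sub, bd_bd, hz, sub_zero]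
  rw [hbw, map_zero, sub_zero, whisker_at_zero, push_sgMap_id] at h2
  have h3 : push R ((whisker γ).at 1) (n + 1) w =
      bd R _ (n + 1) (push R ((whisker γ).at 1) (n + 2) (kc - b)) := by
    rw [bd_push, map_sub (bd R _ (n + 1)), ← hb]
  refine ⟨kc - push R ((whisker γ).at 1) (n + 2) (kc - b) + (whisker γ).prism R (n + 1) w,
    Submodule.add_mem _ (Submodule.sub_mem _ (hatPrepend_mem e hc) (hsub _ (push_whisker_mem γ _)))
      (hsub _ (whisker_prism_mem γ hγ h1)), ?_⟩
  rw [map_add, h2, map_sub, ← h3]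
  rw [sub_add_sub_cancel, hw, sub_sub_cancel]

/-- Every cycle of `Dcone(⋃ᵢ Aᵢ → Y)` is homologous to one of `Ĉ_*^x(Y)`. -/
theorem exists_hat_cycle [PathConnectedSpace (DCone A)] {n : ℕ}
    {z : (sg (DCone A)).obj (n + 1) →₀ R} (hz : bd R _ n z = 0) :
    ∃ c ∈ Finsupp.supported R R (hatSet x y e (n + 1)), bd R _ n c = 0 ∧
      ∃ b, z - c = bd R _ (n + 1) b := by
  obtain ⟨γ, hγ⟩ := exists_whiskers (DCone.of A x)
  have h2 := (whisker γ).bd_prism R n z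
  rw [hz, map_zero, sub_zero, whisker_at_zero, push_sgMap_id] at h2
  refine ⟨push R ((whisker γ).at 1) (n + 1) z, Finsupp.supported_mono
    (vertsIn_subset_hatSet x y e _) (push_whisker_mem γ z), ?_, -(whisker γ).prism R (n + 1) z, ?_⟩
  · rw [bd_push, hz, map_zero]
  · rw [map_neg, h2, neg_sub]

end Hat

/-! ### Homology of complexes of modules, elementwise -/

section Represents

variable {R : Type v} [CommRing R] {K L : ChainComplex (ModuleCat.{w} R) ℕ}

/-- The cycle `z` represents the homology class `h`. -/
def Represents {n : ℕ} (z : K.X n) (h : K.homology n) : Prop :=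
  ∃ c : K.cycles n, K.iCycles n c = z ∧ K.homologyπ n c = h

theorem exists_represents {n : ℕ} (h : K.homology n) : ∃ z : K.X n, Represents z h := by
  obtain ⟨c, hc⟩ := (ModuleCat.epi_iff_surjective (K.homologyπ n)).1 inferInstance h
  exact ⟨_, c, rfl, hc⟩

theorem Represents.d_eq_zero {n m : ℕ} {z : K.X n} {h : K.homology n} (hz : Represents z h) :
    K.d n m z = 0 := by
  obtain ⟨c, rfl, -⟩ := hz
  have := congr_arg (fun f => f.hom c) (K.iCycles_d n m)
  exact this

theorem exists_represents_of_cycle {n : ℕ} (z : K.X n) (hz : ∀ m, K.d n m z = 0) :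
    ∃ h : K.homology n, Represents z h := by
  refine ⟨_, (K.sc n).moduleCatCyclesIso.inv ⟨z, hz _⟩, ?_, rfl⟩
  exact (K.sc n).moduleCatCyclesIso_inv_iCycles_apply ⟨z, hz _⟩

theorem Represents.eq_zero_iff {n : ℕ} {z : K.X n} {h : K.homology n} (hz : Represents z h) :
    h = 0 ↔ ∃ c, z = K.d (n + 1) n c := by
  obtain ⟨a, rfl, rfl⟩ := hz
  have hex := (ShortComplex.moduleCat_exact_iff _).1 (ShortComplex.exact_of_g_is_cokernel
    (ShortComplex.mk (K.toCycles (n + 1) n) (K.homologyπ n) (K.toCycles_comp_homologyπ (n + 1) n))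
    (K.homologyIsCokernel (n + 1) n (by simp)))
  have htc : ∀ c, K.iCycles n (K.toCycles (n + 1) n c) = K.d (n + 1) n c := fun c =>
    congr_arg (fun f => f.hom c) (K.toCycles_i (n + 1) n)
  constructor
  · intro h
    obtain ⟨c, hc⟩ := hex a h
    exact ⟨c, by rw [← htc]; exact congr_arg (K.iCycles n) hc.symm⟩
  · rintro ⟨c, hc⟩
    have hinj := (ModuleCat.mono_iff_injective (K.iCycles n)).1 inferInstance
    obtain rfl : a = K.toCycles (n + 1) n c := hinj (hc.trans (htc c).symm)
    exact congr_arg (fun f => f.hom c) (K.toCycles_comp_homologyπ (n + 1) n)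

theorem Represents.sub_smul {n : ℕ} {z z' : K.X n} {h h' : K.homology n} (hz : Represents z h)
    (hz' : Represents z' h') (r : R) : Represents (z - r • z') (h - r • h') := by
  obtain ⟨a, rfl, rfl⟩ := hz
  obtain ⟨b, rfl, rfl⟩ := hz'
  exact ⟨a - r • b, by rw [map_sub, map_smul], by rw [map_sub, map_smul]⟩

theorem Represents.sub {n : ℕ} {z z' : K.X n} {h h' : K.homology n} (hz : Represents z h)
    (hz' : Represents z' h') : Represents (z - z') (h - h') := by
  obtain ⟨a, rfl, rfl⟩ := hz
  obtain ⟨b, rfl, rfl⟩ := hz'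
  exact ⟨a - b, map_sub _ _ _, map_sub _ _ _⟩

theorem Represents.map (f : K ⟶ L) {n : ℕ} {z : K.X n} {h : K.homology n} (hz : Represents z h) :
    Represents (f.f n z) (HomologicalComplex.homologyMap f n h) := by
  obtain ⟨a, rfl, rfl⟩ := hz
  refine ⟨HomologicalComplex.cyclesMap f n a, ?_, ?_⟩
  · exact congr_arg (fun g => g.hom a) (HomologicalComplex.cyclesMap_i f n)
  · exact (congr_arg (fun g => g.hom a) (HomologicalComplex.homologyπ_naturality f n)).symm

/-- A criterion for isomorphisms of homology in terms of cycles and boundaries. -/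
theorem isIso_homologyMap_of_cycles (f : K ⟶ L) (n : ℕ)
    (hinj : ∀ z, (∀ m, K.d n m z = 0) → ∀ c, f.f n z = L.d (n + 1) n c → ∃ b, z = K.d (n + 1) n b)
    (hsurj : ∀ z, (∀ m, L.d n m z = 0) →
      ∃ z', (∀ m, K.d n m z' = 0) ∧ ∃ c, z - f.f n z' = L.d (n + 1) n c) :
    IsIso (HomologicalComplex.homologyMap f n) := by
  rw [ConcreteCategory.isIso_iff_bijective]
  constructor
  · refine (injective_iff_map_eq_zero (HomologicalComplex.homologyMap f n).hom).2 fun h hh => ?_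
    obtain ⟨z, hz⟩ := exists_represents h
    obtain ⟨c, hc⟩ := (hz.map f).eq_zero_iff.1 hh
    exact hz.eq_zero_iff.2 (hinj z (fun m => hz.d_eq_zero) c hc)
  · intro h
    obtain ⟨z, hz⟩ := exists_represents h
    obtain ⟨z', hz', hc⟩ := hsurj z fun m => hz.d_eq_zero
    obtain ⟨h', hh'⟩ := exists_represents_of_cycle z' hz'
    exact ⟨h', (sub_eq_zero.1 ((hz.sub (hh'.map f)).eq_zero_iff.2 hc)).symm⟩

/-- A criterion in terms of cycles and boundaries for homology to be free of rank one. -/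
theorem nonempty_homology_equiv {n : ℕ} {z₀ : K.X n} (h₀ : ∀ m, K.d n m z₀ = 0)
    (hgen : ∀ z, (∀ m, K.d n m z = 0) → ∃ r : R, ∃ c, z - r • z₀ = K.d (n + 1) n c)
    (hfree : ∀ (r : R) (c), r • z₀ = K.d (n + 1) n c → r = 0) :
    Nonempty (K.homology n ≃ₗ[R] R) := by
  obtain ⟨h, hh⟩ := exists_represents_of_cycle z₀ h₀
  refine ⟨(LinearEquiv.ofBijective (LinearMap.toSpanSingleton R _ h) ⟨?_, fun h' => ?_⟩).symm⟩
  · refine (injective_iff_map_eq_zero _).2 fun r hr => ?_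
    have h1 : Represents (0 : K.X n) (0 : K.homology n) := ⟨0, map_zero _, map_zero _⟩
    have h2 : -r • h = 0 := by rw [neg_smul, neg_eq_zero]; exact hr
    obtain ⟨c, hc⟩ := (h1.sub_smul hh (-r)).eq_zero_iff.1 (by rw [h2, sub_zero])
    exact hfree r c (by rw [← hc, neg_smul, zero_sub, neg_neg])
  · obtain ⟨z, hz⟩ := exists_represents h'
    obtain ⟨r, hr⟩ := hgen z fun m => hz.d_eq_zero
    exact ⟨r, (sub_eq_zero.1 ((hz.sub_smul hh r).eq_zero_iff.2 hr)).symm⟩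

end Represents

/-! ### Quasi-isomorphisms between complexes of quasisimplicial sets -/

section Chains

variable {R : Type v} [CommRing R] {S T : QSet.{u}}

theorem chains_d_apply (n : ℕ) (c : S.obj (n + 1) →₀ R) :
    (S.chains R).d (n + 1) n c = bd R S.toA (n + 1) c := by
  exact congr_arg (fun f => f.hom c) (ChainComplex.of_d
    (fun n => ModuleCat.of R (S.obj n →₀ R)) (fun n => ModuleCat.ofHom (QSet.boundary R S n)) n)

theorem chains_d_eq_zero {n : ℕ} {z : S.obj n →₀ R} (hz : bd R S.toA n z = 0) (m : ℕ) :
    (S.chains R).d n m z = 0 := by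
  by_cases h : m + 1 = n
  · subst h
    exact (chains_d_apply m z).trans hz
  · rw [(S.chains R).shape n m h]
    rfl

theorem push_homA_zero (f : QSet.Hom S T) (c : S.toA.obj 0 →₀ R) :
    push R (QSet.homA f) 0 c = c :=
  Finsupp.mapDomain_id

theorem bd_zero_eq_zero_of_push (f : QSet.Hom S T) {z : S.toA.obj 1 →₀ R} {c : T.toA.obj 2 →₀ R}
    (h : push R (QSet.homA f) 1 z = bd R T.toA 1 c) : bd R S.toA 0 z = 0 := by
  have := bd_push R (QSet.homA f) 0 z
  rw [h, bd_bd, push_homA_zero] at this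
  exact this.symm

theorem bd_eq_zero_of_chains {n : ℕ} {z : S.obj (n + 1) →₀ R}
    (hz : ∀ m, (S.chains R).d (n + 1) m z = 0) : bd R S.toA (n + 1) z = 0 :=
  (chains_d_apply n z).symm.trans (hz n)

/-- In degree `0` a chain is made an augmented cycle by subtracting a multiple of a point. -/
theorem exists_of_augmented (f : QSet.Hom S T) (p : S.obj 0)
    (hsurj : ∀ z : T.toA.obj 1 →₀ R, bd R T.toA 0 z = 0 → ∃ z', bd R S.toA 0 z' = 0 ∧
      ∃ c, z - push R (QSet.homA f) 1 z' = bd R T.toA 1 c) (z : T.toA.obj 1 →₀ R) :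
    ∃ z' c, z - push R (QSet.homA f) 1 z' = bd R T.toA 1 c := by
  let p' : S.toA.obj 1 := p
  let o : T.toA.obj 0 := PUnit.unit
  let q : S.toA.obj 1 →₀ R := Finsupp.single p' (bd R T.toA 0 z o)
  have hq : bd R T.toA 0 (z - push R (QSet.homA f) 1 q) = 0 := by
    have hq' : push R (QSet.homA f) 0 (bd R S.toA 0 q) = Finsupp.single o (bd R T.toA 0 z o) := by
      rw [push_homA_zero, bd_single, Fin.sum_univ_one, Fin.val_zero, pow_zero, one_smul]
      rfl
    rw [map_sub, bd_push, hq', sub_eq_zero]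
    exact Finsupp.ext fun v => (Finsupp.single_eq_same (a := o)).symm
  obtain ⟨z', -, c, hc⟩ := hsurj _ hq
  exact ⟨z' + q, c, by rw [← hc, map_add, sub_add_eq_sub_sub_swap]⟩

/-- A morphism of quasisimplicial sets which induces a bijection in augmented homology is a
quasi-isomorphism. -/
theorem isIso_homologyMap (f : QSet.Hom S T) (p : S.obj 0)
    (hinj : ∀ n (z : S.toA.obj (n + 1) →₀ R), bd R S.toA n z = 0 →
      ∀ c, push R (QSet.homA f) (n + 1) z = bd R T.toA (n + 1) c → ∃ b, z = bd R S.toA (n + 1) b)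
    (hsurj : ∀ n (z : T.toA.obj (n + 1) →₀ R), bd R T.toA n z = 0 → ∃ z', bd R S.toA n z' = 0 ∧
      ∃ c, z - push R (QSet.homA f) (n + 1) z' = bd R T.toA (n + 1) c) (n : ℕ) :
    IsIso (HomologicalComplex.homologyMap (QSet.chainsMap R f) n) := by
  refine isIso_homologyMap_of_cycles _ n (fun z hz c hc => ?_) (fun z hz => ?_)
  · have hc' : push R (QSet.homA f) (n + 1) z = bd R T.toA (n + 1) c :=
      hc.trans (chains_d_apply n c)
    have hz' : bd R S.toA n z = 0 := by
      match n, z, c, hz, hc' with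
      | 0, z, c, _, hc' => exact bd_zero_eq_zero_of_push f hc'
      | n + 1, z, _, hz, _ => exact bd_eq_zero_of_chains hz
    obtain ⟨b, hb⟩ := hinj n z hz' c hc'
    exact ⟨b, hb.trans (chains_d_apply n b).symm⟩
  · match n, z, hz with
    | 0, z, hz =>
      obtain ⟨z', c, hc⟩ := exists_of_augmented f p (hsurj 0) z
      refine ⟨z', fun m => ?_, c, hc.trans (chains_d_apply 0 c).symm⟩
      rw [(S.chains R).shape 0 m (by simp)]
      rfl
    | n + 1, z, hz =>
      obtain ⟨z', hz', c, hc⟩ := hsurj (n + 1) z (bd_eq_zero_of_chains hz)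
      exact ⟨z', chains_d_eq_zero hz', c, hc.trans (chains_d_apply (n + 1) c).symm⟩

/-- Chain homotopies from prism operators. -/
theorem nonempty_homotopy {f g : QSet.Hom S T}
    (P : ∀ n, (S.toA.obj n →₀ R) →ₗ[R] (T.toA.obj (n + 1) →₀ R)) (h0 : P 0 = 0)
    (hP : ∀ n c, bd R T.toA (n + 1) (P (n + 1) c) =
      push R (QSet.homA f) (n + 1) c - push R (QSet.homA g) (n + 1) c - P n (bd R S.toA n c)) :
    Nonempty (Homotopy (QSet.chainsMap R f) (QSet.chainsMap R g)) := by
  let h : ∀ i j, (ComplexShape.down ℕ).Rel j i → ((S.chains R).X i ⟶ (T.chains R).X j) :=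
    fun i j r => r ▸ ModuleCat.ofHom (P (i + 1))
  have key : QSet.chainsMap R f - QSet.chainsMap R g = Homotopy.nullHomotopicMap' h := by
    ext n : 1
    match n with
    | 0 =>
      rw [Homotopy.nullHomotopicMap'_f_of_not_rel_left (k₁ := 1) (k₀ := 0) (by simp) (by simp)]
      refine ModuleCat.hom_ext (LinearMap.ext fun c => ?_)
      refine Eq.trans ?_ (chains_d_apply 0 _).symm
      have := hP 0 c
      rw [h0, LinearMap.zero_apply, sub_zero] at this
      exact this.symm
    | n + 1 =>
      rw [Homotopy.nullHomotopicMap'_f (k₂ := n + 2) (k₁ := n + 1) (k₀ := n) (by simp) (by simp)]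
      refine ModuleCat.hom_ext (LinearMap.ext fun c => ?_)
      have h1 : ∀ c, push R (QSet.homA f) (n + 2) c - push R (QSet.homA g) (n + 2) c =
          P (n + 1) (bd R S.toA (n + 1) c) + bd R T.toA (n + 2) (P (n + 2) c) := fun c => by
        rw [hP (n + 1) c, add_sub_cancel]
      refine (h1 c).trans ?_
      exact congr_arg₂ (· + ·) (congr_arg (P (n + 1)) (chains_d_apply n c).symm)
        (chains_d_apply (n + 1) (P (n + 2) c)).symm
  have hh : Homotopy (QSet.chainsMap R f - QSet.chainsMap R g) 0 := by
    rw [key]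
    exact Homotopy.nullHomotopy' h
  exact ⟨Homotopy.equivSubZero.symm hh⟩

end Chains

/-! ### The chain map into the hat complex -/

section HatMap

variable {Y : Type u} [TopologicalSpace Y] {s : ℕ} {A : Fin s → Set Y}
variable (R : Type v) [CommRing R] (x : Y) (y : ∀ i, A i) (e : ∀ i, Path (y i : Y) x)

/-- Moving the vertices of the singular simplices to `x` along the paths `γ`. -/
def toHat (γ : ∀ p, Path p (DCone.of A x)) : QSet.Hom (sing (DCone A)) (hatSimplices x y e) where
  app {n} σ := ⟨((whisker γ).at 1).app (n := n + 1) σ, Or.inl (whisker_at_one_mem γ (n := n) σ)⟩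
  app_face {n} j σ := Subtype.ext (((whisker γ).at 1).app_face (n := n + 1) j σ)

/-- Composition of morphisms of quasisimplicial sets. -/
def QSet.Hom.comp {S T W : QSet.{u}} (g : QSet.Hom T W) (f : QSet.Hom S T) : QSet.Hom S W where
  app s := g.app (f.app s)
  app_face j s := by rw [f.app_face, g.app_face]

theorem chainsMap_comp {S T W : QSet.{u}} (g : QSet.Hom T W) (f : QSet.Hom S T) :
    QSet.chainsMap R (g.comp f) = QSet.chainsMap R f ≫ QSet.chainsMap R g := by
  ext n : 1
  exact ModuleCat.hom_ext (LinearMap.ext fun c : S.obj n →₀ R =>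
    Finsupp.mapDomain_comp (f := f.app) (g := g.app))

/-- The chain map induced by moving all vertices to `x`; it takes values in the simplices with all
vertices in `x`. -/
theorem exists_hatMap [PathConnectedSpace (DCone A)] :
    ∃ F : dconeChains A R ⟶ hatChains R x y e, Nonempty (Homotopy (F ≫ j₁ R x y e) (j₂ A R)) := by
  obtain ⟨γ, -⟩ := exists_whiskers (DCone.of A x)
  refine ⟨QSet.chainsMap R ((toHat x y e γ).comp (dconeSingIncl A)), ?_⟩
  suffices h : Nonempty (Homotopy (QSet.chainsMap R ((QSet.subι (sing (DCone A))
      (fun {_} σ => IsHat x y e σ) (fun {_} j σ h => IsHat.face j σ h)).comp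
        ((toHat x y e γ).comp (dconeSingIncl A)))) (j₂ A R)) from
    h.map fun H => (Homotopy.ofEq (chainsMap_comp R _ _).symm).trans H
  refine nonempty_homotopy (fun n => (whisker γ).prism R n ∘ₗ push R (dcIncl A) n) ?_ fun n c => ?_
  · exact LinearMap.zero_comp _
  · refine ((whisker γ).bd_prism R n (push R (dcIncl A) (n + 1) c)).trans ?_
    have hb := bd_push R (dcIncl A) n c
    have h0 : push R ((whisker γ).at 0) (n + 1) (push R (dcIncl A) (n + 1) c) =
        push R (dcIncl A) (n + 1) c := by rw [whisker_at_zero, push_sgMap_id]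
    refine congr_arg₂ (· - ·) (congr_arg₂ (· - ·) ?_ h0) (congr_arg _ hb)
    exact (push_comp R ((whisker γ).at 1) (dcIncl A) (n + 1) c).symm

/-- The inclusion of the algebraic into the topological cone is a quasi-isomorphism. -/
theorem isIso_homologyMap_j₂ [T2Space Y] [CompactSpace Y] (x : Y) (y : ∀ i, A i)
    (hA : ∀ i, IsClosed (A i)) (n : ℕ) :
    IsIso (HomologicalComplex.homologyMap (j₂ A R) n) :=
  isIso_homologyMap _ (Sum.inl (ContinuousMap.const _ x))
    (fun _ _ hz _ hc => exists_dcone_bd y hz hc) (fun _ _ hz => exists_dcone_cycle hA y hz) n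

/-- The inclusion of the generators of `Ĉ_*^x(Y)` into the singular simplices. -/
def hatIncl : Hom (hatSimplices x y e).toA (sg (DCone A)) :=
  QSet.homA (S := hatSimplices x y e) (QSet.subι _ _ _)

theorem hatIncl_injective (n : ℕ) : Function.Injective (push R (hatIncl x y e) n) := by
  refine Finsupp.mapDomain_injective ?_
  cases n with
  | zero => exact fun _ _ h => h
  | succ n => exact Subtype.val_injective

theorem push_hatIncl_mem {n : ℕ} (c : (hatSimplices x y e).toA.obj (n + 1) →₀ R) :
    push R (hatIncl x y e) (n + 1) c ∈ Finsupp.supported R R (hatSet x y e (n + 1)) := by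
  have hc : c ∈ Finsupp.supported R R Set.univ := fun _ _ => trivial
  refine map_mem_of_supported _ (fun σ _ => ?_) hc
  rw [push_single]
  exact Finsupp.single_mem_supported _ _ σ.2

theorem exists_push_hatIncl {n : ℕ} {c : (sg (DCone A)).obj (n + 1) →₀ R}
    (hc : c ∈ Finsupp.supported R R (hatSet x y e (n + 1))) :
    ∃ c', push R (hatIncl x y e) (n + 1) c' = c := by
  have h := (Finsupp.lmapDomain_supported (M := R) R
    (Subtype.val : {σ : C(Simp n, DCone A) // IsHat x y e σ} → _) Set.univ)
  have hr : (Subtype.val : {σ : C(Simp n, DCone A) // IsHat x y e σ} → _) '' Set.univ =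
      hatSet x y e (n + 1) := Set.image_univ.trans Subtype.range_val
  rw [hr] at h
  obtain ⟨c', -, hc'⟩ := h.ge hc
  exact ⟨c', hc'⟩

/-- The inclusion of the hat complex into the singular chains is a quasi-isomorphism. -/
theorem isIso_homologyMap_j₁ [PathConnectedSpace (DCone A)] (n : ℕ) :
    IsIso (HomologicalComplex.homologyMap (j₁ R x y e) n) := by
  let p : (hatSimplices x y e).obj 0 := ⟨ContinuousMap.const _ (DCone.of A x), Or.inl fun _ => rfl⟩
  refine isIso_homologyMap _ p (fun n z hz c hc => ?_) (fun n z hz => ?_) n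
  · obtain ⟨b, hb, hcb⟩ := exists_hat_bd e (push_hatIncl_mem R x y e z) hc
    obtain ⟨b', rfl⟩ := exists_push_hatIncl R x y e hb
    exact ⟨b', hatIncl_injective R x y e _ (hcb.trans (bd_push R _ _ _))⟩
  · obtain ⟨c, hc, hcz, b, hb⟩ := exists_hat_cycle e hz
    obtain ⟨c', rfl⟩ := exists_push_hatIncl R x y e hc
    refine ⟨c', hatIncl_injective R x y e n ?_, b, hb⟩
    rw [map_zero]
    exact (bd_push R _ _ _).symm.trans hcz

/-- Two-out-of-three for `F`, `j₁` and `j₂`. -/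
theorem isIso_homologyMap_of_homotopy [T2Space Y] [CompactSpace Y]
    [PathConnectedSpace (DCone A)] (hA : ∀ i, IsClosed (A i))
    (F : dconeChains A R ⟶ hatChains R x y e) (hF : Nonempty (Homotopy (F ≫ j₁ R x y e) (j₂ A R)))
    (n : ℕ) : IsIso (HomologicalComplex.homologyMap F n) := by
  obtain ⟨h⟩ := hF
  have h1 := h.homologyMap_eq n
  rw [HomologicalComplex.homologyMap_comp] at h1
  have := isIso_homologyMap_j₁ R x y e n
  have h2 : IsIso (HomologicalComplex.homologyMap F n ≫
      HomologicalComplex.homologyMap (j₁ R x y e) n) := by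
    rw [h1]
    exact isIso_homologyMap_j₂ R x y hA n
  exact IsIso.of_isIso_comp_right _ (HomologicalComplex.homologyMap (j₁ R x y e) n)

/-- The homology of the hat complex is free on one generator as soon as that of
`Dcone(⋃ᵢ Aᵢ → Y)` is. -/
theorem nonempty_hat_homology_equiv [PathConnectedSpace (DCone A)] {n : ℕ}
    {z₀ : (sg (DCone A)).obj (n + 2) →₀ R} (h₀ : bd R _ (n + 1) z₀ = 0)
    (hgen : ∀ z, bd R (sg (DCone A)) (n + 1) z = 0 →
      ∃ r : R, ∃ c, z - r • z₀ = bd R (sg (DCone A)) (n + 2) c)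
    (hfree : ∀ (r : R) (c), r • z₀ = bd R (sg (DCone A)) (n + 2) c → r = 0) :
    Nonempty ((hatChains R x y e).homology (n + 1) ≃ₗ[R] R) := by
  have := isIso_homologyMap_j₁ R x y e (n + 1)
  obtain ⟨E⟩ : Nonempty (((sing (DCone A)).chains R).homology (n + 1) ≃ₗ[R] R) := by
    refine nonempty_homology_equiv (z₀ := z₀) (chains_d_eq_zero h₀) (fun z hz => ?_)
      (fun r c hc => hfree r c (hc.trans (chains_d_apply (S := sing (DCone A)) (n + 1) c)))
    obtain ⟨r, c, hc⟩ := hgen z (bd_eq_zero_of_chains hz)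
    exact ⟨r, c, hc.trans (chains_d_apply (S := sing (DCone A)) (n + 1) c).symm⟩
  exact ⟨(asIso (HomologicalComplex.homologyMap (j₁ R x y e) (n + 1))).toLinearEquiv.trans E⟩

end HatMap

/-! ### Local homology of Euclidean space and linear maps -/

section LocalDegree

variable {R : Type*} [CommRing R] {d : ℕ}

/-- Homotopic maps of pairs agree on relative homology. -/
theorem push_sub_push_mem_relBd_of_homotopy {X : Type u} {Y : Type v} [TopologicalSpace X]
    [TopologicalSpace Y] {f₀ f₁ : C(X, Y)} (G : C(X × unitInterval, Y)) (h0 : ∀ x, G (x, 0) = f₀ x)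
    (h1 : ∀ x, G (x, 1) = f₁ x) {U : Set X} {V : Set Y} (h : ∀ x ∈ U, ∀ t, G (x, t) ∈ V) {n : ℕ}
    {z : (sg X).obj (n + 1) →₀ R} (hz : z ∈ relCyc R U n) :
    push R (sgMap f₁) (n + 1) z - push R (sgMap f₀) (n + 1) z ∈ relBd R V n := by
  obtain rfl : G.comp (slice X 0) = f₀ := ContinuousMap.ext h0
  obtain rfl : G.comp (slice X 1) = f₁ := ContinuousMap.ext h1
  exact push_sub_push_mem_relBd G h hz

variable (R d) in
/-- A relative cycle generating the local homology of `ℝᵈ` along all subboxes of `[-1, 1]ᵈ`. -/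
def stdClass : (sg (Fin d → ℝ)).obj (d + 1) →₀ R :=
  (exists_generator_Icc (R := R) (d := d) (-1) 1
    (neg_le_self zero_le_one)).2.choose

theorem stdClass_mem : stdClass R d ∈ relCyc R (Set.Icc (-1) 1)ᶜ d :=
  (exists_generator_Icc (R := R) (d := d) (-1) 1 (neg_le_self zero_le_one)).2.choose_spec.1

theorem generates_stdClass {a b : Fin d → ℝ} (ha : -1 ≤ a) (hab : a ≤ b) (hb : b ≤ 1) :
    Generates R d (Set.Icc a b) (stdClass R d) :=
  (exists_generator_Icc (R := R) (d := d) (-1) 1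
    (neg_le_self zero_le_one)).2.choose_spec.2 a b ha hab hb

theorem stdClass_mem_zero : stdClass R d ∈ relCyc R {(0 : Fin d → ℝ)}ᶜ d :=
  relCyc_mono (Set.compl_subset_compl.mpr (Set.singleton_subset_iff.mpr
    (Set.mem_Icc.mpr ⟨neg_nonpos.mpr zero_le_one, zero_le_one⟩))) d stdClass_mem

theorem generates_stdClass_zero : Generates R d {(0 : Fin d → ℝ)} (stdClass R d) := by
  rw [← Set.Icc_self]
  exact generates_stdClass (neg_nonpos.mpr zero_le_one) le_rfl zero_le_one

/-- The self-map `f` of `ℝᵈ` acts on the local homology at `0` by multiplication with `r`. -/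
def HasDeg (f : C(Fin d → ℝ, Fin d → ℝ)) (r : R) : Prop :=
  push R (sgMap f) (d + 1) (stdClass R d) - r • stdClass R d ∈ relBd R {0}ᶜ d

theorem hasDeg_id : HasDeg (ContinuousMap.id (Fin d → ℝ)) (1 : R) := by
  rw [HasDeg, push_sgMap_id, one_smul, sub_self]
  exact Submodule.zero_mem _

theorem mapsTo_compl_zero {f : C(Fin d → ℝ, Fin d → ℝ)} (hf : ∀ x, f x = 0 → x = 0) :
    Set.MapsTo f {0}ᶜ {0}ᶜ := fun x hx h => hx (hf x h)

theorem exists_hasDeg {f : C(Fin d → ℝ, Fin d → ℝ)} (hf : ∀ x, f x = 0 → x = 0) :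
    ∃ r : R, HasDeg f r :=
  generates_stdClass_zero.1 _ (push_mem_relCyc f (mapsTo_compl_zero hf) stdClass_mem_zero)

theorem HasDeg.unique {f : C(Fin d → ℝ, Fin d → ℝ)} {r r' : R} (h : HasDeg f r)
    (h' : HasDeg f r') : r = r' := by
  refine sub_eq_zero.mp ((generates_stdClass_zero (R := R) (d := d)).2 _ ?_)
  have := Submodule.sub_mem _ h' h
  rwa [sub_sub_sub_cancel_left, ← sub_smul] at this

theorem HasDeg.comp {f g : C(Fin d → ℝ, Fin d → ℝ)} {r r' : R} (hg : HasDeg g r')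
    (hg0 : ∀ x, g x = 0 → x = 0) (hf : HasDeg f r) : HasDeg (g.comp f) (r * r') := by
  have h1 := push_mem_relBd g (mapsTo_compl_zero hg0) hf
  have h2 := Submodule.add_mem _ h1 (Submodule.smul_mem _ r hg)
  rw [map_sub, map_smul, smul_sub, smul_smul, sub_add_sub_cancel, ← push_sgMap_comp] at h2
  exact h2

/-- The degree is invariant under homotopies through maps vanishing only at `0`. -/
theorem HasDeg.of_homotopy {f g : C(Fin d → ℝ, Fin d → ℝ)} {r : R} (hf : HasDeg f r)
    (G : C((Fin d → ℝ) × unitInterval, Fin d → ℝ)) (h0 : ∀ x, G (x, 0) = f x)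
    (h1 : ∀ x, G (x, 1) = g x) (h : ∀ x t, G (x, t) = 0 → x = 0) : HasDeg g r := by
  have := push_sub_push_mem_relBd_of_homotopy G h0 h1 (U := {0}ᶜ) (V := {0}ᶜ)
    (fun x hx t h' => hx (h x t h')) (stdClass_mem_zero (R := R))
  have h2 := Submodule.add_mem _ this hf
  rwa [sub_add_sub_cancel] at h2

/-- The continuous linear self-map of `ℝᵈ` given by a matrix. -/
def mulVecMap (M : Matrix (Fin d) (Fin d) ℝ) : C(Fin d → ℝ, Fin d → ℝ) :=
  ⟨fun v => M.mulVec v, Continuous.matrix_mulVec continuous_const continuous_id⟩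

theorem mulVecMap_mul (M N : Matrix (Fin d) (Fin d) ℝ) :
    mulVecMap (M * N) = (mulVecMap M).comp (mulVecMap N) :=
  ContinuousMap.ext fun v => (Matrix.mulVec_mulVec v M N).symm

theorem mulVecMap_one : mulVecMap (1 : Matrix (Fin d) (Fin d) ℝ) = ContinuousMap.id _ :=
  ContinuousMap.ext fun v => Matrix.one_mulVec v

theorem mulVecMap_eq_zero {M : Matrix (Fin d) (Fin d) ℝ} (hM : M.det ≠ 0) (x : Fin d → ℝ)
    (h : mulVecMap M x = 0) : x = 0 :=
  Matrix.eq_zero_of_mulVec_eq_zero hM h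

theorem HasDeg.of_path {r : R} (M : C(unitInterval, Matrix (Fin d) (Fin d) ℝ))
    (hM : ∀ t, (M t).det ≠ 0) (h : HasDeg (mulVecMap (M 0)) r) : HasDeg (mulVecMap (M 1)) r :=
  h.of_homotopy ⟨fun q => (M q.2).mulVec q.1,
    Continuous.matrix_mulVec (M.continuous.comp continuous_snd) continuous_fst⟩ (fun _ => rfl)
    (fun _ => rfl) fun x t => mulVecMap_eq_zero (hM t) x

/-- Transvections are connected to the identity by scaling the off-diagonal entry. -/
theorem hasDeg_transvection (t : Matrix.TransvectionStruct (Fin d) ℝ) :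
    HasDeg (mulVecMap t.toMatrix) (1 : R) := by
  have h := HasDeg.of_path (R := R) (r := 1) ⟨fun τ : unitInterval =>
    Matrix.transvection t.i t.j ((τ : ℝ) * t.c), by
      unfold Matrix.transvection
      refine continuous_const.add (continuous_matrix fun i j => ?_)
      simp only [Matrix.single_apply]
      split_ifs <;> fun_prop⟩
    (fun τ => by
      rw [ContinuousMap.coe_mk, Matrix.det_transvection_of_ne _ _ t.hij]
      exact one_ne_zero)
  simp only [ContinuousMap.coe_mk, Set.Icc.coe_zero, zero_mul, Matrix.transvection_zero,
    Set.Icc.coe_one, one_mul, mulVecMap_one] at h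
  exact h hasDeg_id

/-- The diagonal matrix whose only entry different from `1` is the `i`-th one, equal to `u`. -/
def signDiag (i : Fin d) (u : ℤˣ) : Fin d → ℤˣ := Function.update 1 i u

/-- The linear map given by a diagonal matrix of signs. -/
def signMap (s : Fin d → ℤˣ) : C(Fin d → ℝ, Fin d → ℝ) :=
  mulVecMap (Matrix.diagonal fun i => ((s i : ℤ) : ℝ))

theorem signMap_apply (s : Fin d → ℤˣ) (x : Fin d → ℝ) (i : Fin d) :
    signMap s x i = ((s i : ℤ) : ℝ) * x i :=
  Matrix.mulVec_diagonal (fun i => ((s i : ℤ) : ℝ)) x i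

theorem signMap_one : signMap (1 : Fin d → ℤˣ) = ContinuousMap.id _ := by
  ext x i
  simp [signMap_apply]

theorem signMap_mul (s t : Fin d → ℤˣ) : signMap (s * t) = (signMap s).comp (signMap t) := by
  ext x i
  simp [signMap_apply, mul_assoc]

theorem signMap_eq_zero (s : Fin d → ℤˣ) (x : Fin d → ℝ) (h : signMap s x = 0) : x = 0 := by
  have : signMap s (signMap s x) = x := by
    ext i
    rw [signMap_apply, signMap_apply, ← mul_assoc]
    rcases Int.units_eq_one_or (s i) with h | h <;> rw [h] <;> norm_num
  rw [← this, h]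
  ext i
  simp [signMap_apply]

/-- All reflections in coordinate hyperplanes have the same degree, a square root of `1`. -/
theorem exists_signDiag_deg [NeZero d] : ∃ c : R, c * c = 1 ∧
    ∀ i : Fin d, HasDeg (signMap (signDiag i (-1))) c := by
  obtain ⟨c, hc⟩ := exists_hasDeg (R := R) (signMap_eq_zero (signDiag (0 : Fin d) (-1)))
  refine ⟨c, ?_, fun i => ?_⟩
  · have h := hc.comp (signMap_eq_zero _) hc
    rw [← signMap_mul] at h
    have h1 : signDiag (0 : Fin d) (-1) * signDiag 0 (-1) = 1 := by
      ext j
      by_cases hj : j = 0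
      · subst hj
        simp [signDiag]
      · simp [signDiag, hj]
    rw [h1, signMap_one] at h
    exact h.unique hasDeg_id
  · -- the two reflections are conjugate by a permutation of the coordinates
    let P : C(Fin d → ℝ, Fin d → ℝ) := ⟨fun x j => x (Equiv.swap 0 i j), by fun_prop⟩
    have hPP : P.comp P = ContinuousMap.id _ := by
      ext x j
      change x (Equiv.swap 0 i (Equiv.swap 0 i j)) = x j
      rw [Equiv.swap_apply_self]
    have hP0 : ∀ x, P x = 0 → x = 0 := fun x hx => by
      have := DFunLike.congr_fun hPP x
      rw [ContinuousMap.comp_apply, hx] at this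
      exact this.symm
    obtain ⟨p, hp⟩ := exists_hasDeg (R := R) hP0
    have hpp : p * p = 1 := by
      have := hp.comp hP0 hp
      rw [hPP] at this
      exact this.unique hasDeg_id
    have h := (hp.comp hP0 hc).comp
      (fun x hx => signMap_eq_zero (signDiag 0 (-1)) x (hP0 _ hx)) hp
    have h1 : (P.comp (signMap (signDiag 0 (-1)))).comp P = signMap (signDiag i (-1)) := by
      ext x j
      change signMap (signDiag 0 (-1)) (P x) (Equiv.swap 0 i j) = _
      rw [signMap_apply, signMap_apply]
      change _ * x (Equiv.swap 0 i (Equiv.swap 0 i j)) = _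
      rw [Equiv.swap_apply_self]
      congr 3
      unfold signDiag
      simp only [Function.update_apply, Equiv.swap_apply_eq_iff, Equiv.swap_apply_left,
        Pi.one_apply]
    rw [h1] at h
    have h2 : p * (c * p) = c := by rw [mul_left_comm, hpp, mul_one]
    rwa [h2] at h

/-- Invertible linear maps act on the local homology of `ℝᵈ` through the sign of the determinant. -/
theorem exists_sign_character [NeZero d] : ∃ w : ℤˣ → R, w 1 = 1 ∧ (∀ u u', w (u * u') = w u * w u') ∧
    ∀ (M : Matrix (Fin d) (Fin d) ℝ) (u : ℤˣ), 0 < ((u : ℤ) : ℝ) * M.det →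
      HasDeg (mulVecMap M) (w u) := by
  obtain ⟨c, hcc, hc⟩ := exists_signDiag_deg (R := R) (d := d)
  let w : ℤˣ → R := fun u => if u = 1 then 1 else c
  have w1 : w 1 = 1 := if_pos rfl
  have wm : w (-1) = c := if_neg (by decide)
  have wmul : ∀ u u', w (u * u') = w u * w u' := by
    intro u u'
    rcases Int.units_eq_one_or u with rfl | rfl <;> rcases Int.units_eq_one_or u' with rfl | rfl <;>
      simp [w1, wm, hcc]
  -- a diagonal matrix of signs is a product of reflections
  have hsign : ∀ (s : Fin d → ℤˣ), HasDeg (signMap s) (w (∏ i, s i)) := by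
    intro s
    have key : ∀ S : Finset (Fin d),
        HasDeg (signMap fun i => if i ∈ S then s i else 1) (w (∏ i ∈ S, s i)) := by
      intro S
      induction S using Finset.induction_on with
      | empty =>
        simp only [Finset.notMem_empty, if_false, Finset.prod_empty, w1]
        have := signMap_one (d := d)
        rw [Pi.one_def] at this
        rw [this]
        exact hasDeg_id
      | insert i S hi ih =>
        have h1 : HasDeg (signMap (signDiag i (s i))) (w (s i)) := by
          rcases Int.units_eq_one_or (s i) with h | h
          · have h' : signDiag i 1 = 1 := Function.update_eq_self i 1
            rw [h, w1, h', signMap_one]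
            exact hasDeg_id
          · rw [h, wm]
            exact hc i
        have h2 := ih.comp (signMap_eq_zero _) h1
        rw [← wmul, ← Finset.prod_insert hi, ← signMap_mul] at h2
        convert h2 using 2
        ext j
        by_cases hj : j = i
        · subst hj
          simp [signDiag, hi]
        · simp [signDiag, hj]
    simpa using key Finset.univ
  have hu : ∀ {u u' : ℤˣ} {x : ℝ}, 0 < ((u : ℤ) : ℝ) * x → 0 < ((u' : ℤ) : ℝ) * x → u = u' := by
    intro u u' x h h'
    rcases Int.units_eq_one_or u with rfl | rfl <;> rcases Int.units_eq_one_or u' with rfl | rfl <;>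
      first
      | rfl
      | (push_cast at h h'; linarith)
  have hex : ∀ x : ℝ, x ≠ 0 → ∃ u : ℤˣ, 0 < ((u : ℤ) : ℝ) * x := by
    intro x hx
    rcases lt_or_gt_of_ne hx with h | h
    · exact ⟨-1, by push_cast; linarith⟩
    · exact ⟨1, by push_cast; linarith⟩
  refine ⟨w, w1, wmul, fun M u hM => ?_⟩
  have hdet : M.det ≠ 0 := fun h => by rw [h, mul_zero] at hM; exact lt_irrefl _ hM
  revert u
  refine Matrix.diagonal_transvection_induction_of_det_ne_zero (fun M => ∀ u : ℤˣ,
    0 < ((u : ℤ) : ℝ) * M.det → HasDeg (mulVecMap M) (w u)) M hdet (fun D hD u huD => ?_)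
    (fun t u ht => ?_) (fun A B hA hB ihA ihB u hAB => ?_)
  · rw [Matrix.det_diagonal] at hD huD
    have hD' : ∀ i, D i ≠ 0 := fun i h => hD (Finset.prod_eq_zero (Finset.mem_univ i) h)
    choose s hs using fun i => hex (D i) (hD' i)
    have hprod : 0 < (((∏ i, s i : ℤˣ) : ℤ) : ℝ) * ∏ i, D i := by
      push_cast
      rw [← Finset.prod_mul_distrib]
      exact Finset.prod_pos fun i _ => hs i
    rw [hu huD hprod]
    -- a diagonal matrix is joined to the matrix of its signs by a segment of invertible matrices
    have h := HasDeg.of_path (R := R) (r := w (∏ i, s i)) ⟨fun t : unitInterval =>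
      Matrix.diagonal fun i => (1 - (t : ℝ)) * ((s i : ℤ) : ℝ) + t * D i,
        Continuous.matrix_diagonal (by fun_prop)⟩ (fun t => by
        rw [ContinuousMap.coe_mk, Matrix.det_diagonal, Finset.prod_ne_zero_iff]
        intro i _ h0
        have h1 : ((s i : ℤ) : ℝ) * ((s i : ℤ) : ℝ) = 1 := by
          rcases Int.units_eq_one_or (s i) with h | h <;> rw [h] <;> norm_num
        have h2 : 0 < (1 - (t : ℝ)) * (((s i : ℤ) : ℝ) * ((s i : ℤ) : ℝ)) +
            t * (((s i : ℤ) : ℝ) * D i) := by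
          rw [h1]
          have ht0 := t.2.1
          have ht1 := t.2.2
          have := hs i
          rcases ht0.eq_or_lt with h | h
          · rw [← h]; norm_num
          · have := mul_pos h this
            linarith
        have h3 := congr_arg (fun x => ((s i : ℤ) : ℝ) * x) h0
        simp only [mul_zero] at h3
        linarith [h3])
    simp only [ContinuousMap.coe_mk, Set.Icc.coe_zero, sub_zero, one_mul, zero_mul, add_zero,
      Set.Icc.coe_one, sub_self, zero_add] at h
    exact h (hsign s)
  · rw [Matrix.TransvectionStruct.det] at ht
    have : u = 1 := hu (x := 1) (by simpa using ht) (by norm_num)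
    rw [this, w1]
    exact hasDeg_transvection t
  · obtain ⟨a, ha⟩ := hex _ hA
    obtain ⟨b, hb⟩ := hex _ hB
    have h1 := (ihA a ha).comp (mulVecMap_eq_zero hA) (ihB b hb)
    rw [← mulVecMap_mul, ← wmul] at h1
    have h2 : u = b * a := by
      refine hu hAB ?_
      rw [Matrix.det_mul]
      have := mul_pos ha hb
      push_cast
      linarith
    rw [h2]
    exact h1

end LocalDegree

/-! ### Local classes in charts -/

section LocalClass

variable {R : Type*} [CommRing R] {d : ℕ}

/-- The translation by `a`. -/
def translate (a : Fin d → ℝ) : C(Fin d → ℝ, Fin d → ℝ) := ⟨fun x => x + a, by fun_prop⟩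

theorem mapsTo_translate {a p q : Fin d → ℝ} :
    Set.MapsTo (translate a) (Set.Icc p q)ᶜ (Set.Icc (p + a) (q + a))ᶜ := fun x hx h =>
  hx ⟨by have := h.1; exact le_of_add_le_add_right this,
    by have := h.2; exact le_of_add_le_add_right this⟩

variable (R) in
/-- The translate of `stdClass` which generates the local homology at `a`. -/
def stdAt (a : Fin d → ℝ) : (sg (Fin d → ℝ)).obj (d + 1) →₀ R :=
  push R (sgMap (translate a)) (d + 1) (stdClass R d)

theorem stdAt_mem (a : Fin d → ℝ) : stdAt R a ∈ relCyc R (Set.Icc (a - 1) (a + 1))ᶜ d := by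
  have hm : Set.MapsTo (translate a) (Set.Icc (-1) 1)ᶜ (Set.Icc (a - 1) (a + 1))ᶜ := by
    rw [sub_eq_neg_add, add_comm a 1]
    exact mapsTo_translate
  exact push_mem_relCyc _ hm stdClass_mem

theorem push_translate_neg (a : Fin d → ℝ) (n : ℕ) (z : (sg (Fin d → ℝ)).obj n →₀ R) :
    push R (sgMap (translate a)) n (push R (sgMap (translate (-a))) n z) = z := by
  rw [← push_sgMap_comp]
  have : (translate a).comp (translate (-a)) = ContinuousMap.id _ := by
    ext x i
    simp [translate]
  rw [this, push_sgMap_id]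

theorem generates_stdAt {a p q : Fin d → ℝ} (hp : a - 1 ≤ p) (hpq : p ≤ q) (hq : q ≤ a + 1) :
    Generates R d (Set.Icc p q) (stdAt R a) := by
  have hg := generates_stdClass (R := R) (d := d) (a := p + -a) (b := q + -a)
    (by rw [← sub_eq_add_neg, le_sub_iff_add_le, neg_add_eq_sub]; exact hp)
    (by gcongr) (by rw [← sub_eq_add_neg, sub_le_iff_le_add']; exact hq)
  have hpa : p + -a + a = p := neg_add_cancel_right p a
  have hqa : q + -a + a = q := neg_add_cancel_right q a
  have hm : Set.MapsTo (translate a) (Set.Icc (p + -a) (q + -a))ᶜ (Set.Icc p q)ᶜ := by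
    have := mapsTo_translate (a := a) (p := p + -a) (q := q + -a)
    rwa [hpa, hqa] at this
  constructor
  · intro z hz
    obtain ⟨r, hr⟩ := hg.1 _ (push_mem_relCyc _ (mapsTo_translate (a := -a)) hz)
    refine ⟨r, ?_⟩
    have := push_mem_relBd _ hm hr
    rwa [map_sub, map_smul, push_translate_neg] at this
  · intro r hr
    refine hg.2 r ?_
    have := push_mem_relBd _ (mapsTo_translate (a := -a)) hr
    rw [map_smul, stdAt] at this
    have h2 := push_translate_neg (-a) (d + 1) (stdClass R d)
    rw [neg_neg] at h2
    rwa [h2] at this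

theorem generates_stdAt_self (a : Fin d → ℝ) : Generates R d {a} (stdAt R a) := by
  rw [← Set.Icc_self]
  exact generates_stdAt (sub_le_self _ zero_le_one) le_rfl (le_add_of_nonneg_right zero_le_one)

theorem stdAt_mem_self (a : Fin d → ℝ) : stdAt R a ∈ relCyc R {a}ᶜ d :=
  relCyc_mono (Set.compl_subset_compl.mpr (Set.singleton_subset_iff.mpr
    (Set.mem_Icc.mpr ⟨sub_le_self _ zero_le_one, le_add_of_nonneg_right zero_le_one⟩))) d
    (stdAt_mem a)

/-- The classes `stdAt a` are locally constant in `a`. -/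
theorem stdAt_sub_stdAt_mem {a b : Fin d → ℝ} (hb : b ∈ Set.Icc (a - 1) (a + 1)) :
    stdAt R a - stdAt R b ∈ relBd R {b}ᶜ d := by
  refine push_sub_push_mem_relBd_of_homotopy (U := (Set.Icc (-1) 1)ᶜ) (V := {b}ᶜ)
    ⟨fun q => q.1 + ((1 - (q.2 : ℝ)) • b + (q.2 : ℝ) • a), by fun_prop⟩ (fun x => ?_) (fun x => ?_)
    (fun x hx t h => hx ?_) stdClass_mem
  · simp [translate]
  · simp [translate]
  · have h' : ∀ i, x i = t * (b i - a i) := fun i => by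
      have := congr_fun (h : x + ((1 - (t : ℝ)) • b + (t : ℝ) • a) = b) i
      simp at this
      linarith
    have ht0 := t.2.1
    have ht1 := t.2.2
    refine ⟨fun i => ?_, fun i => ?_⟩
    · have h1 := hb.1 i
      simp at h1 ⊢
      rw [h' i]
      nlinarith
    · have h1 := hb.2 i
      simp at h1 ⊢
      rw [h' i]
      nlinarith

variable {X : Type v} [TopologicalSpace X] {Ω : Set (Fin d → ℝ)}

/-- The inclusion of a subset. -/
def inclusion {X : Type v} [TopologicalSpace X] (Ω : Set X) : C(Ω, X) :=
  ⟨Subtype.val, continuous_subtype_val⟩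

theorem isOpenEmbedding_inclusion {X : Type v} [TopologicalSpace X] {Ω : Set X} (h : IsOpen Ω) :
    Topology.IsOpenEmbedding (inclusion Ω) := h.isOpenEmbedding_subtypeVal

/-- In the chart `g`, the relative cycle `z` is `r` times the standard class at the point `a`. -/
def IsLocalClass (g : C(Ω, X)) (a : Ω) (r : R) (z : (sg X).obj (d + 1) →₀ R) : Prop :=
  ∃ z' ∈ relCyc R {a}ᶜ d,
    push R (sgMap (inclusion Ω)) (d + 1) z' - r • stdAt R (a : Fin d → ℝ) ∈ relBd R {(a : Fin d → ℝ)}ᶜ d ∧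
      z - push R (sgMap g) (d + 1) z' ∈ relBd R {g a}ᶜ d

theorem mapsTo_compl_singleton {X : Type u} {Y : Type v} {f : X → Y} (hf : Function.Injective f)
    (a : X) : Set.MapsTo f {a}ᶜ {f a}ᶜ := fun _ hx h => hx (hf h)

section

variable {g : C(Ω, X)} {a : Ω} {r r' : R} {z z' : (sg X).obj (d + 1) →₀ R}

theorem IsLocalClass.congr (h : IsLocalClass g a r z) (hz : z - z' ∈ relBd R {g a}ᶜ d) :
    IsLocalClass g a r z' := by
  obtain ⟨w, hw, h1, h2⟩ := h
  refine ⟨w, hw, h1, ?_⟩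
  have := Submodule.sub_mem _ h2 hz
  rwa [sub_sub_sub_cancel_left] at this

theorem IsLocalClass.sub (h : IsLocalClass g a r z) (h' : IsLocalClass g a r' z') :
    IsLocalClass g a (r - r') (z - z') := by
  obtain ⟨w, hw, h1, h2⟩ := h
  obtain ⟨w', hw', h1', h2'⟩ := h'
  refine ⟨w - w', Submodule.sub_mem _ hw hw', ?_, ?_⟩
  · rw [map_sub, sub_smul, sub_sub_sub_comm]
    exact Submodule.sub_mem _ h1 h1'
  · rw [map_sub, sub_sub_sub_comm]
    exact Submodule.sub_mem _ h2 h2'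

theorem IsLocalClass.smul (h : IsLocalClass g a r z) (c : R) : IsLocalClass g a (c * r) (c • z) := by
  obtain ⟨w, hw, h1, h2⟩ := h
  refine ⟨c • w, Submodule.smul_mem _ c hw, ?_, ?_⟩
  · rw [map_smul, mul_smul, ← smul_sub]
    exact Submodule.smul_mem _ c h1
  · rw [map_smul, ← smul_sub]
    exact Submodule.smul_mem _ c h2

theorem inclusion_image_singleton (Ω : Set (Fin d → ℝ)) (a : Ω) :
    inclusion Ω '' {a} = {(a : Fin d → ℝ)} := Set.image_singleton

/-- Local classes with a given coefficient exist, by excision. -/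
theorem exists_isLocalClass (hΩ : IsOpen Ω) (g : C(Ω, X)) (a : Ω) (r : R) :
    ∃ z, IsLocalClass g a r z := by
  have hi := inclusion_image_singleton Ω a
  obtain ⟨z', hz', h⟩ := exists_push_sub_mem_relBd (isOpenEmbedding_inclusion hΩ) (K := {a})
    (by rw [hi]; exact isClosed_singleton) (z := r • stdAt R (a : Fin d → ℝ))
    (by rw [hi]; exact Submodule.smul_mem _ r (stdAt_mem_self _))
  rw [hi] at h
  refine ⟨push R (sgMap g) (d + 1) z', z', hz', ?_, ?_⟩
  · rw [← neg_sub]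
    exact Submodule.neg_mem _ h
  · rw [sub_self]
    exact Submodule.zero_mem _

variable [T1Space X]

/-- A local class vanishes if and only if its coefficient does. -/
theorem IsLocalClass.mem_relBd_iff (hΩ : IsOpen Ω) (hg : Topology.IsOpenEmbedding g)
    (h : IsLocalClass g a r z) : z ∈ relBd R {g a}ᶜ d ↔ r = 0 := by
  obtain ⟨w, hw, h1, h2⟩ := h
  have hi := inclusion_image_singleton Ω a
  have hga : g '' {a} = {g a} := Set.image_singleton
  constructor
  · intro hz
    have h3 : push R (sgMap g) (d + 1) w ∈ relBd R (g '' {a})ᶜ d := by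
      rw [hga, ← sub_sub_cancel z (push R (sgMap g) (d + 1) w)]
      exact Submodule.sub_mem _ hz h2
    have h4 := mem_relBd_of_push hg (by rw [hga]; exact isClosed_singleton) h3
    have h5 := push_mem_relBd (inclusion Ω) (mapsTo_compl_singleton Subtype.val_injective a) h4
    refine (generates_stdAt_self (a : Fin d → ℝ)).2 r ?_
    have := Submodule.sub_mem _ h5 h1
    rwa [sub_sub_cancel] at this
  · rintro rfl
    rw [zero_smul, sub_zero] at h1
    have h3 := mem_relBd_of_push (isOpenEmbedding_inclusion hΩ) (K := {a})
      (by rw [hi]; exact isClosed_singleton) (by rw [hi]; exact h1)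
    have := Submodule.add_mem _ h2 (push_mem_relBd g (mapsTo_compl_singleton hg.injective a) h3)
    rwa [sub_add_cancel] at this

theorem IsLocalClass.unique (hΩ : IsOpen Ω) (hg : Topology.IsOpenEmbedding g)
    (h : IsLocalClass g a r z) (h' : IsLocalClass g a r' z) : r = r' := by
  refine sub_eq_zero.mp (((h.sub h').mem_relBd_iff hΩ hg).1 ?_)
  rw [sub_self]
  exact Submodule.zero_mem _

theorem IsLocalClass.sub_mem (hΩ : IsOpen Ω) (hg : Topology.IsOpenEmbedding g)
    (h : IsLocalClass g a r z) (h' : IsLocalClass g a r z') : z - z' ∈ relBd R {g a}ᶜ d :=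
  ((h.sub h').mem_relBd_iff hΩ hg).2 (sub_self r)

end

section Box

variable {g : C(Ω, X)} {p q : Fin d → ℝ}

/-- The points of `Ω` in a box. -/
def boxIn (Ω : Set (Fin d → ℝ)) (p q : Fin d → ℝ) : Set Ω := {x | (x : Fin d → ℝ) ∈ Set.Icc p q}

theorem image_boxIn (h : Set.Icc p q ⊆ Ω) : inclusion Ω '' boxIn Ω p q = Set.Icc p q := by
  ext x
  exact ⟨fun ⟨y, hy, hyx⟩ => hyx ▸ hy, fun hx => ⟨⟨x, h hx⟩, hx, rfl⟩⟩

theorem isCompact_boxIn (h : Set.Icc p q ⊆ Ω) : IsCompact (boxIn Ω p q) := by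
  rw [Topology.IsEmbedding.subtypeVal.isCompact_iff]
  have := image_boxIn h
  rw [show Subtype.val '' boxIn Ω p q = Set.Icc p q from this]
  exact isCompact_Icc

theorem isClosed_image_boxIn [T2Space X] (h : Set.Icc p q ⊆ Ω) : IsClosed (g '' boxIn Ω p q) :=
  ((isCompact_boxIn h).image g.continuous).isClosed

theorem mem_Icc_of_small (hqp : q ≤ p + 1) {x y : Fin d → ℝ} (hx : x ∈ Set.Icc p q)
    (hy : y ∈ Set.Icc p q) : y ∈ Set.Icc (x - 1) (x + 1) := by
  refine ⟨?_, ?_⟩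
  · rw [sub_le_iff_le_add]
    exact (hx.2.trans hqp).trans (by gcongr; exact hy.1)
  · exact (hy.2.trans hqp).trans (by gcongr; exact hx.1)

/-- A chain with coefficient `r` on a box has coefficient `r` at each of its points. -/
theorem isLocalClass_push_of_box (hpq : p ≤ q) (hqp : q ≤ p + 1) {r : R}
    {z' : (sg Ω).obj (d + 1) →₀ R} (hz' : z' ∈ relCyc R (boxIn Ω p q)ᶜ d)
    (h : push R (sgMap (inclusion Ω)) (d + 1) z' - r • stdAt R p ∈ relBd R (Set.Icc p q)ᶜ d)
    {z : (sg X).obj (d + 1) →₀ R}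
    (hz : z - push R (sgMap g) (d + 1) z' ∈ relBd R (g '' boxIn Ω p q)ᶜ d) (x : Ω)
    (hx : (x : Fin d → ℝ) ∈ Set.Icc p q) : IsLocalClass g x r z := by
  have hxs : ∀ {x : Ω}, (x : Fin d → ℝ) ∈ Set.Icc p q → (boxIn Ω p q)ᶜ ⊆ {x}ᶜ := fun hx =>
    Set.compl_subset_compl.mpr (Set.singleton_subset_iff.mpr hx)
  refine ⟨z', relCyc_mono (hxs hx) d hz', ?_, relBd_mono ?_ d hz⟩
  · have h1 := relBd_mono (Set.compl_subset_compl.mpr (Set.singleton_subset_iff.mpr hx)) d h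
    have h2 := stdAt_sub_stdAt_mem (R := R) (mem_Icc_of_small hqp ⟨le_rfl, hpq⟩ hx)
    have := Submodule.add_mem _ h1 (Submodule.smul_mem _ r h2)
    rwa [smul_sub, sub_add_sub_cancel] at this
  · exact Set.compl_subset_compl.mpr (Set.singleton_subset_iff.mpr ⟨x, hx, rfl⟩)

/-- The coefficient of a class relative to the complement of a box is constant on the box. -/
theorem exists_isLocalClass_of_box [T2Space X] (hg : Topology.IsOpenEmbedding g)
    (hsub : Set.Icc p q ⊆ Ω) (hpq : p ≤ q) (hqp : q ≤ p + 1) {z : (sg X).obj (d + 1) →₀ R}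
    (hz : z ∈ relCyc R (g '' boxIn Ω p q)ᶜ d) :
    ∃ r : R, ∀ x : Ω, (x : Fin d → ℝ) ∈ Set.Icc p q → IsLocalClass g x r z := by
  obtain ⟨z', hz', h⟩ := exists_push_sub_mem_relBd hg (isClosed_image_boxIn hsub) hz
  have h1 := push_mem_relCyc (inclusion Ω) (U := (boxIn Ω p q)ᶜ) (V := (Set.Icc p q)ᶜ)
    (fun x hx h => hx h) hz'
  obtain ⟨r, hr⟩ := (generates_stdAt (R := R) (a := p) (sub_le_self _ zero_le_one) hpq hqp).1 _ h1
  exact ⟨r, isLocalClass_push_of_box hpq hqp hz' hr h⟩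

/-- A prescribed coefficient is realized on a whole box at once. -/
theorem exists_box_class (hΩ : IsOpen Ω) (g : C(Ω, X)) (hg : Function.Injective g)
    (hsub : Set.Icc p q ⊆ Ω) (hpq : p ≤ q) (hqp : q ≤ p + 1) (r : R) :
    ∃ z ∈ relCyc R (g '' boxIn Ω p q)ᶜ d,
      ∀ x : Ω, (x : Fin d → ℝ) ∈ Set.Icc p q → IsLocalClass g x r z := by
  have hi := image_boxIn hsub
  have hstd : r • stdAt R p ∈ relCyc R (inclusion Ω '' boxIn Ω p q)ᶜ d := by
    rw [hi]
    refine Submodule.smul_mem _ r (relCyc_mono (Set.compl_subset_compl.mpr ?_) d (stdAt_mem p))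
    exact Set.Icc_subset_Icc (sub_le_self _ zero_le_one) hqp
  obtain ⟨z', hz', h⟩ := exists_push_sub_mem_relBd (isOpenEmbedding_inclusion hΩ)
    (by rw [hi]; exact isClosed_Icc) hstd
  rw [hi] at h
  have hm : Set.MapsTo g (boxIn Ω p q)ᶜ (g '' boxIn Ω p q)ᶜ :=
    fun x hx ⟨y, hy, hyx⟩ => hx (by rwa [← hg hyx])
  refine ⟨push R (sgMap g) (d + 1) z', push_mem_relCyc g hm hz',
    isLocalClass_push_of_box hpq hqp hz' ?_ ?_⟩
  · rw [← neg_sub]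
    exact Submodule.neg_mem _ h
  · rw [sub_self]
    exact Submodule.zero_mem _

end Box

/-- Compact subsets of the range of a chart detect relative cycles. -/
theorem detected_of_chart [T2Space X] (hΩ : IsOpen Ω) {g : C(Ω, X)} (hg : Topology.IsOpenEmbedding g)
    {K : Set X} (hK : IsCompact K) (hKg : K ⊆ Set.range g) : Detected R d K := by
  have hgK : g '' (g ⁻¹' K) = K := Set.image_preimage_eq_of_subset hKg
  have hcK : IsCompact (inclusion Ω '' (g ⁻¹' K)) :=
    ((hg.isEmbedding.isCompact_preimage_iff hKg).mpr hK).image (inclusion Ω).continuous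
  have hcl : IsClosed (g '' (g ⁻¹' K)) := by rw [hgK]; exact hK.isClosed
  have hdet := detected_of_isCompact (R := R) hcK
  have hmaps : Set.MapsTo (inclusion Ω) (g ⁻¹' K)ᶜ (inclusion Ω '' (g ⁻¹' K))ᶜ :=
    fun x hx ⟨y, hy, hyx⟩ => hx (by rwa [← Subtype.val_injective hyx])
  have key : ∀ n, ∀ z ∈ relCyc R Kᶜ n, ∃ z' ∈ relCyc R (g ⁻¹' K)ᶜ n,
      z - push R (sgMap g) (n + 1) z' ∈ relBd R Kᶜ n ∧
      (push R (sgMap (inclusion Ω)) (n + 1) z' ∈ relBd R (inclusion Ω '' (g ⁻¹' K))ᶜ n →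
        z ∈ relBd R Kᶜ n) := by
    intro n z hz
    rw [← hgK] at hz
    obtain ⟨z', hz', h⟩ := exists_push_sub_mem_relBd hg hcl hz
    rw [hgK] at h
    refine ⟨z', hz', h, fun h' => ?_⟩
    have h1 := mem_relBd_of_push (isOpenEmbedding_inclusion hΩ) hcK.isClosed h'
    have h2 := push_mem_relBd g (U := (g ⁻¹' K)ᶜ) (V := Kᶜ) (fun x hx hxK => hx hxK) h1
    have := Submodule.add_mem _ h h2
    rwa [sub_add_cancel] at this
  refine ⟨fun i hi z hz => ?_, fun z hz hp => ?_⟩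
  · obtain ⟨z', hz', -, h⟩ := key i z hz
    exact h (hdet.1 i hi (push_mem_relCyc _ hmaps hz'))
  · obtain ⟨z', hz', h1, h⟩ := key d z hz
    refine h (hdet.2 _ (push_mem_relCyc _ hmaps hz') ?_)
    rintro _ ⟨x, hx, rfl⟩
    refine push_mem_relBd _ (mapsTo_compl_singleton Subtype.val_injective x) ?_
    have hgx : g '' {x} = {g x} := Set.image_singleton
    refine mem_relBd_of_push hg (by rw [hgx]; exact isClosed_singleton) ?_
    rw [hgx, ← sub_sub_cancel z (push R (sgMap g) (d + 1) z')]
    refine Submodule.sub_mem _ (hp _ hx) (relBd_mono ?_ d h1)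
    exact Set.compl_subset_compl.mpr (Set.singleton_subset_iff.mpr hx)

end LocalClass

/-! ### Change of charts -/

section Transition

variable {R : Type*} [CommRing R] {d : ℕ} {X : Type v} [TopologicalSpace X]
  {Ω₁ Ω₂ : Set (Fin d → ℝ)}

/-- A map with invertible derivative is homotopic to its affine approximation near a point, along
maps which take the value at this point only there. -/
theorem exists_ball_of_hasFDerivAt {τ : (Fin d → ℝ) → Fin d → ℝ} {a : Fin d → ℝ}
    {A : (Fin d → ℝ) →L[ℝ] Fin d → ℝ} (hτ : HasFDerivAt τ A a) (hA : LinearMap.det A.toLinearMap ≠ 0) :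
    ∀ᶠ y in 𝓝 a, ∀ t ∈ Set.Icc (0 : ℝ) 1,
      (1 - t) • τ y + t • (τ a + A (y - a)) = τ a → y = a := by
  have hker : LinearMap.ker A.toLinearMap = ⊥ := by
    by_contra h
    exact hA (LinearMap.det_eq_zero_iff_ker_ne_bot.mpr h)
  obtain ⟨K, hK, hAK⟩ := A.toLinearMap.exists_antilipschitzWith hker
  have hK' : (0 : ℝ) < (K : ℝ)⁻¹ / 2 := by positivity
  filter_upwards [hτ.isLittleO.def hK'] with y hy t ht h
  by_contra hya
  have hv : 0 < ‖y - a‖ := norm_pos_iff.mpr (sub_ne_zero.mpr hya)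
  have h1 : ‖y - a‖ ≤ K * ‖A (y - a)‖ := by
    have := hAK.le_mul_dist (y - a) 0
    simpa using this
  have h2 : A (y - a) = -((1 - t) • (τ y - τ a - A (y - a))) := by
    have h3 : (1 - t) • τ y + t • (τ a + A (y - a)) - τ a = 0 := sub_eq_zero.mpr h
    rw [← sub_eq_zero, ← h3]
    module
  have h4 : ‖A (y - a)‖ ≤ (K : ℝ)⁻¹ / 2 * ‖y - a‖ := by
    rw [h2, norm_neg, norm_smul, Real.norm_of_nonneg (sub_nonneg.mpr ht.2)]
    refine le_trans ?_ hy
    have := ht.1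
    exact mul_le_of_le_one_left (norm_nonneg _) (by linarith)
  have h5 : ‖y - a‖ ≤ ‖y - a‖ / 2 := by
    refine h1.trans ((mul_le_mul_of_nonneg_left h4 K.coe_nonneg).trans_eq ?_)
    have hK0 : (K : ℝ) ≠ 0 := NNReal.coe_ne_zero.mpr hK.ne'
    rw [← mul_assoc, mul_div_assoc', mul_inv_cancel₀ hK0]
    ring
  linarith

/-- Changing charts multiplies the coefficient of a local class by the value of the sign character at
the sign of the Jacobian determinant. -/
theorem IsLocalClass.transition {w : ℤˣ → R}
    (hw : ∀ (M : Matrix (Fin d) (Fin d) ℝ) (u : ℤˣ), 0 < ((u : ℤ) : ℝ) * M.det →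
      HasDeg (mulVecMap M) (w u)) (hΩ₁ : IsOpen Ω₁)
    {g₁ : C(Ω₁, X)} {g₂ : C(Ω₂, X)} (hg₁ : Function.Injective g₁) (hg₂ : Topology.IsEmbedding g₂)
    {a₁ : Ω₁} {a₂ : Ω₂} (ha : g₁ a₁ = g₂ a₂) {τ : (Fin d → ℝ) → Fin d → ℝ}
    {A : (Fin d → ℝ) →L[ℝ] Fin d → ℝ} (hτ : HasFDerivAt τ A a₁) {u : ℤˣ}
    (hu : 0 < ((u : ℤ) : ℝ) * LinearMap.det A.toLinearMap)
    (hev : ∀ᶠ y in 𝓝 (a₁ : Fin d → ℝ), ∃ (h₁ : y ∈ Ω₁) (h₂ : τ y ∈ Ω₂), g₁ ⟨y, h₁⟩ = g₂ ⟨τ y, h₂⟩)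
    {r : R} {z : (sg X).obj (d + 1) →₀ R} (hz : IsLocalClass g₁ a₁ r z) :
    IsLocalClass g₂ a₂ (w u * r) z := by
  have hA : LinearMap.det A.toLinearMap ≠ 0 := fun h => by
    rw [h, mul_zero] at hu; exact lt_irrefl _ hu
  have ha₂ : τ a₁ = a₂ := by
    obtain ⟨h₁, h₂, h⟩ := hev.self_of_nhds
    exact congr_arg Subtype.val (hg₂.injective (h.symm.trans ha))
  obtain ⟨V, hV, hVo, haV⟩ := eventually_nhds_iff.mp (hev.and (exists_ball_of_hasFDerivAt hτ hA))
  choose h₁ h₂ h₁₂ using fun y : V => (hV y y.2).1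
  let j : C(V, Ω₁) := ⟨fun y => ⟨y, h₁ y⟩, by fun_prop⟩
  have hj : Topology.IsOpenEmbedding j :=
    Topology.IsOpenEmbedding.of_comp j (isOpenEmbedding_inclusion hΩ₁)
      (isOpenEmbedding_inclusion hVo)
  have hτV : Continuous fun y : V => (⟨τ y, h₂ y⟩ : Ω₂) := by
    rw [hg₂.continuous_iff]
    exact (g₁.comp j).continuous.congr h₁₂
  let τV : C(V, Ω₂) := ⟨fun y => ⟨τ y, h₂ y⟩, hτV⟩
  have hcomp : g₂.comp τV = g₁.comp j := ContinuousMap.ext fun y => (h₁₂ y).symm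
  let aV : V := ⟨a₁, haV⟩
  have hjaV : j '' {aV} = {a₁} := Set.image_singleton
  obtain ⟨z', hz', hstd, hzz'⟩ := hz
  obtain ⟨z'', hz'', hlift⟩ := exists_push_sub_mem_relBd hj (K := {aV})
    (by rw [hjaV]; exact isClosed_singleton) (z := z') (by rw [hjaV]; exact hz')
  rw [hjaV] at hlift
  have hmap : Set.MapsTo τV {aV}ᶜ {a₂}ᶜ := by
    intro y hy h
    have h3 : g₁ (j y) = g₁ a₁ := by
      rw [ha, ← (h : τV y = a₂)]
      exact h₁₂ y
    exact hy (Subtype.ext (congr_arg (Subtype.val : Ω₁ → _) (hg₁ h3)))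
  refine ⟨push R (sgMap τV) (d + 1) z'', push_mem_relCyc τV hmap hz'', ?_, ?_⟩
  · -- compare `τ` with the affine map `aff` and use the action of its linear part
    let M := LinearMap.toMatrix' A.toLinearMap
    have hM : ∀ v, M.mulVec v = A v := fun v => LinearMap.toMatrix'_mulVec _ _
    let aff : C(Fin d → ℝ, Fin d → ℝ) := ⟨fun y => (a₂ : Fin d → ℝ) + A (y - a₁), by fun_prop⟩
    have haff : aff.comp (translate (a₁ : Fin d → ℝ)) = (translate (a₂ : Fin d → ℝ)).comp (mulVecMap M) := by
      ext1 y
      change (a₂ : Fin d → ℝ) + A (y + a₁ - a₁) = M.mulVec y + a₂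
      rw [add_sub_cancel_right, hM, add_comm]
    have hmaps : Set.MapsTo aff {(a₁ : Fin d → ℝ)}ᶜ {(a₂ : Fin d → ℝ)}ᶜ := by
      intro y hy h
      have h3 : A (y - a₁) = 0 := by
        have : (a₂ : Fin d → ℝ) + A (y - a₁) = a₂ := h
        exact add_eq_left.mp this
      have hdet : M.det ≠ 0 := by rwa [LinearMap.det_toMatrix']
      exact hy (sub_eq_zero.mp (Matrix.eq_zero_of_mulVec_eq_zero hdet ((hM _).trans h3)))
    have hτc : Continuous fun y : V => τ y := continuous_subtype_val.comp hτV
    have e1 := push_sub_push_mem_relBd_of_homotopy (f₀ := (inclusion Ω₂).comp τV)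
      (f₁ := aff.comp (inclusion V)) (U := {aV}ᶜ) (V := {(a₂ : Fin d → ℝ)}ᶜ)
      ⟨fun q => (1 - (q.2 : ℝ)) • τ q.1 + (q.2 : ℝ) • ((a₂ : Fin d → ℝ) + A (q.1 - a₁)), by
        have h3 := hτc.comp (continuous_fst (X := V) (Y := unitInterval))
        have h4 : Continuous fun q : V × unitInterval => τ q.1 := h3
        have h5 : Continuous fun q : V × unitInterval => A (q.1 - a₁) :=
          A.continuous.comp (by fun_prop)
        have h6 : Continuous fun q : V × unitInterval => (q.2 : ℝ) := by fun_prop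
        exact ((continuous_const.sub h6).smul h4).add (h6.smul (continuous_const.add h5))⟩
      (fun y => by simp [inclusion, τV]) (fun y => by simp [inclusion, aff])
      (fun y hy t h => hy (Subtype.ext ((hV y y.2).2 t t.2 (by rw [ha₂]; exact h)))) hz''
    have e2 := push_mem_relBd aff hmaps (push_mem_relBd (inclusion Ω₁)
      (mapsTo_compl_singleton Subtype.val_injective a₁) hlift)
    have e3 := push_mem_relBd aff hmaps hstd
    have e4 := push_mem_relBd (translate (a₂ : Fin d → ℝ)) (U := {0}ᶜ) (V := {(a₂ : Fin d → ℝ)}ᶜ)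
      (fun y hy h => hy (add_eq_right.mp h)) (hw M u (by rwa [LinearMap.det_toMatrix']))
    have h5 : push R (sgMap aff) (d + 1) (stdAt R (a₁ : Fin d → ℝ)) =
        push R (sgMap (translate (a₂ : Fin d → ℝ))) (d + 1)
          (push R (sgMap (mulVecMap M)) (d + 1) (stdClass R d)) := by
      rw [stdAt, ← push_sgMap_comp, haff, push_sgMap_comp]
    have h6 : push R (sgMap (aff.comp (inclusion V))) (d + 1) z'' = push R (sgMap aff) (d + 1)
        (push R (sgMap (inclusion Ω₁)) (d + 1) (push R (sgMap j) (d + 1) z'')) := by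
      rw [← push_sgMap_comp R (inclusion Ω₁) j, ← push_sgMap_comp]
      rfl
    rw [push_sgMap_comp R (inclusion Ω₂) τV, h6] at e1
    rw [map_sub, map_sub] at e2
    rw [map_sub, map_smul, h5] at e3
    rw [map_sub, map_smul] at e4
    have h7 := Submodule.add_mem _ (Submodule.sub_mem _ (Submodule.sub_mem _ e3 e2) e1)
      (Submodule.smul_mem _ r e4)
    convert h7 using 1
    rw [smul_sub, smul_smul, mul_comm (w u) r, stdAt]
    abel
  · rw [← push_sgMap_comp, hcomp, push_sgMap_comp]
    have := Submodule.add_mem _ hzz' (push_mem_relBd g₁ (mapsTo_compl_singleton hg₁ a₁) hlift)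
    rw [map_sub, sub_add_sub_cancel] at this
    rwa [← ha]

end Transition

/-! ### Charts of the disjoint cone along the boundary -/

section HalfSpace

variable {d : ℕ} [NeZero d]

/-- The coordinates of a point of the half-space. -/
def halfCoord (h : EuclideanHalfSpace d) : Fin d → ℝ := WithLp.ofLp ((𝓡∂ d) h)

/-- The retraction of `ℝᵈ` onto the half-space. -/
def toHalf (y : Fin d → ℝ) : EuclideanHalfSpace d := (𝓡∂ d).symm (WithLp.toLp 2 y)

theorem continuous_halfCoord : Continuous (halfCoord (d := d)) :=
  (PiLp.continuous_ofLp 2 _).comp (𝓡∂ d).continuous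

theorem continuous_toHalf : Continuous (toHalf (d := d)) :=
  (𝓡∂ d).continuous_symm.comp (PiLp.continuous_toLp 2 _)

theorem halfCoord_nonneg (h : EuclideanHalfSpace d) : 0 ≤ halfCoord h 0 := h.2

theorem halfCoord_toHalf (y : Fin d → ℝ) :
    halfCoord (toHalf y) = Function.update y 0 (max (y 0) 0) := rfl

theorem toHalf_halfCoord (h : EuclideanHalfSpace d) : toHalf (halfCoord h) = h :=
  (𝓡∂ d).left_inv h

theorem halfCoord_injective : Function.Injective (halfCoord (d := d)) :=
  Function.LeftInverse.injective toHalf_halfCoord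

theorem halfCoord_toHalf_of_nonneg {y : Fin d → ℝ} (hy : 0 ≤ y 0) : halfCoord (toHalf y) = y := by
  rw [halfCoord_toHalf, max_eq_left hy, Function.update_eq_self]

theorem halfCoord_toHalf_of_nonpos {y : Fin d → ℝ} (hy : y 0 ≤ 0) :
    halfCoord (toHalf y) = Function.update y 0 0 := by
  rw [halfCoord_toHalf, max_eq_right hy]

theorem toHalf_sub_single {h : EuclideanHalfSpace d} (hh : halfCoord h 0 = 0) {t : ℝ} (ht : 0 ≤ t) :
    toHalf (halfCoord h - Pi.single 0 t) = h := by
  refine halfCoord_injective ?_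
  rw [halfCoord_toHalf_of_nonpos (by simp [hh, ht])]
  ext i
  by_cases hi : i = 0
  · subst hi
    simp [hh]
  · simp [hi]

end HalfSpace

section Collar

variable {d : ℕ} [NeZero d] {M : Type u} [TopologicalSpace M] {s : ℕ} {B : Fin s → Set M}

variable (B) in
/-- The point of height `t` over `m`: it lies on the `i`-th cone if `m ∈ Bᵢ`, and is `m` itself if
`m` lies in none of these sets. -/
def cylAt (q : M × unitInterval) : DCone B :=
  open Classical in
  if h : ∃ i, q.1 ∈ B i then DCone.cyl B h.choose (⟨q.1, h.choose_spec⟩, q.2) else DCone.of B q.1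

theorem cylAt_zero (m : M) : cylAt B (m, 0) = DCone.of B m := by
  unfold cylAt
  split_ifs with h
  · exact DCone.cyl_zero B h.choose ⟨m, h.choose_spec⟩
  · rfl

variable (hdis : ∀ i j, i ≠ j → Disjoint (B i) (B j))

include hdis in
theorem cylAt_of_mem {i : Fin s} {m : M} (hm : m ∈ B i) (t : unitInterval) :
    cylAt B (m, t) = DCone.cyl B i (⟨m, hm⟩, t) := by
  have h : ∃ i, m ∈ B i := ⟨i, hm⟩
  have hi : h.choose = i := by
    by_contra hne
    exact Set.disjoint_left.mp (hdis _ _ hne) h.choose_spec hm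
  unfold cylAt
  rw [dif_pos h]
  have key : ∀ j (hj : j = i) (hmj : m ∈ B j),
      DCone.cyl B j (⟨m, hmj⟩, t) = DCone.cyl B i (⟨m, hm⟩, t) := by
    rintro j rfl _
    rfl
  exact key _ hi _

include hdis in
theorem continuousOn_cylAt (hcl : ∀ i, IsClosed (B i)) :
    ContinuousOn (cylAt B) (⋃ i, B i ×ˢ Set.univ) := by
  refine (locallyFinite_of_finite _).continuousOn_iUnion (fun i => (hcl i).prod isClosed_univ)
    fun i => ?_
  rw [continuousOn_iff_continuous_domRestrict]
  have : Continuous fun q : ↥(B i ×ˢ (Set.univ : Set unitInterval)) =>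
      DCone.cyl B i (⟨q.1.1, q.2.1⟩, q.1.2) := by fun_prop
  exact this.congr fun q => (cylAt_of_mem hdis q.2.1 q.1.2).symm

variable (e : OpenPartialHomeomorph M (EuclideanHalfSpace d))

/-- The domain of the chart of the disjoint cone extending the chart `e`: the points with first
coordinate in `(-1, 0)` correspond to points of the cones. -/
def collarDomain : Set (Fin d → ℝ) := {y | toHalf y ∈ e.target ∧ -1 < y 0}

theorem isOpen_collarDomain : IsOpen (collarDomain e) :=
  (e.open_target.preimage continuous_toHalf).inter
    (isOpen_lt continuous_const (continuous_apply (0 : Fin d)))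

variable {e}

theorem halfCoord_mem_collarDomain {m : M} (hm : m ∈ e.source) :
    halfCoord (e m) ∈ collarDomain e :=
  ⟨by rw [toHalf_halfCoord]; exact e.map_source hm,
    lt_of_lt_of_le (by norm_num) (halfCoord_nonneg _)⟩

theorem exists_mem_of_nonpos (hB : ∀ m ∈ e.source, (∃ i, m ∈ B i) ↔ halfCoord (e m) 0 = 0)
    {y : Fin d → ℝ} (hy : y ∈ collarDomain e) (hy0 : y 0 ≤ 0) : ∃ i, e.symm (toHalf y) ∈ B i := by
  rw [hB _ (e.map_target hy.1), e.right_inv hy.1, halfCoord_toHalf_of_nonpos hy0,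
    Function.update_self]

variable (B e) in
/-- The chart of the disjoint cone extending the chart `e`. -/
def collarFun (y : collarDomain e) : DCone B :=
  cylAt B (e.symm (toHalf y), Set.projIcc 0 1 zero_le_one (-(y : Fin d → ℝ) 0))

theorem collarFun_of_nonneg (y : collarDomain e) (hy : 0 ≤ (y : Fin d → ℝ) 0) :
    collarFun B e y = DCone.of B (e.symm (toHalf y)) := by
  rw [collarFun, Set.projIcc_of_le_left _ (neg_nonpos.mpr hy)]
  exact cylAt_zero _

include hdis in
theorem continuous_collarFun (hcl : ∀ i, IsClosed (B i))
    (hB : ∀ m ∈ e.source, (∃ i, m ∈ B i) ↔ halfCoord (e m) 0 = 0) :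
    Continuous (collarFun B e) := by
  have hsymm : Continuous fun y : collarDomain e => e.symm (toHalf y) :=
    e.continuousOn_symm.comp_continuous (continuous_toHalf.comp continuous_subtype_val)
      fun y => y.2.1
  have hc0 : Continuous fun y : collarDomain e => (y : Fin d → ℝ) 0 :=
    (continuous_apply (0 : Fin d)).comp continuous_subtype_val
  rw [← continuousOn_univ]
  have hun : Set.univ = ({y : ↥(collarDomain e) | 0 ≤ (y : Fin d → ℝ) 0} ∪
      {y : ↥(collarDomain e) | (y : Fin d → ℝ) 0 ≤ 0} : Set ↥(collarDomain e)) :=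
    (Set.eq_univ_of_forall fun y : ↥(collarDomain e) => le_total 0 ((y : Fin d → ℝ) 0)).symm
  rw [hun]
  refine ContinuousOn.union_of_isClosed ?_ ?_ (isClosed_le continuous_const hc0)
    (isClosed_le hc0 continuous_const)
  · exact ((DCone.of B).continuous.comp hsymm).continuousOn.congr
      fun y hy => collarFun_of_nonneg y hy
  · refine (continuousOn_cylAt hdis hcl).comp (Continuous.continuousOn ?_) fun y hy => ?_
    · exact hsymm.prodMk (continuous_projIcc.comp hc0.neg)
    · obtain ⟨i, hi⟩ := exists_mem_of_nonpos hB y.2 hy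
      exact Set.mem_iUnion.mpr ⟨i, hi, trivial⟩

variable (B e) in
/-- The inverse of `collarFun`: the first coordinate is lowered by the height. -/
def collarInv (z : DCone B) : Fin d → ℝ :=
  (DCone.base z).elim 0 fun m => halfCoord (e m) - Pi.single 0 (∑ i, DCone.height i z)

theorem collarInv_eq {z : DCone B} {m : M} (h : DCone.base z = some m) :
    collarInv B e z = halfCoord (e m) - Pi.single 0 (∑ i, DCone.height i z) := by
  rw [collarInv, h]
  rfl

theorem sum_height_cyl (i : Fin s) (q : B i × unitInterval) :
    ∑ j, DCone.height j (DCone.cyl B i q) = q.2 := by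
  simp only [DCone.height_cyl]
  rw [Finset.sum_ite_eq]
  simp

theorem sum_height_of (m : M) : ∑ j, DCone.height j (DCone.of B m) = 0 :=
  Finset.sum_eq_zero fun _ _ => rfl

variable (B e) in
/-- The range of `collarFun`. -/
def collarRange : Set (DCone B) := {z | ∃ m ∈ e.source, DCone.base z = some m}

theorem continuousOn_collarInv : ContinuousOn (collarInv B e) (collarRange B e) := by
  rw [continuousOn_iff_continuous_domRestrict]
  choose m hm hbase using fun z : collarRange B e => z.2
  have hmc : Continuous m := by
    refine continuous_def.mpr fun U hU => ?_
    have h := (DCone.isOpen_base (A := B) hU).preimage (continuous_subtype_val (p := (· ∈ collarRange B e)))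
    convert h using 1
    ext z
    refine ⟨fun hz => ⟨m z, hz, hbase z⟩, fun ⟨m', hm', hb⟩ => ?_⟩
    have : m z = m' := Option.some_injective _ ((hbase z).symm.trans hb)
    rw [Set.mem_preimage, this]
    exact hm'
  have hem : Continuous fun z => e (m z) := e.continuousOn.comp_continuous hmc hm
  have h1 : Continuous fun z : collarRange B e =>
      halfCoord (e (m z)) - (Pi.single 0 (∑ i, DCone.height i (z : DCone B)) : Fin d → ℝ) := by
    refine (continuous_halfCoord.comp hem).sub ?_
    have h2 : Continuous fun z : collarRange B e => ∑ i, DCone.height i (z : DCone B) := by fun_prop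
    exact (continuous_single (A := fun _ : Fin d => ℝ) 0).comp h2
  exact h1.congr fun z => (collarInv_eq (hbase z)).symm

include hdis in
/-- The coordinates `collarInv` recover the point of `ℝᵈ`: the height in the cone is minus the first
coordinate. -/
theorem collarInv_collarFun (hB : ∀ m ∈ e.source, (∃ i, m ∈ B i) ↔ halfCoord (e m) 0 = 0)
    (y : collarDomain e) :
    collarFun B e y ∈ collarRange B e ∧ collarInv B e (collarFun B e y) = y := by
  have hsrc := e.map_target y.2.1
  rcases le_or_gt 0 ((y : Fin d → ℝ) 0) with hy | hy
  · rw [collarFun_of_nonneg y hy]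
    refine ⟨⟨_, hsrc, DCone.base_of _⟩, ?_⟩
    rw [collarInv_eq (DCone.base_of _), sum_height_of, Pi.single_zero, sub_zero, e.right_inv y.2.1,
      halfCoord_toHalf_of_nonneg hy]
  · obtain ⟨i, hi⟩ := exists_mem_of_nonpos hB y.2 hy.le
    have h1 : (Set.projIcc (0 : ℝ) 1 zero_le_one (-(y : Fin d → ℝ) 0) : ℝ) = -(y : Fin d → ℝ) 0 := by
      rw [Set.projIcc_of_mem _ ⟨(neg_pos.mpr hy).le, by have := y.2.2; linarith⟩]
    have hb : DCone.base (collarFun B e y) = some (e.symm (toHalf y)) := by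
      rw [collarFun, cylAt_of_mem hdis hi, DCone.base_cyl, if_neg]
      intro h
      have := congr_arg Subtype.val h
      rw [h1] at this
      have h2 := y.2.2
      have h3 : -(y : Fin d → ℝ) 0 = 1 := this
      linarith
    refine ⟨⟨_, hsrc, hb⟩, ?_⟩
    rw [collarInv_eq hb, collarFun, cylAt_of_mem hdis hi, sum_height_cyl, h1, e.right_inv y.2.1,
      halfCoord_toHalf_of_nonpos hy.le]
    ext k
    by_cases hk : k = 0
    · subst hk
      simp
    · simp [hk]

include hdis in
/-- The chart reaches all points lying over the domain of `e`. -/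
theorem exists_collarFun_eq (hB : ∀ m ∈ e.source, (∃ i, m ∈ B i) ↔ halfCoord (e m) 0 = 0)
    {z : DCone B} (hz : z ∈ collarRange B e) :
    ∃ h : collarInv B e z ∈ collarDomain e, collarFun B e ⟨collarInv B e z, h⟩ = z := by
  obtain ⟨m, hm, hb⟩ := hz
  induction z using DCone.ind with
  | h1 m' =>
    obtain rfl : m' = m := Option.some_injective _ hb
    have h1 : collarInv B e (DCone.of B m') = halfCoord (e m') := by
      rw [collarInv_eq hb, sum_height_of, Pi.single_zero, sub_zero]
    simp only [h1]
    refine ⟨halfCoord_mem_collarDomain hm, ?_⟩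
    rw [collarFun_of_nonneg _ (halfCoord_nonneg _), toHalf_halfCoord, e.left_inv hm]
  | h2 i q =>
    have hb' := hb
    rw [DCone.base_cyl] at hb'
    have hq1 : q.2 ≠ 1 := fun h => by rw [if_pos h] at hb'; simp at hb'
    rw [if_neg hq1] at hb'
    obtain rfl : (q.1 : M) = m := Option.some_injective _ hb'
    have h0 : halfCoord (e (q.1 : M)) 0 = 0 := (hB _ hm).mp ⟨i, q.1.2⟩
    have h1 : collarInv B e (DCone.cyl B i q) = halfCoord (e (q.1 : M)) - Pi.single 0 (q.2 : ℝ) := by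
      rw [collarInv_eq hb, sum_height_cyl]
    have h2 : toHalf (halfCoord (e (q.1 : M)) - Pi.single 0 (q.2 : ℝ)) = e (q.1 : M) :=
      toHalf_sub_single h0 q.2.2.1
    have h3 : (halfCoord (e (q.1 : M)) - Pi.single 0 (q.2 : ℝ) : Fin d → ℝ) 0 = -(q.2 : ℝ) := by
      simp [h0]
    simp only [h1]
    refine ⟨⟨?_, ?_⟩, ?_⟩
    · rw [h2]
      exact e.map_source hm
    · rw [h3]
      have : (q.2 : ℝ) < 1 := lt_of_le_of_ne q.2.2.2 fun h => hq1 (Subtype.ext h)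
      linarith
    · simp only [collarFun, h2, h3, neg_neg, Set.projIcc_val, e.left_inv hm]
      exact cylAt_of_mem hdis q.1.2 q.2
  | h3 i => simp at hb

include hdis in
/-- The extended chart is an open embedding, since its inverse is continuous on an open range. -/
theorem isOpenEmbedding_collarFun (hcl : ∀ i, IsClosed (B i))
    (hB : ∀ m ∈ e.source, (∃ i, m ∈ B i) ↔ halfCoord (e m) 0 = 0) :
    Topology.IsOpenEmbedding (collarFun B e) := by
  refine Topology.IsOpenEmbedding.of_continuous_injective_isOpenMap
    (continuous_collarFun hdis hcl hB) (fun y y' h => ?_) fun U hU => ?_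
  · have h1 := (collarInv_collarFun hdis hB y).2
    rw [h, (collarInv_collarFun hdis hB y').2] at h1
    exact Subtype.ext h1.symm
  · obtain ⟨U', hU', rfl⟩ := isOpen_induced_iff.mp hU
    have hop := continuousOn_collarInv.isOpen_inter_preimage
      (DCone.isOpen_base (A := B) e.open_source) hU' (f := collarInv B e)
    convert hop using 1
    ext z
    constructor
    · rintro ⟨y, hy, rfl⟩
      obtain ⟨h1, h2⟩ := collarInv_collarFun hdis hB y
      exact ⟨h1, by rw [Set.mem_preimage, h2]; exact hy⟩
    · rintro ⟨h1, h2⟩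
      obtain ⟨h3, h4⟩ := exists_collarFun_eq hdis hB h1
      exact ⟨⟨_, h3⟩, h2, h4⟩

variable (B e) in
/-- The chart of the disjoint cone extending the chart `e`, as a continuous map. -/
def collarChart (hdis : ∀ i j, i ≠ j → Disjoint (B i) (B j)) (hcl : ∀ i, IsClosed (B i))
    (hB : ∀ m ∈ e.source, (∃ i, m ∈ B i) ↔ halfCoord (e m) 0 = 0) : C(collarDomain e, DCone B) :=
  ⟨collarFun B e, continuous_collarFun hdis hcl hB⟩

end Collar

/-! ### The fundamental class -/

section Fundamental

variable {R : Type*} [CommRing R] {d : ℕ}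

/-- Each point has arbitrarily small box neighbourhoods with edges of length at most `1`. -/
theorem exists_box {a : Fin d → ℝ} {W : Set (Fin d → ℝ)} (hW : W ∈ 𝓝 a) :
    ∃ p q : Fin d → ℝ, p ≤ q ∧ q ≤ p + 1 ∧ Set.Icc p q ⊆ W ∧ Set.Icc p q ∈ 𝓝 a := by
  obtain ⟨δ, hδ, hsub⟩ := Metric.nhds_basis_closedBall.mem_iff.mp hW
  have hη : 0 < min δ (1 / 2) := lt_min hδ (by norm_num)
  refine ⟨fun i => a i - min δ (1 / 2), fun i => a i + min δ (1 / 2), fun i => ?_, fun i => ?_,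
    fun y hy => hsub ?_, pi_Icc_mem_nhds (fun i => ?_) fun i => ?_⟩
  · dsimp only
    linarith
  · have := min_le_right δ (1 / 2)
    simp only [Pi.add_apply, Pi.one_apply]
    linarith
  · rw [Metric.mem_closedBall, dist_pi_le_iff hδ.le]
    intro i
    have h1 := hy.1 i
    have h2 := hy.2 i
    have := min_le_left δ (1 / 2)
    dsimp only at h1 h2
    rw [Real.dist_eq, abs_le]
    constructor <;> linarith
  · linarith
  · linarith

/-- The points at which a chain bounds form an open set. -/
theorem isOpen_setOf_mem_relBd {X : Type v} [TopologicalSpace X] [T2Space X]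
    (z : (sg X).obj (d + 1) →₀ R) : IsOpen {x | z ∈ relBd R {x}ᶜ d} := by
  refine isOpen_iff_mem_nhds.mpr fun x hx => ?_
  obtain ⟨b, w, hw, rfl⟩ := mem_relBd.mp hx
  obtain ⟨S, hSx, hS, hwS⟩ := exists_isCompact_supp hw
  have hxS : x ∉ S := fun h => hSx h rfl
  filter_upwards [hS.isClosed.isOpen_compl.mem_nhds hxS] with y hy
  exact mem_relBd.mpr ⟨b, w, supp_mono (Set.subset_compl_singleton_iff.mpr hy) _ hwS, rfl⟩

variable {X : Type v} [TopologicalSpace X] [T2Space X] {M : Type u} [TopologicalSpace M]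
  {ι : C(M, X)} {Ω : M → Set (Fin d → ℝ)} {g : ∀ p, C(Ω p, X)} {a : ∀ p, Ω p}
  {w : ℤˣ → R} {ε : M → ℤˣ} {D : Set M}

/-- Near each point there is a relative cycle inducing the local orientations of all nearby
points. -/
theorem exists_local_orientation (hΩ : ∀ p, IsOpen (Ω p))
    (hg : ∀ p, Topology.IsOpenEmbedding (g p)) (ha : ∀ p, g p (a p) = ι p)
    (hwm : ∀ u u', w (u * u') = w u * w u') (hD : Dense D)
    (hcompat : ∀ p, ∀ᶠ q in 𝓝 p, q ∈ D → ∃ y : Ω p, g p y = ι q ∧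
      ∀ (r : R) z, IsLocalClass (g q) (a q) r z → IsLocalClass (g p) y (w (ε p * ε q) * r) z)
    (p : M) :
    ∃ N ∈ 𝓝 p, ∃ z ∈ relCyc R (ι '' N)ᶜ d, ∀ q ∈ N, IsLocalClass (g q) (a q) (w (ε q)) z := by
  have hww : ∀ u u' : ℤˣ, w (u * u') * w u' = w u := fun u u' => by
    rw [← hwm, mul_assoc, Int.units_mul_self, mul_one]
  have hnhds : ∀ q (K : Set (Fin d → ℝ)), K ∈ 𝓝 (a q : Fin d → ℝ) →
      g q '' (Subtype.val ⁻¹' K) ∈ 𝓝 (ι q) := fun q K hK => by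
    rw [← ha q]
    exact (hg q).image_mem_nhds.mpr (continuous_subtype_val.continuousAt.preimage_mem_nhds hK)
  obtain ⟨b, c, hbc, hcb, hsub, hnh⟩ := exists_box ((hΩ p).mem_nhds (a p).2)
  obtain ⟨z, hz, hzloc⟩ := exists_box_class (hΩ p) (g p) (hg p).injective hsub hbc hcb (w (ε p))
  have hKp : g p '' boxIn (Ω p) b c ∈ 𝓝 (ι p) := hnhds p _ hnh
  have key : ∀ q ∈ D, ι q ∈ g p '' boxIn (Ω p) b c → (q ∈ D → ∃ y : Ω p, g p y = ι q ∧
      ∀ (r : R) z, IsLocalClass (g q) (a q) r z → IsLocalClass (g p) y (w (ε p * ε q) * r) z) →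
      IsLocalClass (g q) (a q) (w (ε q)) z := by
    rintro q hqD ⟨y, hy, hyq⟩ hq
    obtain ⟨y', hy', htr⟩ := hq hqD
    obtain rfl : y = y' := (hg p).injective (hyq.trans hy'.symm)
    obtain ⟨z', hz'⟩ := exists_isLocalClass (hΩ q) (g q) (a q) (w (ε q))
    have h1 := htr _ _ hz'
    rw [hww] at h1
    refine hz'.congr ?_
    rw [ha q, ← hyq]
    exact h1.sub_mem (hΩ p) (hg p) (hzloc y hy)
  have hN : ∀ᶠ q in 𝓝 p, ∀ᶠ q' in 𝓝 q, ι q' ∈ interior (g p '' boxIn (Ω p) b c) ∧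
      (q' ∈ D → ∃ y : Ω p, g p y = ι q' ∧
      ∀ (r : R) z, IsLocalClass (g q') (a q') r z → IsLocalClass (g p) y (w (ε p * ε q') * r) z) :=
    eventually_eventually_nhds.mpr ((ι.continuous.continuousAt.eventually
      (interior_mem_nhds.mpr hKp)).and (hcompat p))
  refine ⟨_, hN, z, relCyc_mono (Set.compl_subset_compl.mpr ?_) d hz, fun q hq => ?_⟩
  · rintro _ ⟨q, hq, rfl⟩
    exact interior_subset hq.self_of_nhds.1
  · have hq0 : ι q ∈ interior (g p '' boxIn (Ω p) b c) := hq.self_of_nhds.1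
    -- On a small box around `q` the class `z` is constant, so it can be computed at points of `D`.
    have h1 : g q ⁻¹' interior (g p '' boxIn (Ω p) b c) ∈ 𝓝 (a q) :=
      (g q).continuous.continuousAt.preimage_mem_nhds
        (by rw [ha q]; exact isOpen_interior.mem_nhds hq0)
    obtain ⟨b', c', hbc', hcb', hsub', hnh'⟩ :=
      exists_box ((hΩ q).isOpenEmbedding_subtypeVal.image_mem_nhds.mpr h1)
    have hsubΩ : Set.Icc b' c' ⊆ Ω q := hsub'.trans (Subtype.coe_image_subset _ _)
    have himg : g q '' boxIn (Ω q) b' c' ⊆ g p '' boxIn (Ω p) b c := by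
      rintro _ ⟨y, hy, rfl⟩
      obtain ⟨y', hy', hyy⟩ := hsub' hy
      rw [← Subtype.ext hyy]
      exact interior_subset hy'
    obtain ⟨r, hr⟩ := exists_isLocalClass_of_box (hg q) hsubΩ hbc' hcb'
      (relCyc_mono (Set.compl_subset_compl.mpr himg) d hz)
    have hKq : g q '' boxIn (Ω q) b' c' ∈ 𝓝 (ι q) := hnhds q _ hnh'
    obtain ⟨q', hq'D, ⟨hq'1, hq'2⟩, hq'3, y, hy, hyq⟩ := ((mem_closure_iff_frequently.mp (hD q)).and_eventually
      (hq.and ((hcompat q).and (ι.continuous.continuousAt.eventually hKq)))).exists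
    obtain ⟨y', hy', htr⟩ := hq'3 hq'D
    obtain rfl : y = y' := (hg q).injective (hyq.trans hy'.symm)
    have h2 := htr _ _ (key q' hq'D (interior_subset hq'1) hq'2)
    rw [hww] at h2
    rw [← (hr y hy).unique (hΩ q) (hg q) h2]
    exact hr (a q) (mem_of_mem_nhds hnh')

variable [CompactSpace M] [T2Space M]

/-- Relative top-dimensional cycles modulo the complement of a compact manifold are detected by
their local classes. -/
theorem detected_of_charts (hι : Function.Injective ι) (hΩ : ∀ p, IsOpen (Ω p))
    (hg : ∀ p, Topology.IsOpenEmbedding (g p)) (ha : ∀ p, g p (a p) = ι p) {T : Set M}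
    (hT : IsClosed T) : Detected R d (ι '' T) := by
  have hnh : ∀ p, ∃ N ∈ 𝓝 p, IsClosed N ∧ ι '' N ⊆ Set.range (g p) := fun p => by
    have h1 : ι ⁻¹' Set.range (g p) ∈ 𝓝 p := ι.continuous.continuousAt.preimage_mem_nhds
      ((hg p).isOpen_range.mem_nhds (by rw [← ha p]; exact Set.mem_range_self _))
    obtain ⟨N, hN, hNc, hNs⟩ := exists_mem_nhds_isClosed_subset h1
    exact ⟨N, hN, hNc, Set.image_subset_iff.mpr hNs⟩
  choose N hN hNc hNr using hnh
  obtain ⟨t, ht⟩ := CompactSpace.elim_nhds_subcover N hN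
  suffices h : ∀ t : Finset M, ∀ T : Set M, IsClosed T →
      Detected R d (ι '' (T ∩ ⋃ p ∈ t, N p)) by
    have := h t T hT
    rwa [ht, Set.top_eq_univ, Set.inter_univ] at this
  have hcl : ∀ {S : Set M}, IsClosed S → IsClosed (ι '' S) := fun hS =>
    (hS.isCompact.image ι.continuous).isClosed
  classical
  intro t
  induction t using Finset.induction_on with
  | empty =>
    intro T _
    simpa using detected_empty (R := R) (X := X) d
  | insert p t _ ih =>
    intro T hT
    have hU : IsClosed (⋃ q ∈ t, N q) := t.finite_toSet.isClosed_biUnion fun q _ => hNc q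
    rw [Finset.set_biUnion_insert, Set.inter_union_distrib_left, Set.image_union]
    refine Detected.union (hcl (hT.inter (hNc p))) (hcl (hT.inter hU)) ?_ (ih T hT) ?_
    · exact detected_of_chart (hΩ p) (hg p)
        ((hT.inter (hNc p)).isCompact.image ι.continuous)
        ((Set.image_mono Set.inter_subset_right).trans (hNr p))
    · rw [← Set.image_inter hι]
      have := ih _ (hT.inter (hNc p))
      rwa [show T ∩ N p ∩ (T ∩ ⋃ q ∈ t, N q) = T ∩ N p ∩ ⋃ q ∈ t, N q by
        ext m
        simp only [Set.mem_inter_iff]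
        tauto]

/-- The local orientations come from a global relative cycle. -/
theorem exists_orientation_class (hι : Function.Injective ι) (hΩ : ∀ p, IsOpen (Ω p))
    (hg : ∀ p, Topology.IsOpenEmbedding (g p)) (ha : ∀ p, g p (a p) = ι p)
    (hwm : ∀ u u', w (u * u') = w u * w u') (hD : Dense D)
    (hcompat : ∀ p, ∀ᶠ q in 𝓝 p, q ∈ D → ∃ y : Ω p, g p y = ι q ∧
      ∀ (r : R) z, IsLocalClass (g q) (a q) r z → IsLocalClass (g p) y (w (ε p * ε q) * r) z) :
    ∃ z ∈ relCyc R (Set.range ι)ᶜ d, ∀ q, IsLocalClass (g q) (a q) (w (ε q)) z := by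
  have hnh : ∀ p, ∃ N ∈ 𝓝 p, IsClosed N ∧ ∃ z ∈ relCyc R (ι '' N)ᶜ d,
      ∀ q ∈ N, IsLocalClass (g q) (a q) (w (ε q)) z := fun p => by
    obtain ⟨N₀, hN₀, z, hz, hzl⟩ := exists_local_orientation hΩ hg ha hwm hD hcompat p
    obtain ⟨N, hN, hNc, hNs⟩ := exists_mem_nhds_isClosed_subset hN₀
    exact ⟨N, hN, hNc, z, relCyc_mono (Set.compl_subset_compl.mpr (Set.image_mono hNs)) d hz,
      fun q hq => hzl q (hNs hq)⟩
  choose N hN hNc z hz hzl using hnh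
  obtain ⟨t, ht⟩ := CompactSpace.elim_nhds_subcover N hN
  suffices h : ∀ t : Finset M, ∃ z ∈ relCyc R (ι '' ⋃ p ∈ t, N p)ᶜ d,
      ∀ q ∈ ⋃ p ∈ t, N p, IsLocalClass (g q) (a q) (w (ε q)) z by
    obtain ⟨z, hz, hzl⟩ := h t
    rw [ht, Set.top_eq_univ] at hz hzl
    rw [Set.image_univ] at hz
    exact ⟨z, hz, fun q => hzl q (Set.mem_univ q)⟩
  have hcl : ∀ {S : Set M}, IsClosed S → IsClosed (ι '' S) := fun hS =>
    (hS.isCompact.image ι.continuous).isClosed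
  classical
  intro t
  induction t using Finset.induction_on with
  | empty =>
    refine ⟨0, Submodule.zero_mem _, fun q hq => ?_⟩
    simp at hq
  | insert p t _ ih =>
    obtain ⟨z', hz', hzl'⟩ := ih
    have hU : IsClosed (⋃ q ∈ t, N q) := t.finite_toSet.isClosed_biUnion fun q _ => hNc q
    -- by detection, classes with the same values at the points of the overlap agree there
    have hd : z p - z' ∈ relBd R ((ι '' N p)ᶜ ∪ (ι '' ⋃ q ∈ t, N q)ᶜ) d := by
      rw [← Set.compl_inter, ← Set.image_inter hι]
      refine (detected_of_charts hι hΩ hg ha ((hNc p).inter hU)).2 _ ?_ ?_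
      · rw [Set.image_inter hι, Set.compl_inter]
        exact Submodule.sub_mem _ (relCyc_mono Set.subset_union_left d (hz p))
          (relCyc_mono Set.subset_union_right d hz')
      · rintro _ ⟨q, hq, rfl⟩
        rw [← ha q]
        exact (hzl p q hq.1).sub_mem (hΩ q) (hg q) (hzl' q hq.2)
    obtain ⟨y, hy, hy1, hy2⟩ := exists_glue (hcl (hNc p)).isOpen_compl (hcl hU).isOpen_compl
      (hz p) hz' hd
    rw [Finset.set_biUnion_insert]
    have hpt : ∀ {S : Set M} {q}, q ∈ S → (ι '' S)ᶜ ⊆ {g q (a q)}ᶜ := fun hq =>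
      Set.compl_subset_compl.mpr (Set.singleton_subset_iff.mpr (by rw [ha]; exact ⟨_, hq, rfl⟩))
    refine ⟨y, by rwa [Set.image_union, Set.compl_union], ?_⟩
    rintro q (hq | hq)
    · refine (hzl p q hq).congr ?_
      rw [← neg_sub]
      exact Submodule.neg_mem _ (relBd_mono (hpt hq) d hy1)
    · refine (hzl' q hq).congr ?_
      rw [← neg_sub]
      exact Submodule.neg_mem _ (relBd_mono (hpt hq) d hy2)

/-- The relative homology of top dimension modulo the complement of a compact connected oriented
manifold is free of rank one. -/
theorem exists_fundamental_class [ConnectedSpace M] (hι : Function.Injective ι)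
    (hΩ : ∀ p, IsOpen (Ω p))
    (hg : ∀ p, Topology.IsOpenEmbedding (g p)) (ha : ∀ p, g p (a p) = ι p)
    (hw1 : w 1 = 1) (hwm : ∀ u u', w (u * u') = w u * w u') (hD : Dense D)
    (hcompat : ∀ p, ∀ᶠ q in 𝓝 p, q ∈ D → ∃ y : Ω p, g p y = ι q ∧
      ∀ (r : R) z, IsLocalClass (g q) (a q) r z → IsLocalClass (g p) y (w (ε p * ε q) * r) z) :
    ∃ z₀ ∈ relCyc R (Set.range ι)ᶜ d,
      (∀ z ∈ relCyc R (Set.range ι)ᶜ d, ∃ r : R, z - r • z₀ ∈ relBd R (Set.range ι)ᶜ d) ∧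
      ∀ r : R, r • z₀ ∈ relBd R (Set.range ι)ᶜ d → r = 0 := by
  obtain ⟨z₀, hz₀, hloc⟩ := exists_orientation_class hι hΩ hg ha hwm hD hcompat
  have hww : ∀ u : ℤˣ, w u * w u = 1 := fun u => by rw [← hwm, Int.units_mul_self, hw1]
  have hpt : ∀ q, (Set.range ι)ᶜ ⊆ {ι q}ᶜ := fun q =>
    Set.compl_subset_compl.mpr (Set.singleton_subset_iff.mpr (Set.mem_range_self q))
  have hzero : ∀ q (r : R), r • z₀ ∈ relBd R {ι q}ᶜ d → r = 0 := fun q r hr => by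
    rw [← ha q] at hr
    have := (((hloc q).smul r).mem_relBd_iff (hΩ q) (hg q)).1 hr
    rw [← mul_one r, ← hww (ε q), ← mul_assoc, this, zero_mul]
  refine ⟨z₀, hz₀, fun z hz => ?_, fun r hr => ?_⟩
  -- at each point, `z` is a multiple of the generator `z₀`
  · have hex : ∀ q, ∃ r : R, z - r • z₀ ∈ relBd R {ι q}ᶜ d := fun q => by
      have hq1 : g q '' boxIn (Ω q) (a q) (a q) = {ι q} := by
        rw [← ha q, ← Set.image_singleton]
        congr 1
        ext y
        rw [boxIn, Set.Icc_self]
        exact Subtype.ext_iff.symm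
      obtain ⟨c, hc⟩ := exists_isLocalClass_of_box (R := R) (hg q) (p := a q) (q := a q) (z := z)
        (by rw [Set.Icc_self, Set.singleton_subset_iff]; exact (a q).2) le_rfl
        (le_add_of_nonneg_right zero_le_one) (by rw [hq1]; exact relCyc_mono (hpt q) d hz)
      refine ⟨c * w (ε q), ?_⟩
      have h2 := (hloc q).smul (c * w (ε q))
      rw [mul_assoc, hww, mul_one] at h2
      rw [← ha q]
      exact (hc (a q) (Set.mem_Icc.mpr ⟨le_rfl, le_rfl⟩)).sub_mem (hΩ q) (hg q) h2
    choose r hr using hex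
    -- the coefficient is locally constant because vanishing at a point is an open condition
    have hconst : IsLocallyConstant r := by
      refine IsLocallyConstant.iff_eventually_eq r |>.mpr fun q => ?_
      have h1 := ι.continuous.continuousAt.eventually
        ((isOpen_setOf_mem_relBd (z - r q • z₀)).mem_nhds (hr q))
      filter_upwards [h1] with q' hq'
      refine sub_eq_zero.mp (hzero q' _ ?_)
      have := Submodule.sub_mem _ hq' (hr q')
      rwa [sub_sub_sub_cancel_left, ← sub_smul] at this
    obtain ⟨c, hc⟩ := hconst.exists_eq_const
    refine ⟨c, ?_⟩
    have hdet := detected_of_charts (R := R) hι hΩ hg ha (isClosed_univ (X := M))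
    rw [Set.image_univ] at hdet
    refine hdet.2 _ (Submodule.sub_mem _ hz (Submodule.smul_mem _ c hz₀)) ?_
    rintro _ ⟨q, rfl⟩
    have := hr q
    rwa [hc] at this
  · obtain ⟨q⟩ : Nonempty M := inferInstance
    exact hzero q r (relBd_mono (hpt q) d hr)

end Fundamental

/-! ### Charts and the boundary of a manifold -/

theorem IsPathComponents.disjoint {X : Type u} [TopologicalSpace X] {S : Set X} {s : ℕ}
    {B : Fin s → Set X} (h : IsPathComponents S B) (i j : Fin s) (hij : i ≠ j) :
    Disjoint (B i) (B j) := by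
  rw [Set.disjoint_left]
  intro m hi hj
  refine hij (h.1 ?_)
  have key : ∀ k, m ∈ B k → B k = pathComponentIn S m := fun k hk => by
    obtain ⟨p, -, hp⟩ : B k ∈ {C | ∃ p ∈ S, C = pathComponentIn S p} := h.2 ▸ Set.mem_range_self k
    rw [hp] at hk ⊢
    exact (pathComponentIn_congr hk).symm
  rw [key i hi, key j hj]

theorem IsPathComponents.exists_mem_iff {X : Type u} [TopologicalSpace X] {S : Set X} {s : ℕ}
    {B : Fin s → Set X} (h : IsPathComponents S B) (m : X) : (∃ i, m ∈ B i) ↔ m ∈ S := by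
  constructor
  · rintro ⟨i, hi⟩
    obtain ⟨p, -, hp⟩ : B i ∈ {C | ∃ p ∈ S, C = pathComponentIn S p} := h.2 ▸ Set.mem_range_self i
    rw [hp] at hi
    exact hi.target_mem
  · intro hm
    obtain ⟨i, hi⟩ : pathComponentIn S m ∈ Set.range B := by
      rw [h.2]
      exact ⟨m, hm, rfl⟩
    exact ⟨i, hi ▸ mem_pathComponentIn_self hm⟩

/-- The path components of a closed, locally path connected set are closed. -/
theorem IsPathComponents.isClosed {X : Type u} [TopologicalSpace X] {S : Set X} {s : ℕ}
    {B : Fin s → Set X} (h : IsPathComponents S B) (hS : IsClosed S)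
    (hloc : ∀ m ∈ S, ∀ᶠ m' in 𝓝 m, m' ∈ S → JoinedIn S m m') (i : Fin s) : IsClosed (B i) := by
  obtain ⟨p, -, hp⟩ : B i ∈ {C | ∃ p ∈ S, C = pathComponentIn S p} := h.2 ▸ Set.mem_range_self i
  rw [hp]
  -- a limit point of the component is joined to a point of the component close to it
  refine isClosed_iff_frequently.mpr fun m hm => ?_
  have hmS : m ∈ S := hS.mem_of_frequently_of_tendsto (hm.mono fun m' hm' => hm'.target_mem)
    Filter.tendsto_id
  obtain ⟨m', hm', hj⟩ := (hm.and_eventually (hloc m hmS)).exists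
  exact JoinedIn.trans hm' (hj hm'.target_mem).symm

section HalfCoord

variable {d : ℕ} [NeZero d] {M : Type u} [TopologicalSpace M]
  (e : OpenPartialHomeomorph M (EuclideanHalfSpace d))

theorem continuousAt_symm_toHalf {m : M} (hm : m ∈ e.source) :
    ContinuousAt (fun y => e.symm (toHalf y)) (halfCoord (e m)) := by
  refine ContinuousAt.comp (g := e.symm) ?_ continuous_toHalf.continuousAt
  rw [toHalf_halfCoord]
  exact e.continuousAt_symm (e.map_source hm)

theorem symm_toHalf_halfCoord {m : M} (hm : m ∈ e.source) : e.symm (toHalf (halfCoord (e m))) = m := by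
  rw [toHalf_halfCoord, e.left_inv hm]

theorem continuousAt_halfCoord {m : M} (hm : m ∈ e.source) :
    ContinuousAt (fun m => halfCoord (e m)) m :=
  continuous_halfCoord.continuousAt.comp (e.continuousAt hm)

theorem collarFun_halfCoord {e : OpenPartialHomeomorph M (EuclideanHalfSpace d)} {s : ℕ}
    {B : Fin s → Set M} {m : M} (hm : m ∈ e.source) :
    collarFun B e ⟨halfCoord (e m), halfCoord_mem_collarDomain hm⟩ = DCone.of B m := by
  rw [collarFun_of_nonneg _ (halfCoord_nonneg _)]
  exact congr_arg _ (symm_toHalf_halfCoord e hm)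

end HalfCoord

section Boundary

variable {d : ℕ} [NeZero d] {M : Type u} [TopologicalSpace M]
  [ChartedSpace (EuclideanHalfSpace d) M]

/-- The boundary is given by the vanishing of the first coordinate in any chart, not only in the
preferred chart at the point. -/
theorem mem_boundary_iff [IsManifold (𝓡∂ d) 1 M] (p : M) {m : M}
    (hm : m ∈ (chartAt (EuclideanHalfSpace d) p).source) :
    m ∈ (𝓡∂ d).boundary M ↔ halfCoord (chartAt (EuclideanHalfSpace d) p m) 0 = 0 := by
  have h1 : (𝓡∂ d).IsInteriorPoint m ↔ 0 < halfCoord (chartAt (EuclideanHalfSpace d) p m) 0 := by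
    rw [ModelWithCorners.isInteriorPoint_iff_of_mem_atlas (n := 1) one_ne_zero
      (chart_mem_atlas _ p) hm]
    have h2 := interior_range_modelWithCornersEuclideanHalfSpace d
    constructor
    · intro h
      have h3 := OpenPartialHomeomorph.interior_extend_target_subset_interior_range _ h
      rw [h2] at h3
      exact h3
    · intro h
      refine OpenPartialHomeomorph.mem_interior_extend_target _
        ((chartAt (EuclideanHalfSpace d) p).map_source hm) ?_
      rw [h2]
      exact h
  have h2 : m ∈ (𝓡∂ d).boundary M ↔ ¬ (𝓡∂ d).IsInteriorPoint m := by
    rw [ModelWithCorners.isInteriorPoint_iff_not_isBoundaryPoint, not_not]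
    rfl
  rw [h2, h1, not_lt]
  exact ⟨fun h => le_antisymm h (halfCoord_nonneg _), fun h => h.le⟩

/-- The boundary is locally path connected. -/
theorem eventually_joinedIn_boundary [IsManifold (𝓡∂ d) 1 M] {m : M} (hm : m ∈ (𝓡∂ d).boundary M) :
    ∀ᶠ m' in 𝓝 m, m' ∈ (𝓡∂ d).boundary M → JoinedIn ((𝓡∂ d).boundary M) m m' := by
  set e := chartAt (EuclideanHalfSpace d) m with he
  have hms : m ∈ e.source := mem_chart_source _ m
  obtain ⟨δ, hδ, hsub⟩ := Metric.isOpen_iff.mp (isOpen_collarDomain e) _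
    (halfCoord_mem_collarDomain hms)
  let F : Set (Fin d → ℝ) := Metric.ball (halfCoord (e m)) δ ∩ {y | y 0 = 0}
  have hF : Convex ℝ F := (convex_ball _ _).inter
    (convex_hyperplane (LinearMap.proj (R := ℝ) (φ := fun _ : Fin d => ℝ) 0).isLinear 0)
  have hmF : halfCoord (e m) ∈ F := ⟨Metric.mem_ball_self hδ, (mem_boundary_iff m hms).mp hm⟩
  have hcont : ContinuousOn (fun y => e.symm (toHalf y)) F :=
    e.continuousOn_symm.comp continuous_toHalf.continuousOn fun y hy => (hsub hy.1).1
  have hpc := (hF.isPathConnected ⟨_, hmF⟩).image' hcont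
  have hFb : (fun y => e.symm (toHalf y)) '' F ⊆ (𝓡∂ d).boundary M := by
    rintro _ ⟨y, hy, rfl⟩
    have hy1 := (hsub hy.1).1
    have hy0 : y 0 = 0 := hy.2
    refine (mem_boundary_iff m (e.map_target hy1)).mpr ?_
    rw [← he, e.right_inv hy1, halfCoord_toHalf_of_nonneg hy0.ge]
    exact hy0
  filter_upwards [e.open_source.mem_nhds hms, (continuousAt_halfCoord e hms).eventually
    (Metric.ball_mem_nhds _ hδ)] with m' hm's hm'b hm'
  exact (hpc.joinedIn m ⟨_, hmF, symm_toHalf_halfCoord e hms⟩ m'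
    ⟨_, ⟨hm'b, (mem_boundary_iff m hm's).mp hm'⟩, symm_toHalf_halfCoord e hm's⟩).mono hFb

/-- The interior of a manifold with boundary is dense. -/
theorem dense_compl_boundary [IsManifold (𝓡∂ d) 1 M] : Dense ((𝓡∂ d).boundary M)ᶜ := by
  intro m
  set e := chartAt (EuclideanHalfSpace d) m with he
  have hms : m ∈ e.source := mem_chart_source _ m
  have hline : Filter.Tendsto (fun t : ℝ => halfCoord (e m) + Pi.single 0 t) (𝓝[>] 0)
      (𝓝 (halfCoord (e m))) := by
    have hc : Continuous fun t : ℝ => halfCoord (e m) + (Pi.single 0 t : Fin d → ℝ) :=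
      continuous_const.add (continuous_single (A := fun _ : Fin d => ℝ) 0)
    have := hc.tendsto 0
    rw [Pi.single_zero, add_zero] at this
    exact this.mono_left nhdsWithin_le_nhds
  have ht : Filter.Tendsto (fun t : ℝ => e.symm (toHalf (halfCoord (e m) + Pi.single 0 t))) (𝓝[>] 0)
      (𝓝 m) := by
    have := (continuousAt_symm_toHalf e hms).tendsto.comp hline
    rwa [symm_toHalf_halfCoord e hms] at this
  refine mem_closure_of_tendsto ht ?_
  filter_upwards [hline.eventually ((isOpen_collarDomain e).mem_nhds
    (halfCoord_mem_collarDomain hms)), self_mem_nhdsWithin] with t ht ht0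
  have h0 : 0 < (halfCoord (e m) + Pi.single 0 t : Fin d → ℝ) 0 := by
    have := halfCoord_nonneg (e m)
    have ht0' : 0 < t := ht0
    rw [Pi.add_apply, Pi.single_eq_same]
    linarith
  intro hb
  rw [mem_boundary_iff m (e.map_target ht.1), ← he, e.right_inv ht.1,
    halfCoord_toHalf_of_nonneg h0.le] at hb
  exact h0.ne' hb

variable {s : ℕ} {B : Fin s → Set M}

/-- The path components of the boundary are closed. -/
theorem IsPathComponents.isClosed_of_boundary [IsManifold (𝓡∂ d) 1 M]
    (hB : IsPathComponents ((𝓡∂ d).boundary M) B) (i : Fin s) : IsClosed (B i) :=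
  hB.isClosed ((𝓡∂ d).isClosed_boundary (n := 1) one_ne_zero)
    (fun _ hm => eventually_joinedIn_boundary hm) i

/-- The change of charts at an interior point, in coordinates. -/
theorem exists_hasFDerivAt_transition [IsManifold (𝓡∂ d) 1 M] (p q : M)
    (hq : q ∈ (chartAt (EuclideanHalfSpace d) p).source) (hqb : q ∉ (𝓡∂ d).boundary M) :
    ∃ A : (Fin d → ℝ) →L[ℝ] Fin d → ℝ,
      LinearMap.det A.toLinearMap = (tangentCoordChange (𝓡∂ d) q p q).det ∧
      HasFDerivAt (fun y => halfCoord (chartAt (EuclideanHalfSpace d) p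
        ((chartAt (EuclideanHalfSpace d) q).symm (toHalf y)))) A
        (halfCoord (chartAt (EuclideanHalfSpace d) q q)) := by
  have hqq := mem_chart_source (EuclideanHalfSpace d) q
  let L := PiLp.continuousLinearEquiv 2 ℝ (fun _ : Fin d => ℝ)
  let T : EuclideanSpace ℝ (Fin d) →L[ℝ] EuclideanSpace ℝ (Fin d) := tangentCoordChange (𝓡∂ d) q p q
  have h0 : 0 < halfCoord (chartAt (EuclideanHalfSpace d) q q) 0 :=
    lt_of_le_of_ne (halfCoord_nonneg _) fun h => hqb ((mem_boundary_iff q hqq).mpr h.symm)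
  have h1 : HasFDerivAt (extChartAt (𝓡∂ d) p ∘ (extChartAt (𝓡∂ d) q).symm) T
      (extChartAt (𝓡∂ d) q q) := by
    refine HasFDerivWithinAt.hasFDerivAt (s := Set.range (𝓡∂ d))
      (hasFDerivWithinAt_tangentCoordChange ⟨?_, ?_⟩) ?_
    · rw [extChartAt_source]
      exact hqq
    · rw [extChartAt_source]
      exact hq
    · rw [← mem_interior_iff_mem_nhds, interior_range_modelWithCornersEuclideanHalfSpace]
      exact h0
  refine ⟨(L : _ →L[ℝ] _).comp (T.comp (L.symm : _ →L[ℝ] _)), ?_, ?_⟩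
  · exact LinearMap.det_conj (T : EuclideanSpace ℝ (Fin d) →ₗ[ℝ] EuclideanSpace ℝ (Fin d))
      L.toLinearEquiv
  · have h2 : HasFDerivAt (L.symm : (Fin d → ℝ) → EuclideanSpace ℝ (Fin d)) (L.symm : _ →L[ℝ] _)
        (halfCoord (chartAt (EuclideanHalfSpace d) q q)) := L.symm.hasFDerivAt
    have h3 : HasFDerivAt (extChartAt (𝓡∂ d) p ∘ (extChartAt (𝓡∂ d) q).symm) T
      (L.symm (halfCoord (chartAt (EuclideanHalfSpace d) q q))) := h1
    exact L.hasFDerivAt.comp _ (h3.comp _ h2)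

/-- At an interior point, coefficients with respect to two charts differ by the sign of the
Jacobian. -/
theorem IsLocalClass.of_chart_transition [IsManifold (𝓡∂ d) 1 M] {R : Type*} [CommRing R]
    {w : ℤˣ → R}
    (hw : ∀ (M : Matrix (Fin d) (Fin d) ℝ) (u : ℤˣ), 0 < ((u : ℤ) : ℝ) * M.det →
      HasDeg (mulVecMap M) (w u)) (hdis : ∀ i j, i ≠ j → Disjoint (B i) (B j))
    (hcl : ∀ i, IsClosed (B i)) (hB : ∀ p : M, ∀ m ∈ (chartAt (EuclideanHalfSpace d) p).source,
      (∃ i, m ∈ B i) ↔ halfCoord (chartAt (EuclideanHalfSpace d) p m) 0 = 0)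
    {p q : M} (hq : q ∈ (chartAt (EuclideanHalfSpace d) p).source) (hqb : q ∉ (𝓡∂ d).boundary M)
    {u : ℤˣ} (hu : 0 < ((u : ℤ) : ℝ) * (tangentCoordChange (𝓡∂ d) q p q).det) {r : R}
    {z : (sg (DCone B)).obj (d + 1) →₀ R}
    (hz : IsLocalClass (collarChart B (chartAt (EuclideanHalfSpace d) q) hdis hcl (hB q))
      ⟨_, halfCoord_mem_collarDomain (mem_chart_source _ q)⟩ r z) :
    IsLocalClass (collarChart B (chartAt (EuclideanHalfSpace d) p) hdis hcl (hB p))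
      ⟨_, halfCoord_mem_collarDomain hq⟩ (w u * r) z := by
  have hqq := mem_chart_source (EuclideanHalfSpace d) q
  obtain ⟨A, hA, hτ⟩ := exists_hasFDerivAt_transition p q hq hqb
  have h0 : 0 < halfCoord (chartAt (EuclideanHalfSpace d) q q) 0 :=
    lt_of_le_of_ne (halfCoord_nonneg _) fun h => hqb ((mem_boundary_iff q hqq).mpr h.symm)
  refine hz.transition hw (isOpen_collarDomain _)
    (isOpenEmbedding_collarFun hdis hcl (hB q)).injective
    (isOpenEmbedding_collarFun hdis hcl (hB p)).isEmbedding
    ((collarFun_halfCoord hqq).trans (collarFun_halfCoord hq).symm) hτ (by rw [hA]; exact hu) ?_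
  have h1 := (continuousAt_symm_toHalf (chartAt (EuclideanHalfSpace d) q) hqq).eventually
    ((chartAt (EuclideanHalfSpace d) p).open_source.mem_nhds
      (Set.mem_of_eq_of_mem (symm_toHalf_halfCoord _ hqq) hq))
  filter_upwards [h1, (isOpen_collarDomain _).mem_nhds (halfCoord_mem_collarDomain hqq),
    (isOpen_lt continuous_const (continuous_apply (0 : Fin d))).mem_nhds h0] with y hy1 hy2 hy3
  refine ⟨hy2, halfCoord_mem_collarDomain hy1, ?_⟩
  have hy3' : 0 < y 0 := hy3
  exact (collarFun_of_nonneg (B := B) ⟨y, hy2⟩ hy3'.le).trans (collarFun_halfCoord hy1).symm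

end Boundary

/-! ### The top homology of the disjoint cone -/

section OpenCones

variable {Y : Type u} [TopologicalSpace Y] {s : ℕ} {A : Fin s → Set Y} {R : Type*} [CommRing R]

/-- Cycles of positive dimension in the union of the open cones bound there. -/
theorem exists_bd_of_compl_range_of [T2Space Y] [CompactSpace Y] (hA : ∀ i, IsClosed (A i))
    (a : ∀ i, A i) {n : ℕ} {b : (sg (DCone A)).obj (n + 2) →₀ R}
    (hb : b ∈ supp R (Set.range (DCone.of A))ᶜ (n + 2)) (hb0 : bd R _ (n + 1) b = 0) :
    ∃ c ∈ supp R (Set.range (DCone.of A))ᶜ (n + 3), b = bd R _ (n + 2) c := by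
  rw [DCone.compl_range_of] at hb ⊢
  rcases isEmpty_or_nonempty (Fin s) with hs | hs
  · refine ⟨0, Submodule.zero_mem _, ?_⟩
    rw [Set.iUnion_of_empty, supp_empty, Submodule.mem_bot] at hb
    rw [hb, map_zero]
  obtain ⟨D, hD, h⟩ := exists_small (fun i => DCone.isOpen_openCone (A := A) i) hb
  rw [hb0, map_zero, sub_zero, smallChains, Finsupp.supported_iUnion,
    Submodule.mem_iSup_iff_exists_finsupp] at h
  obtain ⟨f, hf, h⟩ := h
  have hsum : b - bd R _ (n + 2) (D (n + 2) b) = ∑ i, f i := by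
    rw [← h]
    exact Finset.sum_subset (Finset.subset_univ _) fun i _ hi => Finsupp.notMem_support_iff.mp hi
  have hf' : ∀ i, f i ∈ supp R (DCone.openCone A i) (n + 2) := hf
  -- the summands are cycles because the open cones are disjoint
  have hcyc : ∀ i, bd R _ (n + 1) (f i) = 0 := by
    intro i
    have h1 := mem_supp_of_sum (R := R) (U := ∅) (V := DCone.openCone A)
      (fun i j hij => (DCone.openCone_disjoint hij).subset) (fun i => bd_mem_supp (hf' i))
      (by rw [← map_sum, ← hsum, map_sub, hb0, bd_bd, sub_zero]; exact Submodule.zero_mem _) i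
    rwa [supp_empty, Submodule.mem_bot] at h1
  choose c hc hfc using fun i => DCone.exists_bd_of_openCone (hA i) (a i) (hf' i) (hcyc i)
  refine ⟨D (n + 2) b + ∑ i, c i, Submodule.add_mem _ (hD _ _ _ hb) (Submodule.sum_mem _ fun i _ =>
    supp_mono (Set.subset_iUnion _ i) _ (hc i)), ?_⟩
  rw [map_add, map_sum, ← Finset.sum_congr rfl fun i _ => hfc i, ← hsum, add_sub_cancel]

/-- A relative fundamental class modulo the open cones lifts to an absolute one. -/
theorem exists_absolute_class [T2Space Y] [CompactSpace Y] (hA : ∀ i, IsClosed (A i))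
    (a : ∀ i, A i) {n : ℕ}
    (h : ∃ z₀ ∈ relCyc R (Set.range (DCone.of A))ᶜ (n + 2),
      (∀ z ∈ relCyc R (Set.range (DCone.of A))ᶜ (n + 2),
        ∃ r : R, z - r • z₀ ∈ relBd R (Set.range (DCone.of A))ᶜ (n + 2)) ∧
      ∀ r : R, r • z₀ ∈ relBd R (Set.range (DCone.of A))ᶜ (n + 2) → r = 0) :
    ∃ z₀ : (sg (DCone A)).obj (n + 3) →₀ R, bd R _ (n + 2) z₀ = 0 ∧
      (∀ z, bd R _ (n + 2) z = 0 → ∃ (r : R) (c : _), z - r • z₀ = bd R _ (n + 3) c) ∧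
      ∀ (r : R) (c : _), r • z₀ = bd R _ (n + 3) c → r = 0 := by
  obtain ⟨z₀, hz₀, hgen, hfree⟩ := h
  obtain ⟨c₀, hc₀, hzc⟩ := exists_bd_of_compl_range_of hA a (mem_relCyc.mp hz₀) (bd_bd ..)
  refine ⟨z₀ - c₀, by rw [map_sub, hzc, sub_self], fun z hz => ?_, fun r c hrc => ?_⟩
  · obtain ⟨r, hr⟩ := hgen z (by rw [mem_relCyc, hz]; exact Submodule.zero_mem _)
    obtain ⟨b, w, hw, hbw⟩ := mem_relBd.mp hr
    have h1 : z - r • (z₀ - c₀) = bd R _ (n + 3) b + (w + r • c₀) := by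
      rw [smul_sub, ← add_assoc, ← hbw]
      abel
    obtain ⟨c, -, hc⟩ := exists_bd_of_compl_range_of hA a (b := w + r • c₀)
      (Submodule.add_mem _ hw (Submodule.smul_mem _ r hc₀)) (by
        rw [← sub_eq_iff_eq_add'.mpr h1, map_sub, bd_bd, map_sub, map_smul, map_sub, hzc, hz]
        simp)
    exact ⟨r, b + c, by rw [h1, map_add, hc]⟩
  · refine hfree r (mem_relBd.mpr ⟨c, r • c₀, Submodule.smul_mem _ r hc₀, ?_⟩)
    rw [← hrc, smul_sub, sub_add_cancel]

end OpenCones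

section Manifold

variable {d : ℕ} [NeZero d] {M : Type u} [TopologicalSpace M] [T2Space M] [CompactSpace M]
  [ConnectedSpace M] [ChartedSpace (EuclideanHalfSpace d) M] [IsManifold (𝓡∂ d) ∞ M]

/-- A compact connected oriented manifold has a fundamental class in the homology of the disjoint
cone over its boundary relative to the open cones. -/
theorem IsOrientable.exists_fundamental_class (hor : IsOrientable d M) {s : ℕ} {B : Fin s → Set M}
    (hB : IsPathComponents ((𝓡∂ d).boundary M) B) (R : Type*) [CommRing R] :
    ∃ z₀ ∈ relCyc R (Set.range (DCone.of B))ᶜ d,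
      (∀ z ∈ relCyc R (Set.range (DCone.of B))ᶜ d,
        ∃ r : R, z - r • z₀ ∈ relBd R (Set.range (DCone.of B))ᶜ d) ∧
      ∀ r : R, r • z₀ ∈ relBd R (Set.range (DCone.of B))ᶜ d → r = 0 := by
  have : IsManifold (𝓡∂ d) 1 M := IsManifold.of_le (n := ∞) (by simp)
  obtain ⟨ε, hε⟩ := hor
  obtain ⟨w, hw1, hwm, hw⟩ := exists_sign_character (R := R) (d := d)
  have hcl := hB.isClosed_of_boundary
  have hmem : ∀ p : M, ∀ m ∈ (chartAt (EuclideanHalfSpace d) p).source,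
      (∃ i, m ∈ B i) ↔ halfCoord (chartAt (EuclideanHalfSpace d) p m) 0 = 0 := fun p m hm =>
    (hB.exists_mem_iff m).trans (mem_boundary_iff p hm)
  refine HatComplex.exists_fundamental_class (ι := DCone.of B)
    (g := fun p => collarChart B (chartAt (EuclideanHalfSpace d) p) hB.disjoint hcl (hmem p))
    (a := fun p => ⟨_, halfCoord_mem_collarDomain (mem_chart_source _ p)⟩) (ε := ε)
    DCone.isEmbedding_of.injective (fun p => isOpen_collarDomain _)
    (fun p => isOpenEmbedding_collarFun hB.disjoint hcl (hmem p))
    (fun p => collarFun_halfCoord (mem_chart_source _ p)) hw1 hwm (D := ((𝓡∂ d).boundary M)ᶜ) dense_compl_boundary fun p => ?_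
  filter_upwards [hε p, (chartAt (EuclideanHalfSpace d) p).open_source.mem_nhds
    (mem_chart_source _ p)] with q hq1 hq2 hqb
  exact ⟨⟨_, halfCoord_mem_collarDomain hq2⟩, collarFun_halfCoord hq2, fun r z hz =>
    hz.of_chart_transition hw hB.disjoint hcl hmem hq2 hqb hq1⟩

end Manifold

end HatComplex

end

theorem corollary5p2
    (d : ℕ) [NeZero d] (M : Type*) [TopologicalSpace M] [T2Space M] [CompactSpace M]
    [ConnectedSpace M] [ChartedSpace (EuclideanHalfSpace d) M] [IsManifold (𝓡∂ d) ∞ M]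
    (hor : HatComplex.IsOrientable d M)
    (hasph : HatComplex.IsAspherical M)
    (s : ℕ) (B : Fin s → Set M)
    (hB : HatComplex.IsPathComponents ((𝓡∂ d).boundary M) B)
    (hBasph : ∀ i, HatComplex.IsAspherical (B i))
    (hBinj : ∀ i, ∀ p : B i,
      Function.Injective (FundamentalGroup.map (HatComplex.incl B i) p))
    (x : M) (y : ∀ i, B i) (e : ∀ i, Path (y i : M) x)
    (hΓ : ∀ i j, i ≠ j →
      HatComplex.peripheralSubgroup i (e i) ⊓ HatComplex.peripheralSubgroup j (e j) = ⊥) :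
    (∀ (R : Type*) [CommRing R],
      (∃ F : HatComplex.dconeChains B R ⟶ HatComplex.hatChains R x y e,
        Nonempty (Homotopy (F ≫ HatComplex.j₁ R x y e) (HatComplex.j₂ B R))) ∧
      ∀ F : HatComplex.dconeChains B R ⟶ HatComplex.hatChains R x y e,
        Nonempty (Homotopy (F ≫ HatComplex.j₁ R x y e) (HatComplex.j₂ B R)) →
        ∀ n : ℕ, IsIso (HomologicalComplex.homologyMap F n)) ∧
    (2 ≤ d → Nonempty ((HatComplex.hatChains ℝ x y e).homology d ≃ₗ[ℝ] ℝ)) := by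
  have : IsManifold (𝓡∂ d) 1 M := IsManifold.of_le (n := ∞) (by simp)
  have : PathConnectedSpace M := hasph.1
  have : PathConnectedSpace (HatComplex.DCone B) :=
    HatComplex.DCone.pathConnectedSpace fun i => ⟨y i, (y i).2⟩
  have hcl : ∀ i, IsClosed (B i) := hB.isClosed_of_boundary
  have : T2Space (HatComplex.DCone B) := inferInstance
  refine ⟨fun R _ => ⟨HatComplex.exists_hatMap R x y e, fun F hF n =>
    HatComplex.isIso_homologyMap_of_homotopy R x y e hcl F hF n⟩, fun hd => ?_⟩
  obtain ⟨n, rfl⟩ := Nat.exists_eq_add_of_le' hd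
  obtain ⟨z₀, h₀, hgen, hfree⟩ :=
    HatComplex.exists_absolute_class hcl y (hor.exists_fundamental_class hB ℝ)
  exact HatComplex.nonempty_hat_homology_equiv ℝ x y e h₀ hgen hfree
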